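/- Let $d=3$. A *symmetric dimer* is $D=D_1\cup D_2\subset\mathbb R^3$ with $D_1=D_0+(-L,0,0)$, $D_2=\mathcal R(D_0)+(L,0,0)$, $L>0$, where $D_0$ is a bounded connected open set with (at least $C^2$) regular boundary, $\mathcal R(x_1,x_2,x_3)=(-x_1,x_2,x_3)$, and $\overline{D_1}\cap\overline{D_2}=\emptyset$. Put $\mathcal R[u](x)=u(\mathcal R x)$; $u$ is even if $\mathcal R[u]=u$ and odd if $\mathcal R[u]=-u$. Let $\langle f,g\rangle=\int_D\bar f g\,dx$, let $$\mathcal K_D^{\omega}[\varphi](x)=\int_D\frac{e^{i\omega|x-y|}}{4\pi|x-y|}\varphi(y)\,dy,\qquad \mathcal K_D=\mathcal K_D^{0},\qquad N(u)=u+|u|^2u ,$$ and consider, for $\epsilon>0$, the scaled nonlinear resonance problem $$u=\hat\omega^2\,\mathcal K_D^{\epsilon\hat\omega}[N(u)],\qquad (\hat\omega,u)\in\mathbb C\times H^2(D).\tag{1}$$ Let $\lambda_+$ be the largest eigenvalue of $\mathcal K_D$ on $L^2(D)$ and $\lambda_-<\lambda_+$ the second largest one, with $L^2$-normalized eigenfunctions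 $\varphi_+,\varphi_-$. Assume that $\lambda_-$ is simple and that $\varphi_-$ is odd. Let $P_r u=u-\langle\varphi_+,u\rangle\varphi_+-\langle\varphi_-,u\rangle\varphi_-$, and $$\Omega=\{\hat\omega:\ \mathrm{dist}(\hat\omega^{-2},\sigma(\mathcal K_D)\setminus\{\lambda_\pm\})>d_*\},\qquad d_*=\tfrac12\,\mathrm{dist}(\{\lambda_+,\lambda_-\},\sigma(\mathcal K_D)\setminus\{\lambda_\pm\}).$$ Then there are constants $c_*,\epsilon_*,\rho,C>0$ and $0<\delta\le\min(c_*,\epsilon_*)$ such that the following holds. 1. For $\hat\omega\in\Omega$, $c_\pm\in\mathbb C$ with $|c_+|+|c_-|<c_*$ and $0<\epsilon<\epsilon_*$ there is exactly one $r=r(\hat\omega,c_+,c_-,\epsilon)\in H^2(D)$ with $\langle\varphi_\pm,r\rangle=0$, $\|r\|_{H^2(D)}<\rho$ and $$r=\hat\omega^2P_r\mathcal K_D^{\epsilon\hat\omega}[N(c_+\varphi_++c_-\varphi_-+r)] .$$ The map $r$ is real-analytic and $\|r\|_{H^2(D)}\le C(|c_+|^2+|c_-|^2+\epsilon)(|c_+|+|c_-|)$.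 2. For $0<\epsilon<\delta$ there are scaled linear resonances $\hat\omega_{*,\pm}(\epsilon)$, i.e. numbers for which $u=\hat\omega_{*,\pm}^2\mathcal K_D^{\epsilon\hat\omega_{*,\pm}}[u]$ has a solution $0\ne u\in H^2(D)$, with $|\hat\omega_{*,\pm}(\epsilon)-1/\sqrt{\lambda_\pm}|\le C\epsilon$, and any scaled linear resonance $z$ with $|z-1/\sqrt{\lambda_\pm}|<\delta$ equals $\hat\omega_{*,\pm}(\epsilon)$. 3. For real $c_\pm$ with $|c_\pm|<\delta$ and $0<\epsilon<\delta$ there are $\hat\omega_\pm(c_\pm,\epsilon)\in\Omega$ such that, for all $\theta\in\mathbb R$, $$\bigl(\hat\omega_+(c_+,\epsilon),\ u_+=e^{i\theta}[c_+\varphi_++r(\hat\omega_+(c_+,\epsilon),c_+,0,\epsilon)]\bigr),\qquad \bigl(\hat\omega_-(c_-,\epsilon),\ u_-=e^{i\theta}[c_-\varphi_-+r(\hat\omega_-(c_-,\epsilon),0,c_-,\epsilon)]\bigr)$$ solve (1), $u_+$ is even, $u_-$ is odd, and $|\hat\omega_\pm(c_\pm,\epsilon)-\hat\omega_{*,\pm}(\epsilon)|\le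 C(c_\pm^2+|c_\pm|\epsilon)$. 4. These are the only nontrivial small solutions, up to the symmetry $(\hat\omega,u)\mapsto(-\overline{\hat\omega},\overline u)$ of (1): if $0<\epsilon<\delta$, $\hat\omega\in\Omega$, and $u=c_+\varphi_++c_-\varphi_-+s\neq0$ solves (1) with $|c_+|+|c_-|<\delta$, $s\in H^2(D)$, $\langle\varphi_\pm,s\rangle=0$, $\|s\|_{H^2(D)}<\rho$, then $(\hat\omega,u)$ or $(-\overline{\hat\omega},\overline u)$ is a member of one of the two families in 3 (with parameter $|c|<\delta$ and the same $\epsilon$). -/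

import Mathlib

open MeasureTheory Complex Set Filter
open scoped ENNReal

noncomputable section

namespace KerrDimer

/-- Three-dimensional Euclidean space. -/
abbrev E3 : Type := EuclideanSpace ℝ (Fin 3)

/-- The complex Hilbert space `L²(D)`. Mathlib's `inner ℂ f g` is `∫_D conj f * g`. -/
abbrev L2 (D : Set E3) : Type := Lp ℂ 2 (volume.restrict D)

/-! ### The Sobolev space `H²(D)` -/

/-- `v` is the weak partial derivative of `u` on `D` in the `i`-th coordinate direction. -/
def IsWeakPartial (D : Set E3) (i : Fin 3) (u v : E3 → ℂ) : Prop :=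
  ∀ ψ : E3 → ℝ, ContDiff ℝ (⊤ : ℕ∞) ψ → HasCompactSupport ψ → tsupport ψ ⊆ D →
    ∫ x in D, ((fderiv ℝ ψ x (EuclideanSpace.single i 1) : ℝ) : ℂ) * u x
      = - ∫ x in D, ((ψ x : ℝ) : ℂ) * v x

/-- Labels of the components of a second-order jet: the function itself, its first partial
derivatives, its second partial derivatives. -/
abbrev JetIndex : Type := Unit ⊕ (Fin 3 ⊕ (Fin 3 × Fin 3))

/-- Square-integrable second-order jets, with the Hilbert-sum norm. -/
abbrev Jets (D : Set E3) : Type := PiLp 2 (fun _ : JetIndex => L2 D)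

/-- The function component of a jet. -/
def Jets.fn {D : Set E3} (p : Jets D) : L2 D := p (Sum.inl ())

/-- The first-order components of a jet. -/
def Jets.grad {D : Set E3} (p : Jets D) (i : Fin 3) : L2 D := p (Sum.inr (Sum.inl i))

/-- The second-order components of a jet. -/
def Jets.hess {D : Set E3} (p : Jets D) (i j : Fin 3) : L2 D := p (Sum.inr (Sum.inr (i, j)))

lemma integrable_real_mul {D : Set E3} (g : E3 → ℝ) (hg : Continuous g)
    (hc : HasCompactSupport g) (u : L2 D) :
    Integrable (fun x => ((g x : ℝ) : ℂ) * u x) (volume.restrict D) := by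
  have h1 : MemLp (fun x => ((g x : ℝ) : ℂ)) 2 (volume.restrict D) := by
    apply Continuous.memLp_of_hasCompactSupport (Complex.continuous_ofReal.comp hg)
    exact hc.comp_left (g := fun t : ℝ => (t : ℂ)) (by simp)
  exact h1.integrable_mul (Lp.memLp u)

lemma continuous_partial {ψ : E3 → ℝ} (h : ContDiff ℝ (⊤ : ℕ∞) ψ) (v : E3) :
    Continuous (fun x => fderiv ℝ ψ x v) :=
  (h.continuous_fderiv (by simp)).clm_apply continuous_const

lemma hasCompactSupport_partial {ψ : E3 → ℝ} (h : HasCompactSupport ψ) (v : E3) :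
    HasCompactSupport (fun x => fderiv ℝ ψ x v) :=
  (h.fderiv (𝕜 := ℝ)).comp_left (g := fun l : E3 →L[ℝ] ℝ => l v) (by simp)

lemma IsWeakPartial.zero (D : Set E3) (i : Fin 3) :
    IsWeakPartial D i ((0 : L2 D) : E3 → ℂ) ((0 : L2 D) : E3 → ℂ) := by
  intro ψ _ _ _
  have h0 : ∀ g : E3 → ℂ, ∫ x in D, g x * ((0 : L2 D) : E3 → ℂ) x = 0 := by
    intro g
    rw [integral_eq_zero_of_ae]
    filter_upwards [Lp.coeFn_zero ℂ 2 (volume.restrict D)] with x hx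
    rw [hx]; simp
  rw [h0, h0, neg_zero]

lemma IsWeakPartial.add {D : Set E3} {i : Fin 3} {u v u' v' : L2 D}
    (h : IsWeakPartial D i u v) (h' : IsWeakPartial D i u' v') :
    IsWeakPartial D i ((u + u' : L2 D) : E3 → ℂ) ((v + v' : L2 D) : E3 → ℂ) := by
  intro ψ h1 h2 h3
  have key : ∀ g : E3 → ℝ, Continuous g → HasCompactSupport g → ∀ a b : L2 D,
      ∫ x in D, ((g x : ℝ) : ℂ) * ((a + b : L2 D) : E3 → ℂ) x
        = (∫ x in D, ((g x : ℝ) : ℂ) * a x) + ∫ x in D, ((g x : ℝ) : ℂ) * b x := by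
    intro g hg hc a b
    rw [← integral_add (integrable_real_mul g hg hc a) (integrable_real_mul g hg hc b)]
    apply integral_congr_ae
    filter_upwards [Lp.coeFn_add a b] with x hx
    rw [hx, Pi.add_apply, mul_add]
  rw [key _ (continuous_partial h1 _) (hasCompactSupport_partial h2 _), key _ h1.continuous h2,
    h ψ h1 h2 h3, h' ψ h1 h2 h3, neg_add]

lemma IsWeakPartial.smul {D : Set E3} {i : Fin 3} {u v : L2 D} (c : ℂ)
    (h : IsWeakPartial D i u v) :
    IsWeakPartial D i ((c • u : L2 D) : E3 → ℂ) ((c • v : L2 D) : E3 → ℂ) := by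
  intro ψ h1 h2 h3
  have key : ∀ (g : E3 → ℝ) (a : L2 D),
      ∫ x in D, ((g x : ℝ) : ℂ) * ((c • a : L2 D) : E3 → ℂ) x
        = c * ∫ x in D, ((g x : ℝ) : ℂ) * a x := by
    intro g a
    rw [← integral_const_mul]
    apply integral_congr_ae
    filter_upwards [Lp.coeFn_smul c a] with x hx
    rw [hx, Pi.smul_apply, smul_eq_mul]
    ring
  rw [key (fun x => fderiv ℝ ψ x (EuclideanSpace.single i 1)) u, key, h ψ h1 h2 h3, mul_neg]

/-- The Sobolev space `H²(D)`, each function being recorded together with its weak first and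
second partial derivatives in `L²(D)`; its norm is the usual one,
`‖u‖² = ∑_{|α| ≤ 2} ‖∂^α u‖²` (mixed second derivatives occurring twice). -/
def H2 (D : Set E3) : Submodule ℂ (Jets D) where
  carrier := {p | (∀ i, IsWeakPartial D i p.fn (p.grad i)) ∧
    ∀ i j, IsWeakPartial D j (p.grad i) (p.hess i j)}
  zero_mem' := ⟨fun i => IsWeakPartial.zero D i, fun _ j => IsWeakPartial.zero D j⟩
  add_mem' := fun hp hq => ⟨fun i => (hp.1 i).add (hq.1 i), fun i j => (hp.2 i j).add (hq.2 i j)⟩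
  smul_mem' := fun c _ hp => ⟨fun i => (hp.1 i).smul c, fun i j => (hp.2 i j).smul c⟩

/-- The inclusion of `H²(D)` into `L²(D)`. -/
def toL2 {D : Set E3} (u : H2 D) : L2 D := (u : Jets D).fn

/-! ### The volume potential -/

/-- The outgoing Green's function of `-(Δ + ω²)` in `ℝ³`. -/
def green (ω : ℂ) (x : E3) : ℂ :=
  Complex.exp (Complex.I * ω * (‖x‖ : ℂ)) / (4 * (Real.pi : ℂ) * (‖x‖ : ℂ))

/-- The integral `x ↦ ∫_D G^ω(x - y) f(y) dy`. -/
def potentialFun (D : Set E3) (ω : ℂ) (f : E3 → ℂ) (x : E3) : ℂ :=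
  ∫ y in D, green ω (x - y) * f y

lemma measurable_green (ω : ℂ) : Measurable (green ω) := by
  unfold green
  fun_prop

lemma lintegral_ball_lt_top (R : ℝ) :
    ∫⁻ z in Metric.ball (0 : E3) R, ENNReal.ofReal (‖z‖⁻¹ ^ 2) < ∞ := by
  have h : Integrable (fun z : E3 => (Iio R).indicator (fun t : ℝ => t⁻¹ ^ 2) ‖z‖) volume := by
    rw [integrable_fun_norm_addHaar (μ := (volume : Measure E3))
      (f := (Iio R).indicator (fun t : ℝ => t⁻¹ ^ 2))]
    have h1 : IntegrableOn ((Iio R).indicator (fun _ : ℝ => (1 : ℝ))) (Ioi 0) := by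
      rw [integrableOn_indicator_iff measurableSet_Iio]
      refine integrableOn_const ?_
      rw [inter_comm, Ioi_inter_Iio]
      simp
    refine h1.congr_fun ?_ measurableSet_Ioi
    intro t ht
    have ht' : (0 : ℝ) < t := ht
    by_cases htR : t ∈ Iio R
    · simp [indicator_of_mem htR, ht'.ne']
    · simp [indicator_of_notMem htR]
  have h2 := h.2
  rw [hasFiniteIntegral_iff_norm] at h2
  refine lt_of_le_of_lt ?_ h2
  rw [← lintegral_indicator Metric.isOpen_ball.measurableSet]
  apply lintegral_mono
  intro z
  by_cases hz : z ∈ Metric.ball (0 : E3) R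
  · have hz' : ‖z‖ ∈ Iio R := by simpa using hz
    rw [indicator_of_mem hz]
    beta_reduce
    rw [indicator_of_mem hz']
    exact ENNReal.ofReal_le_ofReal (Real.le_norm_self _)
  · rw [indicator_of_notMem hz]
    exact zero_le

lemma exists_green_bound {D : Set E3} (hD : Bornology.IsBounded D) (ω : ℂ) :
    ∃ M : ℝ≥0∞, M ≠ ∞ ∧ ∀ x ∈ D,
      ∫⁻ y in D, ‖green ω (x - y)‖ₑ ^ (2 : ℝ) ≤ M := by
  obtain ⟨R, hR⟩ := hD.exists_norm_le
  set S : ℝ := 2 * R + 1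
  set c : ℝ := Real.exp (‖ω‖ * S) / (4 * Real.pi)
  refine ⟨ENNReal.ofReal (c ^ 2) * ∫⁻ z in Metric.ball (0 : E3) S, ENNReal.ofReal (‖z‖⁻¹ ^ 2),
    ENNReal.mul_ne_top ENNReal.ofReal_ne_top (lintegral_ball_lt_top S).ne, ?_⟩
  intro x hx
  have hpt : ∀ y ∈ D, ‖green ω (x - y)‖ₑ ^ (2 : ℝ) ≤
      ENNReal.ofReal (c ^ 2) *
        (Metric.ball (0 : E3) S).indicator (fun z => ENNReal.ofReal (‖z‖⁻¹ ^ 2)) (x - y) := by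
    intro y hy
    have hS : ‖x - y‖ < S := by
      have := norm_sub_le x y
      have := hR x hx
      have := hR y hy
      simp only [S]
      linarith
    have hmem : x - y ∈ Metric.ball (0 : E3) S := by simpa using hS
    rw [indicator_of_mem hmem, ← ENNReal.ofReal_mul (by positivity), ← ofReal_norm,
      ENNReal.ofReal_rpow_of_nonneg (norm_nonneg _) (by norm_num)]
    apply ENNReal.ofReal_le_ofReal
    rw [Real.rpow_two, ← mul_pow]
    apply pow_le_pow_left₀ (norm_nonneg _)
    unfold green
    rw [norm_div, Complex.norm_exp]
    have h1 : (Complex.I * ω * (‖x - y‖ : ℂ)).re ≤ ‖ω‖ * S := by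
      calc (Complex.I * ω * (‖x - y‖ : ℂ)).re ≤ ‖Complex.I * ω * (‖x - y‖ : ℂ)‖ :=
            Complex.re_le_norm _
        _ = ‖ω‖ * ‖x - y‖ := by simp
        _ ≤ ‖ω‖ * S := by gcongr
    have h2 : ‖(4 * (Real.pi : ℂ) * (‖x - y‖ : ℂ))‖ = 4 * Real.pi * ‖x - y‖ := by
      simp [abs_of_pos Real.pi_pos]
    rw [h2]
    simp only [c]
    rw [div_mul_eq_mul_div, div_mul_eq_div_div, ← div_eq_mul_inv]
    rw [div_right_comm]
    gcongr
  have hmeas : Measurable (fun y : E3 => ENNReal.ofReal (c ^ 2) *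
        (Metric.ball (0 : E3) S).indicator (fun z => ENNReal.ofReal (‖z‖⁻¹ ^ 2)) (x - y)) := by
    apply Measurable.const_mul
    apply Measurable.comp (g := (Metric.ball (0 : E3) S).indicator
      (fun z => ENNReal.ofReal (‖z‖⁻¹ ^ 2)))
    · apply Measurable.indicator _ Metric.isOpen_ball.measurableSet
      fun_prop
    · fun_prop
  calc ∫⁻ y in D, ‖green ω (x - y)‖ₑ ^ (2 : ℝ)
      ≤ ∫⁻ y in D, ENNReal.ofReal (c ^ 2) *
        (Metric.ball (0 : E3) S).indicator (fun z => ENNReal.ofReal (‖z‖⁻¹ ^ 2)) (x - y) :=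
        setLIntegral_mono hmeas hpt
    _ ≤ ∫⁻ y, ENNReal.ofReal (c ^ 2) *
        (Metric.ball (0 : E3) S).indicator (fun z => ENNReal.ofReal (‖z‖⁻¹ ^ 2)) (x - y) :=
        setLIntegral_le_lintegral _ _
    _ = ENNReal.ofReal (c ^ 2) * ∫⁻ z in Metric.ball (0 : E3) S, ENNReal.ofReal (‖z‖⁻¹ ^ 2) := by
        rw [lintegral_const_mul' _ _ ENNReal.ofReal_ne_top,
          lintegral_sub_left_eq_self (fun z => (Metric.ball (0 : E3) S).indicator
            (fun z => ENNReal.ofReal (‖z‖⁻¹ ^ 2)) z) x,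
          lintegral_indicator Metric.isOpen_ball.measurableSet]

lemma memLp_green {D : Set E3} (hD : Bornology.IsBounded D) (ω : ℂ) {x : E3} (hx : x ∈ D) :
    MemLp (fun y => green ω (x - y)) 2 (volume.restrict D) := by
  obtain ⟨M, hM, h⟩ := exists_green_bound hD ω
  refine ⟨((measurable_green ω).comp (measurable_const.sub measurable_id)).aestronglyMeasurable,
    ?_⟩
  rw [eLpNorm_lt_top_iff_lintegral_rpow_enorm_lt_top (by norm_num) (by norm_num)]
  exact lt_of_le_of_lt (h x hx) hM.lt_top

lemma integrable_green_mul {D : Set E3} (hD : Bornology.IsBounded D) (ω : ℂ) {x : E3}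
    (hx : x ∈ D) (f : L2 D) :
    Integrable (fun y => green ω (x - y) * f y) (volume.restrict D) :=
  (memLp_green hD ω hx).integrable_mul (Lp.memLp f)

lemma exists_potential_bound {D : Set E3} (hD : Bornology.IsBounded D) (ω : ℂ) :
    ∃ B : ℝ, 0 ≤ B ∧ ∀ f : L2 D, ∀ x ∈ D, ‖potentialFun D ω f x‖ ≤ B * ‖f‖ := by
  obtain ⟨M, hM, h⟩ := exists_green_bound hD ω
  refine ⟨(M ^ (1 / (2 : ℝ))).toReal, ENNReal.toReal_nonneg, ?_⟩
  intro f x hx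
  have hf : (∫⁻ y in D, ‖f y‖ₑ ^ (2 : ℝ)) ^ (1 / (2 : ℝ)) = ‖f‖ₑ := by
    rw [Lp.enorm_def, eLpNorm_eq_lintegral_rpow_enorm_toReal (by norm_num) (by norm_num)]
    simp
  have h1 : ‖potentialFun D ω f x‖ₑ ≤ M ^ (1 / (2 : ℝ)) * ‖f‖ₑ := by
    calc ‖potentialFun D ω f x‖ₑ ≤ ∫⁻ y in D, ‖green ω (x - y) * f y‖ₑ :=
          enorm_integral_le_lintegral_enorm _
      _ = ∫⁻ y in D, ((fun y => ‖green ω (x - y)‖ₑ) * (fun y => ‖f y‖ₑ)) y := by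
          simp only [enorm_mul, Pi.mul_apply]
      _ ≤ (∫⁻ y in D, ‖green ω (x - y)‖ₑ ^ (2 : ℝ)) ^ (1 / (2 : ℝ)) *
          (∫⁻ y in D, ‖f y‖ₑ ^ (2 : ℝ)) ^ (1 / (2 : ℝ)) := by
          apply ENNReal.lintegral_mul_le_Lp_mul_Lq _ Real.HolderConjugate.two_two
          · exact ((measurable_green ω).comp
              (measurable_const.sub measurable_id)).enorm.aemeasurable
          · exact (Lp.aestronglyMeasurable f).enorm
      _ ≤ M ^ (1 / (2 : ℝ)) * ‖f‖ₑ := by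
          rw [hf]
          gcongr
          exact h x hx
  have h2 : M ^ (1 / (2 : ℝ)) * ‖f‖ₑ ≠ ∞ :=
    ENNReal.mul_ne_top (ENNReal.rpow_ne_top_of_nonneg (by norm_num) hM) enorm_ne_top
  have h3 := ENNReal.toReal_mono h2 h1
  rwa [ENNReal.toReal_mul, toReal_enorm, toReal_enorm] at h3

lemma memLp_potentialFun {D : Set E3} (hD : Bornology.IsBounded D) (hm : MeasurableSet D)
    (ω : ℂ) (f : L2 D) : MemLp (potentialFun D ω f) 2 (volume.restrict D) := by
  obtain ⟨B, _, hB⟩ := exists_potential_bound hD ω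
  have : IsFiniteMeasure (volume.restrict D) := ⟨by
    rw [Measure.restrict_apply_univ]
    exact hD.measure_lt_top⟩
  refine MemLp.of_bound ?_ (B * ‖f‖) ?_
  · apply AEStronglyMeasurable.integral_prod_right' (μ := volume.restrict D)
      (ν := volume.restrict D) (f := fun p : E3 × E3 => green ω (p.1 - p.2) * f p.2)
    apply AEStronglyMeasurable.mul
    · exact ((measurable_green ω).comp (measurable_fst.sub measurable_snd)).aestronglyMeasurable
    · exact (Lp.aestronglyMeasurable f).comp_snd
  · filter_upwards [ae_restrict_mem hm] with x hx
    exact hB f x hx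

/-- The volume potential `K_D^ω`, as a bounded operator on `L²(D)` for bounded measurable `D`. -/
def volumePotential (D : Set E3) (hD : Bornology.IsBounded D) (hm : MeasurableSet D) (ω : ℂ) :
    L2 D →L[ℂ] L2 D :=
  LinearMap.mkContinuousOfExistsBound
    { toFun := fun f => (memLp_potentialFun hD hm ω f).toLp (potentialFun D ω f)
      map_add' := by
        intro f g
        rw [← MemLp.toLp_add]
        apply MemLp.toLp_congr
        filter_upwards [ae_restrict_mem hm] with x hx
        simp only [Pi.add_apply, potentialFun]
        rw [← integral_add (integrable_green_mul hD ω hx f) (integrable_green_mul hD ω hx g)]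
        apply integral_congr_ae
        filter_upwards [Lp.coeFn_add f g] with y hy
        rw [hy, Pi.add_apply, mul_add]
      map_smul' := by
        intro c f
        rw [RingHom.id_apply, ← MemLp.toLp_const_smul]
        apply MemLp.toLp_congr
        filter_upwards with x
        simp only [Pi.smul_apply, potentialFun, smul_eq_mul]
        rw [← integral_const_mul]
        apply integral_congr_ae
        filter_upwards [Lp.coeFn_smul c f] with y hy
        rw [hy, Pi.smul_apply, smul_eq_mul]
        ring }
    (by
      obtain ⟨B, hB0, hB⟩ := exists_potential_bound hD ω
      refine ⟨(volume.restrict D).real univ ^ ((2 : ℝ≥0∞).toReal⁻¹) * B, ?_⟩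
      have : IsFiniteMeasure (volume.restrict D) := ⟨by
        rw [Measure.restrict_apply_univ]
        exact hD.measure_lt_top⟩
      intro f
      rw [mul_assoc]
      apply Lp.norm_le_of_ae_bound (by positivity)
      filter_upwards [ae_restrict_mem hm,
        (memLp_potentialFun hD hm ω f).coeFn_toLp] with x hx hx'
      simp only [LinearMap.coe_mk, AddHom.coe_mk]
      rw [hx']
      exact hB f x hx)

/-! ### The symmetric dimer -/

/-- `D` has a boundary of class `C²`: near each boundary point, `D` is a strict sublevel set of a
`C²` function whose gradient does not vanish at that point. -/
def HasC2Boundary (D : Set E3) : Prop :=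
  ∀ x ∈ frontier D, ∃ U : Set E3, IsOpen U ∧ x ∈ U ∧ ∃ g : E3 → ℝ,
    ContDiff ℝ 2 g ∧ fderiv ℝ g x ≠ 0 ∧ D ∩ U = {y ∈ U | g y < 0}

/-- The reflection `(x₁, x₂, x₃) ↦ (-x₁, x₂, x₃)`. -/
def reflect (x : E3) : E3 := !₂[-x 0, x 1, x 2]

/-- The vector `(t, 0, 0)`. -/
def shift (t : ℝ) : E3 := !₂[t, 0, 0]

/-- A symmetric dimer: a particle `D₀` (bounded, connected, open, with regular boundary), moved to
the left by `L`, together with the mirror image of `D₀`, moved to the right by `L`; the two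
particles do not touch. -/
structure SymmetricDimer where
  D₀ : Set E3
  isOpen : IsOpen D₀
  isBounded : Bornology.IsBounded D₀
  isConnected : IsConnected D₀
  boundary : HasC2Boundary D₀
  L : ℝ
  L_pos : 0 < L
  separated : Disjoint (closure ((fun x => x + shift (-L)) '' D₀))
    (closure ((fun x => x + shift L) '' (reflect '' D₀)))

namespace SymmetricDimer

/-- The left particle `D₁ = D₀ + (-L, 0, 0)`. -/
def D₁ (d : SymmetricDimer) : Set E3 := (fun x => x + shift (-d.L)) '' d.D₀

/-- The right particle `D₂ = R(D₀) + (L, 0, 0)`. -/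
def D₂ (d : SymmetricDimer) : Set E3 := (fun x => x + shift d.L) '' (reflect '' d.D₀)

/-- The region `D = D₁ ∪ D₂` occupied by the dimer. -/
def D (d : SymmetricDimer) : Set E3 := d.D₁ ∪ d.D₂

end SymmetricDimer

lemma reflect_reflect (x : E3) : reflect (reflect x) = x := by
  ext i
  fin_cases i <;> simp [reflect]

lemma lipschitz_reflect : LipschitzWith 1 reflect := by
  apply LipschitzWith.of_dist_le_mul
  intro x y
  simp only [NNReal.coe_one, one_mul, EuclideanSpace.dist_eq, Fin.sum_univ_three]
  apply Real.sqrt_le_sqrt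
  simp [reflect, Real.dist_eq, ← abs_neg (x 0 - y 0)]

namespace SymmetricDimer

lemma isOpen_D (d : SymmetricDimer) : IsOpen d.D := by
  apply IsOpen.union
  · exact (Homeomorph.addRight (shift (-d.L))).isOpenMap _ d.isOpen
  · apply (Homeomorph.addRight (shift d.L)).isOpenMap
    have h : reflect '' d.D₀ = reflect ⁻¹' d.D₀ :=
      congrFun (image_eq_preimage_of_inverse reflect_reflect reflect_reflect) _
    rw [h]
    exact d.isOpen.preimage lipschitz_reflect.continuous

lemma isBounded_D (d : SymmetricDimer) : Bornology.IsBounded d.D := by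
  have h : ∀ (t : ℝ) (s : Set E3), Bornology.IsBounded s →
      Bornology.IsBounded ((fun x => x + shift t) '' s) := by
    intro t s hs
    exact (LipschitzWith.of_dist_le_mul (K := 1) (by simp) :
      LipschitzWith 1 (fun x : E3 => x + shift t)).isBounded_image hs
  exact (h _ _ d.isBounded).union (h _ _ (lipschitz_reflect.isBounded_image d.isBounded))

/-- The volume potential `K_D^ω` of the dimer on `L²(D)`. -/
def K (d : SymmetricDimer) (ω : ℂ) : L2 d.D →L[ℂ] L2 d.D :=
  volumePotential d.D d.isBounded_D d.isOpen_D.measurableSet ω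

/-- The Newtonian potential `K_D = K_D^0` of the dimer. -/
def newton (d : SymmetricDimer) : L2 d.D →L[ℂ] L2 d.D := d.K 0

/-- The set of (real) eigenvalues of the Newtonian potential. -/
def eigenvalues (d : SymmetricDimer) : Set ℝ :=
  {μ | Module.End.HasEigenvalue (d.newton : L2 d.D →ₗ[ℂ] L2 d.D) (μ : ℂ)}

/-- `φ` is an `L²`-normalized eigenfunction of the Newtonian potential for `μ`. -/
def IsNormalizedMode (d : SymmetricDimer) (μ : ℝ) (φ : L2 d.D) : Prop :=
  d.newton φ = (μ : ℂ) • φ ∧ ‖φ‖ = 1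

/-- `R[u] = u`. -/
def IsEven (d : SymmetricDimer) (u : L2 d.D) : Prop :=
  ∀ᵐ x ∂(volume.restrict d.D), u (reflect x) = u x

/-- `R[u] = -u`. -/
def IsOdd (d : SymmetricDimer) (u : L2 d.D) : Prop :=
  ∀ᵐ x ∂(volume.restrict d.D), u (reflect x) = -u x

/-- `v` is the function `N(u) = u + |u|² u`. -/
def IsKerr (d : SymmetricDimer) (u v : L2 d.D) : Prop :=
  ∀ᵐ x ∂(volume.restrict d.D), v x = u x + (‖u x‖ : ℂ) ^ 2 * u x

/-- `(ω, u)`, with `u ∈ H²(D)`, solves the scaled Lippmann-Schwinger equation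
`u = ω² K_D^{εω}[N(u)]`. -/
def IsSolution (d : SymmetricDimer) (ε : ℝ) (ω : ℂ) (u : L2 d.D) : Prop :=
  (∃ v : H2 d.D, toL2 v = u) ∧
    ∃ Nu : L2 d.D, d.IsKerr u Nu ∧ u = ω ^ 2 • d.K ((ε : ℂ) * ω) Nu

/-- `ω` is a scaled linear resonance: `u = ω² K_D^{εω}[u]` for some nonzero `u ∈ H²(D)`. -/
def IsLinearResonance (d : SymmetricDimer) (ε : ℝ) (ω : ℂ) : Prop :=
  ∃ v : H2 d.D, toL2 v ≠ 0 ∧ toL2 v = ω ^ 2 • d.K ((ε : ℂ) * ω) (toL2 v)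

/-- The rest of the spectrum of the Newtonian potential, `σ(K_D) \ {lamP, lamM}`. -/
def restSpectrum (d : SymmetricDimer) (lamP lamM : ℝ) : Set ℂ :=
  spectrum ℂ d.newton \ {(lamP : ℂ), (lamM : ℂ)}

/-- Half the distance of `{lamP, lamM}` to the rest of the spectrum. -/
def gap (d : SymmetricDimer) (lamP lamM : ℝ) : ℝ :=
  (1 / 2) * min (Metric.infDist (lamP : ℂ) (d.restSpectrum lamP lamM))
    (Metric.infDist (lamM : ℂ) (d.restSpectrum lamP lamM))

/-- The admissible scaled frequencies: `ω⁻²` has distance more than `gap` to the rest of the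
spectrum. (As `0` is in the spectrum, `ω = 0` is not admissible with the convention `0⁻¹ = 0`.) -/
def freqRegion (d : SymmetricDimer) (lamP lamM : ℝ) : Set ℂ :=
  {ω | d.gap lamP lamM < Metric.infDist ((ω ^ 2)⁻¹) (d.restSpectrum lamP lamM)}

/-- The projection `P_r = I - P_+ - P_-`. -/
def projRest (d : SymmetricDimer) (φP φM u : L2 d.D) : L2 d.D :=
  u - inner ℂ φP u • φP - inner ℂ φM u • φM

/-- The ansatz `u = c₊ φ₊ + c₋ φ₋ + r`. -/
def ansatz (d : SymmetricDimer) (φP φM : L2 d.D) (cP cM : ℂ) (r : H2 d.D) : L2 d.D :=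
  cP • φP + cM • φM + toL2 r

/-- `r ∈ H²(D)` is orthogonal to `φ₊, φ₋` and solves the `P_r`-component
`r = ω² P_r K_D^{εω}[N(c₊ φ₊ + c₋ φ₋ + r)]` of the scaled equation. -/
def IsRemainder (d : SymmetricDimer) (φP φM : L2 d.D) (ω cP cM : ℂ) (ε : ℝ) (r : H2 d.D) :
    Prop :=
  inner ℂ φP (toL2 r) = 0 ∧ inner ℂ φM (toL2 r) = 0 ∧
    ∃ Nu : L2 d.D, d.IsKerr (d.ansatz φP φM cP cM r) Nu ∧
      toL2 r = ω ^ 2 • d.projRest φP φM (d.K ((ε : ℂ) * ω) Nu)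

end SymmetricDimer

end KerrDimer

end

noncomputable section

namespace KerrDimer

set_option linter.unusedSectionVars false

/-! The proof is a Lyapunov–Schmidt reduction carried out in three spaces: `L²(D)`, where `K_D` is
compact and self-adjoint; `L^∞(D)`, where the cubic term is a real polynomial map; and `H²(D)`, the
space of the theorem. They are linked by the volume potential, which maps `L²` boundedly into `L^∞`
and into `H²` and is entire in the frequency (`differentiable_potE`, `differentiable_potV`). Every
solution is therefore bounded, and the nonlinear analysis takes place in `L^∞`. `ResonanceModel`
isolates the facts that are used; `ResonanceModel.main` is the theorem in that setting.

Remainder. On the complement of the two modes `1 - ω² P K_D` is invertible uniformly for `ω ∈ Ω`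
(`exists_inverse`), and what is left of the equation is Lipschitz with constant of order `ε` plus
amplitude squared (`exists_rest_lipschitz`). Contraction gives existence, stability and uniqueness
(`exists_isRem`, `exists_stability`, `exists_isRem_unique`); the analytic implicit function theorem
gives analyticity (`analyticAt_remainder`).

The two families. A factor `τ` is put in front of the cubic term. Since `T (c u) = |c|² c T u`, a
solution of amplitude `c` with `τ = 1` is `c` times a solution of amplitude `1` with `τ = c²`.
Linear resonances (`τ = 0`) and nonlinear frequencies (`τ = c²`) thus belong to one family, obtained
by solving a scalar equation near `1/√λ` by contraction (`exists_family`); its Lipschitz dependence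
on `τ` gives a frequency shift of order `c²`.

Classification. The remainder of an odd mode part is odd by uniqueness, so the even scalar equation
holds trivially when its coefficient `a` vanishes; by stability its right-hand side is at most a
small multiple of `|a|` (`exists_cp_rest_le`). If both coefficients were nonzero, `1 - ω² λ₊` and `1
- ω² λ₋` would both be small, which is impossible for `λ₊ ≠ λ₋` (`exists_classification`). So a
small solution has one mode only, its frequency lies near `1/√λ` or `-1/√λ`, the second case is the
mirror image of the first, and uniqueness puts it on the family (`exists_branch`). Smallness of the
remainder is known only in `H²`; that it implies smallness in `L^∞` follows from the equation itself
and `-Δ K_D f = f` (`exists_sup_bound`).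

Potential theory. The kernel `|x|⁻¹` is locally square integrable in dimension three, which yields
the `L^∞` bound and compactness. For `H²`, the Green's function is the Yukawa potential at frequency
`2πi` plus a convergent series in the powers `|x|^n`, whose second derivatives are again dominated
by `|x|⁻¹`. The Yukawa potential is a Bessel potential up to a factor, as its fundamental-solution
property shows (`integral_yuk_fundamental`, `exists_yukawa_jet`).

Spectral theory. Positivity of the kernel makes `λ₊` simple and `φ₊` even (`exists_phase`). Test
functions on small balls show that `0` is in the spectrum and that `λ₊, λ₋ > 0`. Removing the two
modes leaves a self-adjoint operator with spectrum `σ(K_D) \ {λ₊, λ₋}` (`restSpectrum_eq`), whose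
resolvent is bounded by the inverse of the distance. -/

/-- A map that is `1/2`-Lipschitz on a closed ball and moves the centre by at most half the radius
has a fixed point in the ball. -/
lemma exists_fixedPoint_closedBall {X : Type*} [NormedAddCommGroup X] [CompleteSpace X]
    (f : X → X) (x₀ : X) {r : ℝ} (hr : 0 ≤ r) (hx₀ : ‖f x₀ - x₀‖ ≤ r / 2)
    (hf : ∀ x y, ‖x - x₀‖ ≤ r → ‖y - x₀‖ ≤ r → ‖f x - f y‖ ≤ (1 / 2) * ‖x - y‖) :
    ∃ x, ‖x - x₀‖ ≤ r ∧ f x = x := by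
  have hmap : MapsTo f (Metric.closedBall x₀ r) (Metric.closedBall x₀ r) := by
    intro x hx
    rw [Metric.mem_closedBall, dist_eq_norm] at hx ⊢
    have h1 := hf x x₀ hx (by simpa using hr)
    have h2 := norm_sub_le_norm_sub_add_norm_sub (f x) (f x₀) x₀
    linarith
  have hc : ContractingWith (1 / 2) (hmap.restrict f _ _) := by
    refine ⟨by norm_num, LipschitzWith.of_dist_le_mul fun x y => ?_⟩
    have := hf x y (mem_closedBall_iff_norm.1 x.2) (mem_closedBall_iff_norm.1 y.2)
    simpa [Subtype.dist_eq, dist_eq_norm] using this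
  obtain ⟨y, hy, hfy, -⟩ := hc.exists_fixedPoint' Metric.isClosed_closedBall.isComplete hmap
    (Metric.mem_closedBall_self hr) (edist_ne_top _ _)
  exact ⟨y, by simpa [dist_eq_norm] using hy, hfy⟩

/-! ### The abstract model and its splitting into modes and remainder -/

/-- The functional-analytic data behind the dimer problem: the Hilbert space `H` of square
integrable functions, the space `E` of bounded functions carrying the cubic nonlinearity, and the
Sobolev space `V`, together with the integral operators `G z : H → E`, `GV z : H → V`, the two
modes, the admissible frequencies, the reflection `ρ` and the conjugation `κ`. -/
structure ResonanceModel (H E V : Type*)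
    [NormedAddCommGroup H] [InnerProductSpace ℂ H]
    [NormedAddCommGroup E] [NormedSpace ℂ E]
    [NormedAddCommGroup V] [NormedSpace ℂ V] where
  ι : E →L[ℂ] H
  ι_injective : Function.Injective ι
  T : E → E
  contDiff_T : ContDiff ℝ ⊤ T
  T_smul : ∀ (c : ℂ) (u : E), T (c • u) = ((‖c‖ ^ 2 : ℝ) : ℂ) • c • T u
  T_lipschitz : ∃ t > (0 : ℝ), ∀ (M : ℝ) (u w : E), ‖u‖ ≤ M → ‖w‖ ≤ M →
    ‖T u - T w‖ ≤ t * M ^ 2 * ‖u - w‖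
  G : ℂ → H →L[ℂ] E
  differentiable_G : Differentiable ℂ G
  j : V →L[ℂ] H
  j_injective : Function.Injective j
  GV : ℂ → H →L[ℂ] V
  differentiable_GV : Differentiable ℂ GV
  j_GV : ∀ z x, j (GV z x) = ι (G z x)
  -- For the dimer this is `-Δ K_D f = f`. It is what turns smallness in `V` into smallness in `E`.
  GV_lower : ∃ k > (0 : ℝ), ∀ x, ‖x‖ ≤ k * ‖GV 0 x‖
  symm : ∀ x y, inner ℂ (ι (G 0 x)) y = inner ℂ x (ι (G 0 y))
  φp : E
  φm : E
  lp : ℝ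
  lm : ℝ
  lp_pos : 0 < lp
  lm_pos : 0 < lm
  lp_ne_lm : lp ≠ lm
  G_φp : G 0 (ι φp) = (lp : ℂ) • φp
  G_φm : G 0 (ι φm) = (lm : ℂ) • φm
  norm_φp : ‖ι φp‖ = 1
  norm_φm : ‖ι φm‖ = 1
  Ω : Set ℂ
  isOpen_Ω : IsOpen Ω
  ne_zero_of_mem : ∀ ω ∈ Ω, ω ≠ 0
  bounded_Ω : ∃ W > (0 : ℝ), ∀ ω ∈ Ω, ‖ω‖ ≤ W
  neg_conj_mem : ∀ ω ∈ Ω, -(starRingEnd ℂ) ω ∈ Ω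
  mem_p : ((1 / √lp : ℝ) : ℂ) ∈ Ω
  mem_m : ((1 / √lm : ℝ) : ℂ) ∈ Ω
  -- The bound is uniform in `ω`: for the dimer it is the inverse of the spectral gap `d_*`. The
  -- operator inverted is `(ω²)⁻¹ - P G 0`, written out on `H`.
  resolvent : ∃ B > (0 : ℝ), ∀ ω ∈ Ω, ∃ R : H →L[ℂ] H, ‖R‖ ≤ B ∧
    (∀ x, R ((ω ^ 2)⁻¹ • x - (ι (G 0 x) - inner ℂ (ι φp) (ι (G 0 x)) • ι φp
      - inner ℂ (ι φm) (ι (G 0 x)) • ι φm)) = x) ∧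
    ∀ x, (ω ^ 2)⁻¹ • R x - (ι (G 0 (R x)) - inner ℂ (ι φp) (ι (G 0 (R x))) • ι φp
      - inner ℂ (ι φm) (ι (G 0 (R x))) • ι φm) = x
  ρ : E →L[ℂ] E
  norm_ρ : ∀ x, ‖ρ x‖ ≤ ‖x‖
  ρ_T : ∀ u, ρ (T u) = T (ρ u)
  ρ_G : ∀ z u, ρ (G z (ι u)) = G z (ι (ρ u))
  ρ_φp : ρ φp = φp
  ρ_φm : ρ φm = -φm
  inner_ρ : ∀ x y, inner ℂ (ι (ρ x)) (ι (ρ y)) = inner ℂ (ι x) (ι y)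
  κ : E →ₗ⋆[ℂ] E
  norm_κ : ∀ x, ‖κ x‖ ≤ ‖x‖
  κ_κ : ∀ x, κ (κ x) = x
  inner_κ : ∀ x y, inner ℂ (ι (κ x)) (ι (κ y)) = inner ℂ (ι y) (ι x)
  κ_T : ∀ u, κ (T u) = T (κ u)
  κ_G : ∀ z u, κ (G z (ι u)) = G (-(starRingEnd ℂ) z) (ι (κ u))
  κ_φp : ∃ α : ℂ, ‖α‖ = 1 ∧ κ φp = α • φp
  κ_φm : ∃ α : ℂ, ‖α‖ = 1 ∧ κ φm = α • φm
  -- For the cubic term this comes from `t³ ≤ t² + t⁴`: the mode coefficients of `T u` are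
  -- controlled by `L²` norms only.
  weak_T : ∃ c > (0 : ℝ), ∀ u,
    ‖inner ℂ (ι φp) (ι (T u))‖ ≤ c * (‖ι u‖ ^ 2 + ‖ι u‖ * ‖ι (T u)‖) ∧
    ‖inner ℂ (ι φm) (ι (T u))‖ ≤ c * (‖ι u‖ ^ 2 + ‖ι u‖ * ‖ι (T u)‖)

namespace ResonanceModel

variable {H E V : Type*}
    [NormedAddCommGroup H] [InnerProductSpace ℂ H]
    [NormedAddCommGroup E] [NormedSpace ℂ E]
    [NormedAddCommGroup V] [NormedSpace ℂ V] (m : ResonanceModel H E V)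

/-- The model with the roles of the two modes exchanged. -/
def swap : ResonanceModel H E V where
  __ := m
  φp := m.φm
  φm := m.φp
  lp := m.lm
  lm := m.lp
  lp_pos := m.lm_pos
  lm_pos := m.lp_pos
  lp_ne_lm := m.lp_ne_lm.symm
  G_φp := m.G_φm
  G_φm := m.G_φp
  norm_φp := m.norm_φm
  norm_φm := m.norm_φp
  mem_p := m.mem_m
  mem_m := m.mem_p
  resolvent := by
    obtain ⟨B, hB, h⟩ := m.resolvent
    refine ⟨B, hB, fun ω hω => ?_⟩
    obtain ⟨R, hR, h1, h2⟩ := h ω hω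
    refine ⟨R, hR, fun x => ?_, fun x => ?_⟩
    · rw [sub_right_comm]; exact h1 x
    · rw [sub_right_comm]; exact h2 x
  -- With the sign changed, the second mode is the invariant one and the first is reversed, so
  -- statements about the even mode become statements about the odd mode.
  ρ := -m.ρ
  norm_ρ x := by simpa using m.norm_ρ x
  ρ_T u := by
    have := m.T_smul (-1) (m.ρ u)
    simp only [neg_smul, one_smul, norm_neg, norm_one, one_pow, ofReal_one] at this
    simp [m.ρ_T, this]
  ρ_G z u := by simp [m.ρ_G]
  ρ_φp := by simp [m.ρ_φm]
  ρ_φm := by simp [m.ρ_φp]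
  inner_ρ x y := by simp [m.inner_ρ]
  κ_φp := m.κ_φm
  κ_φm := m.κ_φp
  weak_T := by
    obtain ⟨c, hc, h⟩ := m.weak_T
    exact ⟨c, hc, fun u => (h u).symm⟩

/-- The coefficient functional of the first mode. -/
def cp : E →L[ℂ] ℂ := innerSL ℂ (m.ι m.φp) ∘L m.ι

/-- The coefficient functional of the second mode. -/
def cm : E →L[ℂ] ℂ := innerSL ℂ (m.ι m.φm) ∘L m.ι

lemma cp_apply (x : E) : m.cp x = inner ℂ (m.ι m.φp) (m.ι x) := rfl

lemma cm_apply (x : E) : m.cm x = inner ℂ (m.ι m.φm) (m.ι x) := rfl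

/-- The projection that removes the two modes. -/
def P : E →L[ℂ] E := ContinuousLinearMap.id ℂ E - m.cp.smulRight m.φp - m.cm.smulRight m.φm

lemma P_apply (x : E) : m.P x = x - m.cp x • m.φp - m.cm x • m.φm := rfl

/-- The span of the modes. -/
def mode (a b : ℂ) : E := a • m.φp + b • m.φm

/-- The equation is `u = ω² (G 0 u + rest ω ε τ u)`. -/
def rest (ω : ℂ) (ε τ : ℝ) (u : E) : E :=
  -- The first summand is of order `ε`, the second of order `τ ‖u‖³`; the unperturbed linear part `G
  -- 0 u` has been split off.
  (m.G (ε * ω) - m.G 0) (m.ι (u + (τ : ℂ) • m.T u)) + (τ : ℂ) • m.G 0 (m.ι (m.T u))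

/-- `q` is the remainder belonging to the mode part `v`. -/
def IsRem (ω : ℂ) (ε τ : ℝ) (v q : E) : Prop :=
  q = ω ^ 2 • m.P (m.G (ε * ω) (m.ι (v + q + (τ : ℂ) • m.T (v + q))))

/-- `u` solves the full equation. -/
def IsSol (ω : ℂ) (ε τ : ℝ) (u : E) : Prop :=
  u = ω ^ 2 • m.G (ε * ω) (m.ι (u + (τ : ℂ) • m.T u))

lemma cp_G (x : E) : m.cp (m.G 0 (m.ι x)) = m.lp * m.cp x := by
  rw [cp_apply, cp_apply, ← m.symm, m.G_φp, map_smul, inner_smul_left]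
  simp

lemma cm_G (x : E) : m.cm (m.G 0 (m.ι x)) = m.lm * m.cm x := m.swap.cp_G x

lemma cp_φp : m.cp m.φp = 1 := by
  rw [cp_apply, inner_self_eq_norm_sq_to_K, m.norm_φp]; simp

lemma cm_φm : m.cm m.φm = 1 := m.swap.cp_φp

lemma cp_φm : m.cp m.φm = 0 := by
  have h := m.cp_G m.φm
  rw [m.G_φm, map_smul, smul_eq_mul] at h
  have h2 : ((m.lp : ℂ) - m.lm) * m.cp m.φm = 0 := by rw [sub_mul, h, sub_self]
  rcases mul_eq_zero.1 h2 with h3 | h3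
  · exact absurd (by exact_mod_cast sub_eq_zero.1 h3) m.lp_ne_lm
  · exact h3

lemma cm_φp : m.cm m.φp = 0 := m.swap.cp_φm

lemma cp_mode (a b : ℂ) : m.cp (m.mode a b) = a := by
  simp [mode, cp_φp, cp_φm]

lemma cm_mode (a b : ℂ) : m.cm (m.mode a b) = b := by
  simp [mode, cm_φp, cm_φm]

lemma P_mode (a b : ℂ) : m.P (m.mode a b) = 0 := by
  rw [P_apply, cp_mode, cm_mode, mode]; abel

lemma cp_P (x : E) : m.cp (m.P x) = 0 := by simp [P_apply, cp_φp, cp_φm]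

lemma cm_P (x : E) : m.cm (m.P x) = 0 := by simp [P_apply, cm_φp, cm_φm]

lemma G_mode (a b : ℂ) : m.G 0 (m.ι (m.mode a b)) = m.mode (a * m.lp) (b * m.lm) := by
  simp only [mode, map_add, map_smul, m.G_φp, m.G_φm, smul_smul]

lemma P_G_mode (a b : ℂ) : m.P (m.G 0 (m.ι (m.mode a b))) = 0 := by rw [G_mode, P_mode]

lemma mode_sub (a b a' b' : ℂ) : m.mode a b - m.mode a' b' = m.mode (a - a') (b - b') := by
  simp only [mode, sub_smul]; abel

lemma mode_eq_add_P (x : E) : x = m.mode (m.cp x) (m.cm x) + m.P x := by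
  rw [P_apply, mode]; abel

lemma swap_P : m.swap.P = m.P := by
  ext x; change x - m.cm x • m.φm - m.cp x • m.φp = x - m.cp x • m.φp - m.cm x • m.φm
  abel

lemma swap_mode (a b : ℂ) : m.swap.mode a b = m.mode b a := add_comm _ _

lemma swap_isSol : m.swap.IsSol = m.IsSol := rfl

lemma swap_isRem : m.swap.IsRem = m.IsRem := by
  funext ω ε τ v q
  simp only [IsRem, swap_P]; rfl

lemma G_eq_rest (ω : ℂ) (ε τ : ℝ) (u : E) :
    m.G (ε * ω) (m.ι (u + (τ : ℂ) • m.T u)) = m.G 0 (m.ι u) + m.rest ω ε τ u := by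
  simp only [rest, sub_apply, map_add, map_smul, smul_sub]; abel

/-- `G 0` maps modes to modes and `P` annihilates them, so the unperturbed operator acts on the
remainder alone. -/
lemma isRem_iff (ω : ℂ) (ε τ : ℝ) (a b : ℂ) (q : E) : m.IsRem ω ε τ (m.mode a b) q ↔
    q = ω ^ 2 • m.P (m.G 0 (m.ι q) + m.rest ω ε τ (m.mode a b + q)) := by
  rw [IsRem, G_eq_rest, map_add m.ι, map_add (m.G 0), add_assoc, map_add m.P (m.G 0 _),
    P_G_mode, zero_add]

lemma IsRem.cp_eq_zero {m : ResonanceModel H E V} {ω : ℂ} {ε τ : ℝ} {v q : E}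
    (h : m.IsRem ω ε τ v q) : m.cp q = 0 := by
  rw [h, map_smul, cp_P, smul_zero]

lemma IsRem.cm_eq_zero {m : ResonanceModel H E V} {ω : ℂ} {ε τ : ℝ} {v q : E}
    (h : m.IsRem ω ε τ v q) : m.cm q = 0 := by
  rw [h, map_smul, cm_P, smul_zero]

/-- Lyapunov–Schmidt splitting: a vector is determined by its two mode coefficients and its image
under `P`, and `G 0` multiplies the coefficients by `lp` and `lm`. Each mode thus contributes one
scalar equation. -/
lemma isSol_iff (ω : ℂ) (ε τ : ℝ) (a b : ℂ) (q : E) (hp : m.cp q = 0) (hm : m.cm q = 0) :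
    m.IsSol ω ε τ (m.mode a b + q) ↔ m.IsRem ω ε τ (m.mode a b) q ∧
      a * (1 - ω ^ 2 * m.lp) = ω ^ 2 * m.cp (m.rest ω ε τ (m.mode a b + q)) ∧
      b * (1 - ω ^ 2 * m.lm) = ω ^ 2 * m.cm (m.rest ω ε τ (m.mode a b + q)) := by
  obtain ⟨u, hu⟩ : ∃ u, u = m.mode a b + q := ⟨_, rfl⟩
  rw [← hu]
  have h1 : m.cp u = a := by rw [hu, map_add, cp_mode, hp, add_zero]
  have h2 : m.cm u = b := by rw [hu, map_add, cm_mode, hm, add_zero]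
  have h3 : m.P u = q := by
    rw [P_apply, h1, h2, hu, mode]; abel
  constructor
  · intro h
    refine ⟨?_, ?_, ?_⟩
    · rw [IsRem, ← hu, ← map_smul, ← (show u = _ from h), h3]
    · have := congrArg m.cp h
      rw [G_eq_rest, map_smul, map_add, cp_G, h1, smul_eq_mul] at this
      linear_combination this
    · have := congrArg m.cm h
      rw [G_eq_rest, map_smul, map_add, cm_G, h2, smul_eq_mul] at this
      linear_combination this
  · rintro ⟨hq, ha, hb⟩
    rw [IsRem, ← hu] at hq
    rw [IsSol]
    have e := m.mode_eq_add_P (ω ^ 2 • m.G (ε * ω) (m.ι (u + (τ : ℂ) • m.T u)))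
    rw [e, map_smul, map_smul, map_smul, ← hq, G_eq_rest, map_add, map_add, cp_G, cm_G, h1, h2]
    conv_lhs => rw [hu]
    congr 2
    · rw [smul_eq_mul]; linear_combination ha
    · rw [smul_eq_mul]; linear_combination hb

/-! ### Quantitative bounds -/

lemma T_zero : m.T 0 = 0 := by simpa using m.T_smul 0 0

/-- Uniform bounds for the family `G z` on a ball. -/
lemma exists_lipschitz_ball {X : Type*} [NormedAddCommGroup X] [NormedSpace ℂ X] [CompleteSpace X]
    {F : ℂ → X} (hF : Differentiable ℂ F) (W : ℝ) :
    ∃ g > (0 : ℝ), (∀ z, ‖z‖ ≤ W → ‖F z‖ ≤ g) ∧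
      ∀ z w, ‖z‖ ≤ W → ‖w‖ ≤ W → ‖F z - F w‖ ≤ g * ‖z - w‖ := by
  have hK : IsCompact (Metric.closedBall (0 : ℂ) W) := isCompact_closedBall _ _
  obtain ⟨a, ha⟩ := hK.exists_bound_of_continuousOn hF.continuous.continuousOn
  have hd : Continuous (deriv F) := (hF.contDiff (n := 1)).continuous_deriv le_rfl
  obtain ⟨b, hb⟩ := hK.exists_bound_of_continuousOn hd.continuousOn
  refine ⟨max 1 (max a b), by positivity, fun z hz => (ha z (by simpa using hz)).trans
    ((le_max_left _ _).trans (le_max_right _ _)), fun z w hz hw => ?_⟩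
  exact (convex_closedBall (0 : ℂ) W).norm_image_sub_le_of_norm_deriv_le
    (fun x _ => hF x) (fun x hx => (hb x hx).trans ((le_max_right _ _).trans (le_max_right _ _)))
    (by simpa using hw) (by simpa using hz)


variable {H E V : Type*}
    [NormedAddCommGroup H] [InnerProductSpace ℂ H]
    [NormedAddCommGroup E] [NormedSpace ℂ E] [CompleteSpace E]
    [NormedAddCommGroup V] [NormedSpace ℂ V] (m : ResonanceModel H E V)

lemma rest_zero (ω : ℂ) (ε τ : ℝ) : m.rest ω ε τ 0 = 0 := by
  simp [rest, m.T_zero]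

/-- The source of all smallness. A change of `ω` costs a factor `ε` because the frequency enters
only through `G (εω)`; the conditions `τ M² ≤ 1` keep `u + τ T u` of the size of `u`. -/
lemma exists_rest_lipschitz {W : ℝ} (hW : 0 < W) : ∃ C > (0 : ℝ),
    ∀ (ω₁ ω₂ : ℂ) (ε τ₁ τ₂ M : ℝ) (u₁ u₂ : E), ‖ω₁‖ ≤ W → ‖ω₂‖ ≤ W → 0 ≤ ε → ε ≤ 1 →
      0 ≤ τ₁ → 0 ≤ τ₂ → τ₁ * M ^ 2 ≤ 1 → τ₂ * M ^ 2 ≤ 1 → ‖u₁‖ ≤ M → ‖u₂‖ ≤ M →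
      ‖m.rest ω₁ ε τ₁ u₁ - m.rest ω₂ ε τ₂ u₂‖ ≤
        C * ((ε + τ₁ * M ^ 2) * ‖u₁ - u₂‖ + (ε * ‖ω₁ - ω₂‖ + |τ₁ - τ₂| * M ^ 2) * M) := by
  obtain ⟨t, ht, hT⟩ := m.T_lipschitz
  obtain ⟨g, hg, hG, hL⟩ := exists_lipschitz_ball m.differentiable_G W
  set i := ‖m.ι‖ + 1 with hi
  have hi0 : 0 < i := by positivity
  have hι : ∀ x, ‖m.ι x‖ ≤ i * ‖x‖ := fun x =>
    (m.ι.le_opNorm x).trans (by gcongr; simp [hi])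
  refine ⟨g * i * (1 + t) * (1 + W), by positivity, ?_⟩
  intro ω₁ ω₂ ε τ₁ τ₂ M u₁ u₂ h1 h2 hε hε1 hτ₁ hτ₂ hM₁ hM₂ hu₁ hu₂
  have hM : 0 ≤ M := (norm_nonneg _).trans hu₁
  set x := ‖u₁ - u₂‖
  have hT2 : ‖m.T u₂‖ ≤ t * M ^ 2 * M := by
    have := hT M u₂ 0 hu₂ (by simpa using hM)
    rw [m.T_zero, sub_zero, sub_zero] at this
    exact this.trans (by gcongr)
  have hT12 := hT M u₁ u₂ hu₁ hu₂
  set N₁ := u₁ + (τ₁ : ℂ) • m.T u₁ with hN₁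
  set N₂ := u₂ + (τ₂ : ℂ) • m.T u₂ with hN₂
  have habs : ∀ s : ℝ, ∀ y : E, ‖(s : ℂ) • y‖ = |s| * ‖y‖ := fun s y => by
    rw [norm_smul, Complex.norm_real, Real.norm_eq_abs]
  have hd : ‖(τ₁ : ℂ) • m.T u₁ - (τ₂ : ℂ) • m.T u₂‖ ≤
      t * (τ₁ * M ^ 2) * x + t * (|τ₁ - τ₂| * M ^ 2 * M) := by
    have e : (τ₁ : ℂ) • m.T u₁ - (τ₂ : ℂ) • m.T u₂ =
        (τ₁ : ℂ) • (m.T u₁ - m.T u₂) + ((τ₁ - τ₂ : ℝ) : ℂ) • m.T u₂ := by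
      push_cast; rw [smul_sub, sub_smul]; abel
    rw [e]
    refine (norm_add_le _ _).trans ?_
    rw [habs, habs, abs_of_nonneg hτ₁]
    calc _ ≤ τ₁ * (t * M ^ 2 * x) + |τ₁ - τ₂| * (t * M ^ 2 * M) := by gcongr
      _ = _ := by ring
  have hN : ‖N₁ - N₂‖ ≤ (1 + t) * x + t * (|τ₁ - τ₂| * M ^ 2 * M) := by
    have e : N₁ - N₂ = (u₁ - u₂) + ((τ₁ : ℂ) • m.T u₁ - (τ₂ : ℂ) • m.T u₂) := by
      rw [hN₁, hN₂]; abel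
    rw [e]
    have h3 : t * (τ₁ * M ^ 2) * x ≤ t * 1 * x := by gcongr
    have := norm_add_le (u₁ - u₂) ((τ₁ : ℂ) • m.T u₁ - (τ₂ : ℂ) • m.T u₂)
    change _ ≤ x + _ at this
    linarith
  have hN2 : ‖N₂‖ ≤ (1 + t) * M := by
    refine (norm_add_le _ _).trans ?_
    rw [habs, abs_of_nonneg hτ₂]
    calc _ ≤ M + τ₂ * (t * M ^ 2 * M) := by gcongr
      _ = M + t * M * (τ₂ * M ^ 2) := by ring
      _ ≤ M + t * M * 1 := by gcongr
      _ = _ := by ring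
  have hz : ∀ ω : ℂ, ‖ω‖ ≤ W → ‖(ε : ℂ) * ω‖ ≤ W := fun ω hω => by
    rw [norm_mul, Complex.norm_real, Real.norm_eq_abs, abs_of_nonneg hε]
    calc ε * ‖ω‖ ≤ 1 * W := by gcongr
      _ = W := one_mul _
  have hG1 : ‖m.G (ε * ω₁) - m.G 0‖ ≤ g * (ε * W) := by
    refine (hL _ _ (hz _ h1) (by simpa using hW.le)).trans ?_
    rw [sub_zero, norm_mul, Complex.norm_real, Real.norm_eq_abs, abs_of_nonneg hε]
    gcongr
  have hG12 : ‖m.G (ε * ω₁) - m.G (ε * ω₂)‖ ≤ g * (ε * ‖ω₁ - ω₂‖) := by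
    refine (hL _ _ (hz _ h1) (hz _ h2)).trans ?_
    rw [← mul_sub, norm_mul, Complex.norm_real, Real.norm_eq_abs, abs_of_nonneg hε]
  -- Telescoping: first the argument changes, then the frequency, then the cubic term under `G 0`.
  have e : m.rest ω₁ ε τ₁ u₁ - m.rest ω₂ ε τ₂ u₂ =
      (m.G (ε * ω₁) - m.G 0) (m.ι (N₁ - N₂)) + (m.G (ε * ω₁) - m.G (ε * ω₂)) (m.ι N₂) +
      m.G 0 (m.ι ((τ₁ : ℂ) • m.T u₁ - (τ₂ : ℂ) • m.T u₂)) := by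
    simp only [rest, sub_apply, map_sub, map_smul]
    abel
  rw [e]
  have b1 : ‖(m.G (ε * ω₁) - m.G 0) (m.ι (N₁ - N₂))‖ ≤
      g * (ε * W) * (i * ((1 + t) * x + t * (|τ₁ - τ₂| * M ^ 2 * M))) :=
    (ContinuousLinearMap.le_opNorm _ _).trans
      (mul_le_mul hG1 ((hι _).trans (by gcongr)) (norm_nonneg _) (by positivity))
  have b2 : ‖(m.G (ε * ω₁) - m.G (ε * ω₂)) (m.ι N₂)‖ ≤
      g * (ε * ‖ω₁ - ω₂‖) * (i * ((1 + t) * M)) :=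
    (ContinuousLinearMap.le_opNorm _ _).trans
      (mul_le_mul hG12 ((hι _).trans (by gcongr)) (norm_nonneg _) (by positivity))
  have b3 : ‖m.G 0 (m.ι ((τ₁ : ℂ) • m.T u₁ - (τ₂ : ℂ) • m.T u₂))‖ ≤
      g * (i * (t * (τ₁ * M ^ 2) * x + t * (|τ₁ - τ₂| * M ^ 2 * M))) :=
    (ContinuousLinearMap.le_opNorm _ _).trans
      (mul_le_mul (hG 0 (by simpa using hW.le)) ((hι _).trans (by gcongr)) (norm_nonneg _) hg.le)
  have b4 : g * (ε * W) * (i * ((1 + t) * x + t * (|τ₁ - τ₂| * M ^ 2 * M))) ≤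
      g * i * (ε * W * ((1 + t) * x)) + g * i * W * t * (|τ₁ - τ₂| * M ^ 2 * M) := by
    have : g * i * W * t * (|τ₁ - τ₂| * M ^ 2 * M) * ε ≤
      g * i * W * t * (|τ₁ - τ₂| * M ^ 2 * M) * 1 := by gcongr
    linarith
  refine (norm_add₃_le).trans ?_
  have hx : 0 ≤ x := norm_nonneg _
  have p1 : 0 ≤ g * i * ((1 + t) * (ε * x)) := by positivity
  have p2 : 0 ≤ g * i * (1 + t) * W * (τ₁ * M ^ 2 * x) := by positivity
  have p2' : 0 ≤ g * i * (τ₁ * M ^ 2 * x) := by positivity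
  have p3 : 0 ≤ g * i * (1 + t) * W * (ε * ‖ω₁ - ω₂‖ * M) := by positivity
  have p4 : 0 ≤ g * i * (1 + W) * (|τ₁ - τ₂| * M ^ 2 * M) := by positivity
  linarith

lemma exists_rest_bound {W : ℝ} (hW : 0 < W) : ∃ C > (0 : ℝ),
    ∀ (ω : ℂ) (ε τ M : ℝ) (u : E), ‖ω‖ ≤ W → 0 ≤ ε → ε ≤ 1 → 0 ≤ τ → τ * M ^ 2 ≤ 1 →
      ‖u‖ ≤ M → ‖m.rest ω ε τ u‖ ≤ C * (ε + τ * M ^ 2) * ‖u‖ := by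
  obtain ⟨C, hC, h⟩ := m.exists_rest_lipschitz hW
  refine ⟨C, hC, fun ω ε τ M u hω hε hε1 hτ hM hu => ?_⟩
  have hM0 : 0 ≤ M := (norm_nonneg _).trans hu
  have := h ω ω ε τ τ M u 0 hω hω hε hε1 hτ hτ hM hM hu (by simpa using hM0)
  simpa [rest_zero, mul_assoc] using this

/-- With `A = P G 0 : H → E` and `R` the resolvent of `ι A` at `(ω²)⁻¹`, the inverse is `1 + A R ι`.
The resolvent lives on `H` only, but `A` maps `H` into `E`, so the formula defines an operator on
`E` with a uniform bound. -/
lemma exists_inverse : ∃ s > (0 : ℝ), ∀ ω ∈ m.Ω, ∃ S : E →L[ℂ] E, ‖S‖ ≤ s ∧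
    (∀ x, S (x - ω ^ 2 • m.P (m.G 0 (m.ι x))) = x) ∧
    ∀ x, S x - ω ^ 2 • m.P (m.G 0 (m.ι (S x))) = x := by
  obtain ⟨B, hB, h⟩ := m.resolvent
  set A : H →L[ℂ] E := m.P ∘L m.G 0 with hA
  refine ⟨1 + ‖A‖ * B * ‖m.ι‖, by positivity, fun ω hω => ?_⟩
  have hω0 : ω ^ 2 ≠ 0 := pow_ne_zero 2 (m.ne_zero_of_mem ω hω)
  obtain ⟨R, hR, h1, h2⟩ := h ω hω
  have hP : ∀ x : H, m.ι (A x) = m.ι (m.G 0 x) - inner ℂ (m.ι m.φp) (m.ι (m.G 0 x)) • m.ι m.φp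
      - inner ℂ (m.ι m.φm) (m.ι (m.G 0 x)) • m.ι m.φm := by
    intro x
    simp only [hA, ContinuousLinearMap.comp_apply, P_apply, map_sub, map_smul, cp_apply, cm_apply]
  simp only [← hP] at h1 h2
  refine ⟨ContinuousLinearMap.id ℂ E + A ∘L R ∘L m.ι, ?_, fun x => ?_, fun x => ?_⟩
  · refine (norm_add_le _ _).trans (add_le_add ContinuousLinearMap.norm_id_le ?_)
    refine (ContinuousLinearMap.opNorm_comp_le _ _).trans ?_
    rw [mul_assoc]
    gcongr
    exact (ContinuousLinearMap.opNorm_comp_le _ _).trans (by gcongr)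
  · change (x - ω ^ 2 • A (m.ι x)) + A (R (m.ι (x - ω ^ 2 • A (m.ι x)))) = x
    have e : R (m.ι (x - ω ^ 2 • A (m.ι x))) = ω ^ 2 • m.ι x := by
      have := h1 (ω ^ 2 • m.ι x)
      rw [smul_smul, inv_mul_cancel₀ hω0, one_smul] at this
      rw [← this]
      simp only [map_sub, map_smul]
    rw [e, map_smul]; abel
  · change (x + A (R (m.ι x))) - ω ^ 2 • A (m.ι (x + A (R (m.ι x)))) = x
    have e : m.ι (x + A (R (m.ι x))) = (ω ^ 2)⁻¹ • R (m.ι x) := by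
      rw [map_add]
      conv_lhs => enter [1]; rw [← h2 (m.ι x)]
      abel
    rw [e, map_smul, smul_smul, mul_inv_cancel₀ hω0, one_smul]; abel

/-- Stability of remainders under perturbations of the mode part and of the equation. -/
lemma exists_stability : ∃ C > (0 : ℝ), ∃ η > (0 : ℝ), η ≤ 1 ∧ ∀ ω ∈ m.Ω,
    ∀ (ε τ M : ℝ) (a₁ b₁ a₂ b₂ : ℂ) (q₁ q₂ e₁ e₂ : E), 0 ≤ ε → ε ≤ η → 0 ≤ τ → τ * M ^ 2 ≤ η →
      ‖m.mode a₁ b₁ + q₁‖ ≤ M → ‖m.mode a₂ b₂ + q₂‖ ≤ M →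
      q₁ = ω ^ 2 • m.P (m.G 0 (m.ι q₁) + m.rest ω ε τ (m.mode a₁ b₁ + q₁)) + e₁ →
      q₂ = ω ^ 2 • m.P (m.G 0 (m.ι q₂) + m.rest ω ε τ (m.mode a₂ b₂ + q₂)) + e₂ →
      ‖q₁ - q₂‖ ≤ C * (‖e₁ - e₂‖ + (ε + τ * M ^ 2) * ‖m.mode a₁ b₁ - m.mode a₂ b₂‖) := by
  obtain ⟨W, hW, hΩ⟩ := m.bounded_Ω
  obtain ⟨C, hC, hR⟩ := m.exists_rest_lipschitz hW
  obtain ⟨s, hs, hS⟩ := m.exists_inverse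
  set p := ‖m.P‖ + 1 with hp
  have hp0 : 0 < p := by positivity
  set K := s * (W ^ 2 * (p * C)) with hK
  have hK0 : 0 < K := by positivity
  refine ⟨2 * (s + K), by positivity, min 1 (1 / (4 * K)), by positivity, min_le_left _ _, ?_⟩
  intro ω hω ε τ M a₁ b₁ a₂ b₂ q₁ q₂ e₁ e₂ hε hε1 hτ hM hu₁ hu₂ h₁ h₂
  obtain ⟨S, hSs, hS1, -⟩ := hS ω hω
  have hsmall : ε + τ * M ^ 2 ≤ 1 / (2 * K) := by
    have h3 := hε1.trans (min_le_right _ _)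
    have h4 := hM.trans (min_le_right _ _)
    have : 1 / (2 * K) = 1 / (4 * K) + 1 / (4 * K) := by field_simp; norm_num
    linarith
  have hr := hR ω ω ε τ τ M _ _ (hΩ ω hω) (hΩ ω hω) hε (hε1.trans (min_le_left _ _)) hτ hτ
    (hM.trans (min_le_left _ _)) (hM.trans (min_le_left _ _)) hu₁ hu₂
  rw [sub_self, sub_self, norm_zero, abs_zero, mul_zero, zero_mul, add_zero, zero_mul,
    add_zero] at hr
  set u₁ := m.mode a₁ b₁ + q₁
  set u₂ := m.mode a₂ b₂ + q₂
  -- After inverting the linear part, `q₁ - q₂` recurs on the right only through `rest`, with factor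
  -- `K (ε + τ M²) ≤ 1/2`, and is absorbed below. The defects `e₁, e₂` are carried along so that
  -- remainders of different equations can be compared.
  have hd : q₁ - q₂ = S (ω ^ 2 • m.P (m.rest ω ε τ u₁ - m.rest ω ε τ u₂) + (e₁ - e₂)) := by
    conv_lhs => rw [← hS1 (q₁ - q₂)]
    congr 1
    conv_lhs => enter [1]; rw [h₁, h₂]
    simp only [map_add, map_sub, smul_add, smul_sub]
    abel
  have hu : ‖u₁ - u₂‖ ≤ ‖m.mode a₁ b₁ - m.mode a₂ b₂‖ + ‖q₁ - q₂‖ := by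
    rw [show u₁ - u₂ = (m.mode a₁ b₁ - m.mode a₂ b₂) + (q₁ - q₂) by simp only [u₁, u₂]; abel]
    exact norm_add_le _ _
  set x := ‖m.mode a₁ b₁ - m.mode a₂ b₂‖
  have hP : ∀ y, ‖m.P y‖ ≤ p * ‖y‖ := fun y => (m.P.le_opNorm y).trans (by gcongr; simp [hp])
  have hb : ‖q₁ - q₂‖ ≤ s * (W ^ 2 * (p * (C * ((ε + τ * M ^ 2) * (x + ‖q₁ - q₂‖)))) +
      ‖e₁ - e₂‖) := by
    conv_lhs => rw [hd]
    refine (S.le_opNorm _).trans ?_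
    gcongr
    refine (norm_add_le _ _).trans ?_
    gcongr
    rw [norm_smul, norm_pow]
    gcongr
    · exact hΩ ω hω
    · refine (hP _).trans ?_
      gcongr
      refine hr.trans ?_
      gcongr
  have hb2 : K * ((ε + τ * M ^ 2) * ‖q₁ - q₂‖) ≤ (1 / 2) * ‖q₁ - q₂‖ := by
    calc K * ((ε + τ * M ^ 2) * ‖q₁ - q₂‖) ≤ K * (1 / (2 * K) * ‖q₁ - q₂‖) := by gcongr
      _ = _ := by field_simp
  have hb3 : ‖q₁ - q₂‖ ≤ K * ((ε + τ * M ^ 2) * x) + K * ((ε + τ * M ^ 2) * ‖q₁ - q₂‖)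
      + s * ‖e₁ - e₂‖ := by
    refine hb.trans (le_of_eq ?_)
    rw [hK]; ring
  have : 0 ≤ s * ((ε + τ * M ^ 2) * x) := by positivity
  have : 0 ≤ K * ‖e₁ - e₂‖ := by positivity
  linarith

/-- Uniqueness and size of remainders. -/
lemma exists_isRem_unique : ∃ C > (0 : ℝ), ∃ η > (0 : ℝ), η ≤ 1 ∧ ∀ ω ∈ m.Ω,
    ∀ (ε τ M : ℝ) (a b : ℂ) (q : E), 0 ≤ ε → ε ≤ η → 0 ≤ τ → τ * M ^ 2 ≤ η →
      ‖m.mode a b + q‖ ≤ M → m.IsRem ω ε τ (m.mode a b) q →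
      ‖q‖ ≤ C * (ε + τ * M ^ 2) * ‖m.mode a b‖ ∧
      ∀ q', ‖m.mode a b + q'‖ ≤ M → m.IsRem ω ε τ (m.mode a b) q' → q' = q := by
  obtain ⟨C, hC, η, hη, hη1, h⟩ := m.exists_stability
  refine ⟨C, hC, η, hη, hη1, fun ω hω ε τ M a b q hε hεη hτ hM hq hr => ⟨?_, ?_⟩⟩
  · have hm0 : m.mode 0 0 = 0 := by simp [mode]
    -- Comparison with the zero remainder of the zero mode part.
    have := h ω hω ε τ M a b 0 0 q 0 0 0 hε hεη hτ hM hq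
      (by simpa [hm0] using (norm_nonneg _).trans hq)
      (by rw [add_zero]; exact (m.isRem_iff _ _ _ _ _ _).1 hr) (by simp [hm0, rest_zero])
    simpa [hm0, mul_assoc] using this
  · intro q' hq' hr'
    have := h ω hω ε τ M a b a b q' q 0 0 hε hεη hτ hM hq' hq
      (by rw [add_zero]; exact (m.isRem_iff _ _ _ _ _ _).1 hr')
      (by rw [add_zero]; exact (m.isRem_iff _ _ _ _ _ _).1 hr)
    rw [sub_self, sub_self, norm_zero, mul_zero, add_zero, mul_zero] at this
    exact sub_eq_zero.1 (norm_le_zero_iff.1 this)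

/-- Existence of remainders. -/
lemma exists_isRem : ∃ η > (0 : ℝ), η ≤ 1 ∧ ∀ ω ∈ m.Ω,
    ∀ (ε τ : ℝ) (a b : ℂ), 0 ≤ ε → ε ≤ η → 0 ≤ τ → τ * ‖m.mode a b‖ ^ 2 ≤ η →
      ∃ q, m.IsRem ω ε τ (m.mode a b) q ∧ ‖q‖ ≤ ‖m.mode a b‖ := by
  obtain ⟨W, hW, hΩ⟩ := m.bounded_Ω
  obtain ⟨C, hC, hR⟩ := m.exists_rest_lipschitz hW
  obtain ⟨s, hs, hS⟩ := m.exists_inverse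
  set p := ‖m.P‖ + 1 with hp
  have hp0 : 0 < p := by positivity
  have hP : ∀ y, ‖m.P y‖ ≤ p * ‖y‖ := fun y => (m.P.le_opNorm y).trans (by gcongr; simp [hp])
  set K := s * (W ^ 2 * (p * C)) with hK
  have hK0 : 0 < K := by positivity
  -- For `‖q‖ ≤ ‖v‖` one has `‖v + q‖ ≤ 2‖v‖`, so `τ M²` becomes `4 τ ‖v‖²`. The first entry bounds
  -- this by `1`; the second gives `ε + 4 τ ‖v‖² ≤ 5/(10K)`, hence contraction constant `1/2`.
  refine ⟨min (1 / 4) (1 / (10 * K)), by positivity,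
    (min_le_left _ _).trans (by norm_num), ?_⟩
  intro ω hω ε τ a b hε hε1 hτ hM
  obtain ⟨S, hSs, -, hS2⟩ := hS ω hω
  set v := m.mode a b
  have hε4 : ε ≤ 1 / 4 := hε1.trans (min_le_left _ _)
  have hM4 : τ * (2 * ‖v‖) ^ 2 ≤ 1 := by linarith [hM.trans (min_le_left _ _)]
  have hsmall : K * (ε + τ * (2 * ‖v‖) ^ 2) ≤ 1 / 2 := by
    have h3 := hε1.trans (min_le_right _ _)
    have h4 := hM.trans (min_le_right _ _)
    have : ε + τ * (2 * ‖v‖) ^ 2 ≤ 5 * (1 / (10 * K)) := by linarith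
    calc K * (ε + τ * (2 * ‖v‖) ^ 2) ≤ K * (5 * (1 / (10 * K))) := by gcongr
      _ = 1 / 2 := by field_simp; norm_num
  have hlip : ∀ x y : E, ‖x‖ ≤ 2 * ‖v‖ → ‖y‖ ≤ 2 * ‖v‖ →
      ‖S (ω ^ 2 • m.P (m.rest ω ε τ x)) - S (ω ^ 2 • m.P (m.rest ω ε τ y))‖ ≤
        (1 / 2) * ‖x - y‖ := by
    intro x y hx hy
    have hr := hR ω ω ε τ τ (2 * ‖v‖) x y (hΩ ω hω) (hΩ ω hω) hε (hε4.trans (by norm_num)) hτ hτ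
      hM4 hM4 hx hy
    rw [sub_self, sub_self, norm_zero, abs_zero, mul_zero, zero_mul, add_zero, zero_mul,
      add_zero] at hr
    rw [← map_sub, ← smul_sub, ← map_sub]
    calc _ ≤ s * (W ^ 2 * (p * (C * ((ε + τ * (2 * ‖v‖) ^ 2) * ‖x - y‖)))) := by
          refine (S.le_opNorm _).trans ?_
          gcongr
          rw [norm_smul, norm_pow]
          gcongr
          · exact hΩ ω hω
          · exact (hP _).trans (by gcongr)
      _ = K * (ε + τ * (2 * ‖v‖) ^ 2) * ‖x - y‖ := by rw [hK]; ring
      _ ≤ _ := by gcongr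
  have hball : ∀ q : E, ‖q - 0‖ ≤ ‖v‖ → ‖v + q‖ ≤ 2 * ‖v‖ := fun q hq => by
    rw [sub_zero] at hq
    linarith [norm_add_le v q]
  obtain ⟨q, hq, hfix⟩ := exists_fixedPoint_closedBall
    (fun q => S (ω ^ 2 • m.P (m.rest ω ε τ (v + q)))) 0 (norm_nonneg v)
    (by
      have := hlip v 0 (by linarith [norm_nonneg v]) (by simp)
      rw [rest_zero, map_zero, smul_zero, map_zero, sub_zero, sub_zero] at this
      rw [add_zero, sub_zero]; linarith)
    (fun x y hx hy => by
      have := hlip _ _ (hball x hx) (hball y hy)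
      rwa [add_sub_add_left_eq_sub] at this)
  refine ⟨q, (m.isRem_iff _ _ _ _ _ _).2 ?_, by simpa using hq⟩
  have h := hS2 (ω ^ 2 • m.P (m.rest ω ε τ (v + q)))
  beta_reduce at hfix
  rw [hfix] at h
  rw [map_add, smul_add, ← h]
  abel

end ResonanceModel
-- Real-analytic dependence of the remainder
section ContDiffComplex

variable {X : Type*} [NormedAddCommGroup X] [NormedSpace ℝ X]
  {F G : Type*} [NormedAddCommGroup F] [NormedSpace ℂ F] [NormedAddCommGroup G] [NormedSpace ℂ G]

/-- The nonlinearity is smooth over `ℝ` only, whereas the operators are complex linear; the lemmas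
of this section restrict scalars in the bilinear operations that join the two. -/
lemma _root_.ContDiff.clm_apply_complex {n : WithTop ℕ∞} {A : X → F →L[ℂ] G} {f : X → F}
    (hA : ContDiff ℝ n A) (hf : ContDiff ℝ n f) : ContDiff ℝ n fun x => A x (f x) :=
  ((isBoundedBilinearMap_apply (𝕜 := ℂ) (E := F) (F := G)).contDiff.restrict_scalars ℝ).comp
    (hA.prodMk hf)

lemma _root_.ContDiff.smul_complex {n : WithTop ℕ∞} {c : X → ℂ} {f : X → F}
    (hc : ContDiff ℝ n c) (hf : ContDiff ℝ n f) : ContDiff ℝ n fun x => c x • f x :=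
  ((isBoundedBilinearMap_smul (𝕜 := ℂ) (A := ℂ) (E := F)).contDiff.restrict_scalars ℝ).comp
    (hc.prodMk hf)

lemma _root_.ContDiff.clm_complex {n : WithTop ℕ∞} (A : F →L[ℂ] G) {f : X → F}
    (hf : ContDiff ℝ n f) : ContDiff ℝ n fun x => A (f x) :=
  (A.contDiff.restrict_scalars ℝ).comp hf

end ContDiffComplex

namespace ResonanceModel

variable {H E V : Type*}
    [NormedAddCommGroup H] [InnerProductSpace ℂ H]
    [NormedAddCommGroup E] [NormedSpace ℂ E] [CompleteSpace E]
    [NormedAddCommGroup V] [NormedSpace ℂ V] (m : ResonanceModel H E V)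

/-- The right-hand side of the equation before projection, as a function of `(ω, a, b, ε)` and
the remainder. -/
def source (x : (ℂ × ℂ × ℂ × ℝ) × E) : H :=
  m.ι (m.mode x.1.2.1 x.1.2.2.1 + x.2 + m.T (m.mode x.1.2.1 x.1.2.2.1 + x.2))

lemma contDiff_source : ContDiff ℝ ⊤ m.source := by
  have h1 : ContDiff ℝ ⊤ fun x : (ℂ × ℂ × ℂ × ℝ) × E =>
      m.mode x.1.2.1 x.1.2.2.1 + x.2 := by
    refine ContDiff.add (ContDiff.add ?_ ?_) contDiff_snd
    · exact ContDiff.smul_complex (by fun_prop) contDiff_const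
    · exact ContDiff.smul_complex (by fun_prop) contDiff_const
  exact ContDiff.clm_complex m.ι (h1.add (m.contDiff_T.comp h1))

lemma contDiff_family {X : Type*} [NormedAddCommGroup X] [NormedSpace ℂ X] [CompleteSpace X]
    {A : ℂ → X} (hA : Differentiable ℂ A) :
    ContDiff ℝ ⊤ fun x : (ℂ × ℂ × ℂ × ℝ) × E => A ((x.1.2.2.2 : ℂ) * x.1.1) := by
  refine (hA.contDiff.restrict_scalars ℝ).comp ?_
  have : ContDiff ℝ ⊤ fun x : (ℂ × ℂ × ℂ × ℝ) × E => (x.1.2.2.2 : ℂ) :=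
    Complex.ofRealCLM.contDiff.comp (by fun_prop)
  exact this.mul (by fun_prop)

/-- Implicit function theorem in the analytic class, which is what the smoothness exponent `⊤`
denotes here. The partial derivative in the remainder is `A (1 - S L)`, where `A` is the invertible
linear part, `S` its inverse and `S L` has norm at most `1/2`. No continuity of `r` is needed:
uniqueness identifies it with the implicit function, and the strict bound `< M` makes the ball
condition open. -/
lemma analyticAt_remainder : ∃ η > (0 : ℝ), η ≤ 1 ∧
    ∀ (r : ℂ → ℂ → ℂ → ℝ → E) (c M εs : ℝ), 0 ≤ M → M ^ 2 ≤ η → εs ≤ η →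
      (∀ ω ∈ m.Ω, ∀ a b : ℂ, ‖a‖ + ‖b‖ < c → ∀ ε : ℝ, 0 < ε → ε < εs →
        m.IsRem ω ε 1 (m.mode a b) (r ω a b ε) ∧ ‖m.mode a b + r ω a b ε‖ < M) →
      ∀ p : ℂ × ℂ × ℂ × ℝ, p.1 ∈ m.Ω → ‖p.2.1‖ + ‖p.2.2.1‖ < c → 0 < p.2.2.2 → p.2.2.2 < εs →
        ContDiffAt ℝ ⊤ (fun p : ℂ × ℂ × ℂ × ℝ => r p.1 p.2.1 p.2.2.1 p.2.2.2) p := by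
  obtain ⟨W, hW, hΩ⟩ := m.bounded_Ω
  obtain ⟨C, hC, hR⟩ := m.exists_rest_lipschitz hW
  obtain ⟨s, hs, hS⟩ := m.exists_inverse
  obtain ⟨C₁, hC₁, η₁, hη₁, hη₁1, huniq⟩ := m.exists_isRem_unique
  set k := ‖m.P‖ + 1 with hk
  have hk0 : 0 < k := by positivity
  have hP : ∀ y, ‖m.P y‖ ≤ k * ‖y‖ := fun y => (m.P.le_opNorm y).trans (by gcongr; simp [hk])
  set K := s * (W ^ 2 * (k * C)) with hK
  have hK0 : 0 < K := by positivity
  refine ⟨min η₁ (1 / (4 * K)), by positivity, (min_le_left _ _).trans hη₁1, ?_⟩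
  intro r c M εs hM0 hM hεs hr p₀ hp1 hp2 hp3 hp4
  obtain ⟨hrem, hlt⟩ := hr _ hp1 _ _ hp2 _ hp3 hp4
  have hε₀ : p₀.2.2.2 ≤ η₁ := (hp4.le.trans hεs).trans (min_le_left _ _)
  have hM1 : 1 * M ^ 2 ≤ η₁ := by rw [one_mul]; exact hM.trans (min_le_left _ _)
  have hsmall : K * (p₀.2.2.2 + 1 * M ^ 2) ≤ 1 / 2 := by
    have h3 := (hp4.le.trans hεs).trans (min_le_right _ _)
    have h4 := hM.trans (min_le_right _ _)
    calc K * (p₀.2.2.2 + 1 * M ^ 2) ≤ K * (1 / (4 * K) + 1 / (4 * K)) := by rw [one_mul]; gcongr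
      _ = 1 / 2 := by field_simp; norm_num
  set ρ : ℂ × ℂ × ℂ × ℝ → E := fun p => r p.1 p.2.1 p.2.2.1 p.2.2.2 with hρ
  set Φ : (ℂ × ℂ × ℂ × ℝ) × E → E := fun x => x.2 - x.1.1 ^ 2 •
    m.P (m.G ((x.1.2.2.2 : ℂ) * x.1.1) (m.source x)) with hΦ
  have hΦc : ContDiff ℝ ⊤ Φ :=
    contDiff_snd.sub (ContDiff.smul_complex (by fun_prop) (ContDiff.clm_complex _
      (ContDiff.clm_apply_complex (contDiff_family m.differentiable_G) m.contDiff_source)))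
  have hΦ_iff : ∀ p q, Φ (p, q) = 0 ↔
      m.IsRem p.1 p.2.2.2 1 (m.mode p.2.1 p.2.2.1) q := by
    intro p q
    rw [IsRem, ofReal_one, one_smul]
    exact sub_eq_zero
  obtain ⟨S, hSs, hS1, hS2⟩ := hS _ hp1
  set A : E →L[ℝ] E := (ContinuousLinearMap.id ℂ E -
    p₀.1 ^ 2 • (m.P ∘L m.G 0 ∘L m.ι)).restrictScalars ℝ with hA
  have hAap : ∀ x, A x = x - p₀.1 ^ 2 • m.P (m.G 0 (m.ι x)) := fun x => rfl
  set v₀ := m.mode p₀.2.1 p₀.2.2.1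
  have hslice : ∀ q, Φ (p₀, q) = A q - p₀.1 ^ 2 • m.P (m.rest p₀.1 p₀.2.2.2 1 (v₀ + q)) := by
    intro q
    have h := m.G_eq_rest p₀.1 p₀.2.2.2 1 (v₀ + q)
    rw [ofReal_one, one_smul] at h
    change q - p₀.1 ^ 2 • m.P (m.G _ (m.ι (v₀ + q + m.T (v₀ + q)))) = _
    rw [h, hAap, map_add m.P, map_add m.ι, map_add (m.G 0), map_add m.P, P_G_mode, zero_add,
      smul_add]
    abel
  have hder := (hΦc.differentiable (by simp)).differentiableAt (x := (p₀, ρ p₀)) |>.hasFDerivAt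
  set f' := fderiv ℝ Φ (p₀, ρ p₀) with hf'
  have hpart : HasFDerivAt (fun q => Φ (p₀, q)) (f' ∘L ContinuousLinearMap.inr ℝ _ E) (ρ p₀) :=
    hder.comp (ρ p₀) (hasFDerivAt_prodMk_right p₀ (ρ p₀))
  set L := A - f' ∘L ContinuousLinearMap.inr ℝ _ E with hL
  have hrest : HasFDerivAt (fun q => S (p₀.1 ^ 2 • m.P (m.rest p₀.1 p₀.2.2.2 1 (v₀ + q))))
      (S.restrictScalars ℝ ∘L L) (ρ p₀) := by
    have h1 : HasFDerivAt (fun q => A q - Φ (p₀, q)) L (ρ p₀) := A.hasFDerivAt.sub hpart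
    have h2 := (S.restrictScalars ℝ).hasFDerivAt.comp (ρ p₀) h1
    refine h2.congr_of_eventuallyEq (Eventually.of_forall fun q => ?_)
    simp only [Function.comp_apply, hslice]
    simp
  have hnorm : ‖S.restrictScalars ℝ ∘L L‖ ≤ 1 / 2 := by
    -- A derivative is bounded by the local Lipschitz constant, so the derivative of the
    -- nonlinearity need not be computed.
    refine hrest.le_of_lip' (by norm_num) ?_
    have hopen : ∀ᶠ q in nhds (ρ p₀), ‖v₀ + q‖ < M :=
      (continuous_const.add continuous_id).norm.continuousAt.eventually_lt continuousAt_const hlt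
    filter_upwards [hopen] with q hq
    have h := hR p₀.1 p₀.1 p₀.2.2.2 1 1 M _ _ (hΩ _ hp1) (hΩ _ hp1) hp3.le
      (hε₀.trans hη₁1) zero_le_one zero_le_one (hM1.trans hη₁1) (hM1.trans hη₁1) hq.le hlt.le
    rw [sub_self, sub_self, norm_zero, abs_zero, mul_zero, zero_mul, add_zero, zero_mul,
      add_zero, add_sub_add_left_eq_sub] at h
    rw [← map_sub, ← smul_sub, ← map_sub]
    calc _ ≤ s * (W ^ 2 * (k * (C * ((p₀.2.2.2 + 1 * M ^ 2) * ‖q - ρ p₀‖)))) := by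
          refine (S.le_opNorm _).trans ?_
          gcongr
          rw [norm_smul, norm_pow]
          gcongr
          · exact hΩ _ hp1
          · exact (hP _).trans (by gcongr)
      _ = K * (p₀.2.2.2 + 1 * M ^ 2) * ‖q - ρ p₀‖ := by rw [hK]; ring
      _ ≤ _ := by gcongr
  have hAinv : A.IsInvertible := by
    refine ContinuousLinearMap.IsInvertible.of_inverse (g := S.restrictScalars ℝ) ?_ ?_
    · ext x; exact hS2 x
    · ext x; exact hS1 x
  have hUinv : (ContinuousLinearMap.id ℝ E - S.restrictScalars ℝ ∘L L).IsInvertible := by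
    obtain ⟨u, hu⟩ := isUnit_one_sub_of_norm_lt_one
      (x := (S.restrictScalars ℝ ∘L L : E →L[ℝ] E)) (by linarith)
    refine ContinuousLinearMap.IsInvertible.of_inverse (g := (↑u⁻¹ : E →L[ℝ] E)) ?_ ?_
    · rw [show ContinuousLinearMap.id ℝ E - S.restrictScalars ℝ ∘L L = (u : E →L[ℝ] E) from hu.symm]
      exact u.mul_inv
    · rw [show ContinuousLinearMap.id ℝ E - S.restrictScalars ℝ ∘L L = (u : E →L[ℝ] E) from hu.symm]
      exact u.inv_mul
  have hinv : (f' ∘L ContinuousLinearMap.inr ℝ (ℂ × ℂ × ℂ × ℝ) E).IsInvertible := by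
    have : f' ∘L ContinuousLinearMap.inr ℝ (ℂ × ℂ × ℂ × ℝ) E =
        A ∘L (ContinuousLinearMap.id ℝ E - S.restrictScalars ℝ ∘L L) := by
      ext x
      have : A (S (L x)) = L x := hS2 _
      change _ = A (x - S (L x))
      rw [map_sub, this]
      simp [hL]
    rw [this]
    exact hAinv.comp hUinv
  have hcd : ContDiffAt ℝ ⊤ Φ (p₀, ρ p₀) := hΦc.contDiffAt
  have hψ := hcd.contDiffAt_implicitFunction (by simp) hinv
  have hψ0 := hcd.implicitFunction_apply_self (by simp) hinv
  have hψe := hcd.eventually_apply_implicitFunction (by simp) hinv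
  set ψ := hcd.implicitFunction (by simp) hinv
  simp only at hψ hψ0 hψe
  have hΦ0 : Φ (p₀, ρ p₀) = 0 := (hΦ_iff _ _).2 hrem
  have hmode : Continuous fun p : ℂ × ℂ × ℂ × ℝ => m.mode p.2.1 p.2.2.1 := by
    unfold mode; fun_prop
  -- Near `p₀` both `ψ p` and the given remainder solve the equation inside the ball of radius `M`,
  -- hence they agree.
  refine hψ.congr_of_eventuallyEq ?_
  have e1 : ∀ᶠ p in nhds p₀, ‖m.mode p.2.1 p.2.2.1 + ψ p‖ < M := by
    refine ContinuousAt.eventually_lt ?_ continuousAt_const ?_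
    · exact (hmode.continuousAt.add hψ.continuousAt).norm
    · rw [hψ0]; exact hlt
  have e2 : ∀ᶠ p : ℂ × ℂ × ℂ × ℝ in nhds p₀, p.1 ∈ m.Ω :=
    continuous_fst.continuousAt.eventually (m.isOpen_Ω.mem_nhds hp1)
  have e3 : ∀ᶠ p : ℂ × ℂ × ℂ × ℝ in nhds p₀, ‖p.2.1‖ + ‖p.2.2.1‖ < c :=
    ContinuousAt.eventually_lt (by fun_prop) continuousAt_const hp2
  have e4 : ∀ᶠ p : ℂ × ℂ × ℂ × ℝ in nhds p₀, 0 < p.2.2.2 :=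
    ContinuousAt.eventually_lt continuousAt_const (by fun_prop) hp3
  have e5 : ∀ᶠ p : ℂ × ℂ × ℂ × ℝ in nhds p₀, p.2.2.2 < εs :=
    ContinuousAt.eventually_lt (by fun_prop) continuousAt_const hp4
  filter_upwards [hψe, e1, e2, e3, e4, e5] with p he h1 h2 h3 h4 h5
  obtain ⟨ha, hb⟩ := hr _ h2 _ _ h3 _ h4 h5
  rw [hΦ0] at he
  exact (huniq _ h2 p.2.2.2 1 M _ _ (ψ p) h4.le ((h5.le.trans hεs).trans (min_le_left _ _))
    zero_le_one hM1 h1.le ((hΦ_iff _ _).1 he)).2 _ hb.le ha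


variable {H E V : Type*}
    [NormedAddCommGroup H] [InnerProductSpace ℂ H]
    [NormedAddCommGroup E] [NormedSpace ℂ E] [CompleteSpace E]
    [NormedAddCommGroup V] [NormedSpace ℂ V] (m : ResonanceModel H E V)

/-! ### Symmetries -/

lemma cp_ρ (x : E) : m.cp (m.ρ x) = m.cp x := by
  rw [cp_apply, cp_apply, ← m.inner_ρ m.φp x, m.ρ_φp]

lemma cm_ρ (x : E) : m.cm (m.ρ x) = -m.cm x := by
  rw [cm_apply, cm_apply, ← m.inner_ρ m.φm x, m.ρ_φm, map_neg, inner_neg_left, neg_neg]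

lemma P_ρ (x : E) : m.P (m.ρ x) = m.ρ (m.P x) := by
  simp only [P_apply, cp_ρ, cm_ρ, map_sub, map_smul, m.ρ_φp, m.ρ_φm, smul_neg, neg_smul]

lemma rest_ρ (ω : ℂ) (ε τ : ℝ) (u : E) : m.ρ (m.rest ω ε τ u) = m.rest ω ε τ (m.ρ u) := by
  simp only [rest, sub_apply, map_add, map_sub, map_smul, m.ρ_G, m.ρ_T]

lemma ρ_mode (a b : ℂ) : m.ρ (m.mode a b) = m.mode a (-b) := by
  simp only [mode, map_add, map_smul, m.ρ_φp, m.ρ_φm, smul_neg, neg_smul]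

lemma isRem_ρ {ω : ℂ} {ε τ : ℝ} {v q : E} (h : m.IsRem ω ε τ v q) :
    m.IsRem ω ε τ (m.ρ v) (m.ρ q) := by
  rw [IsRem] at h ⊢
  conv_lhs => rw [h]
  simp only [map_smul, ← P_ρ, m.ρ_G, map_add, m.ρ_T]

/-- `rest` commutes with `ρ` while `cm` changes sign under it, so the value equals its own negative.
-/
lemma cm_rest_eq_zero {ω : ℂ} {ε τ : ℝ} {u : E} (h : m.ρ u = u) : m.cm (m.rest ω ε τ u) = 0 := by
  have := m.cm_ρ (m.rest ω ε τ u)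
  rw [rest_ρ, h] at this
  exact self_eq_neg.1 this

lemma T_smul_of_norm_one {c : ℂ} (hc : ‖c‖ = 1) (u : E) : m.T (c • u) = c • m.T u := by
  rw [m.T_smul, hc]; simp

lemma isSol_smul {ω : ℂ} {ε τ : ℝ} {c : ℂ} (hc : ‖c‖ = 1) {u : E} (h : m.IsSol ω ε τ u) :
    m.IsSol ω ε τ (c • u) := by
  rw [IsSol, m.T_smul_of_norm_one hc, smul_comm (τ : ℂ) c, ← smul_add, map_smul, map_smul,
    smul_comm, ← (show u = _ from h)]

/-- Scaling trades the size of the solution against the strength of the nonlinearity. -/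
lemma isRem_scale {ω : ℂ} {ε τ : ℝ} (c : ℂ) {v q : E} (h : m.IsRem ω ε (τ * ‖c‖ ^ 2) v q) :
    m.IsRem ω ε τ (c • v) (c • q) := by
  rw [IsRem] at h ⊢
  conv_lhs => rw [h]
  rw [← smul_add, m.T_smul, smul_smul (τ : ℂ), smul_comm _ c, ← smul_add, map_smul, map_smul,
    map_smul, smul_comm c]
  push_cast
  rfl

lemma isSol_scale {ω : ℂ} {ε τ : ℝ} (c : ℂ) {u : E} (h : m.IsSol ω ε (τ * ‖c‖ ^ 2) u) :
    m.IsSol ω ε τ (c • u) := by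
  rw [IsSol] at h ⊢
  conv_lhs => rw [h]
  rw [m.T_smul, smul_smul (τ : ℂ), smul_comm _ c, ← smul_add, map_smul, map_smul, smul_comm c]
  push_cast
  rfl

/-- `κ` is antilinear and carries `G z` to `G (-z̄)`; since `(-ω̄)²` is the conjugate of `ω²`, the
frequency `-ω̄` is the one that fits. -/
lemma isSol_κ {ω : ℂ} {ε τ : ℝ} {u : E} (h : m.IsSol ω ε τ u) :
    m.IsSol (-(starRingEnd ℂ) ω) ε τ (m.κ u) := by
  rw [IsSol] at h ⊢
  conv_lhs => rw [h]
  rw [LinearMap.map_smulₛₗ, m.κ_G, map_add, LinearMap.map_smulₛₗ, m.κ_T]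
  simp

/-! ### Classification of small solutions -/

lemma norm_mode_le (a b : ℂ) : ‖m.mode a b‖ ≤ (‖m.φp‖ + ‖m.φm‖) * (‖a‖ + ‖b‖) := by
  refine (norm_add_le _ _).trans ?_
  rw [norm_smul, norm_smul]
  have := mul_nonneg (norm_nonneg a) (norm_nonneg m.φm)
  have := mul_nonneg (norm_nonneg b) (norm_nonneg m.φp)
  linarith

/-- The first scalar equation is, up to a small factor, proportional to the first coefficient. -/
lemma exists_cp_rest_le : ∃ C > (0 : ℝ), ∃ η > (0 : ℝ), η ≤ 1 ∧ ∀ ω ∈ m.Ω,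
    ∀ (ε τ M : ℝ) (a b : ℂ) (q : E), 0 ≤ ε → ε ≤ η → 0 ≤ τ → τ * M ^ 2 ≤ η →
      ‖m.mode a b + q‖ ≤ M → m.IsRem ω ε τ (m.mode a b) q →
      ‖m.cp (m.rest ω ε τ (m.mode a b + q))‖ ≤ C * (ε + τ * M ^ 2) * ‖a‖ := by
  obtain ⟨W, hW, hΩ⟩ := m.bounded_Ω
  obtain ⟨C₁, hC₁, hR⟩ := m.exists_rest_lipschitz hW
  obtain ⟨C₂, hC₂, η₂, hη₂, hη₂1, hst⟩ := m.exists_stability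
  obtain ⟨η₃, hη₃, hη₃1, hex⟩ := m.exists_isRem
  obtain ⟨C₄, hC₄, η₄, hη₄, hη₄1, huniq⟩ := m.swap.exists_isRem_unique
  rw [swap_isRem] at huniq
  set k := ‖m.cm‖ * ‖m.φm‖ with hk
  -- `l M` is a radius containing both the given solution and the comparison solution with `a = 0`,
  -- whose norm is at most `2 k M`. The smallness threshold is divided by `l²` accordingly.
  set l := 1 + 2 * k with hl
  have hl1 : 1 ≤ l := by rw [hl]; have : 0 ≤ k := by positivity
                         linarith
  set f := ‖m.φp‖
  refine ⟨(‖m.cp‖ + 1) * (C₁ * l ^ 2 * ((1 + 2 * C₂) * (f + 1))), by positivity,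
    min η₂ (min η₃ η₄) / l ^ 2, by positivity, ?_, ?_⟩
  · exact (div_le_self (by positivity) (by nlinarith)).trans ((min_le_left _ _).trans hη₂1)
  intro ω hω ε τ M a b q hε hεη hτ hM hu hq
  have hM0 : 0 ≤ M := (norm_nonneg _).trans hu
  have hsm : τ * (l * M) ^ 2 ≤ min η₂ (min η₃ η₄) := by
    rw [le_div_iff₀ (by positivity)] at hM
    linarith
  have hεm : ε ≤ min η₂ (min η₃ η₄) :=
    hεη.trans (div_le_self (by positivity) (by nlinarith))
  have hb : ‖m.mode 0 b‖ ≤ k * M := by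
    have h1 : m.cm (m.mode a b + q) = b := by rw [map_add, cm_mode, hq.cm_eq_zero, add_zero]
    have h2 : ‖b‖ ≤ ‖m.cm‖ * M := by
      rw [← h1]; exact (m.cm.le_opNorm _).trans (by gcongr)
    rw [mode, zero_smul, zero_add, norm_smul, hk]
    calc ‖b‖ * ‖m.φm‖ ≤ (‖m.cm‖ * M) * ‖m.φm‖ := by gcongr
      _ = _ := by ring
  have hkM : k * M ≤ l * M := by gcongr; rw [hl]; have : 0 ≤ k := by positivity
                                 linarith
  obtain ⟨q', hq', hq'n⟩ := hex ω hω ε τ 0 b hε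
    (hεm.trans ((min_le_right _ _).trans (min_le_left _ _))) hτ (by
      refine le_trans ?_ (hsm.trans ((min_le_right _ _).trans (min_le_left _ _)))
      gcongr
      exact hb.trans hkM)
  have hu' : ‖m.mode 0 b + q'‖ ≤ l * M := by
    have := norm_add_le (m.mode 0 b) q'
    rw [hl]; linarith
  -- `-ρ q'` is again a remainder for `mode 0 b` in the same ball, so uniqueness gives `-ρ q' = q'`.
  have hodd : m.ρ (m.mode 0 b + q') = -(m.mode 0 b + q') := by
    have h1 := m.swap.isRem_ρ (m.swap_isRem ▸ hq')
    rw [swap_isRem] at h1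
    have e : m.swap.ρ (m.mode 0 b) = m.mode 0 b := by
      change -m.ρ (m.mode 0 b) = _
      rw [ρ_mode]; simp [mode]
    rw [e] at h1
    have h2 := (huniq ω hω ε τ (l * M) b 0 q' hε
      (hεm.trans ((min_le_right _ _).trans (min_le_right _ _))) hτ
      (hsm.trans ((min_le_right _ _).trans (min_le_right _ _)))
      (by rw [swap_mode]; exact hu') (by rw [swap_mode]; exact hq')).2 (m.swap.ρ q')
      (by
        rw [swap_mode]
        have : m.mode 0 b + m.swap.ρ q' = m.swap.ρ (m.mode 0 b + q') := by rw [map_add, e]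
        rw [this]
        exact (m.swap.norm_ρ _).trans hu')
      (by rw [swap_mode]; exact h1)
    change -m.ρ q' = q' at h2
    change -m.ρ (m.mode 0 b) = _ at e
    rw [map_add]
    nth_rewrite 2 [← h2, ← e]
    abel
  -- The comparison solution satisfies the first scalar equation trivially; the required bound is
  -- then the Lipschitz bound of `rest` between the two solutions, whose distance is of order `|a|`.
  have hzero : m.cp (m.rest ω ε τ (m.mode 0 b + q')) = 0 :=
    m.swap.cm_rest_eq_zero (u := m.mode 0 b + q') (by
      change -m.ρ _ = _
      rw [hodd, neg_neg])
  have hMl : M ≤ l * M := le_mul_of_one_le_left hM0 hl1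
  have hs := hst ω hω ε τ (l * M) a b 0 b q q' 0 0 hε (hεm.trans (min_le_left _ _)) hτ
    (hsm.trans (min_le_left _ _)) (hu.trans hMl) hu'
    (by rw [add_zero]; exact (m.isRem_iff _ _ _ _ _ _).1 hq)
    (by rw [add_zero]; exact (m.isRem_iff _ _ _ _ _ _).1 hq')
  have hmode : ‖m.mode a b - m.mode 0 b‖ = ‖a‖ * f := by
    rw [mode_sub, mode, sub_self, zero_smul, add_zero, sub_zero, norm_smul]
  rw [hmode, sub_self, norm_zero, zero_add] at hs
  have hε1 : ε ≤ 1 := (hεm.trans (min_le_left _ _)).trans hη₂1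
  have hM1 : τ * (l * M) ^ 2 ≤ 1 := (hsm.trans (min_le_left _ _)).trans hη₂1
  have hs2 : ‖q - q'‖ ≤ 2 * C₂ * (‖a‖ * f) := by
    refine hs.trans ?_
    calc C₂ * ((ε + τ * (l * M) ^ 2) * (‖a‖ * f)) ≤ C₂ * ((1 + 1) * (‖a‖ * f)) := by gcongr
      _ = _ := by ring
  have hdiff : ‖(m.mode a b + q) - (m.mode 0 b + q')‖ ≤ (1 + 2 * C₂) * (f + 1) * ‖a‖ := by
    rw [add_sub_add_comm]
    refine (norm_add_le _ _).trans ?_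
    rw [hmode]
    have : 0 ≤ (1 + 2 * C₂) * ‖a‖ := by positivity
    linarith
  have hr := hR ω ω ε τ τ (l * M) _ _ (hΩ ω hω) (hΩ ω hω) hε hε1 hτ hτ hM1 hM1
    (hu.trans hMl) hu'
  rw [sub_self, sub_self, norm_zero, abs_zero, mul_zero, zero_mul, add_zero, zero_mul,
    add_zero] at hr
  have e : m.cp (m.rest ω ε τ (m.mode a b + q)) =
      m.cp (m.rest ω ε τ (m.mode a b + q) - m.rest ω ε τ (m.mode 0 b + q')) := by
    rw [map_sub, hzero, sub_zero]
  rw [e]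
  calc _ ≤ (‖m.cp‖ + 1) * (C₁ * ((l ^ 2 * (ε + τ * M ^ 2)) * ((1 + 2 * C₂) * (f + 1) * ‖a‖))) := by
        refine (m.cp.le_opNorm _).trans ?_
        gcongr
        · linarith
        refine hr.trans ?_
        gcongr
        have : 1 * ε ≤ l ^ 2 * ε := by gcongr; nlinarith
        linarith
    _ = _ := by ring

/-- A nonzero coefficient can be cancelled from its scalar equation, which makes `1 - ω² lp`,
respectively `1 - ω² lm`, small. Both cannot be small since `lp ≠ lm`. If both coefficients vanish,
so does the remainder, and with it the solution. -/
lemma exists_classification : ∃ C > (0 : ℝ), ∃ η > (0 : ℝ), η ≤ 1 ∧ ∀ ω ∈ m.Ω,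
    ∀ (ε τ M : ℝ) (a b : ℂ) (q : E), 0 ≤ ε → ε ≤ η → 0 ≤ τ → τ * M ^ 2 ≤ η →
      m.cp q = 0 → m.cm q = 0 → ‖m.mode a b + q‖ ≤ M → m.IsSol ω ε τ (m.mode a b + q) →
      m.mode a b + q ≠ 0 →
      (a ≠ 0 ∧ b = 0 ∧ ‖1 - ω ^ 2 * m.lp‖ ≤ C * (ε + τ * M ^ 2)) ∨
      (a = 0 ∧ b ≠ 0 ∧ ‖1 - ω ^ 2 * m.lm‖ ≤ C * (ε + τ * M ^ 2)) := by
  obtain ⟨W, hW, hΩ⟩ := m.bounded_Ω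
  obtain ⟨C₁, hC₁, η₁, hη₁, hη₁1, h₁⟩ := m.exists_cp_rest_le
  obtain ⟨C₂, hC₂, η₂, hη₂, hη₂1, h₂⟩ := m.swap.exists_cp_rest_le
  obtain ⟨C₃, hC₃, η₃, hη₃, hη₃1, h₃⟩ := m.exists_isRem_unique
  rw [swap_isRem] at h₂
  set C := W ^ 2 * (C₁ + C₂) with hC
  have hC0 : 0 < C := by positivity
  set g := |m.lm - m.lp| with hg
  have hg0 : 0 < g := abs_pos.2 (sub_ne_zero.2 m.lp_ne_lm.symm)
  have hl0 : 0 < m.lm + m.lp := add_pos m.lm_pos m.lp_pos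
  refine ⟨C, hC0, min (min η₁ (min η₂ η₃)) (g / (4 * (C * (m.lm + m.lp)))), by positivity,
    (min_le_left _ _).trans ((min_le_left _ _).trans hη₁1), ?_⟩
  intro ω hω ε τ M a b q hε hεη hτ hM hp hm hu hsol hne
  obtain ⟨hrem, hea, heb⟩ := (m.isSol_iff ω ε τ a b q hp hm).1 hsol
  have hεη' := hεη.trans (min_le_left _ _)
  have hM' := hM.trans (min_le_left _ _)
  have ha1 : a ≠ 0 → ‖1 - ω ^ 2 * m.lp‖ ≤ C * (ε + τ * M ^ 2) := by
    intro ha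
    have := h₁ ω hω ε τ M a b q hε (hεη'.trans (min_le_left _ _)) hτ (hM'.trans (min_le_left _ _))
      hu hrem
    have h4 : ‖a‖ * ‖1 - ω ^ 2 * m.lp‖ ≤ ‖a‖ * (C * (ε + τ * M ^ 2)) := by
      rw [← norm_mul, hea, norm_mul, norm_pow]
      calc _ ≤ W ^ 2 * (C₁ * (ε + τ * M ^ 2) * ‖a‖) := by gcongr; exact hΩ ω hω
        _ ≤ W ^ 2 * ((C₁ + C₂) * (ε + τ * M ^ 2) * ‖a‖) := by gcongr; linarith
        _ = _ := by rw [hC]; ring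
    exact le_of_mul_le_mul_left h4 (norm_pos_iff.2 ha)
  have hb1 : b ≠ 0 → ‖1 - ω ^ 2 * m.lm‖ ≤ C * (ε + τ * M ^ 2) := by
    intro hb
    have := h₂ ω hω ε τ M b a q hε (hεη'.trans ((min_le_right _ _).trans (min_le_left _ _))) hτ
      (hM'.trans ((min_le_right _ _).trans (min_le_left _ _)))
      (by rw [swap_mode]; exact hu) (by rw [swap_mode]; exact hrem)
    rw [swap_mode] at this
    change ‖m.cm (m.rest ω ε τ _)‖ ≤ _ at this
    have h4 : ‖b‖ * ‖1 - ω ^ 2 * m.lm‖ ≤ ‖b‖ * (C * (ε + τ * M ^ 2)) := by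
      rw [← norm_mul, heb, norm_mul, norm_pow]
      calc _ ≤ W ^ 2 * (C₂ * (ε + τ * M ^ 2) * ‖b‖) := by gcongr; exact hΩ ω hω
        _ ≤ W ^ 2 * ((C₁ + C₂) * (ε + τ * M ^ 2) * ‖b‖) := by gcongr; linarith
        _ = _ := by rw [hC]; ring
    exact le_of_mul_le_mul_left h4 (norm_pos_iff.2 hb)
  by_cases ha : a = 0
  · by_cases hb : b = 0
    · exfalso
      subst ha hb
      have hm0 : m.mode 0 0 = 0 := by simp [mode]
      have := (h₃ ω hω ε τ M 0 0 q hε (hεη'.trans ((min_le_right _ _).trans (min_le_right _ _))) hτ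
        (hM'.trans ((min_le_right _ _).trans (min_le_right _ _))) hu hrem).1
      rw [hm0, norm_zero, mul_zero, norm_le_zero_iff] at this
      exact hne (by rw [hm0, this, add_zero])
    · exact Or.inr ⟨ha, hb, hb1 hb⟩
  · by_cases hb : b = 0
    · exact Or.inl ⟨ha, hb, ha1 ha⟩
    · exfalso
      have h5 := ha1 ha
      have h6 := hb1 hb
      -- The combination that eliminates `ω²`. The threshold `g / (4 C (lm + lp))` makes its
      -- right-hand side at most `g / 2 < g`.
      have e : ((m.lm - m.lp : ℝ) : ℂ) =
          m.lm * (1 - ω ^ 2 * m.lp) - m.lp * (1 - ω ^ 2 * m.lm) := by push_cast; ring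
      have h7 : g ≤ m.lm * (C * (ε + τ * M ^ 2)) + m.lp * (C * (ε + τ * M ^ 2)) := by
        rw [hg, ← Real.norm_eq_abs, ← Complex.norm_real, e]
        refine (norm_sub_le _ _).trans ?_
        rw [norm_mul, norm_mul, Complex.norm_real, Complex.norm_real, Real.norm_of_nonneg
          m.lm_pos.le, Real.norm_of_nonneg m.lp_pos.le]
        have := m.lm_pos.le
        have := m.lp_pos.le
        gcongr
      have h8 := hεη.trans (min_le_right _ _)
      have h9 := hM.trans (min_le_right _ _)
      have h10 : (m.lm + m.lp) * C * (ε + τ * M ^ 2) ≤ g / 2 := by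
        calc _ ≤ (m.lm + m.lp) * C * (g / (4 * (C * (m.lm + m.lp))) +
              g / (4 * (C * (m.lm + m.lp)))) := by gcongr
          _ = g / 2 := by field_simp; norm_num
      linarith


variable {H E V : Type*}
    [NormedAddCommGroup H] [InnerProductSpace ℂ H]
    [NormedAddCommGroup E] [NormedSpace ℂ E] [CompleteSpace E]
    [NormedAddCommGroup V] [NormedSpace ℂ V] (m : ResonanceModel H E V)

/-! ### The frequency of the first mode -/

/-- `(ω, φp + q)` solves the full equation. -/
def IsModeSol (ω : ℂ) (ε τ : ℝ) (q : E) : Prop :=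
  m.IsRem ω ε τ (m.mode 1 0) q ∧ ‖q‖ ≤ ‖m.mode 1 0‖ ∧
    1 - ω ^ 2 * m.lp = ω ^ 2 * m.cp (m.rest ω ε τ (m.mode 1 0 + q))

set_option maxHeartbeats 2000000 in
/-- The shift of the frequency depends on the frequency only weakly. -/
lemma exists_shift_bound : ∃ C > (0 : ℝ), ∃ η > (0 : ℝ), η ≤ 1 ∧
    (∀ ω ∈ m.Ω, ∀ (ε τ : ℝ), 0 ≤ ε → ε ≤ η → 0 ≤ τ → τ ≤ η →
      ∃ q, m.IsRem ω ε τ (m.mode 1 0) q ∧ ‖q‖ ≤ ‖m.mode 1 0‖) ∧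
    ∀ ω₁ ∈ m.Ω, ∀ ω₂ ∈ m.Ω, ∀ (ε τ₁ τ₂ : ℝ) (q₁ q₂ : E), 0 ≤ ε → ε ≤ η → 0 ≤ τ₁ → τ₁ ≤ η →
      0 ≤ τ₂ → τ₂ ≤ η → m.IsRem ω₁ ε τ₁ (m.mode 1 0) q₁ → ‖q₁‖ ≤ ‖m.mode 1 0‖ →
      m.IsRem ω₂ ε τ₂ (m.mode 1 0) q₂ → ‖q₂‖ ≤ ‖m.mode 1 0‖ →
      ‖ω₁ ^ 2 * m.cp (m.rest ω₁ ε τ₁ (m.mode 1 0 + q₁))‖ ≤ C * (ε + τ₁) ∧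
      ‖ω₁ ^ 2 * m.cp (m.rest ω₁ ε τ₁ (m.mode 1 0 + q₁))
        - ω₂ ^ 2 * m.cp (m.rest ω₂ ε τ₂ (m.mode 1 0 + q₂))‖ ≤
        C * ((ε + τ₁) * ‖ω₁ - ω₂‖ + |τ₁ - τ₂|) := by
  obtain ⟨W, hW, hΩ⟩ := m.bounded_Ω
  obtain ⟨C₁, hC₁, hR⟩ := m.exists_rest_lipschitz hW
  obtain ⟨C₂, hC₂, hB⟩ := m.exists_rest_bound hW
  obtain ⟨C₃, hC₃, η₃, hη₃, hη₃1, hst⟩ := m.exists_stability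
  obtain ⟨η₄, hη₄, hη₄1, hex⟩ := m.exists_isRem
  set f := ‖m.mode 1 0‖
  set M := 2 * f + 1 with hMdef
  have hf0 : 0 ≤ f := norm_nonneg _
  have hM1 : 1 ≤ M := by rw [hMdef]; linarith
  have hM0 : 0 < M := by linarith
  have hM2 : (1 : ℝ) ≤ M ^ 2 := one_le_pow₀ hM1
  set p := ‖m.P‖ + 1 with hp
  have hp0 : 0 < p := by positivity
  have hP : ∀ y, ‖m.P y‖ ≤ p * ‖y‖ := fun y => (m.P.le_opNorm y).trans (by gcongr; simp [hp])
  set c := ‖m.cp‖ + 1 with hc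
  have hc0 : 0 < c := by positivity
  have hcp : ∀ y, ‖m.cp y‖ ≤ c * ‖y‖ := fun y => (m.cp.le_opNorm y).trans (by gcongr; simp [hc])
  set g := ‖m.G 0 ∘L m.ι‖ with hg
  have hg0 : 0 ≤ g := norm_nonneg _
  have hGι : ∀ x, ‖m.G 0 (m.ι x)‖ ≤ g * ‖x‖ := (m.G 0 ∘L m.ι).le_opNorm
  -- the constants for the perturbation of the equation
  set A := 2 * W * (p * (g * M + C₂ * 2 * M)) + W ^ 2 * (p * (C₁ * (M + M ^ 3))) with hA
  have hA0 : 0 < A := by positivity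
  set B := C₁ * (M ^ 2 * (C₃ * A) + M + M ^ 3) with hBdef
  have hB0 : 0 < B := by positivity
  refine ⟨W ^ 2 * (c * (C₂ * M ^ 3)) + 2 * W * (c * (C₂ * M ^ 3)) + W ^ 2 * (c * (2 * B)),
    by positivity, min η₃ η₄ / M ^ 2, by positivity, ?_, ?_, ?_⟩
  · exact (div_le_self (by positivity) hM2).trans ((min_le_left _ _).trans hη₃1)
  · intro ω hω ε τ hε hεη hτ hτη
    refine hex ω hω ε τ 1 0 hε ?_ hτ ?_
    · exact hεη.trans ((div_le_self (by positivity) hM2).trans (min_le_right _ _))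
    · rw [le_div_iff₀ (by positivity)] at hτη
      refine le_trans ?_ (hτη.trans (min_le_right _ _))
      gcongr
      rw [hMdef]; linarith
  intro ω₁ hω₁ ω₂ hω₂ ε τ₁ τ₂ q₁ q₂ hε hεη hτ₁ hτ₁η hτ₂ hτ₂η hq₁ hq₁n hq₂ hq₂n
  have hεm : ε ≤ min η₃ η₄ := hεη.trans (div_le_self (by positivity) hM2)
  have hε1 : ε ≤ 1 := hεm.trans ((min_le_left _ _).trans hη₃1)
  rw [le_div_iff₀ (by positivity)] at hτ₁η hτ₂η
  have hτ₁M : τ₁ * M ^ 2 ≤ 1 := hτ₁η.trans ((min_le_left _ _).trans hη₃1)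
  have hτ₂M : τ₂ * M ^ 2 ≤ 1 := hτ₂η.trans ((min_le_left _ _).trans hη₃1)
  set u₁ := m.mode 1 0 + q₁
  set u₂ := m.mode 1 0 + q₂
  have hu₁ : ‖u₁‖ ≤ M := (norm_add_le _ _).trans (by rw [hMdef]; linarith)
  have hu₂ : ‖u₂‖ ≤ M := (norm_add_le _ _).trans (by rw [hMdef]; linarith)
  have hq₂M : ‖q₂‖ ≤ M := hq₂n.trans (by rw [hMdef]; linarith)
  have hr2 : ‖m.rest ω₂ ε τ₂ u₂‖ ≤ C₂ * 2 * M := by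
    refine (hB ω₂ ε τ₂ M u₂ (hΩ _ hω₂) hε hε1 hτ₂ hτ₂M hu₂).trans ?_
    calc _ ≤ C₂ * (1 + 1) * M := by gcongr
      _ = _ := by ring
  set x := ‖ω₁ - ω₂‖
  set y := |τ₁ - τ₂|
  have hx0 : 0 ≤ x := norm_nonneg _
  have hy0 : 0 ≤ y := abs_nonneg _
  have hsq : ‖ω₁ ^ 2 - ω₂ ^ 2‖ ≤ 2 * W * x := by
    rw [show ω₁ ^ 2 - ω₂ ^ 2 = (ω₁ + ω₂) * (ω₁ - ω₂) by ring, norm_mul]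
    gcongr
    refine (norm_add_le _ _).trans ?_
    linarith [hΩ _ hω₁, hΩ _ hω₂]
  -- The defect with which `q₂` satisfies the equation for `ω₁, τ₁`. It allows `exists_stability`,
  -- which has a single frequency, to compare remainders at two frequencies.
  set e := (ω₂ ^ 2 - ω₁ ^ 2) • m.P (m.G 0 (m.ι q₂) + m.rest ω₂ ε τ₂ u₂) +
    ω₁ ^ 2 • m.P (m.rest ω₂ ε τ₂ u₂ - m.rest ω₁ ε τ₁ u₂) with he
  have hen : ‖e‖ ≤ A * (x + y) := by
    have hrr := hR ω₂ ω₁ ε τ₂ τ₁ M u₂ u₂ (hΩ _ hω₂) (hΩ _ hω₁) hε hε1 hτ₂ hτ₁ hτ₂M hτ₁M hu₂ hu₂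
    rw [sub_self, norm_zero, mul_zero, zero_add, norm_sub_rev ω₂, abs_sub_comm τ₂] at hrr
    refine (norm_add_le _ _).trans ?_
    rw [norm_smul, norm_smul, norm_pow, ← norm_neg (ω₂ ^ 2 - ω₁ ^ 2), neg_sub]
    have t1 : ‖ω₁ ^ 2 - ω₂ ^ 2‖ * ‖m.P (m.G 0 (m.ι q₂) + m.rest ω₂ ε τ₂ u₂)‖ ≤
        2 * W * x * (p * (g * M + C₂ * 2 * M)) := by
      gcongr
      refine (hP _).trans ?_
      gcongr
      refine (norm_add_le _ _).trans (add_le_add ((hGι _).trans (by gcongr)) hr2)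
    have t2 : ‖ω₁‖ ^ 2 * ‖m.P (m.rest ω₂ ε τ₂ u₂ - m.rest ω₁ ε τ₁ u₂)‖ ≤
        W ^ 2 * (p * (C₁ * ((1 * x + y * M ^ 2) * M))) := by
      gcongr
      · exact hΩ _ hω₁
      · refine (hP _).trans ?_
        gcongr
        refine hrr.trans ?_
        gcongr
    refine (add_le_add t1 t2).trans ?_
    rw [hA]
    have s1 : 0 ≤ 2 * W * (p * (g * M + C₂ * 2 * M)) * y := by positivity
    have s2 : 0 ≤ W ^ 2 * (p * (C₁ * (M ^ 3))) * x := by positivity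
    have s3 : 0 ≤ W ^ 2 * (p * (C₁ * M)) * y := by positivity
    linarith
  have heq : q₂ = ω₁ ^ 2 • m.P (m.G 0 (m.ι q₂) + m.rest ω₁ ε τ₁ u₂) + e := by
    have h := (m.isRem_iff ω₂ ε τ₂ 1 0 q₂).1 hq₂
    conv_lhs => rw [h]
    change ω₂ ^ 2 • m.P (m.G 0 (m.ι q₂) + m.rest ω₂ ε τ₂ u₂) = _
    rw [he]
    simp only [map_add, map_sub, smul_add, smul_sub, sub_smul]
    abel
  have hs := hst ω₁ hω₁ ε τ₁ M 1 0 1 0 q₁ q₂ 0 e hε (hεm.trans (min_le_left _ _)) hτ₁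
    (hτ₁η.trans (min_le_left _ _)) hu₁ hu₂
    (by rw [add_zero]; exact (m.isRem_iff _ _ _ _ _ _).1 hq₁) heq
  rw [sub_self, norm_zero, mul_zero, add_zero, zero_sub, norm_neg] at hs
  have hqd : ‖u₁ - u₂‖ ≤ C₃ * A * (x + y) := by
    rw [show u₁ - u₂ = q₁ - q₂ from add_sub_add_left_eq_sub _ _ _]
    refine hs.trans ?_
    rw [mul_assoc]
    gcongr
  have hτM : τ₁ * M ^ 2 ≤ M ^ 2 * τ₁ := by linarith
  have hετ : ε + τ₁ * M ^ 2 ≤ M ^ 2 * (ε + τ₁) := by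
    have : 1 * ε ≤ M ^ 2 * ε := by gcongr
    linarith
  have hrr := hR ω₁ ω₂ ε τ₁ τ₂ M u₁ u₂ (hΩ _ hω₁) (hΩ _ hω₂) hε hε1 hτ₁ hτ₂ hτ₁M hτ₂M hu₁ hu₂
  have hrest : ‖m.rest ω₁ ε τ₁ u₁ - m.rest ω₂ ε τ₂ u₂‖ ≤ 2 * B * ((ε + τ₁) * x + y) := by
    refine hrr.trans ?_
    -- The small factor `ε + τ₁` must survive in front of the frequency difference, where it later
    -- yields a contraction; in front of `|τ₁ - τ₂|` it is only bounded by `2`.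
    have s1 : (ε + τ₁ * M ^ 2) * ‖u₁ - u₂‖ ≤ M ^ 2 * (C₃ * A) * ((ε + τ₁) * x + 2 * y) := by
      calc _ ≤ (M ^ 2 * (ε + τ₁)) * (C₃ * A * (x + y)) := by gcongr
        _ = M ^ 2 * (C₃ * A) * ((ε + τ₁) * x + (ε + τ₁) * y) := by ring
        _ ≤ M ^ 2 * (C₃ * A) * ((ε + τ₁) * x + 2 * y) := by
          gcongr
          have : τ₁ * 1 ≤ τ₁ * M ^ 2 := by gcongr
          linarith
    have s2 : (ε * x + y * M ^ 2) * M ≤ (M + M ^ 3) * ((ε + τ₁) * x + y) := by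
      have r1 : 0 ≤ τ₁ * x * M := by positivity
      have r2 : 0 ≤ M ^ 3 * ((ε + τ₁) * x) := by positivity
      have r3 : 0 ≤ M * y := by positivity
      linarith
    have s4 : 0 ≤ (M + M ^ 3) * ((ε + τ₁) * x + y) := by positivity
    have r1 : M ^ 2 * (C₃ * A) * ((ε + τ₁) * x + 2 * y) ≤
        2 * (M ^ 2 * (C₃ * A) * ((ε + τ₁) * x + y)) := by
      have h0 : 0 ≤ M ^ 2 * (C₃ * A) := by positivity
      calc _ ≤ M ^ 2 * (C₃ * A) * (2 * ((ε + τ₁) * x + y)) :=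
            mul_le_mul_of_nonneg_left (by linarith [mul_nonneg (add_nonneg hε hτ₁) hx0]) h0
        _ = _ := by ring
    have r2 : (M + M ^ 3) * ((ε + τ₁) * x + y) ≤ 2 * ((M + M ^ 3) * ((ε + τ₁) * x + y)) := by
      linarith
    calc _ ≤ C₁ * (M ^ 2 * (C₃ * A) * ((ε + τ₁) * x + 2 * y) +
          (M + M ^ 3) * ((ε + τ₁) * x + y)) := by gcongr
      _ ≤ C₁ * (2 * (M ^ 2 * (C₃ * A) * ((ε + τ₁) * x + y)) +
          2 * ((M + M ^ 3) * ((ε + τ₁) * x + y))) :=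
          mul_le_mul_of_nonneg_left (add_le_add r1 r2) hC₁.le
      _ = _ := by rw [hBdef]; ring
  have hcb : ‖m.cp (m.rest ω₁ ε τ₁ u₁)‖ ≤ c * (C₂ * M ^ 3) * (ε + τ₁) := by
    refine (hcp _).trans ?_
    calc c * ‖m.rest ω₁ ε τ₁ u₁‖ ≤ c * (C₂ * (ε + τ₁ * M ^ 2) * ‖u₁‖) := by
          gcongr; exact hB ω₁ ε τ₁ M u₁ (hΩ _ hω₁) hε hε1 hτ₁ hτ₁M hu₁
      _ ≤ c * (C₂ * (M ^ 2 * (ε + τ₁)) * M) := by gcongr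
      _ = _ := by ring
  have hετ0 : 0 ≤ ε + τ₁ := by positivity
  constructor
  · rw [norm_mul, norm_pow]
    calc _ ≤ W ^ 2 * (c * (C₂ * M ^ 3) * (ε + τ₁)) := by gcongr; exact hΩ _ hω₁
      _ ≤ _ := by
        have : 0 ≤ (2 * W * (c * (C₂ * M ^ 3)) + W ^ 2 * (c * (2 * B))) * (ε + τ₁) := by positivity
        linarith
  · have e2 : ω₁ ^ 2 * m.cp (m.rest ω₁ ε τ₁ u₁) - ω₂ ^ 2 * m.cp (m.rest ω₂ ε τ₂ u₂) =
        (ω₁ ^ 2 - ω₂ ^ 2) * m.cp (m.rest ω₁ ε τ₁ u₁) +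
        ω₂ ^ 2 * m.cp (m.rest ω₁ ε τ₁ u₁ - m.rest ω₂ ε τ₂ u₂) := by rw [map_sub]; ring
    rw [e2]
    refine (norm_add_le _ _).trans ?_
    rw [norm_mul, norm_mul, norm_pow]
    have t1 : ‖ω₁ ^ 2 - ω₂ ^ 2‖ * ‖m.cp (m.rest ω₁ ε τ₁ u₁)‖ ≤
        2 * W * x * (c * (C₂ * M ^ 3) * (ε + τ₁)) := by gcongr
    have t2 : ‖ω₂‖ ^ 2 * ‖m.cp (m.rest ω₁ ε τ₁ u₁ - m.rest ω₂ ε τ₂ u₂)‖ ≤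
        W ^ 2 * (c * (2 * B * ((ε + τ₁) * x + y))) := by
      gcongr
      · exact hΩ _ hω₂
      · exact (hcp _).trans (by gcongr)
    have t3 : 0 ≤ 2 * W * (c * (C₂ * M ^ 3)) * y := by positivity
    have t4 : 0 ≤ W ^ 2 * (c * (C₂ * M ^ 3)) * ((ε + τ₁) * x + y) := by positivity
    linarith

/-- With `w = 1/√lp` one has `1 - ω² lp = -lp ((ω - w)² + 2w (ω - w))`. Since `2w ≠ 0`, the first
scalar equation can be solved for `ω - w` by contraction, its right-hand side being small and weakly
dependent on `ω`. The same factorization gives Lipschitz dependence on `τ`, hence uniqueness at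
fixed `τ`. -/
lemma exists_family : ∃ C > (0 : ℝ), ∃ δ > (0 : ℝ), ∃ η > (0 : ℝ), η ≤ 1 ∧
    δ ≤ 1 / √m.lp ∧
    (∀ ω : ℂ, ‖ω - ((1 / √m.lp : ℝ) : ℂ)‖ ≤ δ → ω ∈ m.Ω) ∧
    (∀ ω ∈ m.Ω, ∀ (ε τ : ℝ), 0 ≤ ε → ε ≤ η → 0 ≤ τ → τ ≤ η →
      ∃ q, m.IsRem ω ε τ (m.mode 1 0) q ∧ ‖q‖ ≤ ‖m.mode 1 0‖) ∧
    (∀ ε τ : ℝ, 0 ≤ ε → ε ≤ η → 0 ≤ τ → τ ≤ η → ∃ (ω : ℂ) (q : E),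
      ‖ω - ((1 / √m.lp : ℝ) : ℂ)‖ ≤ δ ∧ ‖ω - ((1 / √m.lp : ℝ) : ℂ)‖ ≤ C * (ε + τ) ∧
      m.IsModeSol ω ε τ q) ∧
    ∀ (ε τ₁ τ₂ : ℝ) (ω₁ ω₂ : ℂ) (q₁ q₂ : E), 0 ≤ ε → ε ≤ η → 0 ≤ τ₁ → τ₁ ≤ η →
      0 ≤ τ₂ → τ₂ ≤ η → ‖ω₁ - ((1 / √m.lp : ℝ) : ℂ)‖ ≤ δ → ‖ω₂ - ((1 / √m.lp : ℝ) : ℂ)‖ ≤ δ →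
      m.IsModeSol ω₁ ε τ₁ q₁ → m.IsModeSol ω₂ ε τ₂ q₂ → ‖ω₁ - ω₂‖ ≤ C * |τ₁ - τ₂| := by
  obtain ⟨A, hA, η₁, hη₁, hη₁1, hex, hsh⟩ := m.exists_shift_bound
  obtain ⟨δ₁, hδ₁, hball⟩ := Metric.isOpen_iff.1 m.isOpen_Ω _ m.mem_p
  have hlp := m.lp_pos
  set w : ℝ := 1 / √m.lp with hw
  have hw0 : 0 < w := by positivity
  have hwl : w ^ 2 * m.lp = 1 := by
    rw [hw, div_pow, one_pow, Real.sq_sqrt hlp.le]; field_simp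
  have hwlC : (w : ℂ) ^ 2 * (m.lp : ℂ) = 1 := by exact_mod_cast hwl
  have hwC : (w : ℂ) ≠ 0 := by exact_mod_cast hw0.ne'
  have hlC : (m.lp : ℂ) ≠ 0 := by exact_mod_cast hlp.ne'
  have h2w : ‖(2 * w : ℂ)‖ = 2 * w := by
    rw [norm_mul, Complex.norm_real, Real.norm_of_nonneg hw0.le]; simp
  have h2wl : ‖(2 * w * m.lp : ℂ)‖ = 2 * w * m.lp := by
    rw [norm_mul, h2w, Complex.norm_real, Real.norm_of_nonneg hlp.le]
  set δ := min (δ₁ / 2) (w / 4) with hδ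
  have hδ0 : 0 < δ := by positivity
  have hδw : δ ≤ w / 4 := min_le_right _ _
  have hΩ : ∀ ω : ℂ, ‖ω - (w : ℂ)‖ ≤ δ → ω ∈ m.Ω := fun ω hω => by
    refine hball ?_
    rw [Metric.mem_ball, dist_eq_norm]
    have := min_le_left (δ₁ / 2) (w / 4)
    linarith
  set κ := w * m.lp with hκ
  have hκ0 : 0 < κ := by positivity
  -- `κ / (4A)` gives `A (ε + τ) ≤ κ/2`, so the shift term contributes Lipschitz constant `1/4`; `δ
  -- κ / (2A)` makes the radius `A (ε + τ) / κ` of the contraction ball at most `δ`.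
  set η := min η₁ (min (κ / (4 * A)) (δ * κ / (2 * A))) with hη
  have hη0 : 0 < η := by positivity
  refine ⟨2 * A / κ, by positivity, δ, hδ0, η, hη0, (min_le_left _ _).trans hη₁1,
    by linarith, hΩ, ?_, ?_, ?_⟩
  · exact fun ω hω ε τ h1 h2 h3 h4 =>
      hex ω hω ε τ h1 (h2.trans (min_le_left _ _)) h3 (h4.trans (min_le_left _ _))
  · intro ε τ hε hεη hτ hτη
    have hε1 := hεη.trans (min_le_left _ _)
    have hτ1 := hτη.trans (min_le_left _ _)
    have hsm1 : A * (ε + τ) ≤ κ / 2 := by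
      have h1 := hεη.trans ((min_le_right _ _).trans (min_le_left _ _))
      have h2 := hτη.trans ((min_le_right _ _).trans (min_le_left _ _))
      calc A * (ε + τ) ≤ A * (κ / (4 * A) + κ / (4 * A)) := by gcongr
        _ = κ / 2 := by field_simp; norm_num
    have hsm2 : A * (ε + τ) ≤ δ * κ := by
      have h1 := hεη.trans ((min_le_right _ _).trans (min_le_right _ _))
      have h2 := hτη.trans ((min_le_right _ _).trans (min_le_right _ _))
      calc A * (ε + τ) ≤ A * (δ * κ / (2 * A) + δ * κ / (2 * A)) := by gcongr
        _ = δ * κ := by field_simp; norm_num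
    have hch : ∀ ω : ℂ, ∃ q, ω ∈ m.Ω → m.IsRem ω ε τ (m.mode 1 0) q ∧ ‖q‖ ≤ ‖m.mode 1 0‖ := by
      intro ω
      by_cases hω : ω ∈ m.Ω
      · obtain ⟨q, hq⟩ := hex ω hω ε τ hε hε1 hτ hτ1
        exact ⟨q, fun _ => hq⟩
      · exact ⟨0, fun h => absurd h hω⟩
    choose q hq using hch
    set h : ℂ → ℂ := fun ω => ω ^ 2 * m.cp (m.rest ω ε τ (m.mode 1 0 + q ω)) with hh
    -- Fixed points of `Ψ` are the solutions of the scalar equation. On the ball of radius `δ ≤ w/4`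
    -- the quadratic term also has Lipschitz constant `1/4`.
    set Ψ : ℂ → ℂ := fun ω => w - (ω - w) ^ 2 / (2 * w) - h ω / (2 * w * m.lp) with hΨ
    set ρ := A * (ε + τ) / κ with hρ
    have hρδ : ρ ≤ δ := by rw [hρ, div_le_iff₀ hκ0]; exact hsm2
    have hρ0 : 0 ≤ ρ := by positivity
    have hwΩ : (w : ℂ) ∈ m.Ω := hΩ _ (by simpa using hδ0.le)
    obtain ⟨ω, hω, hfix⟩ := exists_fixedPoint_closedBall Ψ (w : ℂ) hρ0
      (by
        have h1 := (hsh _ hwΩ _ hwΩ ε τ τ _ _ hε hε1 hτ hτ1 hτ hτ1 (hq w hwΩ).1 (hq w hwΩ).2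
          (hq w hwΩ).1 (hq w hwΩ).2).1
        have : Ψ w - w = -(h w / (2 * w * m.lp)) := by simp only [hΨ]; ring
        rw [this, norm_neg, norm_div, h2wl, div_le_iff₀ (by positivity)]
        refine h1.trans (le_of_eq ?_)
        rw [hρ, hκ]
        field_simp)
      (by
        intro x y hx hy
        have hxΩ := hΩ x (hx.trans hρδ)
        have hyΩ := hΩ y (hy.trans hρδ)
        have h1 := (hsh _ hxΩ _ hyΩ ε τ τ _ _ hε hε1 hτ hτ1 hτ hτ1 (hq x hxΩ).1 (hq x hxΩ).2
          (hq y hyΩ).1 (hq y hyΩ).2).2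
        rw [sub_self, abs_zero, add_zero] at h1
        change ‖h x - h y‖ ≤ _ at h1
        have e : Ψ x - Ψ y = -(((x - w) + (y - w)) * (x - y) / (2 * w))
            - (h x - h y) / (2 * w * m.lp) := by simp only [hΨ]; ring
        rw [e]
        refine (norm_sub_le _ _).trans ?_
        rw [norm_neg, norm_div, norm_div, h2w, h2wl, norm_mul]
        have t1 : ‖(x - w) + (y - w)‖ * ‖x - y‖ / (2 * w) ≤ (1 / 4) * ‖x - y‖ := by
          rw [div_le_iff₀ (by positivity)]
          have : ‖(x - w) + (y - w)‖ ≤ w / 2 := by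
            refine (norm_add_le _ _).trans ?_
            linarith
          calc _ ≤ w / 2 * ‖x - y‖ := by gcongr
            _ = _ := by ring
        have t2 : ‖h x - h y‖ / (2 * w * m.lp) ≤ (1 / 4) * ‖x - y‖ := by
          rw [div_le_iff₀ (by positivity)]
          calc _ ≤ (A * (ε + τ)) * ‖x - y‖ := by linarith
            _ ≤ (κ / 2) * ‖x - y‖ := by gcongr
            _ = _ := by rw [hκ]; ring
        linarith)
    have hωΩ := hΩ ω (hω.trans hρδ)
    refine ⟨ω, q ω, hω.trans hρδ, ?_, (hq ω hωΩ).1, (hq ω hωΩ).2, ?_⟩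
    · refine hω.trans ?_
      have : 0 ≤ A * (ε + τ) / κ := hρ0
      rw [hρ]
      have e : 2 * A / κ * (ε + τ) = 2 * (A * (ε + τ) / κ) := by ring
      linarith
    · change 1 - ω ^ 2 * (m.lp : ℂ) = h ω
      have e : w - (ω - w) ^ 2 / (2 * w) - h ω / (2 * w * m.lp) = ω := hfix
      field_simp at e
      have e3 : (w : ℂ) ≠ 0 := hwC
      linear_combination e + (1 : ℂ) * hwlC - 2 * hwlC
  · intro ε τ₁ τ₂ ω₁ ω₂ q₁ q₂ hε hεη hτ₁ hτ₁η hτ₂ hτ₂η hω₁ hω₂ h₁ h₂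
    have hb := (hsh _ (hΩ _ hω₁) _ (hΩ _ hω₂) ε τ₁ τ₂ q₁ q₂ hε (hεη.trans (min_le_left _ _)) hτ₁
      (hτ₁η.trans (min_le_left _ _)) hτ₂ (hτ₂η.trans (min_le_left _ _)) h₁.1 h₁.2.1 h₂.1 h₂.2.1).2
    rw [← h₁.2.2, ← h₂.2.2] at hb
    have hsm1 : A * (ε + τ₁) ≤ κ / 2 := by
      have h1 := hεη.trans ((min_le_right _ _).trans (min_le_left _ _))
      have h2 := hτ₁η.trans ((min_le_right _ _).trans (min_le_left _ _))
      calc A * (ε + τ₁) ≤ A * (κ / (4 * A) + κ / (4 * A)) := by gcongr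
        _ = κ / 2 := by field_simp; norm_num
    have e : (1 - ω₁ ^ 2 * (m.lp : ℂ)) - (1 - ω₂ ^ 2 * (m.lp : ℂ)) =
        -((2 * w + ((ω₁ - w) + (ω₂ - w))) * m.lp * (ω₁ - ω₂)) := by ring
    rw [e, norm_neg, norm_mul, norm_mul, Complex.norm_real, Real.norm_of_nonneg hlp.le] at hb
    -- The factor in front of `ω₁ - ω₂` stays away from zero, since `2δ ≤ w/2`; it outweighs the
    -- frequency dependence of the shift.
    have hlow : w ≤ ‖(2 * w + ((ω₁ - w) + (ω₂ - w)) : ℂ)‖ := by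
      have t1 := norm_sub_le_norm_add (2 * w : ℂ) ((ω₁ - w) + (ω₂ - w))
      have t2 := norm_add_le (ω₁ - w : ℂ) (ω₂ - w)
      rw [h2w] at t1
      linarith
    have h3 : κ * ‖ω₁ - ω₂‖ ≤ κ / 2 * ‖ω₁ - ω₂‖ + A * |τ₁ - τ₂| := by
      calc κ * ‖ω₁ - ω₂‖ ≤ ‖(2 * w + ((ω₁ - w) + (ω₂ - w)) : ℂ)‖ * m.lp * ‖ω₁ - ω₂‖ := by
            rw [hκ]; gcongr
        _ ≤ _ := hb
        _ = (A * (ε + τ₁)) * ‖ω₁ - ω₂‖ + A * |τ₁ - τ₂| := by ring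
        _ ≤ _ := by gcongr
    rw [div_mul_eq_mul_div, le_div_iff₀ hκ0]
    linarith

/-! ### Smallness in the Sobolev space implies boundedness -/

set_option maxHeartbeats 2000000 in
-- Smallness of `s` in `V` gives no direct bound on the cubic term. The density `f = ω² N(u)` is
-- estimated instead, through `‖f‖ ≤ k ‖GV 0 f‖`: up to an error of order `ε ‖f‖`, `GV 0 f` is `s`
-- plus a combination of the modes. Its coefficients involve only pairings of the modes with `f`,
-- which `weak_T` bounds by terms of order `x` and `x ‖f‖`. For small `ε + x` the terms with `‖f‖`
-- are absorbed, and `G` maps the resulting `H` bound to a bound in `E`.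
lemma exists_sup_bound [CompleteSpace V] : ∃ C > (0 : ℝ), ∃ η > (0 : ℝ), η ≤ 1 ∧ ∀ ω ∈ m.Ω,
    ∀ (ε : ℝ) (a b : ℂ) (s : V) (q : E), 0 ≤ ε → ε ≤ η → ‖a‖ + ‖b‖ + ‖s‖ ≤ η →
      m.IsRem ω ε 1 (m.mode a b) q → m.j s = m.ι q → ‖q‖ ≤ C * (‖a‖ + ‖b‖ + ‖s‖) := by
  obtain ⟨W, hW, hΩ⟩ := m.bounded_Ω
  obtain ⟨g, hg, hG, hL⟩ := exists_lipschitz_ball m.differentiable_G W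
  obtain ⟨gV, hgV, -, hLV⟩ := exists_lipschitz_ball m.differentiable_GV W
  obtain ⟨k, hk, hlow⟩ := m.GV_lower
  obtain ⟨c, hc, hweak⟩ := m.weak_T
  have hlp := m.lp_pos
  have hlm := m.lm_pos
  set J := 1 + ‖m.j‖ with hJ
  have hJ1 : 1 ≤ J := by rw [hJ]; linarith [norm_nonneg m.j]
  set l := m.lp + m.lm with hl
  have hl0 : 0 < l := by positivity
  set n := ‖m.cp‖ + ‖m.cm‖ with hn
  have hn0 : 0 ≤ n := by positivity
  set w := m.lp⁻¹ * ‖m.GV 0 (m.ι m.φp)‖ + m.lm⁻¹ * ‖m.GV 0 (m.ι m.φm)‖ with hw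
  have hw0 : 0 ≤ w := by positivity
  -- bounds for the coefficients of the modes
  set B := l * W ^ 2 * (1 + c) * J ^ 2 * 3 + l * c * J + n * g * W with hB
  have hB0 : 0 < B := by positivity
  set D := k * (1 + gV * W + w * B) with hD
  have hD0 : 0 < D := by positivity
  set p := ‖m.P‖ + 1 with hp
  have hp0 : 0 < p := by positivity
  refine ⟨p * (g * (2 * D)), by positivity, min 1 (1 / (4 * D)), by positivity,
    min_le_left _ _, ?_⟩
  intro ω hω ε a b s q hε hεη hx hq hs
  set x := ‖a‖ + ‖b‖ + ‖s‖ with hxdef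
  have hx0 : 0 ≤ x := by positivity
  have hx1 : x ≤ 1 := hx.trans (min_le_left _ _)
  have hε1 : ε ≤ 1 := hεη.trans (min_le_left _ _)
  set u := m.mode a b + q with hu
  obtain ⟨f, hf⟩ : ∃ f : H, f = ω ^ 2 • m.ι (u + m.T u) := ⟨_, rfl⟩
  have hωW := hΩ ω hω
  have hzn : ‖(ε : ℂ) * ω‖ = ε * ‖ω‖ := by
    rw [norm_mul, Complex.norm_real, Real.norm_of_nonneg hε]
  have hzW : ‖(ε : ℂ) * ω‖ ≤ W := by
    rw [hzn]; calc ε * ‖ω‖ ≤ 1 * W := by gcongr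
      _ = W := one_mul W
  set F := m.G (ε * ω) f with hF
  have hqF : q = m.P F := by
    have h := hq
    rw [IsRem, ofReal_one, one_smul, ← map_smul, ← map_smul] at h
    rw [hF, hf]
    exact h
  have hGd : ‖(m.G (ε * ω) - m.G 0) f‖ ≤ g * W * (ε * ‖f‖) := by
    have h1 := hL (ε * ω) 0 hzW (by simpa using hW.le)
    rw [sub_zero, hzn] at h1
    calc _ ≤ (g * (ε * ‖ω‖)) * ‖f‖ := (ContinuousLinearMap.le_opNorm _ _).trans (by gcongr)
      _ ≤ (g * (ε * W)) * ‖f‖ := by gcongr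
      _ = _ := by ring
  have hGVd : ‖(m.GV (ε * ω) - m.GV 0) f‖ ≤ gV * W * (ε * ‖f‖) := by
    have h1 := hLV (ε * ω) 0 hzW (by simpa using hW.le)
    rw [sub_zero, hzn] at h1
    calc _ ≤ (gV * (ε * ‖ω‖)) * ‖f‖ := (ContinuousLinearMap.le_opNorm _ _).trans (by gcongr)
      _ ≤ (gV * (ε * W)) * ‖f‖ := by gcongr
      _ = _ := by ring
  have hιm : ‖m.ι (m.mode a b)‖ ≤ ‖a‖ + ‖b‖ := by
    rw [mode, map_add, map_smul, map_smul]
    refine (norm_add_le _ _).trans ?_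
    rw [norm_smul, norm_smul, m.norm_φp, m.norm_φm, mul_one, mul_one]
  have hιu : ‖m.ι u‖ ≤ J * x := by
    rw [hu, map_add, ← hs]
    refine (norm_add_le _ _).trans ?_
    have h1 := m.j.le_opNorm s
    have h2 : ‖m.j‖ * ‖s‖ ≤ ‖m.j‖ * x := by
      gcongr; rw [hxdef]; linarith [norm_nonneg a, norm_nonneg b]
    have h3 : ‖a‖ + ‖b‖ ≤ x := by rw [hxdef]; linarith [norm_nonneg s]
    rw [hJ]; linarith
  -- The cubic term is recovered from the density: `ω² T u = f - ω² u`.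
  have hιT : ‖ω‖ ^ 2 * ‖m.ι (m.T u)‖ ≤ ‖f‖ + W ^ 2 * (J * x) := by
    have e : ω ^ 2 • m.ι (m.T u) = f - ω ^ 2 • m.ι u := by rw [hf, map_add, smul_add]; abel
    rw [← norm_pow, ← norm_smul, e]
    refine (norm_sub_le _ _).trans ?_
    rw [norm_smul, norm_pow]
    gcongr
  -- the coefficients
  have hcoef : ∀ (e : E) (t : ℂ), ‖t‖ ≤ x → inner ℂ (m.ι e) (m.ι u) = t →
      ‖inner ℂ (m.ι e) (m.ι (m.T u))‖ ≤ c * (‖m.ι u‖ ^ 2 + ‖m.ι u‖ * ‖m.ι (m.T u)‖) →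
      ‖inner ℂ (m.ι e) f‖ ≤ W ^ 2 * (1 + c) * J ^ 2 * 3 * x + c * J * (x * ‖f‖) := by
    intro e t ht he hwk
    have hfe : inner ℂ (m.ι e) f = ω ^ 2 * (t + inner ℂ (m.ι e) (m.ι (m.T u))) := by
      rw [hf, inner_smul_right, map_add, inner_add_right, he]
    rw [hfe, norm_mul, norm_pow]
    have h1 : ‖ω‖ ^ 2 * ‖inner ℂ (m.ι e) (m.ι (m.T u))‖ ≤
        c * (W ^ 2 * (J * x) ^ 2 + (J * x) * (‖f‖ + W ^ 2 * (J * x))) := by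
      calc _ ≤ ‖ω‖ ^ 2 * (c * (‖m.ι u‖ ^ 2 + ‖m.ι u‖ * ‖m.ι (m.T u)‖)) := by gcongr
        _ = c * (‖ω‖ ^ 2 * ‖m.ι u‖ ^ 2 + ‖m.ι u‖ * (‖ω‖ ^ 2 * ‖m.ι (m.T u)‖)) := by ring
        _ ≤ _ := by gcongr
    have h2 : ‖ω‖ ^ 2 * ‖t‖ ≤ W ^ 2 * x := by gcongr
    calc _ ≤ ‖ω‖ ^ 2 * (‖t‖ + ‖inner ℂ (m.ι e) (m.ι (m.T u))‖) := by
          gcongr; exact norm_add_le _ _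
      _ ≤ W ^ 2 * x + c * (W ^ 2 * (J * x) ^ 2 + (J * x) * (‖f‖ + W ^ 2 * (J * x))) := by
          rw [mul_add]; exact add_le_add h2 h1
      _ = W ^ 2 * 1 * 1 * x + W ^ 2 * c * J ^ 2 * 2 * (x * x) + c * J * (x * ‖f‖) := by ring
      _ ≤ W ^ 2 * (1 + c) * J ^ 2 * x + W ^ 2 * (1 + c) * J ^ 2 * 2 * (x * 1) +
          c * J * (x * ‖f‖) := by
          have : (1 : ℝ) ≤ J ^ 2 := one_le_pow₀ hJ1
          gcongr <;> linarith
      _ = _ := by ring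
  have hcpu : m.cp u = a := by rw [hu, map_add, cp_mode, hq.cp_eq_zero, add_zero]
  have hcmu : m.cm u = b := by rw [hu, map_add, cm_mode, hq.cm_eq_zero, add_zero]
  have hpf := hcoef m.φp a (by rw [hxdef]; linarith [norm_nonneg b, norm_nonneg s]) hcpu
    (hweak u).1
  have hmf := hcoef m.φm b (by rw [hxdef]; linarith [norm_nonneg a, norm_nonneg s]) hcmu
    (hweak u).2
  have hfx : 0 ≤ x * ‖f‖ := by positivity
  have hfε : 0 ≤ ε * ‖f‖ := by positivity
  have hfinal : ∀ (C : E →L[ℂ] ℂ) (e : E) (r : ℝ), 0 ≤ r → r ≤ l → ‖C‖ ≤ n →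
      C (m.G 0 f) = r * inner ℂ (m.ι e) f →
      ‖inner ℂ (m.ι e) f‖ ≤ W ^ 2 * (1 + c) * J ^ 2 * 3 * x + c * J * (x * ‖f‖) →
      ‖C F‖ ≤ B * (x + (ε + x) * ‖f‖) := by
    intro C e r hr hrl hCn hC hcf
    have e1 : F = m.G 0 f + (m.G (ε * ω) - m.G 0) f := by rw [hF, sub_apply]; abel
    rw [e1, map_add, hC]
    refine (norm_add_le _ _).trans ?_
    rw [norm_mul, Complex.norm_real, Real.norm_of_nonneg hr]
    have t1 : r * ‖inner ℂ (m.ι e) f‖ ≤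
        l * (W ^ 2 * (1 + c) * J ^ 2 * 3 * x + c * J * (x * ‖f‖)) := by gcongr
    have t2 : ‖C ((m.G (ε * ω) - m.G 0) f)‖ ≤ n * (g * W * (ε * ‖f‖)) :=
      (C.le_opNorm _).trans (by gcongr)
    have s1 : 0 ≤ (l * W ^ 2 * (1 + c) * J ^ 2 * 3) * (ε * ‖f‖ + x * ‖f‖) := by positivity
    have s2 : 0 ≤ l * c * J * (x + ε * ‖f‖) := by positivity
    have s3 : 0 ≤ n * g * W * (x + x * ‖f‖) := by positivity
    have e2 : B * (x + (ε + x) * ‖f‖) = l * (W ^ 2 * (1 + c) * J ^ 2 * 3 * x + c * J * (x * ‖f‖)) +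
        n * (g * W * (ε * ‖f‖)) + ((l * W ^ 2 * (1 + c) * J ^ 2 * 3) * (ε * ‖f‖ + x * ‖f‖) +
        l * c * J * (x + ε * ‖f‖) + n * g * W * (x + x * ‖f‖)) := by rw [hB]; ring
    rw [e2]
    linarith
  have hα := hfinal m.cp m.φp m.lp hlp.le (by rw [hl]; linarith)
    (by rw [hn]; linarith [norm_nonneg m.cm])
    (by rw [cp_apply, ← m.symm, m.G_φp, map_smul, inner_smul_left]; simp) hpf
  have hβ := hfinal m.cm m.φm m.lm hlm.le (by rw [hl]; linarith)
    (by rw [hn]; linarith [norm_nonneg m.cp])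
    (by rw [cm_apply, ← m.symm, m.G_φm, map_smul, inner_smul_left]; simp) hmf
  have hjφp : m.j (m.GV 0 (m.ι m.φp)) = (m.lp : ℂ) • m.ι m.φp := by rw [m.j_GV, m.G_φp, map_smul]
  have hjφm : m.j (m.GV 0 (m.ι m.φm)) = (m.lm : ℂ) • m.ι m.φm := by rw [m.j_GV, m.G_φm, map_smul]
  have hlpC : (m.lp : ℂ) ≠ 0 := by exact_mod_cast hlp.ne'
  have hlmC : (m.lm : ℂ) ≠ 0 := by exact_mod_cast hlm.ne'
  -- The equation for `q` lifted to `V`. The modes have lifts because each is the inverse eigenvalue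
  -- times its own potential; injectivity of `j` makes the lift unique.
  have hsV : s = m.GV (ε * ω) f - m.cp F • (m.lp : ℂ)⁻¹ • m.GV 0 (m.ι m.φp)
      - m.cm F • (m.lm : ℂ)⁻¹ • m.GV 0 (m.ι m.φm) := by
    apply m.j_injective
    rw [hs, hqF, P_apply]
    simp only [map_sub, map_smul, hjφp, hjφm, m.j_GV, smul_smul]
    rw [mul_assoc, mul_assoc, inv_mul_cancel₀ hlpC, inv_mul_cancel₀ hlmC, mul_one, mul_one]
  have hfn : ‖f‖ ≤ D * x + D * ((ε + x) * ‖f‖) := by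
    have e1 : m.GV 0 f = s - (m.GV (ε * ω) - m.GV 0) f +
        (m.cp F • (m.lp : ℂ)⁻¹ • m.GV 0 (m.ι m.φp) + m.cm F • (m.lm : ℂ)⁻¹ • m.GV 0 (m.ι m.φm)) := by
      conv_rhs => enter [1, 1]; rw [hsV]
      rw [sub_apply]; abel
    have t1 : ‖m.cp F • (m.lp : ℂ)⁻¹ • m.GV 0 (m.ι m.φp) +
        m.cm F • (m.lm : ℂ)⁻¹ • m.GV 0 (m.ι m.φm)‖ ≤ w * (B * (x + (ε + x) * ‖f‖)) := by
      refine (norm_add_le _ _).trans ?_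
      rw [norm_smul, norm_smul, norm_smul, norm_smul, norm_inv, norm_inv, Complex.norm_real,
        Complex.norm_real, Real.norm_of_nonneg hlp.le, Real.norm_of_nonneg hlm.le, hw, add_mul]
      rw [mul_comm _ (B * _), mul_comm _ (B * _)]
      gcongr
    have t2 : ‖s‖ ≤ x := by rw [hxdef]; linarith [norm_nonneg a, norm_nonneg b]
    refine (hlow f).trans ?_
    rw [e1]
    calc _ ≤ k * ((x + gV * W * (ε * ‖f‖)) + w * (B * (x + (ε + x) * ‖f‖))) := by
          gcongr
          refine (norm_add_le _ _).trans (add_le_add ((norm_sub_le _ _).trans ?_) t1)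
          gcongr
      _ ≤ k * ((x + gV * W * (ε * ‖f‖)) + w * (B * (x + (ε + x) * ‖f‖)) +
          ((ε + x) * ‖f‖ + gV * W * (x + x * ‖f‖))) := by
          refine mul_le_mul_of_nonneg_left (le_add_of_nonneg_right ?_) hk.le
          positivity
      _ = _ := by rw [hD]; ring
  -- Absorption: both `ε` and `x` are at most `1/(4D)`.
  have hsmall : D * ((ε + x) * ‖f‖) ≤ (1 / 2) * ‖f‖ := by
    have h1 := hεη.trans (min_le_right _ _)
    have h2 := hx.trans (min_le_right _ _)
    calc _ ≤ D * ((1 / (4 * D) + 1 / (4 * D)) * ‖f‖) := by gcongr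
      _ = _ := by field_simp; ring
  have hf2 : ‖f‖ ≤ 2 * D * x := by linarith
  calc ‖q‖ = ‖m.P F‖ := by rw [← hqF]
    _ ≤ p * (g * (2 * D * x)) := by
        refine (m.P.le_opNorm _).trans ?_
        gcongr
        · simp [hp]
        · exact (ContinuousLinearMap.le_opNorm _ _).trans (by gcongr; exact hG _ hzW)
    _ = _ := by ring


variable {H E V : Type*}
    [NormedAddCommGroup H] [InnerProductSpace ℂ H]
    [NormedAddCommGroup E] [NormedSpace ℂ E] [CompleteSpace E]
    [NormedAddCommGroup V] [NormedSpace ℂ V] (m : ResonanceModel H E V)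

/-! ### The branch of solutions of the first mode -/

lemma cp_κ (α : ℂ) (hα : m.κ m.φp = α • m.φp) (h1 : ‖α‖ = 1) (x : E) :
    m.cp (m.κ x) = α * (starRingEnd ℂ) (m.cp x) := by
  have h := m.inner_κ m.φp x
  rw [hα, map_smul, inner_smul_left, ← inner_conj_symm (m.ι x)] at h
  have h2 : α * (starRingEnd ℂ) α = 1 := by
    rw [Complex.mul_conj, Complex.normSq_eq_norm_sq, h1]; simp
  rw [cp_apply, cp_apply]
  linear_combination α * h - (inner ℂ (m.ι m.φp) (m.ι (m.κ x)) : ℂ) * h2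

lemma mode_smul (c a b : ℂ) : c • m.mode a b = m.mode (c * a) (c * b) := by
  simp only [mode, smul_add, smul_smul]

lemma norm_φp_pos : 0 < ‖m.φp‖ := by
  rw [norm_pos_iff]
  intro h
  have := m.norm_φp
  rw [h, map_zero, norm_zero] at this
  exact zero_ne_one this

lemma norm_mode_one : ‖m.mode 1 0‖ = ‖m.φp‖ := by simp [mode]

lemma norm_mode_left (a : ℂ) : ‖m.mode a 0‖ = ‖a‖ * ‖m.φp‖ := by simp [mode, norm_smul]

/-- A solution with nonzero first and vanishing second coefficient is a multiple of a normalized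
one. -/
lemma exists_isModeSol_of_isSol : ∃ η > (0 : ℝ), η ≤ 1 ∧ ∀ ω ∈ m.Ω,
    ∀ (ε τ M : ℝ) (a : ℂ) (q : E), 0 ≤ ε → ε ≤ η → 0 ≤ τ → τ * M ^ 2 ≤ η → a ≠ 0 →
      m.cp q = 0 → m.cm q = 0 → ‖m.mode a 0 + q‖ ≤ M → m.IsSol ω ε τ (m.mode a 0 + q) →
      m.IsModeSol ω ε (τ * ‖a‖ ^ 2) (a⁻¹ • q) := by
  obtain ⟨C, hC, η, hη, hη1, h⟩ := m.exists_isRem_unique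
  refine ⟨min η (1 / (2 * C)), by positivity, (min_le_left _ _).trans hη1, ?_⟩
  intro ω hω ε τ M a q hε hεη hτ hτη ha hp hm hu hs
  have hrem := ((m.isSol_iff _ _ _ _ _ _ hp hm).1 hs).1
  have hq := (h ω hω ε τ M a 0 q hε (hεη.trans (min_le_left _ _)) hτ
    (hτη.trans (min_le_left _ _)) hu hrem).1
  have hC1 : C * (ε + τ * M ^ 2) ≤ 1 := by
    calc _ ≤ C * (1 / (2 * C) + 1 / (2 * C)) := by
          gcongr
          · exact hεη.trans (min_le_right _ _)
          · exact hτη.trans (min_le_right _ _)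
      _ = 1 := by field_simp; norm_num
  have hq1 : ‖q‖ ≤ ‖m.mode a 0‖ :=
    hq.trans (mul_le_of_le_one_left (norm_nonneg _) hC1)
  have ha0 : 0 < ‖a‖ := norm_pos_iff.2 ha
  have hτe : τ = τ * ‖a‖ ^ 2 * ‖a⁻¹‖ ^ 2 := by rw [norm_inv]; field_simp
  have hs1 : m.IsSol ω ε (τ * ‖a‖ ^ 2) (a⁻¹ • (m.mode a 0 + q)) :=
    m.isSol_scale a⁻¹ (by rw [← hτe]; exact hs)
  rw [smul_add, mode_smul, inv_mul_cancel₀ ha, mul_zero] at hs1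
  obtain ⟨g1, g2, -⟩ := (m.isSol_iff _ _ _ 1 0 (a⁻¹ • q) (by rw [map_smul, hp, smul_zero])
    (by rw [map_smul, hm, smul_zero])).1 hs1
  refine ⟨g1, ?_, by rw [one_mul] at g2; exact g2⟩
  rw [norm_smul, norm_inv, inv_mul_le_iff₀ ha0, norm_mode_one, ← norm_mode_left]
  exact hq1

/-- `IsModeSol` contains only the first scalar equation. The second is automatic: by uniqueness the
remainder of the invariant mode is fixed by `ρ`, so `cm` of `rest` vanishes. -/
lemma exists_isSol_of_isModeSol : ∃ η > (0 : ℝ), η ≤ 1 ∧ ∀ ω ∈ m.Ω,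
    ∀ (ε τ : ℝ) (q : E), 0 ≤ ε → ε ≤ η → 0 ≤ τ → τ ≤ η → m.IsModeSol ω ε τ q →
      m.IsSol ω ε τ (m.mode 1 0 + q) ∧ m.ρ (m.mode 1 0 + q) = m.mode 1 0 + q := by
  obtain ⟨C, hC, η, hη, hη1, h⟩ := m.exists_isRem_unique
  have hf := m.norm_φp_pos
  refine ⟨min η (η / (2 * ‖m.φp‖) ^ 2), by positivity, (min_le_left _ _).trans hη1, ?_⟩
  intro ω hω ε τ q hε hεη hτ hτη hq
  have hτ2 : τ * (2 * ‖m.φp‖) ^ 2 ≤ η := by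
    rw [← le_div_iff₀ (by positivity)]
    exact hτη.trans (min_le_right _ _)
  have hqn := hq.2.1
  rw [norm_mode_one] at hqn
  have hn : ∀ q', ‖q'‖ ≤ ‖m.φp‖ → ‖m.mode 1 0 + q'‖ ≤ 2 * ‖m.φp‖ := fun q' hq' =>
    (norm_add_le _ _).trans (by rw [norm_mode_one]; linarith)
  have hrefl : m.ρ q = q := by
    refine (h ω hω ε τ _ 1 0 q hε (hεη.trans (min_le_left _ _)) hτ hτ2 (hn q hqn) hq.1).2 _
      (hn _ ((m.norm_ρ q).trans hqn)) ?_
    have := m.isRem_ρ hq.1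
    rwa [ρ_mode, neg_zero] at this
  have hρ : m.ρ (m.mode 1 0 + q) = m.mode 1 0 + q := by
    rw [map_add, ρ_mode, neg_zero, hrefl]
  refine ⟨?_, hρ⟩
  refine (m.isSol_iff _ _ _ _ _ _ hq.1.cp_eq_zero hq.1.cm_eq_zero).2 ⟨hq.1, ?_, ?_⟩
  · rw [one_mul]; exact hq.2.2
  · rw [m.cm_rest_eq_zero hρ, zero_mul, mul_zero]

lemma ofReal_mul_exp_arg (a : ℂ) : exp (I * (arg a : ℂ)) * (‖a‖ : ℂ) = a := by
  rw [mul_comm, mul_comm I]; exact Complex.norm_mul_exp_arg_mul_I a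

/-- Up to sign the quantity factors as `l (ω - w)(ω + w)`, so one factor has modulus at most `δ`;
and `-ω̄` is as far from `w` as `ω` is from `-w`. -/
lemma near_of_one_sub_sq {l δ : ℝ} (hl : 0 < l) (hδ : 0 ≤ δ) {ω : ℂ}
    (h : ‖1 - ω ^ 2 * l‖ ≤ l * δ ^ 2) :
    ‖ω - ((1 / √l : ℝ) : ℂ)‖ ≤ δ ∨ ‖-(starRingEnd ℂ) ω - ((1 / √l : ℝ) : ℂ)‖ ≤ δ := by
  set w : ℝ := 1 / √l with hw
  have hwl : (w : ℂ) ^ 2 * (l : ℂ) = 1 := by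
    have : w ^ 2 * l = 1 := by rw [hw, div_pow, one_pow, Real.sq_sqrt hl.le]; field_simp
    exact_mod_cast this
  have e : 1 - ω ^ 2 * (l : ℂ) = -((l : ℂ) * ((ω - w) * (ω + w))) := by
    linear_combination (-1 : ℂ) * hwl
  rw [e, norm_neg, norm_mul, norm_mul, Complex.norm_real, Real.norm_of_nonneg hl.le] at h
  have h2 : ‖ω - w‖ * ‖ω + w‖ ≤ δ ^ 2 := le_of_mul_le_mul_left h hl
  have h3 : ‖-(starRingEnd ℂ) ω - (w : ℂ)‖ = ‖ω + w‖ := by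
    rw [← RCLike.norm_conj (ω + w), ← norm_neg]
    congr 1
    simp [add_comm]
  rw [h3]
  by_contra! hc
  have := mul_lt_mul'' hc.1 hc.2 hδ hδ
  nlinarith

/-- Dividing a solution by its coefficient `a` turns it into a normalized one with nonlinearity
strength `‖a‖²`, and normalized solutions near `w` are unique for each strength. Existence, the
frequency shift and completeness of the branch all come from this correspondence; the phase of `a`
becomes the phase of the solution. -/
lemma exists_branch : ∃ C > (0 : ℝ), ∃ δ > (0 : ℝ), ∃ M > (0 : ℝ), ∃ ωP : ℝ → ℝ → ℂ,
    ∃ ωlin : ℝ → ℂ, ∀ ε, 0 < ε → ε < δ →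
    ((∃ u ≠ 0, m.IsSol (ωlin ε) ε 0 u) ∧ ‖ωlin ε - ((1 / √m.lp : ℝ) : ℂ)‖ ≤ C * ε ∧
      ∀ z, ‖z - ((1 / √m.lp : ℝ) : ℂ)‖ < δ → ∀ u ≠ 0, m.IsSol z ε 0 u → z = ωlin ε) ∧
    (∀ c : ℝ, |c| < δ → ωP c ε ∈ m.Ω ∧ ‖ωP c ε - ωlin ε‖ ≤ C * c ^ 2 ∧
      ∀ q, m.IsRem (ωP c ε) ε 1 (m.mode c 0) q → ‖m.mode c 0 + q‖ ≤ M →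
        m.IsSol (ωP c ε) ε 1 (m.mode c 0 + q) ∧
        m.ρ (m.mode c 0 + q) = m.mode c 0 + q) ∧
    ∀ ω ∈ m.Ω, ∀ (a : ℂ) (q : E), a ≠ 0 → ‖a‖ < δ → m.cp q = 0 → m.cm q = 0 →
      ‖m.mode a 0 + q‖ ≤ M → m.IsSol ω ε 1 (m.mode a 0 + q) →
      ∀ q', m.IsRem (ωP ‖a‖ ε) ε 1 (m.mode ‖a‖ 0) q' → ‖m.mode ‖a‖ 0 + q'‖ ≤ M →
      ∃ θ : ℝ, (ω = ωP ‖a‖ ε ∧ m.mode a 0 + q = exp (I * θ) • (m.mode ‖a‖ 0 + q')) ∨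
        (ω = -(starRingEnd ℂ) (ωP ‖a‖ ε) ∧
          m.mode a 0 + q = m.κ (exp (I * θ) • (m.mode ‖a‖ 0 + q'))) := by
  obtain ⟨C₀, hC₀, δ₀, hδ₀, η₀, hη₀, hη₀1, hδw, hball, -, hex, hstab⟩ := m.exists_family
  obtain ⟨C₁, hC₁, η₁, hη₁, hη₁1, hcl⟩ := m.exists_classification
  obtain ⟨η₂, hη₂, hη₂1, hto⟩ := m.exists_isModeSol_of_isSol
  obtain ⟨η₃, hη₃, hη₃1, hof⟩ := m.exists_isSol_of_isModeSol
  obtain ⟨C₄, hC₄, η₄, hη₄, hη₄1, huniq⟩ := m.exists_isRem_unique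
  have hlp := m.lp_pos
  have hlm := m.lm_pos
  have hf := m.norm_φp_pos
  set w : ℝ := 1 / √m.lp with hw
  have hw0 : 0 < w := by positivity
  have hwl : w ^ 2 * m.lp = 1 := by
    rw [hw, div_pow, one_pow, Real.sq_sqrt hlp.le]; field_simp
  set η := min (min η₀ η₁) (min (min η₂ η₃) η₄) with hη
  have hη0 : 0 < η := by positivity
  have hle0 : η ≤ η₀ := (min_le_left _ _).trans (min_le_left _ _)
  have hle1 : η ≤ η₁ := (min_le_left _ _).trans (min_le_right _ _)
  have hle2 : η ≤ η₂ := (min_le_right _ _).trans ((min_le_left _ _).trans (min_le_left _ _))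
  have hle3 : η ≤ η₃ := (min_le_right _ _).trans ((min_le_left _ _).trans (min_le_right _ _))
  have hle4 : η ≤ η₄ := (min_le_right _ _).trans (min_le_right _ _)
  have hηle1 : η ≤ 1 := hle0.trans hη₀1
  set D := |1 - m.lm / m.lp| with hD
  have hD0 : 0 < D := by
    rw [hD, abs_pos, sub_ne_zero, Ne, eq_div_iff hlp.ne', one_mul]
    exact m.lp_ne_lm
  -- the size of the solutions
  set M := min (√η) (√(m.lp * δ₀ ^ 2 / (2 * C₁))) with hMdef
  have hM0 : 0 < M := by positivity
  have hM1 : M ^ 2 ≤ η := by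
    rw [← Real.le_sqrt hM0.le hη0.le]; exact min_le_left _ _
  have hM2 : M ^ 2 ≤ m.lp * δ₀ ^ 2 / (2 * C₁) := by
    rw [← Real.le_sqrt hM0.le (by positivity)]; exact min_le_right _ _
  -- `M / (2‖φp‖)` keeps the rescaled solutions in the ball of radius `M`; `lp δ₀² / (2C₁)` forces
  -- the frequency of a solution within `δ₀` of `±w`; the entries with `D` and `w` exclude linear
  -- resonances of the second mode near `w`.
  set δ := min (min (min η δ₀) (m.lp * δ₀ ^ 2 / (2 * C₁)))
    (min (M / (2 * ‖m.φp‖)) (min (D / (2 * C₁)) (min w (D / (6 * m.lm * w))))) with hδ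
  have hδ0 : 0 < δ := by positivity
  have hδη : δ ≤ η := (min_le_left _ _).trans ((min_le_left _ _).trans (min_le_left _ _))
  have hδδ₀ : δ ≤ δ₀ := (min_le_left _ _).trans ((min_le_left _ _).trans (min_le_right _ _))
  have hδ1 : δ ≤ m.lp * δ₀ ^ 2 / (2 * C₁) := (min_le_left _ _).trans (min_le_right _ _)
  have hδM : δ ≤ M / (2 * ‖m.φp‖) := (min_le_right _ _).trans (min_le_left _ _)
  have hδD : δ ≤ D / (2 * C₁) :=
    (min_le_right _ _).trans ((min_le_right _ _).trans (min_le_left _ _))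
  have hδw' : δ ≤ w :=
    (min_le_right _ _).trans ((min_le_right _ _).trans ((min_le_right _ _).trans (min_le_left _ _)))
  have hδl : δ ≤ D / (6 * m.lm * w) := (min_le_right _ _).trans
    ((min_le_right _ _).trans ((min_le_right _ _).trans (min_le_right _ _)))
  clear_value M δ D η
  have hch : ∀ ε τ : ℝ, ∃ (ω : ℂ) (q : E), 0 ≤ ε → ε ≤ η → 0 ≤ τ → τ ≤ η →
      ‖ω - (w : ℂ)‖ ≤ δ₀ ∧ ‖ω - (w : ℂ)‖ ≤ C₀ * (ε + τ) ∧ m.IsModeSol ω ε τ q := by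
    intro ε τ
    by_cases h : 0 ≤ ε ∧ ε ≤ η ∧ 0 ≤ τ ∧ τ ≤ η
    · obtain ⟨ω, q, h'⟩ := hex ε τ h.1 (h.2.1.trans hle0) h.2.2.1 (h.2.2.2.trans hle0)
      exact ⟨ω, q, fun _ _ _ _ => h'⟩
    · exact ⟨0, 0, fun h1 h2 h3 h4 => absurd ⟨h1, h2, h3, h4⟩ h⟩
  choose Ω' Q hΩQ using hch
  -- Amplitude `c` corresponds to strength `c²`, and the linear resonance is the member of strength
  -- `0`.
  refine ⟨C₀, hC₀, δ, hδ0, M, hM0, fun c ε => Ω' ε (c ^ 2), fun ε => Ω' ε 0, ?_⟩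
  intro ε hε hεδ
  have hεη : ε ≤ η := (hεδ.trans_le hδη).le
  obtain ⟨l1, l2, l3⟩ := hΩQ ε 0 hε.le hεη le_rfl hη0.le
  have hsq : ∀ c : ℝ, |c| < δ → c ^ 2 ≤ η := fun c hc => by
    rw [← sq_abs]
    calc |c| ^ 2 ≤ η ^ 2 := by gcongr; exact hc.le.trans hδη
      _ ≤ η := by nlinarith
  -- the two descriptions of the remainder
  have hrem : ∀ c : ℝ, |c| < δ → ∀ q, m.IsRem (Ω' ε (c ^ 2)) ε 1 (m.mode c 0) q →
      ‖m.mode c 0 + q‖ ≤ M → q = (c : ℂ) • Q ε (c ^ 2) := by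
    intro c hc q hq hqM
    obtain ⟨k1, k2, k3⟩ := hΩQ ε (c ^ 2) hε.le hεη (sq_nonneg c) (hsq c hc)
    symm
    refine (huniq _ (hball _ k1) ε 1 M c 0 q hε.le (hεη.trans hle4) zero_le_one
      (by rw [one_mul]; exact hM1.trans hle4) hqM hq).2 _ ?_ ?_
    · refine (norm_add_le _ _).trans ?_
      have h1 := k3.2.1
      rw [norm_mode_one] at h1
      rw [norm_mode_left, norm_smul, Complex.norm_real, Real.norm_eq_abs]
      calc _ ≤ |c| * ‖m.φp‖ + |c| * ‖m.φp‖ := by gcongr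
        _ = |c| * (2 * ‖m.φp‖) := by ring
        _ ≤ δ * (2 * ‖m.φp‖) := by gcongr
        _ ≤ M := by rwa [← le_div_iff₀ (by positivity)]
    · have := m.isRem_scale (τ := 1) (c : ℂ) (v := m.mode 1 0) (q := Q ε (c ^ 2))
        (ω := Ω' ε (c ^ 2)) (ε := ε)
        (by rw [Complex.norm_real, Real.norm_eq_abs, sq_abs, one_mul]; exact k3.1)
      rwa [mode_smul, mul_one, mul_zero] at this
  -- `N` is a free radius so that linear solutions of any size are covered: for `τ = 0` the
  -- condition `τ N² ≤ η` is no restriction.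
  have hnear : ∀ z, ‖z - (w : ℂ)‖ ≤ δ₀ → ∀ (τ N : ℝ) (a : ℂ) (q : E), 0 ≤ τ → τ * N ^ 2 ≤ η →
      τ * ‖a‖ ^ 2 ≤ η → a ≠ 0 → m.cp q = 0 → m.cm q = 0 → ‖m.mode a 0 + q‖ ≤ N →
      m.IsSol z ε τ (m.mode a 0 + q) →
      z = Ω' ε (τ * ‖a‖ ^ 2) ∧ m.IsModeSol z ε (τ * ‖a‖ ^ 2) (a⁻¹ • q) := by
    intro z hz τ N a q hτ hτN hτa ha hp hm hN hs
    have hms := hto z (hball z hz) ε τ N a q hε.le (hεη.trans hle2) hτ (hτN.trans hle2) ha hp hm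
      hN hs
    have hτa0 : 0 ≤ τ * ‖a‖ ^ 2 := by positivity
    obtain ⟨k1, k2, k3⟩ := hΩQ ε (τ * ‖a‖ ^ 2) hε.le hεη hτa0 hτa
    have := hstab ε _ _ z _ _ _ hε.le (hεη.trans hle0) hτa0 (hτa.trans hle0) hτa0
      (hτa.trans hle0) hz k1 hms k3
    rw [sub_self, abs_zero, mul_zero] at this
    exact ⟨sub_eq_zero.1 (norm_le_zero_iff.1 this), hms⟩
  refine ⟨⟨⟨m.mode 1 0 + Q ε 0, ?_, ?_⟩, ?_, ?_⟩, ?_, ?_⟩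
  · intro h
    have := congrArg m.cp h
    rw [map_add, cp_mode, l3.1.cp_eq_zero, map_zero, add_zero] at this
    exact one_ne_zero this
  · exact (hof _ (hball _ l1) ε 0 _ hε.le (hεη.trans hle3) le_rfl hη₃.le l3).1
  · rw [add_zero] at l2; exact l2
  · intro z hz u hu hs
    have hzδ : ‖z - (w : ℂ)‖ ≤ δ₀ := hz.le.trans hδδ₀
    have hud := m.mode_eq_add_P u
    rw [hud] at hs hu
    rcases hcl z (hball z hzδ) ε 0 ‖u‖ _ _ _ hε.le (hεη.trans hle1) le_rfl
      (by rw [zero_mul]; exact hη₁.le) (m.cp_P u) (m.cm_P u) (by rw [← hud]) hs hu with h | h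
    · rw [h.2.1] at hs hud
      have := (hnear z hzδ 0 ‖u‖ _ _ le_rfl (by rw [zero_mul]; exact hη0.le)
        (by rw [zero_mul]; exact hη0.le) h.1 (m.cp_P u) (m.cm_P u) (by rw [← hud]) hs).1
      rwa [zero_mul] at this
    -- The alternative is a resonance of the second mode. Near `w`, however, `1 - z² lm` is close to
    -- `1 - lm/lp`, of modulus `D`, and each of the two errors is less than `D/2`.
    · exfalso
      have h3 := h.2.2
      rw [zero_mul, add_zero] at h3
      have e : (1 - z ^ 2 * (m.lm : ℂ)) = ((1 - m.lm / m.lp : ℝ) : ℂ) -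
          (m.lm : ℂ) * ((z - w) * (2 * w + (z - w))) := by
        have : (w : ℂ) ^ 2 * m.lp = 1 := by exact_mod_cast hwl
        have h5 : ((m.lm / m.lp : ℝ) : ℂ) = m.lm * (w : ℂ) ^ 2 := by
          have hlC : (m.lp : ℂ) ≠ 0 := by exact_mod_cast hlp.ne'
          rw [ofReal_div, div_eq_iff hlC]
          linear_combination (-(m.lm : ℂ)) * this
        rw [ofReal_sub, h5]
        push_cast
        ring
      have t1 := norm_sub_norm_le ((1 - m.lm / m.lp : ℝ) : ℂ)
        ((m.lm : ℂ) * ((z - w) * (2 * w + (z - w))))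
      rw [← e, Complex.norm_real, Real.norm_eq_abs, ← hD] at t1
      have t2 : ‖(m.lm : ℂ) * ((z - w) * (2 * w + (z - w)))‖ < D / 2 := by
        rw [norm_mul, norm_mul, Complex.norm_real, Real.norm_of_nonneg hlm.le]
        have : ‖(2 * w + (z - w) : ℂ)‖ ≤ 3 * w := by
          refine (norm_add_le _ _).trans ?_
          rw [norm_mul, Complex.norm_real, Real.norm_of_nonneg hw0.le]
          simp only [Complex.norm_ofNat]
          linarith
        calc _ ≤ m.lm * (‖z - w‖ * (3 * w)) := by gcongr
          _ < m.lm * (δ * (3 * w)) := by gcongr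
          _ ≤ m.lm * (D / (6 * m.lm * w) * (3 * w)) := by gcongr
          _ = D / 2 := by field_simp; norm_num
      have t3 : C₁ * ε < D / 2 := by
        calc C₁ * ε < C₁ * δ := by gcongr
          _ ≤ C₁ * (D / (2 * C₁)) := by gcongr
          _ = D / 2 := by field_simp
      linarith
  · intro c hc
    obtain ⟨k1, k2, k3⟩ := hΩQ ε (c ^ 2) hε.le hεη (sq_nonneg c) (hsq c hc)
    refine ⟨hball _ k1, ?_, ?_⟩
    · have := hstab ε _ _ _ _ _ _ hε.le (hεη.trans hle0) (sq_nonneg c) ((hsq c hc).trans hle0)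
        le_rfl hη₀.le k1 l1 k3 l3
      rwa [sub_zero, abs_of_nonneg (sq_nonneg c)] at this
    · intro q hq hqM
      obtain ⟨s1, s2⟩ := hof _ (hball _ k1) ε _ _ hε.le (hεη.trans hle3) (sq_nonneg c)
        ((hsq c hc).trans hle3) k3
      have e : m.mode c 0 + q = (c : ℂ) • (m.mode 1 0 + Q ε (c ^ 2)) := by
        rw [hrem c hc q hq hqM, smul_add, mode_smul, mul_one, mul_zero]
      rw [e]
      refine ⟨m.isSol_scale _ ?_, by rw [map_smul, s2]⟩
      rw [Complex.norm_real, Real.norm_eq_abs, sq_abs, one_mul]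
      exact s1
  · have main : ∀ ω, ‖ω - (w : ℂ)‖ ≤ δ₀ → ∀ (a : ℂ) (q : E), a ≠ 0 → ‖a‖ < δ → m.cp q = 0 →
        m.cm q = 0 → ‖m.mode a 0 + q‖ ≤ M → m.IsSol ω ε 1 (m.mode a 0 + q) →
        ∀ q', m.IsRem (Ω' ε (‖a‖ ^ 2)) ε 1 (m.mode ‖a‖ 0) q' → ‖m.mode ‖a‖ 0 + q'‖ ≤ M →
        ω = Ω' ε (‖a‖ ^ 2) ∧ m.mode a 0 + q = exp (I * arg a) • (m.mode ‖a‖ 0 + q') := by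
      intro ω hω a q ha haδ hp hm hqM hs q' hq' hqM'
      have hcδ : |‖a‖| < δ := by rwa [abs_norm]
      obtain ⟨e1, hms⟩ := hnear ω hω 1 M a q zero_le_one (by rwa [one_mul])
        (by rw [one_mul]; exact hsq _ hcδ) ha hp hm hqM hs
      rw [one_mul] at e1 hms
      refine ⟨e1, ?_⟩
      symm
      rw [smul_add, mode_smul, mul_zero, ofReal_mul_exp_arg]
      congr 1
      obtain ⟨k1, k2, k3⟩ := hΩQ ε (‖a‖ ^ 2) hε.le hεη (sq_nonneg _) (hsq _ hcδ)
      rw [hrem ‖a‖ hcδ q' hq' hqM', smul_smul, ofReal_mul_exp_arg]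
      refine (huniq _ (hball _ hω) ε 1 M a 0 q hε.le (hεη.trans hle4) zero_le_one
        (by rw [one_mul]; exact hM1.trans hle4) hqM
        ((m.isSol_iff _ _ _ _ _ _ hp hm).1 hs).1).2 _ ?_ ?_
      · have : m.mode a 0 + a • Q ε (‖a‖ ^ 2) = exp (I * arg a) • (m.mode ‖a‖ 0 + q') := by
          rw [hrem ‖a‖ hcδ q' hq' hqM', smul_add, mode_smul, mul_zero, smul_smul,
            ofReal_mul_exp_arg]
        rw [this, norm_smul, mul_comm I, Complex.norm_exp_ofReal_mul_I, one_mul]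
        exact hqM'
      · have := m.isRem_scale (τ := 1) a (v := m.mode 1 0) (q := Q ε (‖a‖ ^ 2)) (ω := ω) (ε := ε)
          (by rw [one_mul, e1]; exact k3.1)
        rwa [mode_smul, mul_one, mul_zero] at this
    intro ω hω a q ha haδ hp hm hqM hs q' hq' hqM'
    have hu0 : m.mode a 0 + q ≠ 0 := by
      intro h
      have := congrArg m.cp h
      rw [map_add, cp_mode, hp, map_zero, add_zero] at this
      exact ha this
    have hsm : C₁ * (ε + 1 * M ^ 2) ≤ m.lp * δ₀ ^ 2 := by
      rw [one_mul]
      calc _ ≤ C₁ * (m.lp * δ₀ ^ 2 / (2 * C₁) + m.lp * δ₀ ^ 2 / (2 * C₁)) := by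
            gcongr
            exact hεδ.le.trans hδ1
        _ = _ := by field_simp; ring
    have hlast : ‖1 - ω ^ 2 * (m.lp : ℂ)‖ ≤ m.lp * δ₀ ^ 2 := by
      rcases hcl ω hω ε 1 M a 0 q hε.le (hεη.trans hle1) zero_le_one
        (by rw [one_mul]; exact hM1.trans hle1) hp hm hqM hs hu0 with h | h
      · exact h.2.2.trans hsm
      · exact absurd rfl h.2.1
    rcases near_of_one_sub_sq hlp hδ₀.le hlast with h | h
    · exact ⟨arg a, Or.inl (main ω h a q ha haδ hp hm hqM hs q' hq' hqM')⟩
    -- Here `ω` lies near `-w`. Its image under `κ` lies near `w`, belongs to the branch, and is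
    -- mapped back by `κ`; multiplying `a` by the unimodular `α` does not change the amplitude.
    · obtain ⟨α, hα1, hα⟩ := m.κ_φp
      obtain ⟨β, hβ1, hβ⟩ := m.κ_φm
      have hκu : m.κ (m.mode a 0 + q) = m.mode (α * (starRingEnd ℂ) a) 0 + m.κ q := by
        rw [map_add, mode, zero_smul, add_zero, LinearMap.map_smulₛₗ, hα, smul_smul, mode,
          zero_smul, add_zero, mul_comm α]
      have hn : ‖α * (starRingEnd ℂ) a‖ = ‖a‖ := by rw [norm_mul, hα1, one_mul, RCLike.norm_conj]
      have hα0 : α ≠ 0 := by intro h0; rw [h0, norm_zero] at hα1; exact zero_ne_one hα1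
      have hmain := main _ h (α * (starRingEnd ℂ) a) (m.κ q)
        (mul_ne_zero hα0 (by simpa using ha)) (by rw [hn]; exact haδ)
        (by rw [m.cp_κ α hα hα1, hp, map_zero, mul_zero])
        (by rw [show m.cm (m.κ q) = β * (starRingEnd ℂ) (m.cm q) from m.swap.cp_κ β hβ hβ1 q, hm,
              map_zero, mul_zero])
        (by rw [← hκu]; exact (m.norm_κ _).trans hqM) (by rw [← hκu]; exact m.isSol_κ hs) q'
        (by rw [hn]; exact hq') (by rw [hn]; exact hqM')
      rw [hn] at hmain
      refine ⟨arg (α * (starRingEnd ℂ) a), Or.inr ⟨?_, ?_⟩⟩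
      · change ω = -(starRingEnd ℂ) (Ω' ε (‖a‖ ^ 2))
        rw [← hmain.1]; simp
      · rw [← hmain.2, ← hκu, m.κ_κ]


variable {H E V : Type*}
    [NormedAddCommGroup H] [InnerProductSpace ℂ H]
    [NormedAddCommGroup E] [NormedSpace ℂ E] [CompleteSpace E]
    [NormedAddCommGroup V] [NormedSpace ℂ V] (m : ResonanceModel H E V)

/-! ### The remainder in the Sobolev space -/

/-- The lift to `V` of `ω² P (G (εω) f)`. -/
def liftP (ω : ℂ) (ε : ℝ) (f : H) : V :=
  ω ^ 2 • (m.GV (ε * ω) f - m.cp (m.G (ε * ω) f) • (m.lp : ℂ)⁻¹ • m.GV 0 (m.ι m.φp)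
    - m.cm (m.G (ε * ω) f) • (m.lm : ℂ)⁻¹ • m.GV 0 (m.ι m.φm))

lemma j_inv_smul_φp : m.j ((m.lp : ℂ)⁻¹ • m.GV 0 (m.ι m.φp)) = m.ι m.φp := by
  have hlpC : (m.lp : ℂ) ≠ 0 := by exact_mod_cast m.lp_pos.ne'
  rw [map_smul, m.j_GV, m.G_φp, map_smul, smul_smul, inv_mul_cancel₀ hlpC, one_smul]

lemma j_inv_smul_φm : m.j ((m.lm : ℂ)⁻¹ • m.GV 0 (m.ι m.φm)) = m.ι m.φm := m.swap.j_inv_smul_φp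

lemma j_liftP (ω : ℂ) (ε : ℝ) (f : H) :
    m.j (m.liftP ω ε f) = m.ι (ω ^ 2 • m.P (m.G (ε * ω) f)) := by
  rw [liftP, P_apply, map_smul, map_smul, map_sub, map_sub, map_smul m.j (m.cp _),
    map_smul m.j (m.cm _), j_inv_smul_φp, j_inv_smul_φm, m.j_GV, map_sub, map_sub, map_smul,
    map_smul]

lemma contDiff_liftP [CompleteSpace V] : ContDiff ℝ ⊤ fun x : (ℂ × ℂ × ℂ × ℝ) × E =>
    m.liftP x.1.1 x.1.2.2.2 (m.source x) := by
  have h1 := m.contDiff_source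
  have hG := (contDiff_family (E := E) m.differentiable_G).clm_apply_complex h1
  have hGV := (contDiff_family (E := E) m.differentiable_GV).clm_apply_complex h1
  refine ContDiff.smul_complex (by fun_prop) ((hGV.sub ?_).sub ?_)
  · exact ContDiff.smul_complex (ContDiff.clm_complex m.cp hG) contDiff_const
  · exact ContDiff.smul_complex (ContDiff.clm_complex m.cm hG) contDiff_const

/-- The equation recovers the `V` norm from bounds in `E`: the lift of the remainder is `ω²` times
the potential of `q`, the lift of `rest`, and minus the mode components of `rest`. The mode part has
dropped out under `P`, so every term besides `q` carries `ε` or two powers of the amplitude. -/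
lemma exists_remainder_bound [CompleteSpace V] : ∃ C > (0 : ℝ), ∃ η > (0 : ℝ), η ≤ 1 ∧ ∀ ω ∈ m.Ω,
    ∀ (ε M : ℝ) (a b : ℂ) (s : V) (q : E), 0 ≤ ε → ε ≤ η → M ^ 2 ≤ η → ‖m.mode a b + q‖ ≤ M →
      m.IsRem ω ε 1 (m.mode a b) q → m.j s = m.ι q → ‖s‖ ≤ C * (‖q‖ + (ε + M ^ 2) * M) := by
  obtain ⟨W, hW, hΩ⟩ := m.bounded_Ω
  obtain ⟨t, ht, hT⟩ := m.T_lipschitz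
  obtain ⟨C₁, hC₁, hR⟩ := m.exists_rest_bound hW
  obtain ⟨gV, hgV, hGVn, hLV⟩ := exists_lipschitz_ball m.differentiable_GV W
  set i := ‖m.ι‖ with hi
  have hi0 : 0 ≤ i := norm_nonneg _
  set n := ‖m.cp‖ * ‖(m.lp : ℂ)⁻¹ • m.GV 0 (m.ι m.φp)‖ +
    ‖m.cm‖ * ‖(m.lm : ℂ)⁻¹ • m.GV 0 (m.ι m.φm)‖ with hn
  have hn0 : 0 ≤ n := by positivity
  refine ⟨W ^ 2 * (gV * i + gV * W * (i * (1 + t)) + gV * (i * t) + n * C₁) + 1, by positivity,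
    1, one_pos, le_rfl, ?_⟩
  intro ω hω ε M a b s q hε hε1 hM1 hu hq hs
  have hωW := hΩ ω hω
  obtain ⟨u, hudef⟩ : ∃ u, u = m.mode a b + q := ⟨_, rfl⟩
  rw [← hudef] at hu
  have hM0 : 0 ≤ M := (norm_nonneg _).trans hu
  have hzn : ‖(ε : ℂ) * ω‖ = ε * ‖ω‖ := by
    rw [norm_mul, Complex.norm_real, Real.norm_of_nonneg hε]
  have hzW : ‖(ε : ℂ) * ω‖ ≤ W := by
    rw [hzn]; calc ε * ‖ω‖ ≤ 1 * W := by gcongr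
      _ = W := one_mul W
  have hTu : ‖m.T u‖ ≤ t * M ^ 2 * M := by
    have := hT M u 0 hu (by simpa using hM0)
    rw [m.T_zero, sub_zero, sub_zero] at this
    exact this.trans (by gcongr)
  have hrest : ‖m.rest ω ε 1 u‖ ≤ C₁ * (ε + M ^ 2) * M := by
    have := hR ω ε 1 M u hωW hε hε1 zero_le_one (by rwa [one_mul]) hu
    rw [one_mul] at this
    exact this.trans (by gcongr)
  have hsV : s = ω ^ 2 • (m.GV 0 (m.ι q) + ((m.GV (ε * ω) - m.GV 0) (m.ι (u + m.T u)) +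
      m.GV 0 (m.ι (m.T u))) - (m.cp (m.rest ω ε 1 u) • (m.lp : ℂ)⁻¹ • m.GV 0 (m.ι m.φp)
      + m.cm (m.rest ω ε 1 u) • (m.lm : ℂ)⁻¹ • m.GV 0 (m.ι m.φm))) := by
    apply m.j_injective
    rw [hs]
    conv_lhs => rw [(m.isRem_iff _ _ _ _ _ _).1 hq]
    rw [← hudef, P_apply, map_add m.cp, map_add m.cm, cp_G, cm_G, hq.cp_eq_zero, hq.cm_eq_zero, mul_zero,
      mul_zero, zero_add, zero_add]
    rw [map_smul m.ι, map_smul m.j, map_sub m.j, map_add m.j, map_add m.j, map_add m.j,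
      map_smul m.j (m.cp _), map_smul m.j (m.cm _), j_inv_smul_φp, j_inv_smul_φm, sub_apply,
      map_sub m.j, m.j_GV, m.j_GV, m.j_GV, m.j_GV, ← sub_sub]
    simp only [map_sub, map_add, map_smul]
    simp only [rest, ofReal_one, one_smul, sub_apply, map_sub, map_add]
    rw [add_sub_add_comm (m.ι (m.G (ε * ω) (m.ι u)))]
  have hι : ∀ x, ‖m.ι x‖ ≤ i * ‖x‖ := m.ι.le_opNorm
  have hGV0 : ‖m.GV 0‖ ≤ gV := hGVn 0 (by simpa using hW.le)
  have t1 : ‖m.GV 0 (m.ι q)‖ ≤ gV * (i * ‖q‖) :=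
    (ContinuousLinearMap.le_opNorm _ _).trans (by gcongr; exact hι q)
  have t3 : ‖m.GV 0 (m.ι (m.T u))‖ ≤ gV * (i * (t * M ^ 2 * M)) :=
    (ContinuousLinearMap.le_opNorm _ _).trans (by gcongr; exact (hι _).trans (by gcongr))
  have t2 : ‖(m.GV (ε * ω) - m.GV 0) (m.ι (u + m.T u))‖ ≤ gV * (ε * W) * (i * ((1 + t) * M)) := by
    have h1 := hLV (ε * ω) 0 hzW (by simpa using hW.le)
    rw [sub_zero, hzn] at h1
    refine (ContinuousLinearMap.le_opNorm _ _).trans ?_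
    gcongr
    · exact h1.trans (by gcongr)
    · refine (hι _).trans ?_
      gcongr
      refine (norm_add_le _ _).trans ?_
      have : t * M ^ 2 * M ≤ t * 1 * M := by gcongr
      linarith
  have t4 : ‖m.cp (m.rest ω ε 1 u) • (m.lp : ℂ)⁻¹ • m.GV 0 (m.ι m.φp)
      + m.cm (m.rest ω ε 1 u) • (m.lm : ℂ)⁻¹ • m.GV 0 (m.ι m.φm)‖ ≤
      n * (C₁ * (ε + M ^ 2) * M) := by
    refine (norm_add_le _ _).trans ?_
    rw [norm_smul (m.cp _), norm_smul (m.cm _)]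
    calc _ ≤ (‖m.cp‖ * (C₁ * (ε + M ^ 2) * M)) * ‖(m.lp : ℂ)⁻¹ • m.GV 0 (m.ι m.φp)‖ +
          (‖m.cm‖ * (C₁ * (ε + M ^ 2) * M)) * ‖(m.lm : ℂ)⁻¹ • m.GV 0 (m.ι m.φm)‖ := by
          gcongr
          · exact (m.cp.le_opNorm _).trans (by gcongr)
          · exact (m.cm.le_opNorm _).trans (by gcongr)
      _ = _ := by rw [hn]; ring
  rw [hsV, norm_smul, norm_pow]
  clear_value n i
  set y := (ε + M ^ 2) * M with hy
  have hy0 : 0 ≤ y := by positivity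
  have y1 : ε * M ≤ y := by rw [hy]; gcongr; linarith [sq_nonneg M]
  have y2 : M ^ 2 * M ≤ y := by rw [hy]; gcongr; linarith
  calc _ ≤ W ^ 2 * (gV * (i * ‖q‖) + (gV * (ε * W) * (i * ((1 + t) * M)) +
        gV * (i * (t * M ^ 2 * M))) + n * (C₁ * (ε + M ^ 2) * M)) := by
        gcongr
        refine (norm_sub_le _ _).trans (add_le_add ((norm_add_le _ _).trans
          (add_le_add t1 ((norm_add_le _ _).trans (add_le_add t2 t3)))) t4)
    _ = W ^ 2 * (gV * i * ‖q‖ + (gV * W * (i * (1 + t)) * (ε * M) +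
        gV * (i * t) * (M ^ 2 * M)) + n * C₁ * y) := by rw [hy]; ring
    _ ≤ W ^ 2 * (gV * i * (‖q‖ + y) + (gV * W * (i * (1 + t)) * (‖q‖ + y) +
        gV * (i * t) * (‖q‖ + y)) + n * C₁ * (‖q‖ + y)) := by
        have hq0 := norm_nonneg q
        gcongr <;> linarith
    _ ≤ _ := by
        have : 0 ≤ ‖q‖ + y := by positivity
        linarith


variable {H E V : Type*}
    [NormedAddCommGroup H] [InnerProductSpace ℂ H]
    [NormedAddCommGroup E] [NormedSpace ℂ E] [CompleteSpace E]
    [NormedAddCommGroup V] [NormedSpace ℂ V] (m : ResonanceModel H E V)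

/-! ### The main theorem for a resonance model -/

/-- The remainder function, with its uniqueness, size and analyticity. -/
lemma exists_remainder [CompleteSpace V] {M : ℝ} (hM : 0 < M) :
    ∃ cs > (0 : ℝ), ∃ εs > (0 : ℝ), ∃ ϱ > (0 : ℝ), ∃ C > (0 : ℝ),
    ∃ (r : ℂ → ℂ → ℂ → ℝ → V) (q : ℂ → ℂ → ℂ → ℝ → E),
      (∀ ω ∈ m.Ω, ∀ a b : ℂ, ‖a‖ + ‖b‖ < cs → ∀ ε : ℝ, 0 < ε → ε < εs →
        m.j (r ω a b ε) = m.ι (q ω a b ε) ∧ m.IsRem ω ε 1 (m.mode a b) (q ω a b ε) ∧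
        ‖m.mode a b + q ω a b ε‖ ≤ M ∧ ‖r ω a b ε‖ < ϱ ∧
        (∀ (s : V) (q' : E), m.j s = m.ι q' → m.IsRem ω ε 1 (m.mode a b) q' → ‖s‖ < ϱ →
          s = r ω a b ε ∧ ‖m.mode a b + q'‖ ≤ M) ∧
        ‖r ω a b ε‖ ≤ C * (‖a‖ ^ 2 + ‖b‖ ^ 2 + ε) * (‖a‖ + ‖b‖)) ∧
      AnalyticOnNhd ℝ (fun p : ℂ × ℂ × ℂ × ℝ => r p.1 p.2.1 p.2.2.1 p.2.2.2)
        {p | p.1 ∈ m.Ω ∧ ‖p.2.1‖ + ‖p.2.2.1‖ < cs ∧ 0 < p.2.2.2 ∧ p.2.2.2 < εs} := by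
  obtain ⟨C₁, hC₁, η₁, hη₁, hη₁1, huniq⟩ := m.exists_isRem_unique
  obtain ⟨η₂, hη₂, hη₂1, hex⟩ := m.exists_isRem
  obtain ⟨C₃, hC₃, η₃, hη₃, hη₃1, hsup⟩ := m.exists_sup_bound
  obtain ⟨C₄, hC₄, η₄, hη₄, hη₄1, hbd⟩ := m.exists_remainder_bound
  obtain ⟨η₅, hη₅, hη₅1, han⟩ := m.analyticAt_remainder
  set η := min (min η₁ η₂) (min (min η₃ η₄) η₅) with hη
  have hη0 : 0 < η := by positivity
  have hle1 : η ≤ η₁ := (min_le_left _ _).trans (min_le_left _ _)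
  have hle2 : η ≤ η₂ := (min_le_left _ _).trans (min_le_right _ _)
  have hle3 : η ≤ η₃ := (min_le_right _ _).trans ((min_le_left _ _).trans (min_le_left _ _))
  have hle4 : η ≤ η₄ := (min_le_right _ _).trans ((min_le_left _ _).trans (min_le_right _ _))
  have hle5 : η ≤ η₅ := (min_le_right _ _).trans (min_le_right _ _)
  have hηle1 : η ≤ 1 := hle1.trans hη₁1
  set k := ‖m.φp‖ + ‖m.φm‖ with hk
  have hk0 : 0 < k := add_pos_of_pos_of_nonneg m.norm_φp_pos (norm_nonneg _)
  have hmode : ∀ a b : ℂ, ‖m.mode a b‖ ≤ k * (‖a‖ + ‖b‖) := m.norm_mode_le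
  clear_value η k
  -- the size of `u`
  set N := min M (√η) with hN
  have hN0 : 0 < N := by positivity
  have hNM : N ≤ M := min_le_left _ _
  have hN2 : N ^ 2 ≤ η := by rw [← Real.le_sqrt hN0.le hη0.le]; exact min_le_right _ _
  clear_value N
  -- the constant in the bound for the remainder
  set C := C₄ * ((C₁ + 2) * (k * (1 + 8 * k ^ 2))) with hC
  have hC0 : 0 < C := by positivity
  clear_value C
  set ϱ := min (η / 2) (N / (4 * C₃)) with hϱ
  have hϱ0 : 0 < ϱ := by positivity
  have hϱ1 : ϱ ≤ η / 2 := min_le_left _ _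
  have hϱ2 : ϱ ≤ N / (4 * C₃) := min_le_right _ _
  clear_value ϱ
  -- With `N / (4C₃)`, both here and for `ϱ`, `exists_sup_bound` gives `‖q'‖ ≤ N/2`; `N / (4k)`
  -- bounds the mode part by `N/4`; `ϱ / (4C)` makes the size estimate yield `‖r‖ ≤ ϱ/2`.
  set cs := min (min (η / 2) (N / (4 * C₃))) (min (N / (4 * k)) (ϱ / (4 * C))) with hcs
  have hcs0 : 0 < cs := by positivity
  have hcs1 : cs ≤ η / 2 := (min_le_left _ _).trans (min_le_left _ _)
  have hcs2 : cs ≤ N / (4 * C₃) := (min_le_left _ _).trans (min_le_right _ _)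
  have hcs3 : cs ≤ N / (4 * k) := (min_le_right _ _).trans (min_le_left _ _)
  have hcs4 : cs ≤ ϱ / (4 * C) := (min_le_right _ _).trans (min_le_right _ _)
  clear_value cs
  -- the remainder in the space of bounded functions
  have hmodeN : ∀ a b : ℂ, ‖a‖ + ‖b‖ < cs → ‖m.mode a b‖ ≤ N / 4 := fun a b h => by
    refine (hmode a b).trans ?_
    calc _ ≤ k * (N / (4 * k)) := by gcongr; exact h.le.trans hcs3
      _ = _ := by field_simp
  have hch : ∀ (ω a b : ℂ) (ε : ℝ), ∃ q, ω ∈ m.Ω → ‖a‖ + ‖b‖ < cs → 0 < ε → ε < η →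
      m.IsRem ω ε 1 (m.mode a b) q ∧ ‖q‖ ≤ ‖m.mode a b‖ := by
    intro ω a b ε
    by_cases h : ω ∈ m.Ω ∧ ‖a‖ + ‖b‖ < cs ∧ 0 < ε ∧ ε < η
    · obtain ⟨h1, h2, h3, h4⟩ := h
      obtain ⟨q, hq⟩ := hex ω h1 ε 1 a b h3.le (h4.le.trans hle2) zero_le_one (by
        rw [one_mul]
        refine le_trans ?_ (hN2.trans hle2)
        gcongr
        linarith [hmodeN a b h2])
      exact ⟨q, fun _ _ _ _ => hq⟩
    · exact ⟨0, fun h1 h2 h3 h4 => absurd ⟨h1, h2, h3, h4⟩ h⟩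
  choose q hq using hch
  have hqN : ∀ ω ∈ m.Ω, ∀ a b : ℂ, ‖a‖ + ‖b‖ < cs → ∀ ε : ℝ, 0 < ε → ε < η →
      ‖m.mode a b + q ω a b ε‖ < N := by
    intro ω hω a b h ε h1 h2
    have := (hq ω a b ε hω h h1 h2).2
    have := hmodeN a b h
    exact (norm_add_le _ _).trans_lt (by linarith)
  set F : (ℂ × ℂ × ℂ × ℝ) × E → V := fun x => m.liftP x.1.1 x.1.2.2.2 (m.source x) with hF
  -- `r` is an explicit analytic expression in the parameters and `q`, so its analyticity reduces to
  -- that of `q`.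
  refine ⟨cs, hcs0, η, hη0, ϱ, hϱ0, C, hC0,
    fun ω a b ε => F ((ω, a, b, ε), q ω a b ε), q, ?_, ?_⟩
  · intro ω hω a b hab ε hε hεη
    obtain ⟨hr, hqm⟩ := hq ω a b ε hω hab hε hεη
    have huN := hqN ω hω a b hab ε hε hεη
    have hj : m.j (F ((ω, a, b, ε), q ω a b ε)) = m.ι (q ω a b ε) := by
      rw [hF]
      change m.j (m.liftP ω ε _) = _
      rw [j_liftP]
      congr 1
      conv_rhs => rw [hr]
      rw [ofReal_one, one_smul]
      rfl
    have hnorm : ‖F ((ω, a, b, ε), q ω a b ε)‖ ≤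
        C * (‖a‖ ^ 2 + ‖b‖ ^ 2 + ε) * (‖a‖ + ‖b‖) := by
      set x := ‖a‖ + ‖b‖ with hx
      have hx0 : 0 ≤ x := by positivity
      have hu2 : ‖m.mode a b + q ω a b ε‖ ≤ 2 * k * x := by
        refine (norm_add_le _ _).trans ?_
        have := hmode a b
        linarith
      have h2kx : 2 * k * x ≤ N := by
        calc 2 * k * x ≤ 2 * k * (N / (4 * k)) := by gcongr; exact hab.le.trans hcs3
          _ = N / 2 := by field_simp; norm_num
          _ ≤ N := by linarith
      have h2kx2 : (2 * k * x) ^ 2 ≤ η := by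
        refine le_trans ?_ hN2
        gcongr
      have hq1 := (huniq ω hω ε 1 (2 * k * x) a b _ hε.le (hεη.le.trans hle1) zero_le_one
        (by rw [one_mul]; exact h2kx2.trans hle1) hu2 hr).1
      have hs := hbd ω hω ε (2 * k * x) a b _ _ hε.le (hεη.le.trans hle4) (h2kx2.trans hle4) hu2
        hr hj
      rw [one_mul] at hq1
      have hsq : ε + (2 * k * x) ^ 2 ≤ (1 + 8 * k ^ 2) * (‖a‖ ^ 2 + ‖b‖ ^ 2 + ε) := by
        have h1 : x ^ 2 ≤ 2 * (‖a‖ ^ 2 + ‖b‖ ^ 2) := by rw [hx]; exact add_sq_le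
        have h2 : 4 * k ^ 2 * x ^ 2 ≤ 4 * k ^ 2 * (2 * (‖a‖ ^ 2 + ‖b‖ ^ 2)) := by gcongr
        have h3 : 0 ≤ 8 * k ^ 2 * ε := by positivity
        have h4 : 0 ≤ ‖a‖ ^ 2 + ‖b‖ ^ 2 := by positivity
        linarith
      calc _ ≤ C₄ * (C₁ * (ε + (2 * k * x) ^ 2) * (k * x) + (ε + (2 * k * x) ^ 2) * (2 * k * x)) := by
            refine hs.trans ?_
            gcongr
            refine hq1.trans ?_
            gcongr
            exact hmode a b
        _ = C₄ * ((C₁ + 2) * (k * (ε + (2 * k * x) ^ 2))) * x := by ring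
        _ ≤ C₄ * ((C₁ + 2) * (k * ((1 + 8 * k ^ 2) * (‖a‖ ^ 2 + ‖b‖ ^ 2 + ε)))) * x := by gcongr
        _ = _ := by rw [hC]; ring
    refine ⟨hj, hr, huN.le.trans hNM, ?_, ?_, hnorm⟩
    · refine hnorm.trans_lt ?_
      have h1 : ‖a‖ ^ 2 + ‖b‖ ^ 2 + ε ≤ 2 := by
        have ha := norm_nonneg a
        have hb := norm_nonneg b
        have h2 : ‖a‖ ^ 2 + ‖b‖ ^ 2 ≤ (‖a‖ + ‖b‖) ^ 2 := by
          linarith [mul_nonneg ha hb, add_sq ‖a‖ ‖b‖]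
        have h3 : (‖a‖ + ‖b‖) ^ 2 ≤ 1 ^ 2 := by gcongr; linarith
        linarith
      calc _ ≤ C * 2 * (ϱ / (4 * C)) := by
            gcongr
            exact hab.le.trans hcs4
        _ = ϱ / 2 := by field_simp; norm_num
        _ < ϱ := by linarith
    · intro s q' hsq' hr' hsϱ
      have hq' := hsup ω hω ε a b s q' hε.le (hεη.le.trans hle3) (by linarith) hr' hsq'
      have hu' : ‖m.mode a b + q'‖ ≤ N := by
        refine (norm_add_le _ _).trans ?_
        have h1 : C₃ * (‖a‖ + ‖b‖ + ‖s‖) ≤ C₃ * (N / (4 * C₃) + N / (4 * C₃)) := by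
          gcongr <;> linarith
        have h2 : C₃ * (N / (4 * C₃) + N / (4 * C₃)) = N / 2 := by field_simp; norm_num
        linarith [hmodeN a b hab]
      refine ⟨m.j_injective ?_, hu'.trans hNM⟩
      rw [hj, hsq', (huniq ω hω ε 1 N a b _ hε.le (hεη.le.trans hle1) zero_le_one
        (by rw [one_mul]; exact hN2.trans hle1) huN.le hr).2 q' hu' hr']
  · rintro ⟨ω, a, b, ε⟩ ⟨hω, hab, hε, hεη⟩
    have h1 := han q cs N η hN0.le (hN2.trans hle5) hle5
      (fun ω hω a b hab ε h1 h2 => ⟨(hq ω a b ε hω hab h1 h2).1, hqN ω hω a b hab ε h1 h2⟩)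
      (ω, a, b, ε) hω hab hε hεη
    have h2 : ContDiffAt ℝ ⊤ (fun p : ℂ × ℂ × ℂ × ℝ => F (p, q p.1 p.2.1 p.2.2.1 p.2.2.2))
        (ω, a, b, ε) :=
      (m.contDiff_liftP.contDiffAt (x := _)).comp (ω, a, b, ε) (contDiffAt_id.prodMk h1)
    exact h2.analyticAt

/-- Perturbation theory for the two modes of a resonance model. -/
theorem main [CompleteSpace V] :
    ∃ cs > (0 : ℝ), ∃ εs > (0 : ℝ), ∃ ϱ > (0 : ℝ), ∃ C > (0 : ℝ),
    ∃ (r : ℂ → ℂ → ℂ → ℝ → V) (q : ℂ → ℂ → ℂ → ℝ → E),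
      (∀ ω ∈ m.Ω, ∀ a b : ℂ, ‖a‖ + ‖b‖ < cs → ∀ ε : ℝ, 0 < ε → ε < εs →
        m.j (r ω a b ε) = m.ι (q ω a b ε) ∧ m.IsRem ω ε 1 (m.mode a b) (q ω a b ε) ∧
        ‖r ω a b ε‖ < ϱ ∧
        (∀ (s : V) (q' : E), m.j s = m.ι q' → m.IsRem ω ε 1 (m.mode a b) q' → ‖s‖ < ϱ →
          s = r ω a b ε) ∧
        ‖r ω a b ε‖ ≤ C * (‖a‖ ^ 2 + ‖b‖ ^ 2 + ε) * (‖a‖ + ‖b‖)) ∧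
      AnalyticOnNhd ℝ (fun p : ℂ × ℂ × ℂ × ℝ => r p.1 p.2.1 p.2.2.1 p.2.2.2)
        {p | p.1 ∈ m.Ω ∧ ‖p.2.1‖ + ‖p.2.2.1‖ < cs ∧ 0 < p.2.2.2 ∧ p.2.2.2 < εs} ∧
      ∃ δ > (0 : ℝ), δ ≤ cs ∧ δ ≤ εs ∧ ∃ ωP ωM : ℝ → ℝ → ℂ, ∃ ωlinP ωlinM : ℝ → ℂ,
        (∀ ε : ℝ, 0 < ε → ε < δ →
          (∃ u ≠ 0, m.IsSol (ωlinP ε) ε 0 u) ∧ ‖ωlinP ε - ((1 / √m.lp : ℝ) : ℂ)‖ ≤ C * ε ∧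
          (∀ z, ‖z - ((1 / √m.lp : ℝ) : ℂ)‖ < δ → ∀ u ≠ 0, m.IsSol z ε 0 u → z = ωlinP ε) ∧
          (∃ u ≠ 0, m.IsSol (ωlinM ε) ε 0 u) ∧ ‖ωlinM ε - ((1 / √m.lm : ℝ) : ℂ)‖ ≤ C * ε ∧
          (∀ z, ‖z - ((1 / √m.lm : ℝ) : ℂ)‖ < δ → ∀ u ≠ 0, m.IsSol z ε 0 u → z = ωlinM ε)) ∧
        (∀ c ε : ℝ, |c| < δ → 0 < ε → ε < δ →
          (ωP c ε ∈ m.Ω ∧ ‖ωP c ε - ωlinP ε‖ ≤ C * c ^ 2 ∧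
            m.IsSol (ωP c ε) ε 1 (m.mode c 0 + q (ωP c ε) c 0 ε) ∧
            m.ρ (m.mode c 0 + q (ωP c ε) c 0 ε) = m.mode c 0 + q (ωP c ε) c 0 ε) ∧
          (ωM c ε ∈ m.Ω ∧ ‖ωM c ε - ωlinM ε‖ ≤ C * c ^ 2 ∧
            m.IsSol (ωM c ε) ε 1 (m.mode 0 c + q (ωM c ε) 0 c ε) ∧
            m.ρ (m.mode 0 c + q (ωM c ε) 0 c ε) = -(m.mode 0 c + q (ωM c ε) 0 c ε))) ∧
        ∀ ε : ℝ, 0 < ε → ε < δ → ∀ ω ∈ m.Ω, ∀ a b : ℂ, ‖a‖ + ‖b‖ < δ → ∀ (s : V) (p : E),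
          ‖s‖ < ϱ → m.j s = m.ι p → m.cp p = 0 → m.cm p = 0 → m.mode a b + p ≠ 0 →
          m.IsSol ω ε 1 (m.mode a b + p) →
          ∃ c θ : ℝ, |c| < δ ∧ ∃ (ω' : ℂ) (u' : E),
            ((ω' = ωP c ε ∧ u' = exp (I * θ) • (m.mode c 0 + q (ωP c ε) c 0 ε)) ∨
              (ω' = ωM c ε ∧ u' = exp (I * θ) • (m.mode 0 c + q (ωM c ε) 0 c ε))) ∧
            ((ω = ω' ∧ m.mode a b + p = u') ∨
              (ω = -(starRingEnd ℂ) ω' ∧ m.mode a b + p = m.κ u')) := by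
  obtain ⟨CP, hCP, δP, hδP, MP, hMP, ωP, ωlinP, hP⟩ := m.exists_branch
  -- The odd family is the even family of the swapped model, where the reflection is `-ρ`.
  obtain ⟨CM, hCM, δM, hδM, MM, hMM, ωM, ωlinM, hM⟩ := m.swap.exists_branch
  obtain ⟨C₁, hC₁, η₁, hη₁, hη₁1, hcl⟩ := m.exists_classification
  simp only [swap_isSol, swap_isRem, swap_mode] at hM
  set M := min (min MP MM) (√η₁) with hMdef
  have hM0 : 0 < M := by positivity
  have hMP' : M ≤ MP := (min_le_left _ _).trans (min_le_left _ _)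
  have hMM' : M ≤ MM := (min_le_left _ _).trans (min_le_right _ _)
  have hM2 : M ^ 2 ≤ η₁ := by rw [← Real.le_sqrt hM0.le hη₁.le]; exact min_le_right _ _
  obtain ⟨cs, hcs, εs, hεs, ϱ, hϱ, C, hC, r, q, hr, han⟩ := m.exists_remainder hM0
  refine ⟨cs, hcs, εs, hεs, ϱ, hϱ, C + CP + CM, by positivity, r, q, ?_, han, ?_⟩
  · intro ω hω a b hab ε hε hεs
    obtain ⟨h1, h2, h3, h4, h5, h6⟩ := hr ω hω a b hab ε hε hεs
    refine ⟨h1, h2, h4, fun s q' hs hq' hsϱ => (h5 s q' hs hq' hsϱ).1, h6.trans ?_⟩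
    gcongr
    linarith
  set δ := min (min δP δM) (min (min cs εs) η₁) with hδ
  have hδ0 : 0 < δ := by positivity
  have hdP : δ ≤ δP := (min_le_left _ _).trans (min_le_left _ _)
  have hdM : δ ≤ δM := (min_le_left _ _).trans (min_le_right _ _)
  have hdc : δ ≤ cs := (min_le_right _ _).trans ((min_le_left _ _).trans (min_le_left _ _))
  have hdε : δ ≤ εs := (min_le_right _ _).trans ((min_le_left _ _).trans (min_le_right _ _))
  have hdη : δ ≤ η₁ := (min_le_right _ _).trans (min_le_right _ _)
  clear_value δ M
  have hnc : ∀ c : ℝ, |c| < δ → ‖(c : ℂ)‖ + ‖(0 : ℂ)‖ < cs := fun c hc => by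
    rw [norm_zero, add_zero, Complex.norm_real]; exact hc.trans_le hdc
  have hnc' : ∀ c : ℝ, |c| < δ → ‖(0 : ℂ)‖ + ‖(c : ℂ)‖ < cs := fun c hc => by
    rw [add_comm]; exact hnc c hc
  refine ⟨δ, hδ0, hdc, hdε, ωP, ωM, ωlinP, ωlinM, ?_, ?_, ?_⟩
  · intro ε hε hεδ
    obtain ⟨⟨p1, p2, p3⟩, -, -⟩ := hP ε hε (hεδ.trans_le hdP)
    obtain ⟨⟨m1, m2, m3⟩, -, -⟩ := hM ε hε (hεδ.trans_le hdM)
    refine ⟨p1, p2.trans ?_, fun z hz => p3 z (hz.trans_le hdP), m1, m2.trans ?_,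
      fun z hz => m3 z (hz.trans_le hdM)⟩
    · gcongr; linarith
    · gcongr; linarith
  · intro c ε hc hε hεδ
    obtain ⟨-, p, -⟩ := hP ε hε (hεδ.trans_le hdP)
    obtain ⟨-, n, -⟩ := hM ε hε (hεδ.trans_le hdM)
    obtain ⟨p1, p2, p3⟩ := p c (hc.trans_le hdP)
    obtain ⟨n1, n2, n3⟩ := n c (hc.trans_le hdM)
    obtain ⟨-, r1, r2, -⟩ := hr _ p1 c 0 (hnc c hc) ε hε (hεδ.trans_le hdε)
    obtain ⟨-, s1, s2, -⟩ := hr _ n1 0 c (hnc' c hc) ε hε (hεδ.trans_le hdε)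
    obtain ⟨p4, p5⟩ := p3 _ r1 (r2.trans hMP')
    obtain ⟨n4, n5⟩ := n3 _ s1 (s2.trans hMM')
    refine ⟨⟨p1, p2.trans ?_, p4, p5⟩, ⟨n1, n2.trans ?_, n4, ?_⟩⟩
    · gcongr; linarith
    · gcongr; linarith
    · exact neg_eq_iff_eq_neg.1 n5
  · intro ε hε hεδ ω hω a b hab s p hs hjs hp hm hu0 hsol
    obtain ⟨-, P1, P2⟩ := hP ε hε (hεδ.trans_le hdP)
    obtain ⟨-, N1, N2⟩ := hM ε hε (hεδ.trans_le hdM)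
    have hrem := ((m.isSol_iff _ _ _ _ _ _ hp hm).1 hsol).1
    -- The bound in `E` needed for the classification is not a hypothesis; it comes from smallness
    -- in `V`.
    have huM := ((hr ω hω a b (hab.trans_le hdc) ε hε (hεδ.trans_le hdε)).2.2.2.2.1 s p hjs hrem
      hs).2
    have ha0 := norm_nonneg a
    have hb0 := norm_nonneg b
    rcases hcl ω hω ε 1 M a b p hε.le (hεδ.le.trans hdη) zero_le_one (by rwa [one_mul]) hp hm huM
      hsol hu0 with ⟨ha, hb, -⟩ | ⟨ha, hb, -⟩
    · subst hb
      have haδ : ‖a‖ < δ := by rwa [norm_zero, add_zero] at hab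
      have hcδ : |‖a‖| < δ := by rwa [abs_norm]
      have p1 := (P1 ‖a‖ (hcδ.trans_le hdP)).1
      obtain ⟨-, r1, r2, -⟩ := hr _ p1 (‖a‖ : ℝ) 0 (hnc _ hcδ) ε hε (hεδ.trans_le hdε)
      obtain ⟨θ, hθ⟩ := P2 ω hω a p ha (haδ.trans_le hdP) hp hm (huM.trans hMP') hsol _ r1
        (r2.trans hMP')
      exact ⟨‖a‖, θ, hcδ, _, _, Or.inl ⟨rfl, rfl⟩, hθ⟩
    · subst ha
      have hbδ : ‖b‖ < δ := by rwa [norm_zero, zero_add] at hab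
      have hcδ : |‖b‖| < δ := by rwa [abs_norm]
      have p1 := (N1 ‖b‖ (hcδ.trans_le hdM)).1
      obtain ⟨-, r1, r2, -⟩ := hr _ p1 0 (‖b‖ : ℝ) (hnc' _ hcδ) ε hε (hεδ.trans_le hdε)
      obtain ⟨θ, hθ⟩ := N2 ω hω b p hb (hbδ.trans_le hdM) hm hp (huM.trans hMM') hsol _ r1
        (r2.trans hMM')
      exact ⟨‖b‖, θ, hcδ, _, _, Or.inr ⟨rfl, rfl⟩, hθ⟩

end ResonanceModel

/-! ### Convolution operators on a bounded domain -/

/-- The essentially bounded functions on `D`. -/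
abbrev Linf (D : Set E3) : Type := Lp ℂ ∞ (volume.restrict D)

/-- A ball containing all differences of points of `D`. -/
abbrev diffBall (D : Set E3) : Set E3 := Metric.ball 0 (Metric.diam D + 1)

/-- Square integrable convolution kernels. -/
abbrev Ker (D : Set E3) : Type := Lp ℂ 2 (volume.restrict (diffBall D))

/-- The function `x ↦ ∫_D k (x - y) f y dy`. -/
def convFun (D : Set E3) (k f : E3 → ℂ) (x : E3) : ℂ := ∫ y in D, k (x - y) * f y

section

variable {D : Set E3} [hD : Fact (IsOpen D)] [hb : Fact (Bornology.IsBounded D)]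

instance isFiniteMeasure_restrict_of_isBounded : IsFiniteMeasure (volume.restrict D) := ⟨by
  rw [Measure.restrict_apply_univ]; exact hb.out.measure_lt_top⟩

lemma sub_mem_diffBall {x y : E3} (hx : x ∈ D) (hy : y ∈ D) : x - y ∈ diffBall D := by
  have := Metric.dist_le_diam_of_mem hb.out hx hy
  rw [mem_ball_zero_iff, ← dist_eq_norm]
  linarith

/-- `y ↦ x - y` preserves volume and sends `D` into the ball of differences, so kernels need to be
controlled only there. -/
lemma map_sub_left_le {x : E3} (hx : x ∈ D) :
    (volume.restrict D).map (fun y => x - y) ≤ volume.restrict (diffBall D) := by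
  have hmp := (Measure.measurePreserving_sub_left (volume : Measure E3) x).restrict_preimage
    (s := (fun y => x - y) ⁻¹' D) (hD.out.measurableSet.preimage (by fun_prop))
  have h2 : (fun y => x - y) ⁻¹' ((fun y => x - y) ⁻¹' D) = D := by ext y; simp
  rw [h2] at hmp
  rw [hmp.map_eq]
  refine Measure.restrict_mono (fun z hz => ?_) le_rfl
  have := sub_mem_diffBall hx hz
  simpa using this

lemma memLp_sub_left {k : E3 → ℂ} {p : ℝ≥0∞} (hk : MemLp k p (volume.restrict (diffBall D)))
    {x : E3} (hx : x ∈ D) : MemLp (fun y => k (x - y)) p (volume.restrict D) :=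
  (hk.mono_measure (map_sub_left_le hx)).comp_of_map (by fun_prop)

lemma eLpNorm_sub_left_le {k : E3 → ℂ} {p : ℝ≥0∞}
    (hk : AEStronglyMeasurable k (volume.restrict (diffBall D)))
    {x : E3} (hx : x ∈ D) :
    eLpNorm (fun y => k (x - y)) p (volume.restrict D) ≤
      eLpNorm k p (volume.restrict (diffBall D)) := by
  have := eLpNorm_map_measure (p := p) (f := fun y => x - y) (μ := volume.restrict D) (g := k)
    (hk.mono_measure (map_sub_left_le hx)) (by fun_prop)
  rw [show (fun y => k (x - y)) = k ∘ fun y => x - y from rfl, ← this]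
  exact eLpNorm_mono_measure _ (map_sub_left_le hx)

lemma ae_sub_left {p : E3 → Prop} (h : ∀ᵐ z ∂volume.restrict (diffBall D), p z)
    {x : E3} (hx : x ∈ D) : ∀ᵐ y ∂volume.restrict D, p (x - y) :=
  ae_of_ae_map (by fun_prop) ((Measure.absolutelyContinuous_of_le (map_sub_left_le hx)).ae_le h)

lemma convFun_congr {k k' : E3 → ℂ} (h : k =ᵐ[volume.restrict (diffBall D)] k') (f : E3 → ℂ)
    {x : E3} (hx : x ∈ D) : convFun D k f x = convFun D k' f x := by
  refine integral_congr_ae ?_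
  filter_upwards [ae_sub_left h hx] with y hy
  rw [hy]

lemma integrable_conv {k : E3 → ℂ} (hk : MemLp k 2 (volume.restrict (diffBall D))) (f : L2 D)
    {x : E3} (hx : x ∈ D) : Integrable (fun y => k (x - y) * f y) (volume.restrict D) :=
  (memLp_sub_left hk hx).integrable_mul (Lp.memLp f)

lemma norm_integral_mul_le {α : Type*} [MeasurableSpace α] {μ : Measure α} {g : α → ℂ}
    (hg : MemLp g 2 μ) (f : Lp ℂ 2 μ) :
    ‖∫ y, g y * f y ∂μ‖ ≤ (eLpNorm g 2 μ).toReal * ‖f‖ := by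
  have h := norm_inner_le_norm (𝕜 := ℂ) (hg.star.toLp (star g)) f
  rw [L2.inner_def, Lp.norm_toLp, eLpNorm_star] at h
  refine le_of_eq_of_le ?_ h
  congr 1
  refine integral_congr_ae ?_
  filter_upwards [hg.star.coeFn_toLp] with y hy
  rw [hy]
  simp [mul_comm]

lemma norm_convFun_le {k : E3 → ℂ} (hk : MemLp k 2 (volume.restrict (diffBall D))) (f : L2 D)
    {x : E3} (hx : x ∈ D) :
    ‖convFun D k f x‖ ≤ (eLpNorm k 2 (volume.restrict (diffBall D))).toReal * ‖f‖ := by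
  refine (norm_integral_mul_le (memLp_sub_left hk hx) f).trans ?_
  gcongr
  · exact hk.2.ne
  · exact eLpNorm_sub_left_le hk.1 hx

lemma memLp_convFun (k : Ker D) (f : L2 D) : MemLp (convFun D k f) ∞ (volume.restrict D) := by
  refine memLp_top_of_bound ?_ (‖k‖ * ‖f‖) ?_
  · apply AEStronglyMeasurable.integral_prod_right' (μ := volume.restrict D)
      (ν := volume.restrict D) (f := fun p : E3 × E3 => k (p.1 - p.2) * f p.2)
    refine AEStronglyMeasurable.mul ?_ (Lp.aestronglyMeasurable f).comp_snd
    exact ((Lp.stronglyMeasurable k).comp_measurable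
      (measurable_fst.sub measurable_snd)).aestronglyMeasurable
  · filter_upwards [ae_restrict_mem hD.out.measurableSet] with x hx
    exact norm_convFun_le (Lp.memLp k) f hx

lemma Linf_norm_le {u : Linf D} {C : ℝ} (hC : 0 ≤ C)
    (h : ∀ᵐ x ∂volume.restrict D, ‖u x‖ ≤ C) : ‖u‖ ≤ C := by
  have := Lp.norm_le_of_ae_bound hC h
  simpa using this

lemma ae_norm_le_Linf (u : Linf D) : ∀ᵐ x ∂volume.restrict D, ‖u x‖ ≤ ‖u‖ := by
  have h := ae_le_eLpNormEssSup (f := (u : E3 → ℂ)) (μ := volume.restrict D)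
  filter_upwards [h] with x hx
  rw [Lp.norm_def, eLpNorm_exponent_top, ← toReal_enorm]
  refine ENNReal.toReal_mono ?_ hx
  rw [← eLpNorm_exponent_top]
  exact (Lp.memLp u).2.ne

/-- Convolution with a square integrable kernel maps `L²(D)` to bounded functions. -/
def conv : Ker D →L[ℂ] L2 D →L[ℂ] Linf D :=
  LinearMap.mkContinuous₂
    (LinearMap.mk₂ ℂ (fun k f => (memLp_convFun k f).toLp (convFun D k f))
      (by
        intro k k' f
        rw [← MemLp.toLp_add]
        refine MemLp.toLp_congr _ _ ?_
        filter_upwards [ae_restrict_mem hD.out.measurableSet] with x hx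
        rw [Pi.add_apply, convFun, convFun, convFun,
          ← integral_add (integrable_conv (Lp.memLp k) f hx) (integrable_conv (Lp.memLp k') f hx)]
        refine integral_congr_ae ?_
        filter_upwards [ae_sub_left (Lp.coeFn_add k k') hx] with y hy
        rw [hy, Pi.add_apply, add_mul])
      (by
        intro c k f
        rw [← MemLp.toLp_const_smul]
        refine MemLp.toLp_congr _ _ ?_
        filter_upwards [ae_restrict_mem hD.out.measurableSet] with x hx
        rw [Pi.smul_apply, convFun, convFun, smul_eq_mul, ← integral_const_mul]
        refine integral_congr_ae ?_
        filter_upwards [ae_sub_left (Lp.coeFn_smul c k) hx] with y hy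
        rw [hy, Pi.smul_apply, smul_eq_mul, mul_assoc])
      (by
        intro k f g
        rw [← MemLp.toLp_add]
        refine MemLp.toLp_congr _ _ ?_
        filter_upwards [ae_restrict_mem hD.out.measurableSet] with x hx
        rw [Pi.add_apply, convFun, convFun, convFun,
          ← integral_add (integrable_conv (Lp.memLp k) f hx) (integrable_conv (Lp.memLp k) g hx)]
        refine integral_congr_ae ?_
        filter_upwards [Lp.coeFn_add f g] with y hy
        rw [hy, Pi.add_apply, mul_add])
      (by
        intro c k f
        rw [← MemLp.toLp_const_smul]
        refine MemLp.toLp_congr _ _ ?_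
        filter_upwards [ae_restrict_mem hD.out.measurableSet] with x hx
        rw [Pi.smul_apply, convFun, convFun, smul_eq_mul, ← integral_const_mul]
        refine integral_congr_ae ?_
        filter_upwards [Lp.coeFn_smul c f] with y hy
        rw [hy, Pi.smul_apply, smul_eq_mul, mul_left_comm]))
    1 (by
      intro k f
      rw [one_mul]
      refine Linf_norm_le (by positivity) ?_
      filter_upwards [ae_restrict_mem hD.out.measurableSet,
        (memLp_convFun k f).coeFn_toLp] with x hx hx'
      rw [LinearMap.mk₂_apply, hx']
      exact norm_convFun_le (Lp.memLp k) f hx)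

lemma conv_ae (k : Ker D) (f : L2 D) : conv k f =ᵐ[volume.restrict D] convFun D k f :=
  (memLp_convFun k f).coeFn_toLp

lemma conv_toLp_ae {k : E3 → ℂ} (hk : MemLp k 2 (volume.restrict (diffBall D))) (f : L2 D) :
    conv (hk.toLp k) f =ᵐ[volume.restrict D] convFun D k f := by
  filter_upwards [conv_ae (hk.toLp k) f, ae_restrict_mem hD.out.measurableSet] with x hx hx'
  rw [hx, convFun_congr hk.coeFn_toLp f hx']

lemma norm_conv_apply_le (k : Ker D) (f : L2 D) : ‖conv k f‖ ≤ ‖k‖ * ‖f‖ := by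
  refine Linf_norm_le (by positivity) ?_
  filter_upwards [conv_ae k f, ae_restrict_mem hD.out.measurableSet] with x hx hx'
  rw [hx]
  exact norm_convFun_le (Lp.memLp k) f hx'

/-! ### Bounded functions as square integrable functions -/

variable (D) in
/-- The inclusion of the bounded functions into `L²(D)`. -/
def inclL2 : Linf D →L[ℂ] L2 D :=
  LinearMap.mkContinuous
    { toFun := fun u => ((Lp.memLp u).mono_exponent le_top).toLp u
      map_add' := by
        intro u v
        rw [← MemLp.toLp_add]
        exact MemLp.toLp_congr _ _ (Lp.coeFn_add u v)
      map_smul' := by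
        intro c u
        rw [RingHom.id_apply, ← MemLp.toLp_const_smul]
        exact MemLp.toLp_congr _ _ (Lp.coeFn_smul c u) }
    ((measureUnivNNReal (volume.restrict D) : ℝ) ^ ((2 : ℝ≥0∞).toReal⁻¹)) (by
      intro u
      refine Lp.norm_le_of_ae_bound (norm_nonneg _) ?_
      filter_upwards [((Lp.memLp u).mono_exponent le_top).coeFn_toLp, ae_norm_le_Linf u]
        with x hx hx'
      rw [LinearMap.coe_mk, AddHom.coe_mk, hx]
      exact hx')

lemma inclL2_ae (u : Linf D) : inclL2 D u =ᵐ[volume.restrict D] u :=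
  ((Lp.memLp u).mono_exponent le_top).coeFn_toLp

lemma inclL2_injective : Function.Injective (inclL2 D) := by
  intro u v h
  refine Lp.ext ?_
  filter_upwards [inclL2_ae u, inclL2_ae v] with x hu hv
  rw [← hu, ← hv, h]

/-! ### Compactness -/

/-- Replacing `x` in `k (x - y)` by the nearest point of a finite net of `D` produces a sum of
rank-one operators, and uniform continuity makes the error in the kernel uniformly small. -/
lemma exists_finite_rank_approximation {k : E3 → ℂ} (hu : UniformContinuous k)
    (hk : MemLp k 2 (volume.restrict (diffBall D))) (hne : D.Nonempty) {ε : ℝ} (hε : 0 < ε) :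
    ∃ A : L2 D →L[ℂ] L2 D, IsCompactOperator A ∧
      ‖A - inclL2 D ∘L conv (hk.toLp k)‖ ≤ ε := by
  obtain ⟨x₀, hx₀⟩ := hne
  set n : ℝ := (measureUnivNNReal (volume.restrict D) : ℝ) ^ ((2 : ℝ≥0∞).toReal⁻¹) with hn
  have hn0 : 0 ≤ n := by positivity
  -- `n` is the square root of the volume of `D`. It enters once from the `L²` norm of the kernel
  -- difference and once from passing from a pointwise bound to an `L²` bound.
  set ε' := ε / (n * n + 1) with hε'
  have hε'0 : 0 < ε' := by positivity
  obtain ⟨δ, hδ, hkδ⟩ := Metric.uniformContinuous_iff.1 hu ε' hε'0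
  have htb : TotallyBounded D := by
    have := (Metric.isCompact_of_isClosed_isBounded isClosed_closure hb.out.closure)
    exact this.totallyBounded.subset subset_closure
  obtain ⟨t, htD, ht, hcov⟩ := totallyBounded_iff_subset.1 htb _ (Metric.dist_mem_uniformity hδ)
  set l := ht.toFinset.toList with hl
  -- The list is padded by a point of `D`, because `nearestPtInd e N` ranges over the `N + 1`
  -- indices `0, …, N`.
  set e : ℕ → E3 := fun i => l.getD i x₀ with he
  have heD : ∀ i, e i ∈ D := by
    intro i
    rcases lt_or_ge i l.length with h | h
    · have h1 : l.getD i x₀ = l[i] := List.getD_eq_getElem _ _ h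
      have : l[i] ∈ l := List.getElem_mem h
      rw [he]
      beta_reduce
      rw [h1]
      exact htD (ht.mem_toFinset.1 (Finset.mem_toList.1 this))
    · rw [he]
      beta_reduce
      rw [List.getD_eq_default _ _ h]
      exact hx₀
  set N := l.length with hN
  set I := SimpleFunc.nearestPtInd e N with hI
  have hnear : ∀ x ∈ D, dist (e (I x)) x < δ := by
    intro x hx
    obtain ⟨y, hy, hxy⟩ := mem_iUnion₂.1 (hcov hx)
    have hyl : y ∈ l := Finset.mem_toList.2 (ht.mem_toFinset.2 hy)
    obtain ⟨i, hi, rfl⟩ := List.getElem_of_mem hyl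
    have h1 := SimpleFunc.edist_nearestPt_le e x (k := i) (N := N) hi.le
    have h2 : e i = l[i] := List.getD_eq_getElem _ _ hi
    have h3 : edist (e i) x < ENNReal.ofReal δ := by
      rw [h2, edist_dist, ENNReal.ofReal_lt_ofReal_iff hδ, dist_comm]
      exact hxy
    have h4 := h1.trans_lt h3
    rw [edist_dist, ENNReal.ofReal_lt_ofReal_iff hδ] at h4
    exact h4
  have hms : ∀ i, MeasurableSet {x | I x = i} := fun i => I.measurableSet_fiber i
  set ind : ℕ → L2 D := fun i => indicatorConstLp 2 (hms i) (measure_ne_top _ _) (1 : ℂ) with hind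
  set ℓ : ℕ → (L2 D →L[ℂ] ℂ) := fun i =>
    innerSL ℂ ((memLp_sub_left hk (heD i)).star.toLp (star fun y => k (e i - y))) with hℓ
  have hℓa : ∀ i (f : L2 D), ℓ i f = convFun D k f (e i) := by
    intro i f
    rw [hℓ]
    beta_reduce
    rw [innerSL_apply_apply, L2.inner_def]
    refine integral_congr_ae ?_
    filter_upwards [(memLp_sub_left hk (heD i)).star.coeFn_toLp] with y hy
    rw [hy]
    simp [mul_comm]
  refine ⟨∑ i ∈ Finset.range (N + 1), (ℓ i).smulRight (ind i), ?_, ?_⟩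
  · refine Finset.sum_induction _ (fun A : L2 D →L[ℂ] L2 D => IsCompactOperator A)
      (fun _ _ h1 h2 => h1.add h2) isCompactOperator_zero fun i _ => ?_
    have h1 : IsCompactOperator (ContinuousLinearMap.toSpanSingleton ℂ (ind i)) :=
      isCompactOperator_of_locallyCompactSpace_rng _
    exact h1.comp_clm (ℓ i)
  · refine ContinuousLinearMap.opNorm_le_bound _ hε.le fun f => ?_
    have hpt : ∀ᵐ x ∂volume.restrict D,
        ‖((∑ i ∈ Finset.range (N + 1), (ℓ i).smulRight (ind i) - inclL2 D ∘L conv (hk.toLp k)) f :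
          L2 D) x‖ ≤ (n * ε') * ‖f‖ := by
      rw [sub_apply, sum_apply]
      filter_upwards [Lp.coeFn_sub (∑ i ∈ Finset.range (N + 1), (ℓ i).smulRight (ind i) f)
        ((inclL2 D ∘L conv (hk.toLp k)) f), Lp.coeFn_fun_finsetSum (Finset.range (N + 1))
        (fun i => (ℓ i).smulRight (ind i) f),
        (ae_all_iff.2 fun i => Lp.coeFn_smul (ℓ i f) (ind i)),
        (ae_all_iff.2 fun i => indicatorConstLp_coeFn (p := 2) (hs := hms i)
          (hμs := measure_ne_top (volume.restrict D) _) (c := (1 : ℂ))),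
        inclL2_ae (conv (hk.toLp k) f), conv_toLp_ae hk f, ae_restrict_mem hD.out.measurableSet]
        with x h1 h2 h3 h4 h5 h6 hx
      rw [h1, Pi.sub_apply, h2, ContinuousLinearMap.comp_apply, h5, h6]
      have hsum : ∑ i ∈ Finset.range (N + 1), ((ℓ i).smulRight (ind i) f : L2 D) x =
          convFun D k f (e (I x)) := by
        rw [Finset.sum_eq_single (I x)]
        · rw [ContinuousLinearMap.smulRight_apply, h3, Pi.smul_apply, h4, hℓa]
          simp
        · intro i _ hi
          rw [ContinuousLinearMap.smulRight_apply, h3, Pi.smul_apply, h4,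
            indicator_of_notMem (by simpa using hi.symm), smul_zero]
        · intro h
          exact absurd (Finset.mem_range.2 (Nat.lt_succ_of_le (SimpleFunc.nearestPtInd_le e N x))) h
      rw [hsum, convFun, convFun, ← integral_sub (integrable_conv hk f (heD _))
        (integrable_conv hk f hx)]
      simp only [← sub_mul]
      refine (norm_integral_mul_le
        ((memLp_sub_left hk (heD (I x))).sub (memLp_sub_left hk hx)) f).trans ?_
      gcongr
      have := eLpNorm_le_of_ae_bound (p := 2) (μ := volume.restrict D) (C := ε')
        (f := (fun y => k (e (I x) - y)) - fun y => k (x - y)) (Eventually.of_forall fun y => by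
          rw [Pi.sub_apply, ← dist_eq_norm]
          refine (hkδ ?_).le
          rw [dist_sub_right]
          exact hnear x hx)
      refine (ENNReal.toReal_mono (by finiteness) this).trans (le_of_eq ?_)
      rw [ENNReal.toReal_mul, ENNReal.toReal_ofReal hε'0.le, ← ENNReal.toReal_rpow, hn]
      rfl
    refine (Lp.norm_le_of_ae_bound (by positivity) hpt).trans ?_
    rw [← hn, ← mul_assoc, ← mul_assoc]
    gcongr
    rw [hε', mul_div_assoc', div_le_iff₀ (by positivity)]
    nlinarith

/-- Convolution operators with square integrable kernels are compact on `L²(D)`. -/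
lemma isCompactOperator_conv (k : Ker D) (hne : D.Nonempty) :
    IsCompactOperator (inclL2 D ∘L conv k) := by
  have hcl := isClosed_setOfPred_isCompactOperator (σ₁₂ := RingHom.id ℂ) (M₁ := L2 D) (M₂ := L2 D)
  have hcont : Continuous fun k : Ker D => inclL2 D ∘L conv k :=
    (ContinuousLinearMap.compL ℂ (L2 D) (Linf D) (L2 D) (inclL2 D)).continuous.comp
      conv.continuous
  refine (hcl.preimage hcont).closure_subset_iff.2 subset_rfl
    (Metric.mem_closure_iff.2 fun ε hε => ?_)
  obtain ⟨g, hgc, hgε, hg, hgm⟩ := (Lp.memLp k).exists_hasCompactSupport_eLpNorm_sub_le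
    (by norm_num) (ε := ENNReal.ofReal (ε / 2)) (by simpa using hε)
  refine ⟨hgm.toLp g, ?_, ?_⟩
  · refine hcl.closure_subset_iff.2 subset_rfl (Metric.mem_closure_iff.2 fun ε hε => ?_)
    obtain ⟨A, hA, hAε⟩ := exists_finite_rank_approximation
      (hgc.uniformContinuous_of_continuous hg) hgm hne (ε := ε / 2) (by positivity)
    exact ⟨A, hA, by rw [dist_comm, dist_eq_norm]; linarith⟩
  · have h1 : k = (Lp.memLp k).toLp k := (Lp.toLp_coeFn k (Lp.memLp k)).symm
    rw [dist_eq_norm]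
    conv_lhs => rw [h1]
    rw [← MemLp.toLp_sub, Lp.norm_toLp]
    refine (ENNReal.toReal_mono ENNReal.ofReal_ne_top hgε).trans_lt ?_
    rw [ENNReal.toReal_ofReal (by positivity)]
    linarith

end


/-! ### Radial functions -/

/-- The `i`-th coordinate vector. -/
abbrev e3 (i : Fin 3) : E3 := EuclideanSpace.single i 1

lemma inner_e3 (x : E3) (i : Fin 3) : inner ℝ x (e3 i) = x i := by
  simp [e3, EuclideanSpace.inner_single_right]

lemma hasFDerivAt_normSq_add (η : ℝ) (x : E3) :
    HasFDerivAt (fun x : E3 => ‖x‖ ^ 2 + η) ((2 : ℝ) • innerSL ℝ x) x := by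
  have := (hasStrictFDerivAt_norm_sq x).hasFDerivAt.add_const η
  simpa [two_smul] using this

lemma hasFDerivAt_coord (i : Fin 3) (x : E3) :
    HasFDerivAt (fun x : E3 => x i) (EuclideanSpace.proj (𝕜 := ℝ) i) x :=
  (EuclideanSpace.proj (𝕜 := ℝ) i : E3 →L[ℝ] ℝ).hasFDerivAt

lemma normSq_add_pos {η : ℝ} (hη : 0 < η) (x : E3) : 0 < ‖x‖ ^ 2 + η := by positivity

section radial

variable {Φ Φ' : ℝ → ℝ} {η : ℝ}

lemma hasFDerivAt_radial (h1 : ∀ q > 0, HasDerivAt Φ (Φ' q) q) (hη : 0 < η)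
    (x : E3) : HasFDerivAt (fun x : E3 => Φ (‖x‖ ^ 2 + η))
    (Φ' (‖x‖ ^ 2 + η) • (2 : ℝ) • innerSL ℝ x) x :=
  (h1 _ (normSq_add_pos hη x)).comp_hasFDerivAt x (hasFDerivAt_normSq_add η x)

lemma fderiv_radial (h1 : ∀ q > 0, HasDerivAt Φ (Φ' q) q) (hη : 0 < η)
    (x : E3) (i : Fin 3) :
    fderiv ℝ (fun x : E3 => Φ (‖x‖ ^ 2 + η)) x (e3 i) = 2 * x i * Φ' (‖x‖ ^ 2 + η) := by
  rw [(hasFDerivAt_radial h1 hη x).fderiv]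
  simp only [smul_apply, innerSL_apply_apply, inner_e3, smul_eq_mul]
  ring

lemma hasFDerivAt_coord_radial (h1 : ∀ q > 0, HasDerivAt Φ (Φ' q) q) (hη : 0 < η)
    (x : E3) (i : Fin 3) :
    HasFDerivAt (fun x : E3 => 2 * x i * Φ (‖x‖ ^ 2 + η))
      ((2 * x i) • (Φ' (‖x‖ ^ 2 + η) • (2 : ℝ) • innerSL ℝ x) +
        Φ (‖x‖ ^ 2 + η) • ((2 : ℝ) • (EuclideanSpace.proj (𝕜 := ℝ) i : E3 →L[ℝ] ℝ))) x :=
  ((hasFDerivAt_coord i x).const_mul 2).mul (hasFDerivAt_radial h1 hη x)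

lemma fderiv_coord_radial (h1 : ∀ q > 0, HasDerivAt Φ (Φ' q) q) (hη : 0 < η)
    (x : E3) (i j : Fin 3) :
    fderiv ℝ (fun x : E3 => 2 * x i * Φ (‖x‖ ^ 2 + η)) x (e3 j) =
      2 * (if i = j then 1 else 0) * Φ (‖x‖ ^ 2 + η) + 4 * x i * x j * Φ' (‖x‖ ^ 2 + η) := by
  rw [(hasFDerivAt_coord_radial h1 hη x i).fderiv]
  have hp : (EuclideanSpace.proj (𝕜 := ℝ) i : E3 →L[ℝ] ℝ) (e3 j) = if i = j then 1 else 0 := by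
    change (e3 j : E3) i = _
    rw [PiLp.single_apply]
  simp only [smul_apply, innerSL_apply_apply, inner_e3, smul_eq_mul, add_apply, hp]
  ring

end radial

/-! ### Weak derivatives of kernels -/

/-- `k'` is the weak `i`-th partial derivative of `k` on the whole space. -/
def IsWeakKer (i : Fin 3) (k k' : E3 → ℝ) : Prop :=
  ∀ ψ : E3 → ℝ, ContDiff ℝ (⊤ : ℕ∞) ψ → HasCompactSupport ψ →
    ∫ x, fderiv ℝ ψ x (e3 i) * k x = - ∫ x, ψ x * k' x

lemma isWeakKer_of_differentiable {i : Fin 3} {k k' : E3 → ℝ} (hk : Differentiable ℝ k)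
    (hd : ∀ x, fderiv ℝ k x (e3 i) = k' x) (hc : Continuous k') : IsWeakKer i k k' := by
  intro ψ h1 h2
  have hψd : Differentiable ℝ ψ := h1.differentiable (by simp)
  have := integral_mul_fderiv_eq_neg_fderiv_mul_of_integrable (μ := (volume : Measure E3))
    (f := k) (g := ψ) (v := e3 i) ?_ ?_ ?_ (fun x _ => hk x) (fun x _ => hψd x)
  · simp only [hd] at this
    simp only [mul_comm _ (k _), mul_comm _ (k' _)]
    exact this
  · simp only [hd]
    exact (hc.mul h1.continuous).integrable_of_hasCompactSupport h2.mul_left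
  · exact (hk.continuous.mul (continuous_partial h1 _)).integrable_of_hasCompactSupport
      (hasCompactSupport_partial h2 _).mul_left
  · exact (hk.continuous.mul h1.continuous).integrable_of_hasCompactSupport h2.mul_left

/-- Weak derivatives pass to locally dominated limits. -/
lemma IsWeakKer.of_tendsto {i : Fin 3} {k k' : E3 → ℝ} {F F' : ℕ → E3 → ℝ}
    (h : ∀ n, IsWeakKer i (F n) (F' n)) (hF : ∀ n, Continuous (F n)) (hF' : ∀ n, Continuous (F' n))
    (b : ℝ → ℝ) (hb : ∀ R n x, x ≠ 0 → ‖x‖ ≤ R → ‖F n x‖ ≤ b R * ‖x‖⁻¹ ∧ ‖F' n x‖ ≤ b R * ‖x‖⁻¹)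
    (hlim : ∀ x ≠ 0, Tendsto (fun n => F n x) atTop (nhds (k x)) ∧
      Tendsto (fun n => F' n x) atTop (nhds (k' x))) : IsWeakKer i k k' := by
  have hloc : ∀ R : ℝ, IntegrableOn (fun x : E3 => ‖x‖⁻¹) (Metric.closedBall 0 R) := by
    intro R
    have h1 : MemLp (fun x : E3 => ‖x‖⁻¹) 2 (volume.restrict (Metric.ball 0 (R + 1))) := by
      refine ⟨by fun_prop, ?_⟩
      rw [eLpNorm_lt_top_iff_lintegral_rpow_enorm_lt_top (by norm_num) (by norm_num)]
      convert lintegral_ball_lt_top (R + 1) using 2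
      ext x
      rw [← ofReal_norm, ENNReal.ofReal_rpow_of_nonneg (norm_nonneg _) (by norm_num)]
      simp
    have : IsFiniteMeasure (volume.restrict (Metric.ball (0 : E3) (R + 1))) :=
      ⟨by rw [Measure.restrict_apply_univ]; exact Metric.isBounded_ball.measure_lt_top⟩
    exact IntegrableOn.mono_set (h1.integrable (by norm_num))
      (Metric.closedBall_subset_ball (by linarith))
  have key : ∀ (ψ : E3 → ℝ) (G : ℕ → E3 → ℝ) (g : E3 → ℝ), Continuous ψ → HasCompactSupport ψ →
      (∀ n, Continuous (G n)) → (∀ R n x, x ≠ 0 → ‖x‖ ≤ R → ‖G n x‖ ≤ b R * ‖x‖⁻¹) →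
      (∀ x ≠ 0, Tendsto (fun n => G n x) atTop (nhds (g x))) →
      Tendsto (fun n => ∫ x, ψ x * G n x) atTop (nhds (∫ x, ψ x * g x)) := by
    intro ψ G g h1 h2 hG hbd hl
    obtain ⟨R, hR⟩ := h2.isCompact.isBounded.subset_closedBall 0
    obtain ⟨C, hC⟩ := h1.bounded_above_of_compact_support h2
    have hC0 : 0 ≤ C := (norm_nonneg _).trans (hC 0)
    have h0 : ∀ᵐ x : E3, x ≠ 0 := by simp [ae_iff]
    refine tendsto_integral_of_dominated_convergence
      ((Metric.closedBall (0 : E3) R).indicator fun x => C * (|b R| * ‖x‖⁻¹)) ?_ ?_ ?_ ?_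
    · exact fun n => (h1.mul (hG n)).aestronglyMeasurable
    · rw [integrable_indicator_iff Metric.isClosed_closedBall.measurableSet]
      exact ((hloc R).const_mul _).const_mul _
    · intro n
      filter_upwards [h0] with x hx
      by_cases hxR : x ∈ Metric.closedBall (0 : E3) R
      · rw [indicator_of_mem hxR, norm_mul]
        have h3 := hbd R n x hx (by simpa using hxR)
        gcongr
        · exact hC x
        · exact h3.trans (by gcongr; exact le_abs_self _)
      · rw [indicator_of_notMem hxR, image_eq_zero_of_notMem_tsupport (fun h => hxR (hR h))]
        simp
    · filter_upwards [h0] with x hx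
      exact (hl x hx).const_mul _
  intro ψ h1 h2
  refine tendsto_nhds_unique (key _ F k (continuous_partial h1 (e3 i))
    (hasCompactSupport_partial h2 (e3 i)) hF (fun R n x h h' => (hb R n x h h').1)
    fun x hx => (hlim x hx).1) ?_
  simp only [h _ ψ h1 h2]
  exact (key ψ F' k' h1.continuous h2 hF' (fun R n x h h' => (hb R n x h h').2)
    fun x hx => (hlim x hx).2).neg

/-! ### Powers of the distance -/

lemma abs_coord_le (x : E3) (i : Fin 3) : |x i| ≤ ‖x‖ := by
  simpa using PiLp.norm_apply_le x i

/-- The kernel `|x|^(2α)`, regularized for `η > 0`. -/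
def powKer (α η : ℝ) (x : E3) : ℝ := (‖x‖ ^ 2 + η) ^ α

/-- The gradient of `powKer α η`. -/
def powGrad (α η : ℝ) (i : Fin 3) (x : E3) : ℝ := 2 * x i * (α * (‖x‖ ^ 2 + η) ^ (α - 1))

/-- The second derivatives of `powKer α η`. -/
def powHess (α η : ℝ) (i j : Fin 3) (x : E3) : ℝ :=
  2 * (if i = j then 1 else 0) * (α * (‖x‖ ^ 2 + η) ^ (α - 1)) +
    4 * x i * x j * (α * ((α - 1) * (‖x‖ ^ 2 + η) ^ (α - 1 - 1)))

lemma hasDerivAt_rpow_of_pos (α q : ℝ) (hq : 0 < q) :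
    HasDerivAt (fun q : ℝ => q ^ α) (α * q ^ (α - 1)) q :=
  Real.hasDerivAt_rpow_const (Or.inl hq.ne')

lemma fderiv_powKer {η : ℝ} (hη : 0 < η) (α : ℝ) (i : Fin 3) (x : E3) :
    fderiv ℝ (powKer α η) x (e3 i) = powGrad α η i x :=
  fderiv_radial (hasDerivAt_rpow_of_pos α) hη x i

lemma fderiv_powGrad {η : ℝ} (hη : 0 < η) (α : ℝ) (i j : Fin 3) (x : E3) :
    fderiv ℝ (powGrad α η i) x (e3 j) = powHess α η i j x :=
  fderiv_coord_radial (fun q hq => (hasDerivAt_rpow_of_pos (α - 1) q hq).const_mul α) hη x i j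

lemma differentiable_powKer {η : ℝ} (hη : 0 < η) (α : ℝ) : Differentiable ℝ (powKer α η) :=
  fun x => (hasFDerivAt_radial (hasDerivAt_rpow_of_pos α) hη x).differentiableAt

lemma differentiable_powGrad {η : ℝ} (hη : 0 < η) (α : ℝ) (i : Fin 3) :
    Differentiable ℝ (powGrad α η i) := fun x => (hasFDerivAt_coord_radial
  (fun q hq => (hasDerivAt_rpow_of_pos (α - 1) q hq).const_mul α) hη x i).differentiableAt

lemma continuous_normSq_rpow {η : ℝ} (hη : 0 < η) (α : ℝ) :
    Continuous (fun x : E3 => (‖x‖ ^ 2 + η) ^ α) :=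
  (differentiable_powKer hη α).continuous

lemma continuous_powHess {η : ℝ} (hη : 0 < η) (α : ℝ) (i j : Fin 3) :
    Continuous (powHess α η i j) := by
  have h1 := continuous_normSq_rpow hη (α - 1)
  have h2 := continuous_normSq_rpow hη (α - 1 - 1)
  unfold powHess
  fun_prop

lemma measurable_powKer (α η : ℝ) : Measurable (powKer α η) := by
  unfold powKer
  fun_prop

lemma measurable_powGrad (α η : ℝ) (i : Fin 3) : Measurable (powGrad α η i) := by
  unfold powGrad
  fun_prop

lemma measurable_powHess (α η : ℝ) (i j : Fin 3) : Measurable (powHess α η i j) := by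
  unfold powHess
  fun_prop

/-- With `t = |x|` and `q = |x|² + η` one has `t ≤ q^(1/2)`, so each product is at most a power of
`q` whose exponent lies between `0` and `α + 1`. The lowest exponent is `α - 1/2`, whence the
condition on `α`; the bound does not see `η`. -/
lemma mul_rpow_le {t q B α : ℝ} (hα : 1 / 2 ≤ α) (ht : 0 < t) (h1 : t ^ 2 ≤ q) (h2 : q ≤ B)
    (hB : 1 ≤ B) : q ^ α * t ≤ B ^ (α + 1) ∧ t ^ 2 * q ^ (α - 1) ≤ B ^ (α + 1) ∧
      t * q ^ (α - 1) ≤ B ^ (α + 1) ∧ t ^ 3 * q ^ (α - 1 - 1) ≤ B ^ (α + 1) := by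
  have hq : 0 < q := lt_of_lt_of_le (by positivity) h1
  have ht2 : t ≤ q ^ (1 / 2 : ℝ) := by
    rw [← Real.sqrt_eq_rpow]
    exact Real.le_sqrt_of_sq_le h1
  have ht3 : t ^ 3 ≤ q ^ (3 / 2 : ℝ) := by
    calc t ^ 3 ≤ (q ^ (1 / 2 : ℝ)) ^ 3 := by gcongr
      _ = q ^ (3 / 2 : ℝ) := by
        rw [← Real.rpow_natCast, ← Real.rpow_mul hq.le]; norm_num
  have hmono : ∀ β, 0 ≤ β → β ≤ α + 1 → q ^ β ≤ B ^ (α + 1) := fun β hβ hβ' =>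
    (Real.rpow_le_rpow hq.le h2 hβ).trans (Real.rpow_le_rpow_of_exponent_le hB hβ')
  refine ⟨?_, ?_, ?_, ?_⟩
  · calc q ^ α * t ≤ q ^ α * q ^ (1 / 2 : ℝ) := by gcongr
      _ = q ^ (α + 1 / 2) := (Real.rpow_add hq _ _).symm
      _ ≤ _ := hmono _ (by linarith) (by linarith)
  · calc t ^ 2 * q ^ (α - 1) ≤ q ^ (1 : ℝ) * q ^ (α - 1) := by rw [Real.rpow_one]; gcongr
      _ = q ^ (1 + (α - 1)) := (Real.rpow_add hq _ _).symm
      _ ≤ _ := hmono _ (by linarith) (by linarith)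
  · calc t * q ^ (α - 1) ≤ q ^ (1 / 2 : ℝ) * q ^ (α - 1) := by gcongr
      _ = q ^ (1 / 2 + (α - 1)) := (Real.rpow_add hq _ _).symm
      _ ≤ _ := hmono _ (by linarith) (by linarith)
  · calc t ^ 3 * q ^ (α - 1 - 1) ≤ q ^ (3 / 2 : ℝ) * q ^ (α - 1 - 1) := by gcongr
      _ = q ^ (3 / 2 + (α - 1 - 1)) := (Real.rpow_add hq _ _).symm
      _ ≤ _ := hmono _ (by linarith) (by linarith)

/-- The powers of the distance and their derivatives are dominated by the singularity `|x|⁻¹`,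
uniformly in the regularization. -/
lemma abs_powKer_le {α η B : ℝ} (hα : 1 / 2 ≤ α) (hη : 0 ≤ η) {x : E3} (hx : x ≠ 0)
    (hxB : ‖x‖ ^ 2 + η ≤ B) (hB : 1 ≤ B) (i j : Fin 3) :
    |powKer α η x| ≤ (2 * α + 2) ^ 2 * B ^ (α + 1) * ‖x‖⁻¹ ∧
    |powGrad α η i x| ≤ (2 * α + 2) ^ 2 * B ^ (α + 1) * ‖x‖⁻¹ ∧
    |powHess α η i j x| ≤ (2 * α + 2) ^ 2 * B ^ (α + 1) * ‖x‖⁻¹ := by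
  have ht : 0 < ‖x‖ := norm_pos_iff.2 hx
  obtain ⟨b1, b2, b3, b4⟩ := mul_rpow_le hα ht (le_add_of_nonneg_right hη) hxB hB
  have hq : 0 < ‖x‖ ^ 2 + η := by positivity
  have hi := abs_coord_le x i
  have hj := abs_coord_le x j
  have hα0 : 0 < α := by linarith
  simp only [← div_eq_mul_inv, le_div_iff₀ ht]
  set q := ‖x‖ ^ 2 + η with hqd
  set P := B ^ (α + 1)
  have hP : 0 ≤ P := le_trans (by positivity) b2
  refine ⟨?_, ?_, ?_⟩
  · rw [powKer, ← hqd, abs_of_pos (by positivity)]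
    exact b1.trans (le_mul_of_one_le_left hP (by nlinarith))
  · rw [powGrad, ← hqd, abs_mul, abs_mul, abs_mul, abs_of_pos hα0,
      abs_of_pos (Real.rpow_pos_of_pos hq _), abs_two]
    calc 2 * |x i| * (α * q ^ (α - 1)) * ‖x‖ ≤ 2 * ‖x‖ * (α * q ^ (α - 1)) * ‖x‖ := by gcongr
      _ = 2 * α * (‖x‖ ^ 2 * q ^ (α - 1)) := by ring
      _ ≤ 2 * α * P := by gcongr
      _ ≤ _ := by gcongr; nlinarith
  · have hδ : |(if i = j then 1 else 0 : ℝ)| ≤ 1 := by split_ifs <;> simp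
    have hα1 : |α - 1| ≤ α + 1 := by rw [abs_le]; constructor <;> linarith
    calc |powHess α η i j x| * ‖x‖
        ≤ (2 * 1 * (α * q ^ (α - 1)) +
          4 * ‖x‖ * ‖x‖ * (α * ((α + 1) * q ^ (α - 1 - 1)))) * ‖x‖ := by
          gcongr
          rw [powHess, ← hqd]
          refine (abs_add_le _ _).trans ?_
          simp only [abs_mul, abs_of_pos hα0, abs_of_pos (Real.rpow_pos_of_pos hq _), abs_two,
            abs_of_pos (show (0 : ℝ) < 4 by norm_num)]
          gcongr
      _ = 2 * α * (‖x‖ * q ^ (α - 1)) + 4 * α * (α + 1) * (‖x‖ ^ 3 * q ^ (α - 1 - 1)) := by ring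
      _ ≤ 2 * α * P + 4 * α * (α + 1) * P := by gcongr
      _ = (2 * α + 4 * α * (α + 1)) * P := by ring
      _ ≤ _ := by gcongr; nlinarith

lemma tendsto_normSq_add_rpow {x : E3} (hx : x ≠ 0) (α : ℝ) :
    Tendsto (fun n : ℕ => (‖x‖ ^ 2 + 1 / ((n : ℝ) + 1)) ^ α) atTop
      (nhds ((‖x‖ ^ 2 + 0) ^ α)) := by
  refine Tendsto.rpow_const (tendsto_one_div_add_atTop_nhds_zero_nat.const_add _) (Or.inl ?_)
  have := norm_pos_iff.2 hx
  positivity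

/-- The regularized kernels are differentiable with continuous gradients and, like those gradients,
dominated by a fixed multiple of `|x|⁻¹` on bounded sets; the identity passes to the limit `η → 0`.
-/
lemma isWeakKer_powKer {α : ℝ} (hα : 1 / 2 ≤ α) (i : Fin 3) :
    IsWeakKer i (powKer α 0) (powGrad α 0 i) := by
  have hη : ∀ n : ℕ, 0 < 1 / ((n : ℝ) + 1) := fun n => Nat.one_div_pos_of_nat
  have hη1 : ∀ n : ℕ, 1 / ((n : ℝ) + 1) ≤ 1 := fun n => by
    rw [div_le_one (by positivity)]; linarith [n.cast_nonneg (α := ℝ)]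
  refine IsWeakKer.of_tendsto (F := fun n => powKer α (1 / ((n : ℝ) + 1)))
    (F' := fun n => powGrad α (1 / ((n : ℝ) + 1)) i)
    (fun n => isWeakKer_of_differentiable (differentiable_powKer (hη n) α)
      (fderiv_powKer (hη n) α i) (differentiable_powGrad (hη n) α i).continuous)
    (fun n => (differentiable_powKer (hη n) α).continuous)
    (fun n => (differentiable_powGrad (hη n) α i).continuous)
    (fun R => (2 * α + 2) ^ 2 * (R ^ 2 + 1) ^ (α + 1)) (fun R n x hx hR => ?_)
    (fun x hx => ⟨tendsto_normSq_add_rpow hx α,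
      ((tendsto_normSq_add_rpow hx (α - 1)).const_mul α).const_mul (2 * x i)⟩)
  have := abs_powKer_le (B := R ^ 2 + 1) hα (hη n).le hx
    (by have := hη1 n; gcongr) (by nlinarith) i i
  exact ⟨this.1, this.2.1⟩

lemma isWeakKer_powGrad {α : ℝ} (hα : 1 / 2 ≤ α) (i j : Fin 3) :
    IsWeakKer j (powGrad α 0 i) (powHess α 0 i j) := by
  have hη : ∀ n : ℕ, 0 < 1 / ((n : ℝ) + 1) := fun n => Nat.one_div_pos_of_nat
  have hη1 : ∀ n : ℕ, 1 / ((n : ℝ) + 1) ≤ 1 := fun n => by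
    rw [div_le_one (by positivity)]; linarith [n.cast_nonneg (α := ℝ)]
  refine IsWeakKer.of_tendsto (F := fun n => powGrad α (1 / ((n : ℝ) + 1)) i)
    (F' := fun n => powHess α (1 / ((n : ℝ) + 1)) i j)
    (fun n => isWeakKer_of_differentiable (differentiable_powGrad (hη n) α i)
      (fderiv_powGrad (hη n) α i j) (continuous_powHess (hη n) α i j))
    (fun n => (differentiable_powGrad (hη n) α i).continuous)
    (fun n => continuous_powHess (hη n) α i j)
    (fun R => (2 * α + 2) ^ 2 * (R ^ 2 + 1) ^ (α + 1)) (fun R n x hx hR => ?_)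
    (fun x hx => ⟨((tendsto_normSq_add_rpow hx (α - 1)).const_mul α).const_mul (2 * x i),
      (((tendsto_normSq_add_rpow hx (α - 1)).const_mul α).const_mul _).add
        ((((tendsto_normSq_add_rpow hx (α - 1 - 1)).const_mul _).const_mul α).const_mul _)⟩)
  have := abs_powKer_le (B := R ^ 2 + 1) hα (hη n).le hx
    (by have := hη1 n; gcongr) (by nlinarith) i j
  exact ⟨this.2.1, this.2.2⟩


/-! ### Fubini's theorem for convolutions -/

section

variable {D : Set E3} [hD : Fact (IsOpen D)] [hb : Fact (Bornology.IsBounded D)]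

lemma integrable_prod_conv {k g : E3 → ℂ} (hkm : StronglyMeasurable k)
    (hk : MemLp k 2 (volume.restrict (diffBall D)))
    (hg : Integrable g (volume.restrict D)) (f : L2 D) :
    Integrable (fun p : E3 × E3 => g p.1 * (k (p.1 - p.2) * f p.2))
      ((volume.restrict D).prod (volume.restrict D)) := by
  have hmeas : AEStronglyMeasurable (fun p : E3 × E3 => g p.1 * (k (p.1 - p.2) * f p.2))
      ((volume.restrict D).prod (volume.restrict D)) :=
    hg.1.comp_fst.mul (((hkm.comp_measurable
      (measurable_fst.sub measurable_snd)).aestronglyMeasurable).mul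
      (Lp.aestronglyMeasurable f).comp_snd)
  have hk' : MemLp (fun x => ((‖k x‖ : ℝ) : ℂ)) 2 (volume.restrict (diffBall D)) :=
    hk.norm.ofReal
  have hf' : MemLp (fun x => ((‖f x‖ : ℝ) : ℂ)) 2 (volume.restrict D) := (Lp.memLp f).norm.ofReal
  rw [integrable_prod_iff hmeas]
  constructor
  · filter_upwards [ae_restrict_mem hD.out.measurableSet] with x hx
    exact (integrable_conv hk f hx).const_mul _
  · refine Integrable.mono' (hg.norm.mul_const
      ((eLpNorm (fun x => ((‖k x‖ : ℝ) : ℂ)) 2 (volume.restrict (diffBall D))).toReal *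
        ‖hf'.toLp _‖)) hmeas.norm.integral_prod_right' ?_
    filter_upwards [ae_restrict_mem hD.out.measurableSet] with x hx
    have h1 := norm_convFun_le hk' (hf'.toLp _) hx
    have h2 : convFun D (fun x => ((‖k x‖ : ℝ) : ℂ)) (hf'.toLp _) x
        = ((∫ y in D, ‖k (x - y) * f y‖ : ℝ) : ℂ) := by
      rw [convFun, ← integral_complex_ofReal]
      refine integral_congr_ae ?_
      filter_upwards [hf'.coeFn_toLp] with y hy
      rw [hy]
      simp
    rw [h2, norm_real] at h1
    simp only [norm_mul (g x), integral_const_mul]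
    rw [Real.norm_of_nonneg (by positivity)]
    gcongr
    exact (Real.le_norm_self _).trans h1

lemma integral_mul_convFun {k g : E3 → ℂ} (hkm : StronglyMeasurable k)
    (hk : MemLp k 2 (volume.restrict (diffBall D)))
    (hg : Integrable g (volume.restrict D)) (f : L2 D) :
    ∫ x in D, g x * convFun D k f x = ∫ y in D, (∫ x in D, k (x - y) * g x) * f y := by
  simp only [convFun, ← integral_const_mul, ← integral_mul_const]
  rw [integral_integral_swap (integrable_prod_conv hkm hk hg f)]
  congr 1
  ext y
  congr 1
  ext x
  ring

/-! ### Convolution into `H²(D)` -/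

lemma setIntegral_shift {F : E3 → ℂ} {y : E3} (hy : y ∈ D) (h : ∀ x ∉ D, F x = 0) :
    ∫ x in D, F x = ∫ z in diffBall D, F (z + y) := by
  rw [setIntegral_eq_integral_of_forall_compl_eq_zero h, ← integral_add_right_eq_self F y]
  refine (setIntegral_eq_integral_of_forall_compl_eq_zero fun z hz => h _ fun hzy => hz ?_).symm
  simpa using sub_mem_diffBall hzy hy

/-- By Fubini the derivative falls on the kernel, tested against `z ↦ ψ (z + y)`. For `y ∈ D` this
translate is supported in the ball of differences, so weak derivatives on that ball suffice. -/
lemma IsWeakPartial.conv {k k' : Ker D} {i : Fin 3} (h : IsWeakPartial (diffBall D) i k k')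
    (f : L2 D) : IsWeakPartial D i (inclL2 D (conv k f)) (inclL2 D (conv k' f)) := by
  intro ψ h1 h2 h3
  have hout : ∀ x ∉ D, ψ x = 0 := fun x hx =>
    image_eq_zero_of_notMem_tsupport fun hh => hx (h3 hh)
  have hout' : ∀ x ∉ D, fderiv ℝ ψ x (EuclideanSpace.single i 1) = 0 := fun x hx => by
    rw [image_eq_zero_of_notMem_tsupport (f := fderiv ℝ ψ)
      fun hh => hx (h3 (tsupport_fderiv_subset ℝ hh))]
    rfl
  have key : ∀ (g : E3 → ℝ) (κ : Ker D), Continuous g → HasCompactSupport g →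
      (∀ x ∉ D, g x = 0) →
      ∫ x in D, ((g x : ℝ) : ℂ) * inclL2 D (KerrDimer.conv κ f) x =
        ∫ y in D, (∫ z in diffBall D, ((g (z + y) : ℝ) : ℂ) * κ z) * f y := by
    intro g κ hg hgc hg0
    have hgi : Integrable (fun x => ((g x : ℝ) : ℂ)) (volume.restrict D) :=
      ((hg.integrable_of_hasCompactSupport hgc).ofReal).restrict
    have e1 : ∫ x in D, ((g x : ℝ) : ℂ) * inclL2 D (KerrDimer.conv κ f) x =
        ∫ x in D, ((g x : ℝ) : ℂ) * convFun D κ f x := by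
      refine integral_congr_ae ?_
      filter_upwards [inclL2_ae (KerrDimer.conv κ f), conv_ae κ f] with x hx hx'
      rw [hx, hx']
    rw [e1, integral_mul_convFun (Lp.stronglyMeasurable κ) (Lp.memLp κ) hgi]
    refine integral_congr_ae ?_
    filter_upwards [ae_restrict_mem hD.out.measurableSet] with y hy
    congr 1
    rw [setIntegral_shift hy (fun x hx => by rw [hg0 x hx]; simp)]
    simp only [add_sub_cancel_right, mul_comm]
  rw [key _ _ (continuous_partial h1 _) (hasCompactSupport_partial h2 _) hout',
    key _ _ h1.continuous h2 hout, ← integral_neg]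
  refine integral_congr_ae ?_
  filter_upwards [ae_restrict_mem hD.out.measurableSet] with y hy
  rw [← neg_mul]
  congr 1
  have hts : tsupport (fun z => ψ (z + y)) = (fun z => z + y) ⁻¹' tsupport ψ :=
    tsupport_comp_eq_preimage ψ (Homeomorph.addRight y)
  have := h (fun z => ψ (z + y)) (h1.comp (contDiff_id.add contDiff_const))
    (h2.comp_homeomorph (Homeomorph.addRight y)) ?_
  · simpa only [fderiv_comp_add_right] using this
  · rw [hts]
    intro z hz
    simpa using sub_mem_diffBall (h3 hz) hy

/-- Applying a bounded operator to each component of a jet. -/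
def jetMap {A B : Set E3} (S : L2 A →L[ℂ] L2 B) : Jets A →L[ℂ] Jets B :=
  ((PiLp.continuousLinearEquiv 2 ℂ (fun _ : JetIndex => L2 B)).symm :
      (JetIndex → L2 B) →L[ℂ] Jets B) ∘L
    ContinuousLinearMap.pi fun a => S ∘L PiLp.proj 2 (fun _ : JetIndex => L2 A) a

lemma jetMap_apply {A B : Set E3} (S : L2 A →L[ℂ] L2 B) (p : Jets A) (a : JetIndex) :
    jetMap S p a = S (p a) := rfl

/-- Convolution of a kernel jet with a function. -/
def convJet (p : Jets (diffBall D)) (f : L2 D) : Jets D :=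
  jetMap (inclL2 D ∘L conv.flip f) p

lemma convJet_mem (p : H2 (diffBall D)) (f : L2 D) : convJet p.1 f ∈ H2 D :=
  ⟨fun i => (p.2.1 i).conv f, fun i j => (p.2.2 i j).conv f⟩

lemma norm_convJet_le (p : Jets (diffBall D)) (f : L2 D) :
    ‖convJet p f‖ ≤ ‖inclL2 D‖ * ‖p‖ * ‖f‖ := by
  have h : ∀ a, ‖convJet p f a‖ ≤ ‖inclL2 D‖ * ‖f‖ * ‖p a‖ := fun a => by
    rw [convJet, jetMap_apply]
    calc ‖inclL2 D (conv (p a) f)‖ ≤ ‖inclL2 D‖ * (‖p a‖ * ‖f‖) := by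
          refine (ContinuousLinearMap.le_opNorm _ _).trans ?_
          gcongr
          exact norm_conv_apply_le _ _
      _ = _ := by ring
  rw [PiLp.norm_eq_of_L2, PiLp.norm_eq_of_L2]
  refine Real.sqrt_le_iff.2 ⟨by positivity, ?_⟩
  calc ∑ a, ‖convJet p f a‖ ^ 2 ≤ ∑ a, (‖inclL2 D‖ * ‖f‖ * ‖p a‖) ^ 2 := by
        gcongr with a
        exact h a
    _ = (‖inclL2 D‖ * ‖f‖) ^ 2 * ∑ a, ‖p a‖ ^ 2 := by
        simp only [mul_pow, Finset.mul_sum]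
    _ = (‖inclL2 D‖ * √(∑ a, ‖p a‖ ^ 2) * ‖f‖) ^ 2 := by
        rw [mul_pow, mul_pow, mul_pow, Real.sq_sqrt (by positivity)]
        ring

/-- Convolution with a kernel in `H²` maps `L²(D)` to `H²(D)`. -/
def convH2 : H2 (diffBall D) →L[ℂ] L2 D →L[ℂ] H2 D :=
  LinearMap.mkContinuous₂
    (LinearMap.mk₂ ℂ (fun p f => (⟨convJet p.1 f, convJet_mem p f⟩ : H2 D))
      (by intro p q f; apply Subtype.ext; exact map_add _ _ _)
      (by intro c p f; apply Subtype.ext; exact map_smul _ _ _)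
      (by
        intro p f g
        apply Subtype.ext
        ext1 a
        change inclL2 D (conv (p.1 a) (f + g)) = inclL2 D (conv (p.1 a) f) + inclL2 D (conv (p.1 a) g)
        simp)
      (by
        intro c p f
        apply Subtype.ext
        ext1 a
        change inclL2 D (conv (p.1 a) (c • f)) = c • inclL2 D (conv (p.1 a) f)
        simp))
    ‖inclL2 D‖ (fun p f => norm_convJet_le p.1 f)

lemma toL2_convH2 (p : H2 (diffBall D)) (f : L2 D) :
    toL2 (convH2 p f) = inclL2 D (conv (toL2 p) f) := rfl

end


/-! ### Completeness of `H²(D)` and uniqueness of weak derivatives -/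

lemma continuous_integral_mul {α : Type*} [MeasurableSpace α] {μ : Measure α} {g : α → ℂ}
    (hg : MemLp g 2 μ) : Continuous fun u : Lp ℂ 2 μ => ∫ x, g x * u x ∂μ := by
  have h : (fun u : Lp ℂ 2 μ => ∫ x, g x * u x ∂μ) =
      fun u => inner ℂ (hg.star.toLp (star g)) u := by
    ext u
    rw [L2.inner_def]
    refine integral_congr_ae ?_
    filter_upwards [hg.star.coeFn_toLp] with y hy
    rw [hy]
    simp [mul_comm]
  rw [h]
  fun_prop

lemma memLp_test {D : Set E3} {g : E3 → ℝ} (hg : Continuous g) (hc : HasCompactSupport g)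
    (p : ℝ≥0∞) : MemLp (fun x => ((g x : ℝ) : ℂ)) p (volume.restrict D) :=
  Continuous.memLp_of_hasCompactSupport (Complex.continuous_ofReal.comp hg)
    (hc.comp_left (g := fun t : ℝ => (t : ℂ)) (by simp))

lemma isClosed_isWeakPartial {X : Type*} [TopologicalSpace X] (D : Set E3) (i : Fin 3)
    {u v : X → L2 D} (hu : Continuous u) (hv : Continuous v) :
    IsClosed {x | IsWeakPartial D i (u x) (v x)} := by
  simp only [IsWeakPartial, Set.ofPred_forall]
  refine isClosed_iInter fun ψ => isClosed_iInter fun h1 => isClosed_iInter fun h2 =>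
    isClosed_iInter fun _ => isClosed_eq ?_ ?_
  · exact (continuous_integral_mul (memLp_test (continuous_partial h1 _)
      (hasCompactSupport_partial h2 _) 2)).comp hu
  · exact ((continuous_integral_mul (memLp_test h1.continuous h2 2)).comp hv).neg

lemma isClosed_H2 (D : Set E3) : IsClosed (H2 D : Set (Jets D)) := by
  have hc : ∀ a, Continuous fun p : Jets D => p a := fun a => PiLp.continuous_apply 2 _ a
  have h : (H2 D : Set (Jets D)) = (⋂ i, {p | IsWeakPartial D i p.fn (p.grad i)}) ∩
      ⋂ i, ⋂ j, {p | IsWeakPartial D j (p.grad i) (p.hess i j)} := by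
    ext p
    simp [H2]
  rw [h]
  exact (isClosed_iInter fun i => isClosed_isWeakPartial D i (hc _) (hc _)).inter
    (isClosed_iInter fun i => isClosed_iInter fun j => isClosed_isWeakPartial D j (hc _) (hc _))

instance completeSpace_H2 (D : Set E3) : CompleteSpace (H2 D) :=
  (isClosed_H2 D).completeSpace_coe

lemma ae_eq_of_integral_test {D : Set E3} (hD : IsOpen D) {v v' : L2 D}
    (h : ∀ ψ : E3 → ℝ, ContDiff ℝ (⊤ : ℕ∞) ψ → HasCompactSupport ψ → tsupport ψ ⊆ D →
      ∫ x in D, ((ψ x : ℝ) : ℂ) * v x = ∫ x in D, ((ψ x : ℝ) : ℂ) * v' x) : v = v' := by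
  have hloc : LocallyIntegrableOn (fun x => v x - v' x) D (volume.restrict D) := by
    rw [locallyIntegrableOn_iff hD.isLocallyClosed]
    intro k _ hk
    have : IsFiniteMeasure ((volume.restrict D).restrict k) := ⟨by
      rw [Measure.restrict_apply_univ]
      exact (Measure.restrict_apply_le _ _).trans_lt hk.measure_lt_top⟩
    exact ((((Lp.memLp v).sub (Lp.memLp v')).restrict k).integrable (by norm_num))
  have key := hD.ae_eq_zero_of_integral_contDiff_smul_eq_zero hloc (fun ψ h1 h2 h3 => by
    have e := h ψ h1 h2 h3
    rw [← sub_eq_zero, ← integral_sub (integrable_real_mul ψ h1.continuous h2 v)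
      (integrable_real_mul ψ h1.continuous h2 v')] at e
    rw [← e]
    congr 1
    ext x
    rw [Complex.real_smul, mul_sub])
  refine Lp.ext ?_
  filter_upwards [key, ae_restrict_mem hD.measurableSet] with x hx hx'
  exact sub_eq_zero.1 (hx hx')

lemma IsWeakPartial.unique {D : Set E3} (hD : IsOpen D) {i : Fin 3} {u v v' : L2 D}
    (h : IsWeakPartial D i u v) (h' : IsWeakPartial D i u v') : v = v' :=
  ae_eq_of_integral_test hD fun ψ h1 h2 h3 =>
    neg_injective ((h ψ h1 h2 h3).symm.trans (h' ψ h1 h2 h3))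

lemma toL2_injective {D : Set E3} (hD : IsOpen D) :
    Function.Injective (toL2 : H2 D → L2 D) := by
  intro p q h
  have h0 : p.1.fn = q.1.fn := h
  have h1 : ∀ i, p.1.grad i = q.1.grad i := fun i =>
    (p.2.1 i).unique hD (by rw [h0]; exact q.2.1 i)
  have h2 : ∀ i j, p.1.hess i j = q.1.hess i j := fun i j =>
    (p.2.2 i j).unique hD (by rw [h1]; exact q.2.2 i j)
  apply Subtype.ext
  ext1 a
  rcases a with a | i | ⟨i, j⟩
  · exact h0
  · exact h1 i
  · exact h2 i j

variable (D : Set E3) in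
/-- The inclusion of `H²(D)` into `L²(D)` as a bounded operator. -/
def toL2L : H2 D →L[ℂ] L2 D :=
  PiLp.proj 2 (fun _ : JetIndex => L2 D) (Sum.inl ()) ∘L (H2 D).subtypeL

lemma toL2L_apply {D : Set E3} (u : H2 D) : toL2L D u = toL2 u := rfl

/-! ### Kernels dominated by `|x|⁻¹` -/

section

variable {D : Set E3}

lemma memLp_norm_inv (R : ℝ) :
    MemLp (fun x : E3 => ((‖x‖⁻¹ : ℝ) : ℂ)) 2 (volume.restrict (Metric.ball 0 R)) := by
  refine ⟨by fun_prop, ?_⟩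
  rw [eLpNorm_lt_top_iff_lintegral_rpow_enorm_lt_top (by norm_num) (by norm_num)]
  convert lintegral_ball_lt_top R using 2
  ext x
  rw [← ofReal_norm, ENNReal.ofReal_rpow_of_nonneg (norm_nonneg _) (by norm_num)]
  simp

variable (D) in
/-- The kernel `|x|⁻¹`. -/
def invKer : Ker D := (memLp_norm_inv (Metric.diam D + 1)).toLp _

lemma ae_ne_zero : ∀ᵐ x : E3 ∂volume.restrict (diffBall D), x ≠ 0 :=
  ae_restrict_of_ae (by simp [ae_iff])

lemma memLp_of_norm_le {k : E3 → ℂ} (hm : Measurable k) {c : ℝ}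
    (h : ∀ x ∈ diffBall D, x ≠ 0 → ‖k x‖ ≤ c * ‖x‖⁻¹) :
    MemLp k 2 (volume.restrict (diffBall D)) := by
  refine MemLp.of_le_mul (c := c) (memLp_norm_inv (Metric.diam D + 1))
    hm.aestronglyMeasurable ?_
  filter_upwards [ae_ne_zero, ae_restrict_mem Metric.isOpen_ball.measurableSet] with x hx hx'
  simpa using h x hx' hx

lemma norm_toLp_le {k : E3 → ℂ} {c : ℝ}
    (hk : MemLp k 2 (volume.restrict (diffBall D)))
    (h : ∀ x ∈ diffBall D, x ≠ 0 → ‖k x‖ ≤ c * ‖x‖⁻¹) :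
    ‖hk.toLp k‖ ≤ c * ‖invKer D‖ := by
  refine Lp.norm_le_mul_norm_of_ae_le_mul ?_
  filter_upwards [ae_ne_zero, ae_restrict_mem Metric.isOpen_ball.measurableSet, hk.coeFn_toLp,
    (memLp_norm_inv (Metric.diam D + 1)).coeFn_toLp] with x hx hx' e1 e2
  rw [e1, invKer, e2]
  simpa using h x hx' hx

lemma IsWeakKer.isWeakPartial {i : Fin 3} {k k' : E3 → ℝ} (h : IsWeakKer i k k')
    (hk : MemLp (fun x => ((k x : ℝ) : ℂ)) 2 (volume.restrict D))
    (hk' : MemLp (fun x => ((k' x : ℝ) : ℂ)) 2 (volume.restrict D)) :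
    IsWeakPartial D i (hk.toLp _) (hk'.toLp _) := by
  intro ψ h1 h2 h3
  have key : ∀ (g κ : E3 → ℝ) (hκ : MemLp (fun x => ((κ x : ℝ) : ℂ)) 2 (volume.restrict D)),
      (∀ x ∉ D, g x = 0) →
      ∫ x in D, ((g x : ℝ) : ℂ) * hκ.toLp _ x = ((∫ x, g x * κ x : ℝ) : ℂ) := by
    intro g κ hκ hg
    have e := setIntegral_eq_integral_of_forall_compl_eq_zero (μ := (volume : Measure E3)) (s := D)
      (f := fun x => ((g x * κ x : ℝ) : ℂ)) (fun x hx => by simp [hg x hx])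
    rw [← integral_complex_ofReal, ← e]
    refine integral_congr_ae ?_
    filter_upwards [hκ.coeFn_toLp] with x hx
    rw [hx]
    push_cast
    rfl
  rw [key _ _ _ fun x hx => ?_, key _ _ _ fun x hx => ?_, h ψ h1 h2]
  · push_cast; rfl
  · exact image_eq_zero_of_notMem_tsupport fun hh => hx (h3 hh)
  · rw [image_eq_zero_of_notMem_tsupport (f := fderiv ℝ ψ)
      fun hh => hx (h3 (tsupport_fderiv_subset ℝ hh))]
    rfl

/-! ### The jets of the powers of the distance -/

/-- The function `|x|^n` with its first and second derivatives. -/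
def powJetFun (n : ℕ) : JetIndex → E3 → ℝ :=
  Sum.elim (fun _ => powKer (n / 2) 0)
    (Sum.elim (powGrad (n / 2) 0) fun ij => powHess (n / 2) 0 ij.1 ij.2)

lemma measurable_powJetFun (n : ℕ) (a : JetIndex) : Measurable (powJetFun n a) := by
  rcases a with a | i | ⟨i, j⟩
  · exact measurable_powKer _ _
  · exact measurable_powGrad _ _ _
  · exact measurable_powHess _ _ _ _

lemma powJetFun_inl (n : ℕ) (x : E3) : powJetFun n (Sum.inl ()) x = ‖x‖ ^ n := by
  change (‖x‖ ^ 2 + 0) ^ ((n : ℝ) / 2) = _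
  rw [add_zero, ← Real.rpow_natCast, ← Real.rpow_mul (norm_nonneg _), ← Real.rpow_natCast]
  congr 1
  push_cast
  ring

/-- `n = 0` is separate because `α = n/2 ≥ 1/2` needs `n ≥ 1`. The growth in `n` is quadratic times
geometric, which the factorials in `greenCoeff` outweigh. -/
lemma abs_powJetFun_le {R : ℝ} (hR : 1 ≤ R) (n : ℕ) (a : JetIndex) {x : E3} (hx : x ≠ 0)
    (hxR : ‖x‖ ≤ R) : |powJetFun n a x| ≤ ((n : ℝ) + 2) ^ 2 * R ^ (n + 2) * ‖x‖⁻¹ := by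
  have hp : 0 < ‖x‖ := norm_pos_iff.2 hx
  rcases n.eq_zero_or_pos with rfl | hn
  · have h1 : (1 : ℝ) ≤ ((0 : ℕ) + 2 : ℝ) ^ 2 * R ^ (0 + 2) * ‖x‖⁻¹ := by
      rw [← div_eq_mul_inv, le_div_iff₀ hp]
      simp only [Nat.cast_zero, zero_add]
      nlinarith
    rcases a with a | i | ⟨i, j⟩
    · rw [powJetFun_inl]
      simpa using h1
    · change |2 * x i * (((0 : ℕ) : ℝ) / 2 * _)| ≤ _
      simp only [Nat.cast_zero, zero_div, zero_mul, mul_zero, abs_zero]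
      positivity
    · change |_ * (((0 : ℕ) : ℝ) / 2 * _) + _ * (((0 : ℕ) : ℝ) / 2 * _)| ≤ _
      simp only [Nat.cast_zero, zero_div, zero_mul, mul_zero, abs_zero, add_zero]
      positivity
  · have hα : (1 / 2 : ℝ) ≤ (n : ℝ) / 2 := by
      have : (1 : ℝ) ≤ n := by exact_mod_cast hn
      linarith
    have hB : (R ^ 2) ^ ((n : ℝ) / 2 + 1) = R ^ (n + 2) := by
      rw [← Real.rpow_natCast, ← Real.rpow_natCast, ← Real.rpow_mul (by linarith)]
      congr 1
      push_cast
      ring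
    have h := fun i j => abs_powKer_le (η := 0) (B := R ^ 2) hα le_rfl hx
      (by rw [add_zero]; gcongr) (by nlinarith) i j
    rw [hB] at h
    have e : 2 * ((n : ℝ) / 2) + 2 = n + 2 := by ring
    rw [e] at h
    rcases a with a | i | ⟨i, j⟩
    · exact (h 0 0).1
    · exact (h i 0).2.1
    · exact (h i j).2.2

lemma isWeakKer_powJetFun (n : ℕ) :
    (∀ i, IsWeakKer i (powJetFun n (Sum.inl ())) (powJetFun n (Sum.inr (Sum.inl i)))) ∧
    ∀ i j, IsWeakKer j (powJetFun n (Sum.inr (Sum.inl i))) (powJetFun n (Sum.inr (Sum.inr (i, j))))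
    := by
  rcases n.eq_zero_or_pos with rfl | hn
  · have h1 : powJetFun 0 (Sum.inl ()) = fun _ => 1 := by
      ext x; rw [powJetFun_inl]; simp
    have h2 : ∀ i, powJetFun 0 (Sum.inr (Sum.inl i)) = fun _ => 0 := by
      intro i; ext x
      change 2 * x i * (((0 : ℕ) : ℝ) / 2 * _) = 0
      simp
    have h3 : ∀ i j, powJetFun 0 (Sum.inr (Sum.inr (i, j))) = fun _ => 0 := by
      intro i j; ext x
      change _ * (((0 : ℕ) : ℝ) / 2 * _) + _ * (((0 : ℕ) : ℝ) / 2 * _) = 0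
      simp
    simp only [h1, h2, h3]
    exact ⟨fun i => isWeakKer_of_differentiable (by fun_prop) (by simp) (by fun_prop),
      fun i j => isWeakKer_of_differentiable (by fun_prop) (by simp) (by fun_prop)⟩
  · have hα : (1 / 2 : ℝ) ≤ (n : ℝ) / 2 := by
      have : (1 : ℝ) ≤ n := by exact_mod_cast hn
      linarith
    exact ⟨isWeakKer_powKer hα, isWeakKer_powGrad hα⟩

lemma one_le_radius : 1 ≤ Metric.diam D + 1 := by linarith [Metric.diam_nonneg (s := D)]

lemma norm_powJetFun_le (n : ℕ) (a : JetIndex) : ∀ x ∈ diffBall D, x ≠ 0 →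
    ‖((powJetFun n a x : ℝ) : ℂ)‖ ≤
      ((n : ℝ) + 2) ^ 2 * (Metric.diam D + 1) ^ (n + 2) * ‖x‖⁻¹ := by
  intro x hx hx0
  rw [norm_real]
  exact abs_powJetFun_le one_le_radius n a hx0 (mem_ball_zero_iff.1 hx).le

lemma memLp_powJetFun (n : ℕ) (a : JetIndex) :
    MemLp (fun x => ((powJetFun n a x : ℝ) : ℂ)) 2 (volume.restrict (diffBall D)) :=
  memLp_of_norm_le (measurable_ofReal.comp (measurable_powJetFun n a)) (norm_powJetFun_le n a)

variable (D) in
/-- The kernel `|x|^n` as an element of `H²`. -/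
def powJet (n : ℕ) : H2 (diffBall D) :=
  ⟨WithLp.toLp 2 fun a => (memLp_powJetFun n a).toLp _,
    fun i => ((isWeakKer_powJetFun n).1 i).isWeakPartial (memLp_powJetFun n _) (memLp_powJetFun n _),
    fun i j => ((isWeakKer_powJetFun n).2 i j).isWeakPartial (memLp_powJetFun n _) (memLp_powJetFun n _)⟩

lemma powJet_apply (n : ℕ) (a : JetIndex) :
    (powJet D n).1 a = (memLp_powJetFun (D := D) n a).toLp _ := rfl

lemma toL2_powJet (n : ℕ) :
    toL2 (powJet D n) =ᵐ[volume.restrict (diffBall D)] fun x => ((‖x‖ ^ n : ℝ) : ℂ) := by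
  filter_upwards [(memLp_powJetFun (D := D) n (Sum.inl ())).coeFn_toLp] with x hx
  rw [← powJetFun_inl, toL2, Jets.fn, powJet_apply, hx]

lemma exists_norm_powJet_le : ∃ M : ℝ, 0 ≤ M ∧ ∀ n, ‖powJet D n‖ ≤
    M * (((n : ℝ) + 2) ^ 2 * (Metric.diam D + 1) ^ n) := by
  set R := Metric.diam D + 1 with hR
  have hR1 : 1 ≤ R := one_le_radius
  refine ⟨(Fintype.card JetIndex) * (R ^ 2 * ‖invKer D‖), by positivity, fun n => ?_⟩
  set b := ((n : ℝ) + 2) ^ 2 * R ^ (n + 2) * ‖invKer D‖ with hb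
  have hb0 : 0 ≤ b := by positivity
  have h : ∀ a, ‖(powJet D n).1 a‖ ≤ b := fun a => by
    rw [powJet_apply]
    exact norm_toLp_le (memLp_powJetFun n a) (norm_powJetFun_le n a)
  have hcard : (1 : ℝ) ≤ Fintype.card JetIndex := by
    exact_mod_cast Fintype.card_pos
  calc ‖powJet D n‖ = ‖(powJet D n).1‖ := rfl
    _ ≤ (Fintype.card JetIndex) * b := by
        rw [PiLp.norm_eq_of_L2]
        refine Real.sqrt_le_iff.2 ⟨by positivity, ?_⟩
        calc ∑ a, ‖(powJet D n).1 a‖ ^ 2 ≤ ∑ _a : JetIndex, b ^ 2 :=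
              Finset.sum_le_sum fun a _ => pow_le_pow_left₀ (norm_nonneg _) (h a) 2
          _ = (Fintype.card JetIndex : ℝ) * b ^ 2 := by
              rw [Finset.sum_const, nsmul_eq_mul, Finset.card_univ]
          _ ≤ (Fintype.card JetIndex : ℝ) * (Fintype.card JetIndex : ℝ) * b ^ 2 := by
              gcongr
              exact le_mul_of_one_le_left (by positivity) hcard
          _ = _ := by ring
    _ = _ := by rw [hb, pow_add]; ring

/-! ### Expansion of the Green's function -/

/-- The coefficients of the expansion of `green z - green (2πi)` in powers of the distance. -/
def greenCoeff (n : ℕ) (z : ℂ) : ℂ :=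
  ((I * z) ^ (n + 1) - (-(2 * Real.pi : ℝ) : ℂ) ^ (n + 1)) / (4 * Real.pi * (n + 1).factorial)

lemma norm_greenCoeff_le {n : ℕ} {z : ℂ} {Z : ℝ} (hz : ‖z‖ ≤ Z) (hZ : 2 * Real.pi ≤ Z) :
    ‖greenCoeff n z‖ ≤ Z ^ (n + 1) / (n + 1).factorial := by
  have hpi := Real.pi_gt_three
  have hZ0 : 0 ≤ Z := by linarith
  rw [greenCoeff, norm_div]
  have h1 : ‖(I * z) ^ (n + 1) - (-(2 * Real.pi : ℝ) : ℂ) ^ (n + 1)‖ ≤ 2 * Z ^ (n + 1) := by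
    refine (norm_sub_le _ _).trans ?_
    rw [norm_pow, norm_pow, norm_mul, norm_I, one_mul, norm_neg, norm_real,
      Real.norm_of_nonneg (by positivity), two_mul (Z ^ (n + 1))]
    gcongr
  have h2 : ‖(4 * Real.pi * (n + 1).factorial : ℂ)‖ = 4 * Real.pi * (n + 1).factorial := by
    simp [abs_of_pos Real.pi_pos]
  rw [h2, div_le_div_iff₀ (by positivity) (by positivity)]
  have : 0 ≤ Z ^ (n + 1) * ((n + 1).factorial : ℝ) := by positivity
  calc _ ≤ 2 * Z ^ (n + 1) * ((n + 1).factorial : ℝ) := by gcongr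
    _ ≤ _ := by nlinarith

lemma differentiable_greenCoeff (n : ℕ) : Differentiable ℂ (greenCoeff n) := by
  unfold greenCoeff
  fun_prop

/-- The singular term `1/(4π|x|)` is the zeroth term of both exponential series and cancels in the
difference; only nonnegative powers of `|x|` remain. -/
lemma hasSum_greenCoeff (z : ℂ) {x : E3} (hx : x ≠ 0) :
    HasSum (fun n => greenCoeff n z * ((‖x‖ ^ n : ℝ) : ℂ))
      (green z x - green (2 * Real.pi * I) x) := by
  have hr : (‖x‖ : ℂ) ≠ 0 := by simpa using hx
  have hpi : (Real.pi : ℂ) ≠ 0 := by exact_mod_cast Real.pi_ne_zero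
  have key : ∀ w : ℂ, HasSum (fun n : ℕ => (w * ‖x‖) ^ (n + 1) / (n + 1).factorial)
      (Complex.exp (w * ‖x‖) - 1) := by
    intro w
    have := NormedSpace.exp_series_hasSum_exp' (𝕂 := ℂ) (w * (‖x‖ : ℂ))
    rw [← Complex.exp_eq_exp_ℂ, ← hasSum_nat_add_iff' 1] at this
    simpa [div_eq_inv_mul] using this
  have h := ((key (I * z)).sub (key (-(2 * Real.pi : ℝ)))).div_const (4 * Real.pi * ‖x‖)
  have e1 : ∀ n : ℕ, greenCoeff n z * ((‖x‖ ^ n : ℝ) : ℂ) =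
      ((I * z * ‖x‖) ^ (n + 1) / (n + 1).factorial -
        (-(2 * Real.pi : ℝ) * ‖x‖) ^ (n + 1) / (n + 1).factorial) / (4 * Real.pi * ‖x‖) := by
    intro n
    have hf : ((n + 1).factorial : ℂ) ≠ 0 := by exact_mod_cast Nat.factorial_ne_zero _
    rw [greenCoeff, ofReal_pow, mul_pow (I * z), mul_pow (-(2 * Real.pi : ℝ) : ℂ), ← sub_div, ← sub_mul, pow_succ (‖x‖ : ℂ)]
    field_simp
  have e2 : green z x - green (2 * Real.pi * I) x = (cexp (I * z * ‖x‖) - 1 -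
      (cexp (-(2 * Real.pi : ℝ) * ‖x‖) - 1)) / (4 * Real.pi * ‖x‖) := by
    rw [green, green, ← sub_div, sub_sub_sub_cancel_right]
    congr 3
    push_cast
    linear_combination (2 * Real.pi * ‖x‖ : ℂ) * I_mul_I
  simp only [e1, e2]
  exact h

variable (D) in
/-- The difference `green z - green (2πi)` as a kernel in `H²`. -/
def smoothJet (z : ℂ) : H2 (diffBall D) := ∑' n, greenCoeff n z • powJet D n

lemma exists_summable_bound (Z : ℝ) (hZ : 2 * Real.pi ≤ Z) : ∃ u : ℕ → ℝ, Summable u ∧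
    ∀ n z, ‖z‖ ≤ Z → ‖greenCoeff n z • powJet D n‖ ≤ u n := by
  obtain ⟨M, hM, h⟩ := exists_norm_powJet_le (D := D)
  set R := Metric.diam D + 1 with hR
  have hR1 : 1 ≤ R := one_le_radius
  have hZ0 : 0 < Z := by linarith [Real.pi_pos]
  refine ⟨fun n => 4 * M * Z * ((4 * Z * R) ^ n / n.factorial),
    (Real.summable_pow_div_factorial _).mul_left _, fun n z hz => ?_⟩
  have hn : ((n : ℝ) + 2) ^ 2 ≤ 4 * 4 ^ n := by
    have h1 : ((n : ℝ) + 2) ≤ 2 * 2 ^ n := by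
      have : n + 1 ≤ 2 ^ n := Nat.lt_two_pow_self
      have h2 : ((n : ℝ) + 1) ≤ 2 ^ n := by exact_mod_cast this
      have : (1 : ℝ) ≤ 2 ^ n := one_le_pow₀ (by norm_num)
      linarith
    calc ((n : ℝ) + 2) ^ 2 ≤ (2 * 2 ^ n) ^ 2 := by gcongr
      _ = 4 * 4 ^ n := by rw [mul_pow, ← pow_mul, mul_comm n 2, pow_mul]; norm_num
  have hf : (n.factorial : ℝ) ≤ (n + 1).factorial := by
    exact_mod_cast Nat.factorial_le (Nat.le_succ n)
  rw [norm_smul]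
  calc ‖greenCoeff n z‖ * ‖powJet D n‖
      ≤ (Z ^ (n + 1) / n.factorial) * (M * (4 * 4 ^ n * R ^ n)) := by
        refine mul_le_mul ((norm_greenCoeff_le hz hZ).trans ?_) ((h n).trans ?_)
          (norm_nonneg _) (by positivity)
        · gcongr
        · gcongr
    _ = _ := by
        simp only [mul_pow, pow_succ]
        ring

/-- The series has holomorphic terms and converges uniformly on balls, in the norm of `H²`. -/
lemma differentiable_smoothJet : Differentiable ℂ (smoothJet D) := by
  intro z
  obtain ⟨u, hu, h⟩ := exists_summable_bound (D := D) (‖z‖ + 1 + 2 * Real.pi)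
    (by linarith [norm_nonneg z])
  have := differentiableOn_tsum_of_summable_norm (U := Metric.ball 0 (‖z‖ + 1)) hu
    (F := fun n z => greenCoeff n z • powJet D n)
    (fun n => ((differentiable_greenCoeff n).smul_const _).differentiableOn) Metric.isOpen_ball
    (fun n w hw => h n w (by
      have := mem_ball_zero_iff.1 hw
      linarith [Real.pi_pos]))
  exact (this z (by simp)).differentiableAt (Metric.isOpen_ball.mem_nhds (by simp))

lemma ae_eq_of_tendsto {α : Type*} [MeasurableSpace α] {μ : Measure α} {F : ℕ → Lp ℂ 2 μ}
    {f : Lp ℂ 2 μ} {G : ℕ → α → ℂ} {g : α → ℂ} (h : Tendsto F atTop (nhds f))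
    (hG : ∀ n, F n =ᵐ[μ] G n) (hg : ∀ᵐ x ∂μ, Tendsto (fun n => G n x) atTop (nhds (g x))) :
    f =ᵐ[μ] g := by
  obtain ⟨ns, hns, hlim⟩ := (tendstoInMeasure_of_tendsto_Lp h).exists_seq_tendsto_ae
  filter_upwards [hlim, hg, ae_all_iff.2 hG] with x h1 h2 h3
  simp only [h3] at h1
  exact tendsto_nhds_unique h1 (h2.comp hns.tendsto_atTop)

lemma toL2_smoothJet (z : ℂ) : toL2 (smoothJet D z) =ᵐ[volume.restrict (diffBall D)]
    fun x => green z x - green (2 * Real.pi * I) x := by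
  obtain ⟨u, hu, h⟩ := exists_summable_bound (D := D) (‖z‖ + 2 * Real.pi)
    (by linarith [norm_nonneg z])
  have hs : Summable fun n => greenCoeff n z • powJet D n :=
    Summable.of_norm_bounded hu fun n => h n z (by linarith [Real.pi_pos])
  have ht := (hs.hasSum.mapL (toL2L (diffBall D))).tendsto_sum_nat
  refine ae_eq_of_tendsto ht
    (G := fun n x => ∑ k ∈ Finset.range n, greenCoeff k z * ((‖x‖ ^ k : ℝ) : ℂ)) ?_ ?_
  · intro n
    induction n with
    | zero =>
      filter_upwards [Lp.coeFn_zero ℂ 2 (volume.restrict (diffBall D))] with x hx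
      simpa using hx
    | succ n ih =>
      simp only [Finset.sum_range_succ]
      filter_upwards [ih, toL2_powJet (D := D) n, Lp.coeFn_add (∑ k ∈ Finset.range n,
        toL2L (diffBall D) (greenCoeff k z • powJet D k)) (toL2L (diffBall D)
        (greenCoeff n z • powJet D n)), Lp.coeFn_smul (greenCoeff n z) (toL2 (powJet D n))]
        with x h1 h2 h3 h4
      rw [h3, Pi.add_apply, h1, map_smul, toL2L_apply, h4, Pi.smul_apply, h2, smul_eq_mul]
  · filter_upwards [ae_ne_zero] with x hx
    exact (hasSum_greenCoeff z hx).tendsto_sum_nat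

end


/-! ### The regularized Yukawa potential -/

/-- The Yukawa potential `e^{-κ√q}/(4π√q)`, as a function of the squared distance `q`. -/
def yuk (κ q : ℝ) : ℝ := Real.exp (-κ * √q) / (4 * Real.pi * √q)

/-- The derivative of `yuk κ`. -/
def yuk' (κ q : ℝ) : ℝ := -(Real.exp (-κ * √q) * (κ * √q + 1) / (8 * Real.pi * √q ^ 3))

/-- The second derivative of `yuk κ`. -/
def yuk'' (κ q : ℝ) : ℝ :=
  Real.exp (-κ * √q) * (κ ^ 2 * √q ^ 2 + 3 * κ * √q + 3) / (16 * Real.pi * √q ^ 5)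

lemma hasDerivAt_yuk (κ : ℝ) (q : ℝ) (hq : 0 < q) : HasDerivAt (yuk κ) (yuk' κ q) q := by
  have hs : 0 < √q := Real.sqrt_pos.2 hq
  have h1 := Real.hasDerivAt_sqrt hq.ne'
  have h2 := ((h1.const_mul (-κ)).exp).div (h1.const_mul (4 * Real.pi)) (by positivity)
  refine h2.congr_deriv ?_
  rw [yuk']
  have hpi := Real.pi_pos
  field_simp
  ring

lemma hasDerivAt_yuk' (κ : ℝ) (q : ℝ) (hq : 0 < q) : HasDerivAt (yuk' κ) (yuk'' κ q) q := by
  have hs : 0 < √q := Real.sqrt_pos.2 hq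
  have h1 := Real.hasDerivAt_sqrt hq.ne'
  have h2 := ((((h1.const_mul (-κ)).exp).fun_mul ((h1.const_mul κ).add_const 1)).fun_div
    ((h1.fun_pow 3).const_mul (8 * Real.pi)) (by positivity)).fun_neg
  refine h2.congr_deriv ?_
  rw [yuk'']
  have hpi := Real.pi_pos
  field_simp
  ring

/-- For `q = |x|² + η` the Laplacian of `Φ(q)` is `6Φ' + 4|x|²Φ''`. The identity therefore says that
the regularized potential satisfies `(κ² - Δ)Φ = 4ηΦ''` exactly. -/
lemma yuk_equation (κ : ℝ) {q : ℝ} (hq : 0 < q) :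
    6 * yuk' κ q + 4 * q * yuk'' κ q = κ ^ 2 * yuk κ q := by
  obtain ⟨s, hs, rfl⟩ : ∃ s > 0, q = s ^ 2 := ⟨√q, Real.sqrt_pos.2 hq, (Real.sq_sqrt hq.le).symm⟩
  have hpi := Real.pi_pos
  rw [yuk, yuk', yuk'', Real.sqrt_sq hs.le]
  field_simp
  ring

lemma exp_neg_mul_le {t : ℝ} (ht : 0 ≤ t) :
    Real.exp (-t) * (t + 1) ≤ 1 ∧ Real.exp (-t) * (t ^ 2 + 3 * t + 3) ≤ 8 := by
  have h := Real.quadratic_le_exp_of_nonneg ht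
  have hp := Real.exp_pos t
  rw [Real.exp_neg, inv_mul_le_iff₀ hp, inv_mul_le_iff₀ hp]
  constructor <;> nlinarith [sq_nonneg t]

lemma abs_yuk_le {κ q : ℝ} (hκ : 0 ≤ κ) (hq : 0 < q) : |yuk κ q| ≤ (√q)⁻¹ ∧
    |yuk' κ q| ≤ (√q ^ 3)⁻¹ ∧ |yuk'' κ q| ≤ (√q ^ 5)⁻¹ := by
  have hs : 0 < √q := Real.sqrt_pos.2 hq
  have hpi := Real.pi_gt_three
  obtain ⟨h1, h2⟩ := exp_neg_mul_le (t := κ * √q) (by positivity)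
  have h0 : Real.exp (-(κ * √q)) ≤ 1 := Real.exp_le_one_iff.2 (by
    have : 0 ≤ κ * √q := by positivity
    linarith)
  have e : -κ * √q = -(κ * √q) := by ring
  refine ⟨?_, ?_, ?_⟩
  · rw [yuk, abs_of_nonneg (by positivity), e, ← one_div]
    rw [div_le_div_iff₀ (by positivity) hs]
    have : 0 ≤ (1 - Real.exp (-(κ * √q))) * √q := mul_nonneg (by linarith) hs.le
    nlinarith
  · rw [yuk', abs_neg, abs_of_nonneg (by positivity), e, ← one_div]
    rw [div_le_div_iff₀ (by positivity) (by positivity)]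
    have h3 : 0 < √q ^ 3 := by positivity
    have : 0 ≤ (1 - Real.exp (-(κ * √q)) * (κ * √q + 1)) * √q ^ 3 :=
      mul_nonneg (by linarith) h3.le
    nlinarith
  · rw [yuk'', abs_of_nonneg (by positivity), e, ← one_div]
    rw [div_le_div_iff₀ (by positivity) (by positivity)]
    have h3 : 0 < √q ^ 5 := by positivity
    have h4 : Real.exp (-(κ * √q)) * (κ ^ 2 * √q ^ 2 + 3 * κ * √q + 3) =
      Real.exp (-(κ * √q)) * ((κ * √q) ^ 2 + 3 * (κ * √q) + 3) := by ring
    rw [h4]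
    have : 0 ≤ (8 - Real.exp (-(κ * √q)) * ((κ * √q) ^ 2 + 3 * (κ * √q) + 3)) * √q ^ 5 :=
      mul_nonneg (by linarith) h3.le
    nlinarith

/-! ### Functions with integrable second derivatives -/

/-- Bounded smooth functions with integrable first and second pure partial derivatives. -/
structure IsTame (φ : E3 → ℂ) (φ' φ'' : Fin 3 → E3 → ℂ) : Prop where
  diff : Differentiable ℝ φ
  diff' : ∀ i, Differentiable ℝ (φ' i)
  deriv : ∀ i x, fderiv ℝ φ x (e3 i) = φ' i x
  deriv' : ∀ i x, fderiv ℝ (φ' i) x (e3 i) = φ'' i x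
  int : Integrable φ
  int' : ∀ i, Integrable (φ' i)
  int'' : ∀ i, Integrable (φ'' i)
  bdd : ∃ C, ∀ x, ‖φ x‖ ≤ C
  bdd'' : ∀ i, ∃ C, ∀ x, ‖φ'' i x‖ ≤ C

lemma IsTame.shift {φ : E3 → ℂ} {φ' φ'' : Fin 3 → E3 → ℂ} (h : IsTame φ φ' φ'') (y : E3) :
    IsTame (fun x => φ (x + y)) (fun i x => φ' i (x + y)) (fun i x => φ'' i (x + y)) where
  diff := h.diff.comp (differentiable_id.add_const y)
  diff' i := (h.diff' i).comp (differentiable_id.add_const y)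
  deriv i x := by rw [fderiv_comp_add_right, h.deriv]
  deriv' i x := by rw [fderiv_comp_add_right, h.deriv']
  int := h.int.comp_add_right y
  int' i := (h.int' i).comp_add_right y
  int'' i := (h.int'' i).comp_add_right y
  bdd := h.bdd.imp fun _ hC x => hC _
  bdd'' i := (h.bdd'' i).imp fun _ hC x => hC _

variable {κ η : ℝ}

lemma integrable_bdd_smul {f : E3 → ℝ} {g : E3 → ℂ} {C : ℝ} (hg : Integrable g)
    (hf : Measurable f) (hb : ∀ x, |f x| ≤ C) : Integrable (fun x => f x • g x) := by
  refine Integrable.mono' (hg.norm.const_mul C) (hf.aestronglyMeasurable.smul hg.1)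
    (ae_of_all _ fun x => ?_)
  rw [norm_smul]
  have := hb x
  gcongr
  exact this

lemma measurable_yuk (κ : ℝ) : Measurable (yuk κ) ∧ Measurable (yuk' κ) ∧ Measurable (yuk'' κ) := by
  unfold yuk yuk' yuk''
  exact ⟨by fun_prop, by fun_prop, by fun_prop⟩

lemma sqrt_le_sqrt_normSq_add (η : ℝ) (x : E3) : √η ≤ √(‖x‖ ^ 2 + η) :=
  Real.sqrt_le_sqrt (by nlinarith [sq_nonneg ‖x‖])

lemma abs_coord_le_sqrt (hη : 0 < η) (x : E3) (i : Fin 3) : |x i| ≤ √(‖x‖ ^ 2 + η) :=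
  (abs_coord_le x i).trans (Real.le_sqrt_of_sq_le (by linarith))

lemma abs_yuk_radial_le (hκ : 0 ≤ κ) (hη : 0 < η) (x : E3) :
    |yuk κ (‖x‖ ^ 2 + η)| ≤ (√η)⁻¹ := by
  have hsη : 0 < √η := Real.sqrt_pos.2 hη
  have := sqrt_le_sqrt_normSq_add η x
  exact (abs_yuk_le hκ (normSq_add_pos hη x)).1.trans (by gcongr)

lemma abs_yuk'_radial_le (hκ : 0 ≤ κ) (hη : 0 < η) (x : E3) (i : Fin 3) :
    |2 * x i * yuk' κ (‖x‖ ^ 2 + η)| ≤ 2 * (√η ^ 2)⁻¹ := by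
  have hsη : 0 < √η := Real.sqrt_pos.2 hη
  have hs := sqrt_le_sqrt_normSq_add η x
  have hp : 0 < √(‖x‖ ^ 2 + η) := hsη.trans_le hs
  have hx := abs_coord_le_sqrt hη x i
  rw [abs_mul, abs_mul, abs_two]
  calc 2 * |x i| * |yuk' κ (‖x‖ ^ 2 + η)|
      ≤ 2 * √(‖x‖ ^ 2 + η) * (√(‖x‖ ^ 2 + η) ^ 3)⁻¹ := by
        gcongr
        exact (abs_yuk_le hκ (normSq_add_pos hη x)).2.1
    _ = 2 * (√(‖x‖ ^ 2 + η) ^ 2)⁻¹ := by field_simp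
    _ ≤ _ := by gcongr

lemma abs_yuk''_radial_le (hκ : 0 ≤ κ) (hη : 0 < η) (x : E3) (i : Fin 3) :
    |2 * yuk' κ (‖x‖ ^ 2 + η) + 4 * x i ^ 2 * yuk'' κ (‖x‖ ^ 2 + η)| ≤ 6 * (√η ^ 3)⁻¹ := by
  have hsη : 0 < √η := Real.sqrt_pos.2 hη
  have hs := sqrt_le_sqrt_normSq_add η x
  have hp : 0 < √(‖x‖ ^ 2 + η) := hsη.trans_le hs
  have hx := abs_coord_le_sqrt hη x i
  refine (abs_add_le _ _).trans ?_
  rw [abs_mul, abs_mul, abs_mul, abs_two, abs_pow, abs_of_pos (show (0 : ℝ) < 4 by norm_num)]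
  calc _ ≤ 2 * (√(‖x‖ ^ 2 + η) ^ 3)⁻¹ + 4 * √(‖x‖ ^ 2 + η) ^ 2 * (√(‖x‖ ^ 2 + η) ^ 5)⁻¹ := by
        gcongr
        · exact (abs_yuk_le hκ (normSq_add_pos hη x)).2.1
        · exact (abs_yuk_le hκ (normSq_add_pos hη x)).2.2
    _ = 6 * (√(‖x‖ ^ 2 + η) ^ 3)⁻¹ := by field_simp; ring
    _ ≤ _ := by gcongr

lemma measurable_yuk_radial (κ η : ℝ) (i : Fin 3) :
    Measurable (fun x : E3 => yuk κ (‖x‖ ^ 2 + η)) ∧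
    Measurable (fun x : E3 => 2 * x i * yuk' κ (‖x‖ ^ 2 + η)) ∧
    Measurable (fun x : E3 => 2 * yuk' κ (‖x‖ ^ 2 + η) + 4 * x i ^ 2 * yuk'' κ (‖x‖ ^ 2 + η)) := by
  obtain ⟨m0, m1, m2⟩ := measurable_yuk κ
  have hq : Measurable (fun x : E3 => ‖x‖ ^ 2 + η) := by fun_prop
  have mc : Measurable (fun x : E3 => x i) := by fun_prop
  exact ⟨m0.comp hq, (mc.const_mul 2).mul (m1.comp hq),
    ((m1.comp hq).const_mul 2).add (((mc.pow_const 2).const_mul 4).mul (m2.comp hq))⟩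

lemma integral_yuk_smul {φ : E3 → ℂ} {φ' φ'' : Fin 3 → E3 → ℂ} (h : IsTame φ φ' φ'')
    (hκ : 0 ≤ κ) (hη : 0 < η) (i : Fin 3) :
    ∫ x, yuk κ (‖x‖ ^ 2 + η) • φ'' i x =
      ∫ x, (2 * yuk' κ (‖x‖ ^ 2 + η) + 4 * x i ^ 2 * yuk'' κ (‖x‖ ^ 2 + η)) • φ x := by
  have d1 : ∀ x, fderiv ℝ (fun x : E3 => yuk κ (‖x‖ ^ 2 + η)) x (e3 i) =
      2 * x i * yuk' κ (‖x‖ ^ 2 + η) := fun x => fderiv_radial (hasDerivAt_yuk κ) hη x i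
  have d2 : ∀ x, fderiv ℝ (fun x : E3 => 2 * x i * yuk' κ (‖x‖ ^ 2 + η)) x (e3 i) =
      2 * yuk' κ (‖x‖ ^ 2 + η) + 4 * x i ^ 2 * yuk'' κ (‖x‖ ^ 2 + η) := fun x => by
    rw [fderiv_coord_radial (hasDerivAt_yuk' κ) hη x i i]
    simp only [if_true]
    ring
  have D1 : Differentiable ℝ (fun x : E3 => yuk κ (‖x‖ ^ 2 + η)) := fun x =>
    (hasFDerivAt_radial (hasDerivAt_yuk κ) hη x).differentiableAt
  have D2 : Differentiable ℝ (fun x : E3 => 2 * x i * yuk' κ (‖x‖ ^ 2 + η)) := fun x =>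
    (hasFDerivAt_coord_radial (hasDerivAt_yuk' κ) hη x i).differentiableAt
  obtain ⟨s0, s1, s2⟩ := measurable_yuk_radial κ η i
  have b0 := abs_yuk_radial_le hκ hη
  have b1 := fun x => abs_yuk'_radial_le hκ hη x i
  have b2 := fun x => abs_yuk''_radial_le hκ hη x i
  have step1 := integral_smul_fderiv_eq_neg_fderiv_smul_of_integrable
    (μ := (volume : Measure E3)) (f := fun x : E3 => yuk κ (‖x‖ ^ 2 + η)) (g := φ' i) (v := e3 i)
    (by simp only [d1]; exact integrable_bdd_smul (h.int' i) s1 b1)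
    (by simp only [h.deriv']; exact integrable_bdd_smul (h.int'' i) s0 b0)
    (integrable_bdd_smul (h.int' i) s0 b0) (fun x _ => D1 x) (fun x _ => h.diff' i x)
  have step2 := integral_smul_fderiv_eq_neg_fderiv_smul_of_integrable
    (μ := (volume : Measure E3)) (f := fun x : E3 => 2 * x i * yuk' κ (‖x‖ ^ 2 + η)) (g := φ)
    (v := e3 i)
    (by simp only [d2]; exact integrable_bdd_smul h.int s2 b2)
    (by simp only [h.deriv]; exact integrable_bdd_smul (h.int' i) s1 b1)
    (integrable_bdd_smul h.int s1 b1) (fun x _ => D2 x) (fun x _ => h.diff x)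
  simp only [h.deriv', d1] at step1
  simp only [h.deriv, d2] at step2
  rw [step1, step2, neg_neg]

lemma normSq_eq_sum_sq (x : E3) : ‖x‖ ^ 2 = ∑ i, x i ^ 2 := by
  simp [EuclideanSpace.norm_sq_eq]

/-- Two integrations by parts move the Laplacian onto the regularized potential. Only the term with
the factor `η` survives; it concentrates at the origin as `η → 0`. -/
lemma integral_yuk_equation {φ : E3 → ℂ} {φ' φ'' : Fin 3 → E3 → ℂ} (h : IsTame φ φ' φ'')
    (hκ : 0 ≤ κ) (hη : 0 < η) :
    ∫ x, yuk κ (‖x‖ ^ 2 + η) • (κ ^ 2 • φ x - ∑ i, φ'' i x) =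
      ∫ x, (4 * η * yuk'' κ (‖x‖ ^ 2 + η)) • φ x := by
  have b0 := abs_yuk_radial_le hκ hη
  have s0 := (measurable_yuk_radial κ η 0).1
  have i1 : Integrable (fun x => yuk κ (‖x‖ ^ 2 + η) • κ ^ 2 • φ x) :=
    integrable_bdd_smul (show Integrable (fun x => κ ^ 2 • φ x) from h.int.smul (κ ^ 2)) s0 b0
  have i2 : ∀ i, Integrable (fun x => yuk κ (‖x‖ ^ 2 + η) • φ'' i x) := fun i =>
    integrable_bdd_smul (h.int'' i) s0 b0
  have i3 : ∀ i, Integrable (fun x : E3 =>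
      (2 * yuk' κ (‖x‖ ^ 2 + η) + 4 * x i ^ 2 * yuk'' κ (‖x‖ ^ 2 + η)) • φ x) := fun i =>
    integrable_bdd_smul h.int (measurable_yuk_radial κ η i).2.2
      fun x => abs_yuk''_radial_le hκ hη x i
  simp only [smul_sub, Finset.smul_sum]
  rw [integral_sub i1 (integrable_finsetSum _ fun i _ => i2 i),
    integral_finsetSum _ fun i _ => i2 i]
  simp only [integral_yuk_smul h hκ hη]
  rw [← integral_finsetSum _ fun i _ => i3 i, ← integral_sub i1
    (integrable_finsetSum _ fun i _ => i3 i)]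
  congr 1
  ext x
  rw [← Finset.sum_smul, smul_smul, ← sub_smul]
  congr 1
  have e := yuk_equation κ (normSq_add_pos hη x)
  have hx := normSq_eq_sum_sq x
  rw [Fin.sum_univ_three] at hx ⊢
  linear_combination -e + 4 * yuk'' κ (‖x‖ ^ 2 + η) * hx

/-! ### The limit of vanishing regularization -/

/-- An explicit antiderivative for the radial integral of the limiting profile, which gives its
total mass. -/
lemma hasDerivAt_cube_div (r : ℝ) :
    HasDerivAt (fun r : ℝ => (r / √(1 + r ^ 2)) ^ 3) (r ^ 2 * (3 / √(1 + r ^ 2) ^ 5)) r := by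
  have hq : 0 < 1 + r ^ 2 := by positivity
  have hs : 0 < √(1 + r ^ 2) := Real.sqrt_pos.2 hq
  have h1 : HasDerivAt (fun r : ℝ => √(1 + r ^ 2)) (r / √(1 + r ^ 2)) r := by
    have := (((hasDerivAt_id r).fun_pow 2).const_add 1).sqrt hq.ne'
    refine this.congr_deriv ?_
    simp
    field_simp
  have h2 := (((hasDerivAt_id r).fun_div h1 hs.ne').fun_pow 3)
  refine h2.congr_deriv ?_
  have e : √(1 + r ^ 2) ^ 2 = 1 + r ^ 2 := Real.sq_sqrt hq.le
  have e3 : √(1 + r ^ 2) - r * (r / √(1 + r ^ 2)) = 1 / √(1 + r ^ 2) := by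
    field_simp
    linarith
  simp only [id, one_mul, e3, div_pow]
  field_simp
  norm_num
  ring

lemma tendsto_div_sqrt : Tendsto (fun r : ℝ => (r / √(1 + r ^ 2)) ^ 3) atTop (nhds 1) := by
  have h1 : Tendsto (fun r : ℝ => √(1 - (1 + r ^ 2)⁻¹)) atTop (nhds 1) := by
    have h2 : Tendsto (fun r : ℝ => 1 + r ^ 2) atTop atTop :=
      tendsto_atTop_add_const_left _ _ (tendsto_pow_atTop (by norm_num))
    have := (h2.inv_tendsto_atTop.const_sub 1).sqrt
    simpa using this
  have h3 : Tendsto (fun r : ℝ => r / √(1 + r ^ 2)) atTop (nhds 1) := by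
    refine h1.congr' ?_
    filter_upwards [eventually_gt_atTop 0] with r hr
    have hq : 0 < 1 + r ^ 2 := by positivity
    rw [show 1 - (1 + r ^ 2)⁻¹ = r ^ 2 / (1 + r ^ 2) by field_simp; ring,
      Real.sqrt_div (by positivity), Real.sqrt_sq hr.le]
  simpa using h3.pow 3

lemma integrable_profile : Integrable (fun y : E3 => 3 / √(1 + ‖y‖ ^ 2) ^ 5) := by
  rw [integrable_fun_norm_addHaar (μ := (volume : Measure E3))
    (f := fun r : ℝ => 3 / √(1 + r ^ 2) ^ 5)]
  have := integrableOn_Ioi_deriv_of_nonneg' (a := 0) (fun x _ => hasDerivAt_cube_div x)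
    (fun x _ => by positivity) tendsto_div_sqrt
  simpa using this

lemma integral_profile : ∫ y : E3, 3 / √(1 + ‖y‖ ^ 2) ^ 5 = 4 * Real.pi := by
  rw [integral_fun_norm_addHaar (μ := (volume : Measure E3))
    (fun r : ℝ => 3 / √(1 + r ^ 2) ^ 5)]
  have := integral_Ioi_of_hasDerivAt_of_nonneg' (a := 0) (fun x _ => hasDerivAt_cube_div x)
    (fun x _ => by positivity) tendsto_div_sqrt
  simp only [finrank_euclideanSpace, Fintype.card_fin, Nat.add_one_sub_one, smul_eq_mul, this,
    Measure.real, EuclideanSpace.volume_ball_fin_three]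
  rw [ENNReal.ofReal_one, one_pow, one_mul, ENNReal.toReal_ofReal (by positivity)]
  simp
  ring

/-- The rescaled regularized delta function. -/
lemma integral_yuk''_scaling (κ : ℝ) {h : ℝ} (hh : 0 < h) (φ : E3 → ℂ) :
    ∫ x, (4 * h ^ 2 * yuk'' κ (‖x‖ ^ 2 + h ^ 2)) • φ x =
      ∫ y : E3, (Real.exp (-(κ * h * √(1 + ‖y‖ ^ 2))) * ((κ * h * √(1 + ‖y‖ ^ 2)) ^ 2 +
        3 * (κ * h * √(1 + ‖y‖ ^ 2)) + 3) / (4 * Real.pi * √(1 + ‖y‖ ^ 2) ^ 5)) • φ (h • y) := by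
  have key := Measure.integral_comp_smul (volume : Measure E3)
    (fun x => (4 * h ^ 2 * yuk'' κ (‖x‖ ^ 2 + h ^ 2)) • φ x) h
  rw [finrank_euclideanSpace, Fintype.card_fin, abs_of_pos (by positivity),
    eq_inv_smul_iff₀ (by positivity)] at key
  rw [← key, ← integral_smul]
  congr 1
  ext y
  rw [smul_smul]
  congr 1
  have hq : 0 < 1 + ‖y‖ ^ 2 := by positivity
  have hs : 0 < √(1 + ‖y‖ ^ 2) := Real.sqrt_pos.2 hq
  have e : √(‖h • y‖ ^ 2 + h ^ 2) = h * √(1 + ‖y‖ ^ 2) := by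
    rw [norm_smul, Real.norm_of_nonneg hh.le, show (h * ‖y‖) ^ 2 + h ^ 2 = h ^ 2 * (1 + ‖y‖ ^ 2) by
      ring, Real.sqrt_mul (by positivity), Real.sqrt_sq hh.le]
  rw [yuk'', e]
  have hpi := Real.pi_pos
  rw [show -κ * (h * √(1 + ‖y‖ ^ 2)) = -(κ * h * √(1 + ‖y‖ ^ 2)) by ring]
  field_simp
  ring

/-- After the substitution `x = h y` the kernel tends to `3 / (4π (1 + |y|²)^(5/2))`, of mass one.
Domination uses `e^(-t) (t² + 3t + 3) ≤ 8 ≤ 12π`. -/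
lemma tendsto_integral_yuk'' (hκ : 0 ≤ κ) {φ : E3 → ℂ} (hφ : Continuous φ) {C : ℝ}
    (hC : ∀ x, ‖φ x‖ ≤ C) :
    Tendsto (fun n : ℕ => ∫ x, (4 * (1 / ((n : ℝ) + 1)) ^ 2 *
      yuk'' κ (‖x‖ ^ 2 + (1 / ((n : ℝ) + 1)) ^ 2)) • φ x) atTop (nhds (φ 0)) := by
  have hh : ∀ n : ℕ, 0 < 1 / ((n : ℝ) + 1) := fun n => Nat.one_div_pos_of_nat
  have hh0 : Tendsto (fun n : ℕ => 1 / ((n : ℝ) + 1)) atTop (nhds 0) :=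
    tendsto_one_div_add_atTop_nhds_zero_nat
  have hpi := Real.pi_pos
  simp only [fun n => integral_yuk''_scaling κ (hh n) φ]
  have hlim : φ 0 = ∫ y : E3, (3 / √(1 + ‖y‖ ^ 2) ^ 5 * (1 / (4 * Real.pi))) • φ 0 := by
    rw [integral_smul_const, integral_mul_const, integral_profile, mul_one_div_cancel
      (by positivity), one_smul]
  rw [hlim]
  refine tendsto_integral_of_dominated_convergence
    (fun y => 3 / √(1 + ‖y‖ ^ 2) ^ 5 * C) (fun n => ?_) (integrable_profile.mul_const C)
    (fun n => ae_of_all _ fun y => ?_) (ae_of_all _ fun y => ?_)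
  · have m : Measurable fun y : E3 => Real.exp (-(κ * (1 / ((n : ℝ) + 1)) * √(1 + ‖y‖ ^ 2))) *
        ((κ * (1 / ((n : ℝ) + 1)) * √(1 + ‖y‖ ^ 2)) ^ 2 +
        3 * (κ * (1 / ((n : ℝ) + 1)) * √(1 + ‖y‖ ^ 2)) + 3) /
        (4 * Real.pi * √(1 + ‖y‖ ^ 2) ^ 5) := by fun_prop
    exact m.aestronglyMeasurable.smul (hφ.comp (f := fun y : E3 => (1 / ((n : ℝ) + 1)) • y)
      (by fun_prop)).aestronglyMeasurable
  · have hs : 0 < √(1 + ‖y‖ ^ 2) := Real.sqrt_pos.2 (by positivity)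
    have hn := (hh n).le
    have ht : 0 ≤ κ * (1 / ((n : ℝ) + 1)) * √(1 + ‖y‖ ^ 2) := by positivity
    set t := κ * (1 / ((n : ℝ) + 1)) * √(1 + ‖y‖ ^ 2)
    have hC0 : 0 ≤ C := (norm_nonneg _).trans (hC 0)
    rw [norm_smul, Real.norm_of_nonneg (by positivity)]
    refine mul_le_mul ?_ (hC _) (norm_nonneg _) (by positivity)
    rw [div_le_div_iff₀ (by positivity) (by positivity)]
    have h5 : 0 < √(1 + ‖y‖ ^ 2) ^ 5 := by positivity
    calc _ ≤ 8 * √(1 + ‖y‖ ^ 2) ^ 5 := by gcongr; exact (exp_neg_mul_le ht).2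
      _ ≤ 3 * (4 * Real.pi) * √(1 + ‖y‖ ^ 2) ^ 5 := by
        gcongr
        linarith [Real.pi_gt_three]
      _ = _ := by ring
  · have ht : Tendsto (fun n : ℕ => κ * (1 / ((n : ℝ) + 1)) * √(1 + ‖y‖ ^ 2)) atTop (nhds 0) := by
      simpa using (hh0.const_mul κ).mul_const (√(1 + ‖y‖ ^ 2))
    have h1 : Tendsto (fun n : ℕ => φ ((1 / ((n : ℝ) + 1)) • y)) atTop (nhds (φ 0)) := by
      refine hφ.continuousAt.tendsto.comp ?_
      simpa using hh0.smul_const y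
    refine Tendsto.smul ?_ h1
    have hc : Continuous fun t : ℝ => Real.exp (-t) * (t ^ 2 + 3 * t + 3) /
        (4 * Real.pi * √(1 + ‖y‖ ^ 2) ^ 5) := by fun_prop
    have e : 3 / √(1 + ‖y‖ ^ 2) ^ 5 * (1 / (4 * Real.pi)) = Real.exp (-0) * (0 ^ 2 + 3 * 0 + 3) /
        (4 * Real.pi * √(1 + ‖y‖ ^ 2) ^ 5) := by
      rw [neg_zero, Real.exp_zero]
      field_simp
      norm_num
    rw [e]
    exact hc.continuousAt.tendsto.comp ht

lemma integrable_inv_norm_mul {χ : E3 → ℂ} (hχ : Integrable χ) {C : ℝ} (hC : ∀ x, ‖χ x‖ ≤ C) :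
    Integrable (fun x : E3 => ‖x‖⁻¹ * ‖χ x‖) := by
  have h1 : IntegrableOn (fun x : E3 => ‖x‖⁻¹) (Metric.ball 0 1) := by
    have : IsFiniteMeasure (volume.restrict (Metric.ball (0 : E3) 1)) :=
      ⟨by rw [Measure.restrict_apply_univ]; exact Metric.isBounded_ball.measure_lt_top⟩
    refine ((memLp_norm_inv 1).integrable (by norm_num)).norm.congr (ae_of_all _ fun x => ?_)
    simp
  have h2 := ((integrable_indicator_iff Metric.isOpen_ball.measurableSet).2 h1).mul_const C
  refine Integrable.mono' (h2.add hχ.norm) ?_ (ae_of_all _ fun x => ?_)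
  · exact (Measurable.aestronglyMeasurable (by fun_prop)).mul hχ.1.norm
  · rw [Real.norm_of_nonneg (by positivity), Pi.add_apply]
    have hC0 : 0 ≤ C := (norm_nonneg _).trans (hC 0)
    by_cases hx : x ∈ Metric.ball (0 : E3) 1
    · rw [indicator_of_mem hx]
      have : ‖x‖⁻¹ * ‖χ x‖ ≤ ‖x‖⁻¹ * C := by gcongr; exact hC x
      linarith [norm_nonneg (χ x)]
    · rw [indicator_of_notMem hx, zero_mul, zero_add]
      have : 1 ≤ ‖x‖ := by simpa using hx
      exact mul_le_of_le_one_left (norm_nonneg _) (inv_le_one_of_one_le₀ this)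

lemma tendsto_integral_yuk (hκ : 0 ≤ κ) {χ : E3 → ℂ} (hχ : Integrable χ) {C : ℝ}
    (hC : ∀ x, ‖χ x‖ ≤ C) :
    Tendsto (fun n : ℕ => ∫ x, yuk κ (‖x‖ ^ 2 + (1 / ((n : ℝ) + 1)) ^ 2) • χ x) atTop
      (nhds (∫ x, yuk κ (‖x‖ ^ 2) • χ x)) := by
  have hh : ∀ n : ℕ, 0 < (1 / ((n : ℝ) + 1)) ^ 2 := fun n => pow_pos Nat.one_div_pos_of_nat 2
  have hh0 : Tendsto (fun n : ℕ => (1 / ((n : ℝ) + 1)) ^ 2) atTop (nhds 0) := by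
    simpa using (tendsto_one_div_add_atTop_nhds_zero_nat (𝕜 := ℝ)).pow 2
  refine tendsto_integral_of_dominated_convergence _ (fun n => ?_)
    (integrable_inv_norm_mul hχ hC) (fun n => ?_) ?_
  · exact (integrable_bdd_smul hχ (measurable_yuk_radial κ _ 0).1
      (abs_yuk_radial_le hκ (hh n))).1
  · filter_upwards [show ∀ᵐ x : E3, x ≠ 0 by simp [ae_iff]] with x hx
    have hp := norm_pos_iff.2 hx
    rw [norm_smul]
    refine mul_le_mul_of_nonneg_right ?_ (norm_nonneg _)
    refine (abs_yuk_le hκ (normSq_add_pos (hh n) x)).1.trans ?_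
    refine inv_anti₀ hp (Real.le_sqrt_of_sq_le ?_)
    linarith [hh n]
  · filter_upwards [show ∀ᵐ x : E3, x ≠ 0 by simp [ae_iff]] with x hx
    have hp := norm_pos_iff.2 hx
    refine Tendsto.smul_const ?_ _
    refine (hasDerivAt_yuk κ (‖x‖ ^ 2) (by positivity)).continuousAt.tendsto.comp ?_
    simpa using hh0.const_add (‖x‖ ^ 2)

/-- The fundamental solution of `κ² - Δ`. -/
lemma integral_yuk_fundamental {φ : E3 → ℂ} {φ' φ'' : Fin 3 → E3 → ℂ} (h : IsTame φ φ' φ'')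
    (hκ : 0 ≤ κ) :
    ∫ x, yuk κ (‖x‖ ^ 2) • (κ ^ 2 • φ x - ∑ i, φ'' i x) = φ 0 := by
  obtain ⟨C, hC⟩ := h.bdd
  choose C'' hC'' using h.bdd''
  have h1 := (tendsto_integral_yuk'' hκ h.diff.continuous hC).congr fun n =>
    (integral_yuk_equation h hκ (pow_pos (Nat.one_div_pos_of_nat (n := n)) 2)).symm
  refine tendsto_nhds_unique (tendsto_integral_yuk hκ (C := κ ^ 2 * C + ∑ i, C'' i) ?_ ?_) h1
  · have i1 : Integrable (fun x => κ ^ 2 • φ x) := h.int.smul (κ ^ 2)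
    have i2 : Integrable (fun x => ∑ i, φ'' i x) := integrable_finsetSum _ fun i _ => h.int'' i
    exact i1.sub i2
  · intro x
    refine (norm_sub_le _ _).trans (add_le_add ?_ ((norm_sum_le _ _).trans
      (Finset.sum_le_sum fun i _ => hC'' i x)))
    rw [norm_smul, Real.norm_of_nonneg (by positivity)]
    exact mul_le_mul_of_nonneg_left (hC x) (by positivity)


/-! ### Schwartz functions and the Yukawa potential -/

section

open SchwartzMap FourierTransform LineDeriv

lemma lineDeriv_apply_eq (φ : 𝓢(E3, ℂ)) (m x : E3) : (∂_{m} φ) x = fderiv ℝ φ x m := rfl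

lemma exists_norm_le_schwartz (φ : 𝓢(E3, ℂ)) : ∃ C, ∀ x, ‖φ x‖ ≤ C :=
  ⟨_, fun x => (φ.toBoundedContinuousFunction.norm_coe_le_norm x)⟩

lemma isTame_schwartz (φ : 𝓢(E3, ℂ)) :
    IsTame φ (fun i => ⇑(∂_{e3 i} φ : 𝓢(E3, ℂ)))
      (fun i => ⇑(∂_{e3 i} (∂_{e3 i} φ) : 𝓢(E3, ℂ))) where
  diff := φ.differentiable
  diff' i := (∂_{e3 i} φ).differentiable
  deriv _ x := (lineDeriv_apply_eq φ _ x).symm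
  deriv' i x := (lineDeriv_apply_eq (∂_{e3 i} φ) _ x).symm
  int := φ.integrable
  int' i := (∂_{e3 i} φ).integrable
  int'' i := (∂_{e3 i} (∂_{e3 i} φ) : 𝓢(E3, ℂ)).integrable
  bdd := exists_norm_le_schwartz φ
  bdd'' _ := exists_norm_le_schwartz _

/-- The symbol of the Bessel potential of order two. -/
abbrev bes (ξ : E3) : ℂ := ((1 + ‖ξ‖ ^ 2) ^ ((-2 : ℝ) / 2) : ℝ)

lemma bes_mul (ξ : E3) : (1 + ∑ i, ((ξ i : ℝ) : ℂ) ^ 2) * bes ξ = 1 := by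
  have h : (1 + ∑ i, ((ξ i : ℝ) : ℂ) ^ 2) = ((1 + ‖ξ‖ ^ 2 : ℝ) : ℂ) := by
    rw [normSq_eq_sum_sq]
    push_cast
    rfl
  rw [h, bes, ← ofReal_mul, show (-2 : ℝ) / 2 = -1 by norm_num, Real.rpow_neg_one,
    mul_inv_cancel₀ (by positivity), ofReal_one]

lemma bes_hasTemperateGrowth : Function.HasTemperateGrowth bes := by
  unfold bes
  fun_prop

/-- The Bessel potential of a Schwartz function. -/
def besSchwartz (ψ : 𝓢(E3, ℂ)) : 𝓢(E3, ℂ) := 𝓕 (SchwartzMap.smulLeftCLM ℂ bes (𝓕⁻ ψ))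

/-- In the Fourier convention with `2π` in the exponent, `(2π)² - Δ` has symbol `(2π)² (1 + |ξ|²)`,
which cancels the Bessel symbol. This singles out `2πi` as the reference frequency. -/
lemma besSchwartz_equation (ψ : 𝓢(E3, ℂ)) :
    ((2 * Real.pi) ^ 2 : ℂ) • besSchwartz ψ - ∑ i, ∂_{e3 i} (∂_{e3 i} (besSchwartz ψ)) =
      ((2 * Real.pi) ^ 2 : ℂ) • ψ := by
  set h := SchwartzMap.smulLeftCLM ℂ bes (𝓕⁻ ψ) with hh
  have hg : ∀ i, Function.HasTemperateGrowth (fun x : E3 => x i) := fun i => by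
    have : Function.HasTemperateGrowth (fun x : E3 => inner ℝ x (e3 i)) := by fun_prop
    simpa only [inner_e3] using this
  have key : ((2 * Real.pi) ^ 2 : ℂ) • h - ∑ i, (-(2 * Real.pi * I)) •
      SchwartzMap.smulLeftCLM ℂ (fun x : E3 => x i) ((-(2 * Real.pi * I)) •
      SchwartzMap.smulLeftCLM ℂ (fun x : E3 => x i) h) =
      ((2 * Real.pi) ^ 2 : ℂ) • 𝓕⁻ ψ := by
    ext ξ
    have hb := bes_mul ξ
    rw [Fin.sum_univ_three] at hb
    simp only [Fin.sum_univ_three, sub_apply, add_apply, smul_apply,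
      SchwartzMap.smulLeftCLM_apply_apply (hg _), hh,
      SchwartzMap.smulLeftCLM_apply_apply bes_hasTemperateGrowth, smul_eq_mul,
      Complex.real_smul]
    linear_combination ((2 * Real.pi) ^ 2 * (𝓕⁻ ψ) ξ) * hb -
      (2 * Real.pi) ^ 2 * ((ξ 0 : ℂ) ^ 2 + (ξ 1 : ℂ) ^ 2 + (ξ 2 : ℂ) ^ 2) * bes ξ * (𝓕⁻ ψ) ξ * I_sq
  have := congrArg (fourierCLM ℂ 𝓢(E3, ℂ)) key
  simp only [map_sub, map_sum, map_smul, fourierCLM_apply] at this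
  rw [fourier_fourierInv_eq] at this
  rw [← this, besSchwartz, ← hh]
  congr 1
  refine Finset.sum_congr rfl fun i _ => ?_
  rw [lineDerivOp_fourier_eq, lineDerivOp_fourier_eq]
  simp only [inner_e3, FourierTransform.fourier_smul]

/-- Convolution with the Yukawa potential inverts `κ² - Δ`. -/
lemma integral_yuk_shift {κ : ℝ} {φ : E3 → ℂ} {φ' φ'' : Fin 3 → E3 → ℂ} (h : IsTame φ φ' φ'')
    (hκ : 0 ≤ κ) (y : E3) :
    ∫ x, yuk κ (‖x - y‖ ^ 2) • (κ ^ 2 • φ x - ∑ i, φ'' i x) = φ y := by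
  have := integral_yuk_fundamental (h.shift y) hκ
  rw [zero_add] at this
  rw [← this, ← integral_add_right_eq_self _ y]
  simp

/-- The Yukawa potential inverts `(2π)² - Δ` on tame functions, so the differential equation for the
Bessel potential determines it as a convolution. -/
lemma besSchwartz_apply (ψ : 𝓢(E3, ℂ)) (y : E3) :
    besSchwartz ψ y = (2 * Real.pi) ^ 2 * ∫ x, yuk (2 * Real.pi) (‖x - y‖ ^ 2) • ψ x := by
  rw [← integral_yuk_shift (isTame_schwartz (besSchwartz ψ)) (κ := 2 * Real.pi) (by positivity) y,
    ← integral_const_mul]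
  congr 1
  ext x
  have := congrArg (fun f : 𝓢(E3, ℂ) => f x) (besSchwartz_equation ψ)
  simp only [Fin.sum_univ_three, sub_apply, add_apply, smul_apply, smul_eq_mul] at this
  simp only [Fin.sum_univ_three, Complex.real_smul] at this ⊢
  push_cast
  rw [this]
  ring

end


/-! ### Second derivatives of the Yukawa potential -/

section

open SchwartzMap FourierTransform LineDeriv TemperedDistribution

variable {D : Set E3}

/-- The restriction of a square integrable function to `D`. -/
def restrictL2 (D : Set E3) (u : Lp ℂ 2 (volume : Measure E3)) : L2 D :=
  ((Lp.memLp u).restrict D).toLp u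

lemma restrictL2_ae (u : Lp ℂ 2 (volume : Measure E3)) :
    restrictL2 D u =ᵐ[volume.restrict D] u := ((Lp.memLp u).restrict D).coeFn_toLp

/-- The extension of a function on `D` by zero. -/
lemma memLp_indicator (hD : MeasurableSet D) (f : L2 D) :
    MemLp (D.indicator f) 2 (volume : Measure E3) :=
  (memLp_indicator_iff_restrict hD).2 (Lp.memLp f)

/-- A smooth compactly supported function as a Schwartz function. -/
def testSchwartz {ψ : E3 → ℝ} (h1 : ContDiff ℝ (⊤ : ℕ∞) ψ) (h2 : HasCompactSupport ψ) :
    𝓢(E3, ℂ) :=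
  (h2.comp_left (g := fun t : ℝ => (t : ℂ)) (by simp)).toSchwartzMap
    (Complex.ofRealCLM.contDiff.comp h1)

lemma testSchwartz_apply {ψ : E3 → ℝ} (h1 : ContDiff ℝ (⊤ : ℕ∞) ψ) (h2 : HasCompactSupport ψ)
    (x : E3) : testSchwartz h1 h2 x = ψ x := rfl

lemma lineDeriv_testSchwartz {ψ : E3 → ℝ} (h1 : ContDiff ℝ (⊤ : ℕ∞) ψ)
    (h2 : HasCompactSupport ψ) (m x : E3) :
    (∂_{m} (testSchwartz h1 h2)) x = ((fderiv ℝ ψ x m : ℝ) : ℂ) := by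
  have hd : HasFDerivAt (fun x => ((ψ x : ℝ) : ℂ)) (Complex.ofRealCLM ∘L fderiv ℝ ψ x) x :=
    Complex.ofRealCLM.hasFDerivAt.comp x ((h1.differentiable (by simp)) x).hasFDerivAt
  rw [lineDeriv_apply_eq]
  change fderiv ℝ (fun x => ((ψ x : ℝ) : ℂ)) x m = _
  rw [hd.fderiv]
  rfl

lemma setIntegral_test_mul {g : E3 → ℝ} (hg : ∀ x ∉ D, g x = 0) (u : E3 → ℂ) :
    ∫ x in D, ((g x : ℝ) : ℂ) * u x = ∫ x, ((g x : ℝ) : ℂ) * u x :=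
  setIntegral_eq_integral_of_forall_compl_eq_zero fun x hx => by simp [hg x hx]

lemma test_eq_zero {ψ : E3 → ℝ} (h : tsupport ψ ⊆ D) (x : E3) (hx : x ∉ D) : ψ x = 0 :=
  image_eq_zero_of_notMem_tsupport fun hh => hx (h hh)

lemma fderiv_test_eq_zero {ψ : E3 → ℝ} (h : tsupport ψ ⊆ D) (m x : E3) (hx : x ∉ D) :
    fderiv ℝ ψ x m = 0 := by
  rw [image_eq_zero_of_notMem_tsupport (f := fderiv ℝ ψ)
    fun hh => hx (h (tsupport_fderiv_subset ℝ hh))]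
  rfl

/-- Distributional derivatives are weak derivatives. -/
lemma isWeakPartial_of_lineDeriv {u v : Lp ℂ 2 (volume : Measure E3)} {i : Fin 3}
    (h : ∂_{e3 i} (u : 𝓢'(E3, ℂ)) = (v : 𝓢'(E3, ℂ))) :
    IsWeakPartial D i (restrictL2 D u) (restrictL2 D v) := by
  intro ψ h1 h2 h3
  have key := congrArg (fun T : 𝓢'(E3, ℂ) => T (testSchwartz h1 h2)) h
  simp only [lineDerivOp_apply_apply, Lp.toTemperedDistribution_apply, neg_apply,
    testSchwartz_apply, lineDeriv_testSchwartz, smul_eq_mul, neg_mul, integral_neg] at key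
  have e : ∀ (g : E3 → ℝ) (w : Lp ℂ 2 (volume : Measure E3)), (∀ x ∉ D, g x = 0) →
      ∫ x in D, ((g x : ℝ) : ℂ) * restrictL2 D w x = ∫ x, ((g x : ℝ) : ℂ) * w x := by
    intro g w hg
    rw [← setIntegral_test_mul hg]
    refine integral_congr_ae ?_
    filter_upwards [restrictL2_ae (D := D) w] with x hx
    rw [hx]
  rw [e _ _ (fderiv_test_eq_zero h3 _), e _ _ (test_eq_zero h3), ← key, neg_neg]

/-- The Bessel potential gains two Sobolev orders, so its distributional derivatives up to order two
are square integrable. Restricted to `D` they form a jet. -/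
lemma exists_bessel_jet (F : Lp ℂ 2 (volume : Measure E3)) :
    ∃ u : Lp ℂ 2 (volume : Measure E3),
      besselPotential E3 ℂ (-2) (F : 𝓢'(E3, ℂ)) = (u : 𝓢'(E3, ℂ)) ∧
      ∃ v : H2 D, toL2 v = restrictL2 D u := by
  have hF : MemSobolev 0 2 (F : 𝓢'(E3, ℂ)) := memSobolev_zero_iff.2 ⟨F, rfl⟩
  have hu : MemSobolev 2 2 (besselPotential E3 ℂ (-2) (F : 𝓢'(E3, ℂ))) :=
    memSobolev_besselPotential_iff.2 (by norm_num; exact hF)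
  have hui : ∀ i, MemSobolev 1 2 (∂_{e3 i} (besselPotential E3 ℂ (-2) (F : 𝓢'(E3, ℂ)))) :=
    fun i => by
      have := hu.lineDerivOp (m := e3 i)
      norm_num at this
      exact this
  have huij : ∀ i j, MemSobolev 0 2
      (∂_{e3 j} (∂_{e3 i} (besselPotential E3 ℂ (-2) (F : 𝓢'(E3, ℂ))))) := fun i j => by
      have := (hui i).lineDerivOp (m := e3 j)
      norm_num at this
      exact this
  obtain ⟨u, e⟩ := memSobolev_zero_iff.1 (hu.mono (by norm_num : (0 : ℝ) ≤ 2))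
  choose ui ei using fun i => memSobolev_zero_iff.1 ((hui i).mono (by norm_num : (0 : ℝ) ≤ 1))
  choose uij eij using fun i j => memSobolev_zero_iff.1 (huij i j)
  refine ⟨u, e, ⟨WithLp.toLp 2 (Sum.elim (fun _ => restrictL2 D u)
    (Sum.elim (fun i => restrictL2 D (ui i)) fun ij => restrictL2 D (uij ij.1 ij.2))),
    fun i => ?_, fun i j => ?_⟩, rfl⟩
  · exact isWeakPartial_of_lineDeriv (by rw [← e, ei i])
  · exact isWeakPartial_of_lineDeriv (by rw [← ei i, eij i j])

end

section

variable {D : Set E3} [hD : Fact (IsOpen D)] [hb : Fact (Bornology.IsBounded D)]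

/-! ### The Green's functions as kernels -/

lemma norm_green_le (z : ℂ) : ∀ x ∈ diffBall D, x ≠ 0 →
    ‖green z x‖ ≤ Real.exp (‖z‖ * (Metric.diam D + 1)) * ‖x‖⁻¹ := by
  intro x hx hx0
  have hp := norm_pos_iff.2 hx0
  have hpi := Real.pi_gt_three
  have hxR := (mem_ball_zero_iff.1 hx).le
  have h1 : (I * z * (‖x‖ : ℂ)).re ≤ ‖z‖ * (Metric.diam D + 1) := by
    calc (I * z * (‖x‖ : ℂ)).re ≤ ‖I * z * (‖x‖ : ℂ)‖ := Complex.re_le_norm _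
      _ = ‖z‖ * ‖x‖ := by simp
      _ ≤ _ := by gcongr
  rw [green, norm_div, Complex.norm_exp, div_eq_mul_inv]
  have h2 : ‖(4 * (Real.pi : ℂ) * (‖x‖ : ℂ))‖ = 4 * Real.pi * ‖x‖ := by
    simp [abs_of_pos Real.pi_pos]
  rw [h2]
  have h3 : (4 * Real.pi * ‖x‖)⁻¹ ≤ ‖x‖⁻¹ := by
    apply inv_anti₀ hp
    nlinarith
  gcongr

lemma memLp_green_diffBall (z : ℂ) : MemLp (green z) 2 (volume.restrict (diffBall D)) :=
  memLp_of_norm_le (measurable_green z) (norm_green_le z)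

variable (D) in
/-- The Green's function as a convolution kernel. -/
def greenKer (z : ℂ) : Ker D := (memLp_green_diffBall z).toLp (green z)

lemma greenKer_eq (z : ℂ) :
    greenKer D z = greenKer D (2 * Real.pi * I) + toL2L (diffBall D) (smoothJet D z) := by
  refine Lp.ext ?_
  filter_upwards [(memLp_green_diffBall (D := D) z).coeFn_toLp,
    (memLp_green_diffBall (D := D) (2 * Real.pi * I)).coeFn_toLp, toL2_smoothJet (D := D) z,
    Lp.coeFn_add (greenKer D (2 * Real.pi * I)) (toL2L (diffBall D) (smoothJet D z))]
    with x h1 h2 h3 h4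
  rw [h4, Pi.add_apply, toL2L_apply, h3, greenKer, h1, greenKer, h2]
  ring

variable (D) in
/-- The volume potential with values in the bounded functions. -/
def potE (z : ℂ) : L2 D →L[ℂ] Linf D := conv (greenKer D z)

lemma potE_ae (z : ℂ) (f : L2 D) : potE D z f =ᵐ[volume.restrict D] potentialFun D z f :=
  conv_toLp_ae (memLp_green_diffBall z) f

lemma differentiable_potE : Differentiable ℂ (potE D) := by
  have h : potE D = fun z => conv (greenKer D (2 * Real.pi * I)) +
      conv (toL2L (diffBall D) (smoothJet D z)) := by
    ext1 z
    rw [potE, greenKer_eq, map_add]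
  rw [h]
  exact (conv.differentiable.comp ((toL2L (diffBall D)).differentiable.comp
    differentiable_smoothJet)).const_add _

lemma green_eq_yuk (κ : ℝ) (x : E3) : green (κ * I) x = ((yuk κ (‖x‖ ^ 2) : ℝ) : ℂ) := by
  rw [green, yuk, Real.sqrt_sq (norm_nonneg _)]
  push_cast
  congr 2
  linear_combination (κ * ‖x‖ : ℂ) * I_mul_I

/-- Pairing a potential with a test function. -/
lemma integral_test_mul_pot (z : ℂ) {g : E3 → ℝ} (hg : Continuous g) (hc : HasCompactSupport g)
    (h0 : ∀ x ∉ D, g x = 0) (f : L2 D) :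
    ∫ x in D, ((g x : ℝ) : ℂ) * inclL2 D (potE D z f) x =
      ∫ y in D, (∫ x, green z (x - y) * ((g x : ℝ) : ℂ)) * f y := by
  have e : ∫ x in D, ((g x : ℝ) : ℂ) * inclL2 D (potE D z f) x =
      ∫ x in D, ((g x : ℝ) : ℂ) * convFun D (green z) f x := by
    refine integral_congr_ae ?_
    filter_upwards [inclL2_ae (potE D z f), potE_ae z f] with x h1 h2
    rw [h1, h2]
    rfl
  rw [e, integral_mul_convFun (g := fun x => ((g x : ℝ) : ℂ)) (measurable_green z).stronglyMeasurable (memLp_green_diffBall z)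
    (hg.integrable_of_hasCompactSupport hc).ofReal.restrict]
  congr 1
  ext y
  congr 1
  exact setIntegral_eq_integral_of_forall_compl_eq_zero fun x hx => by simp [h0 x hx]

open SchwartzMap TemperedDistribution in
-- Duality: for `ψ` supported in `D`, pairing it with the Bessel potential of the zero extension of
-- `f` is pairing `besSchwartz ψ` with `f`, and by symmetry of the kernel this is `(2π)²` times the
-- pairing of `ψ` with the Yukawa potential.
lemma exists_yukawa_jet (f : L2 D) :
    ∃ v : H2 D, toL2 v = inclL2 D (potE D (2 * Real.pi * I) f) := by
  have hF := memLp_indicator hD.out.measurableSet f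
  obtain ⟨u, hu, v, hv⟩ := exists_bessel_jet (D := D) (hF.toLp _)
  have hpi : ((2 * Real.pi) ^ 2 : ℂ) ≠ 0 := by
    simp
  refine ⟨((2 * Real.pi) ^ 2 : ℂ)⁻¹ • v, ?_⟩
  rw [← toL2L_apply, map_smul, toL2L_apply, hv, inv_smul_eq_iff₀ hpi]
  refine ae_eq_of_integral_test hD.out fun ψ h1 h2 h3 => ?_
  have h0 := test_eq_zero h3
  have key := congrArg (fun T : 𝓢'(E3, ℂ) => T (testSchwartz h1 h2)) hu
  simp only [Lp.toTemperedDistribution_apply, testSchwartz_apply, smul_eq_mul] at key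
  rw [besselPotential, fourierMultiplierCLM_apply_apply, Lp.toTemperedDistribution_apply] at key
  change ∫ x, besSchwartz (testSchwartz h1 h2) x • (hF.toLp _ : E3 → ℂ) x = _ at key
  have e1 : ∫ x in D, ((ψ x : ℝ) : ℂ) * restrictL2 D u x = ∫ x, ((ψ x : ℝ) : ℂ) * u x := by
    rw [← setIntegral_test_mul h0]
    refine integral_congr_ae ?_
    filter_upwards [restrictL2_ae (D := D) u] with x hx
    rw [hx]
  have e2 : ∫ x in D, ((ψ x : ℝ) : ℂ) *
      (((2 * Real.pi) ^ 2 : ℂ) • inclL2 D (potE D (2 * Real.pi * I) f) : L2 D) x =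
      (2 * Real.pi) ^ 2 * ∫ x in D, ((ψ x : ℝ) : ℂ) * inclL2 D (potE D (2 * Real.pi * I) f) x := by
    rw [← integral_const_mul]
    refine integral_congr_ae ?_
    filter_upwards [Lp.coeFn_smul ((2 * Real.pi) ^ 2 : ℂ)
      (inclL2 D (potE D (2 * Real.pi * I) f))] with x hx
    rw [hx, Pi.smul_apply, smul_eq_mul]
    ring
  have e3' : ∫ x, besSchwartz (testSchwartz h1 h2) x • (hF.toLp _ : E3 → ℂ) x =
      ∫ x in D, besSchwartz (testSchwartz h1 h2) x * f x := by
    rw [← integral_indicator hD.out.measurableSet]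
    refine integral_congr_ae ?_
    filter_upwards [hF.coeFn_toLp] with x hx
    rw [hx, smul_eq_mul]
    by_cases hxD : x ∈ D
    · rw [indicator_of_mem hxD, indicator_of_mem hxD]
    · rw [indicator_of_notMem hxD, indicator_of_notMem hxD, mul_zero]
  rw [e1, ← key, e3', e2, integral_test_mul_pot _ h1.continuous h2 h0, ← integral_const_mul]
  congr 1
  ext y
  rw [besSchwartz_apply, ← mul_assoc]
  congr 3
  ext x
  rw [show (2 * Real.pi * I : ℂ) = ((2 * Real.pi : ℝ) : ℂ) * I by push_cast; ring, green_eq_yuk,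
    testSchwartz_apply, Complex.real_smul]

/-- The Yukawa potential of `f` as an element of `H²(D)`. -/
def yukFun (f : L2 D) : H2 D := (exists_yukawa_jet f).choose

lemma toL2_yukFun (f : L2 D) :
    toL2L D (yukFun f) = inclL2 D (potE D (2 * Real.pi * I) f) :=
  (exists_yukawa_jet f).choose_spec

lemma toL2L_injective : Function.Injective (toL2L D) := toL2_injective hD.out

variable (D) in
/-- The Yukawa potential with values in `H²(D)`. -/
def yukH2 : L2 D →L[ℂ] H2 D :=
  -- Boundedness into `H²` comes from the closed graph theorem: followed by the injective inclusion
  -- into `L²`, the map is a bounded operator.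
  ContinuousLinearMap.ofSeqClosedGraph
    (g := { toFun := yukFun
            map_add' := fun f g => toL2L_injective (by simp only [map_add, toL2_yukFun])
            map_smul' := fun c f => toL2L_injective (by
              simp only [map_smul, toL2_yukFun, RingHom.id_apply]) })
    (by
      intro u x y hux huy
      refine toL2L_injective ?_
      have h1 := ((toL2L D).continuous.tendsto y).comp huy
      have h2 := ((inclL2 D ∘L potE D (2 * Real.pi * I)).continuous.tendsto x).comp hux
      refine (tendsto_nhds_unique h1 (h2.congr fun n => ?_)).trans (toL2_yukFun x).symm
      exact (toL2_yukFun (u n)).symm)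

lemma toL2_yukH2 (f : L2 D) : toL2 (yukH2 D f) = inclL2 D (potE D (2 * Real.pi * I) f) :=
  toL2_yukFun f

variable (D) in
/-- The volume potential with values in `H²(D)`. -/
def potV (z : ℂ) : L2 D →L[ℂ] H2 D := yukH2 D + convH2 (smoothJet D z)

lemma differentiable_potV : Differentiable ℂ (potV D) :=
  Differentiable.const_add (𝕜 := ℂ) (E := ℂ) (F := L2 D →L[ℂ] H2 D) (yukH2 D)
    (Differentiable.comp (𝕜 := ℂ) (E := ℂ) (F := H2 (diffBall D)) (G := L2 D →L[ℂ] H2 D)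
      convH2.differentiable (differentiable_smoothJet (D := D)))

lemma toL2_potV (z : ℂ) (f : L2 D) : toL2 (potV D z f) = inclL2 D (potE D z f) := by
  rw [← toL2L_apply, potV, add_apply, map_add, toL2L_apply, toL2L_apply, toL2_yukH2, toL2_convH2,
    potE, potE, greenKer_eq z, map_add, add_apply, map_add]
  rfl

/-- The Newtonian potential satisfies Poisson's equation. -/
lemma sum_hess_potV (f : L2 D) : ∑ i, (potV D 0 f).1.hess i i = -f := by
  refine ae_eq_of_integral_test hD.out fun ψ h1 h2 h3 => ?_
  set v := potV D 0 f with hv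
  have hc : ∀ i, ContDiff ℝ (⊤ : ℕ∞) fun x => fderiv ℝ ψ x (e3 i) := fun i =>
    (h1.fderiv_right (m := (⊤ : ℕ∞)) (by simp)).clm_apply contDiff_const
  have hs : ∀ i, HasCompactSupport fun x => fderiv ℝ ψ x (e3 i) := fun i =>
    hasCompactSupport_partial h2 _
  have ht : ∀ i, tsupport (fun x => fderiv ℝ ψ x (e3 i)) ⊆ D := fun i =>
    (closure_minimal (fun x (hx : _ ≠ _) => not_not.1 fun hx' =>
      hx (fderiv_test_eq_zero (D := tsupport ψ) subset_rfl (e3 i) x hx'))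
      (isClosed_tsupport ψ)).trans h3
  have e1 : ∀ i, ∫ x in D, ((ψ x : ℝ) : ℂ) * v.1.hess i i x =
      ∫ x in D, ((fderiv ℝ (fun x => fderiv ℝ ψ x (e3 i)) x (e3 i) : ℝ) : ℂ) * toL2 v x := by
    intro i
    have := v.2.1 i _ (hc i) (hs i) (ht i)
    rw [show toL2 v = v.1.fn from rfl, this, v.2.2 i i ψ h1 h2 h3, neg_neg]
  set g : Fin 3 → E3 → ℝ := fun i x => fderiv ℝ (fun x => fderiv ℝ ψ x (e3 i)) x (e3 i) with hg
  have gc : ∀ i, Continuous (g i) := fun i => continuous_partial (hc i) _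
  have gs : ∀ i, HasCompactSupport (g i) := fun i => hasCompactSupport_partial (hs i) _
  have e2 : ∫ x in D, ((g 0 x + g 1 x + g 2 x : ℝ) : ℂ) * toL2 v x =
      (∫ x in D, ((g 0 x : ℝ) : ℂ) * toL2 v x) + (∫ x in D, ((g 1 x : ℝ) : ℂ) * toL2 v x) +
      ∫ x in D, ((g 2 x : ℝ) : ℂ) * toL2 v x := by
    have i0 := fun i => integrable_real_mul (g i) (gc i) (gs i) (toL2 v)
    rw [← integral_add (i0 0) (i0 1), ← integral_add (f := fun x => _ + _) ((i0 0).add (i0 1)) (i0 2)]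
    congr 1
    ext x
    push_cast
    ring
  -- The fundamental solution with `κ = 0`, applied to the test function.
  have e3' : ∀ y, ∫ x, green 0 (x - y) * ((g 0 x + g 1 x + g 2 x : ℝ) : ℂ) = -((ψ y : ℝ) : ℂ) := by
    intro y
    rw [← testSchwartz_apply h1 h2,
      ← integral_yuk_shift (isTame_schwartz (testSchwartz h1 h2)) le_rfl y, ← integral_neg]
    congr 1
    ext x
    have h4 : ∀ i, (LineDeriv.lineDerivOp (e3 i) (LineDeriv.lineDerivOp (e3 i)
        (testSchwartz h1 h2) : SchwartzMap E3 ℂ) : SchwartzMap E3 ℂ) x = ((g i x : ℝ) : ℂ) := by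
      intro i
      have h5 : (LineDeriv.lineDerivOp (e3 i) (testSchwartz h1 h2) : SchwartzMap E3 ℂ) =
          testSchwartz (hc i) (hs i) := by
        ext x
        rw [lineDeriv_testSchwartz, testSchwartz_apply]
      rw [h5, lineDeriv_testSchwartz]
    have h6 := green_eq_yuk 0 (x - y)
    rw [ofReal_zero, zero_mul] at h6
    simp only [h4, Fin.sum_univ_three, h6, Complex.real_smul]
    push_cast
    ring
  have hadd : ∀ a b : L2 D, ∫ x in D, ((ψ x : ℝ) : ℂ) * (a + b : L2 D) x =
      (∫ x in D, ((ψ x : ℝ) : ℂ) * a x) + ∫ x in D, ((ψ x : ℝ) : ℂ) * b x := by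
    intro a b
    rw [← integral_add (integrable_real_mul ψ h1.continuous h2 a)
      (integrable_real_mul ψ h1.continuous h2 b)]
    refine integral_congr_ae ?_
    filter_upwards [Lp.coeFn_add a b] with x hx
    rw [hx, Pi.add_apply, mul_add]
  rw [Fin.sum_univ_three, hadd, hadd, e1, e1, e1, ← e2, hv, toL2_potV,
    integral_test_mul_pot (g := fun x => g 0 x + g 1 x + g 2 x) 0 (((gc 0).add (gc 1)).add (gc 2)) (((gs 0).add (gs 1)).add (gs 2))
      (fun x hx => by simp only [hg, fderiv_test_eq_zero (ht _) _ x hx, add_zero])]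
  simp only [e3']
  refine integral_congr_ae ?_
  filter_upwards [Lp.coeFn_neg f] with x hx
  rw [hx, Pi.neg_apply]
  ring

/-- By Poisson's equation `f` is minus the trace of a Hessian whose entries are bounded by the `H²`
norm. -/
lemma norm_le_potV (f : L2 D) : ‖f‖ ≤ 3 * ‖potV D 0 f‖ := by
  have h : ∀ i, ‖(potV D 0 f).1.hess i i‖ ≤ ‖potV D 0 f‖ := fun i => PiLp.norm_apply_le _ _
  calc ‖f‖ = ‖∑ i, (potV D 0 f).1.hess i i‖ := by rw [sum_hess_potV, norm_neg]
    _ ≤ ∑ i, ‖(potV D 0 f).1.hess i i‖ := norm_sum_le _ _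
    _ ≤ ∑ _i : Fin 3, ‖potV D 0 f‖ := Finset.sum_le_sum fun i _ => h i
    _ = 3 * ‖potV D 0 f‖ := by simp

end


/-! ### Compact self-adjoint operators -/

section Hilbert

variable {H : Type*} [NormedAddCommGroup H] [InnerProductSpace ℂ H] [CompleteSpace H]

lemma mem_spectrum_iff_exists_eigenvector {A : H →L[ℂ] H} (hc : IsCompactOperator A) {μ : ℂ}
    (hμ : μ ≠ 0) : μ ∈ spectrum ℂ A ↔ ∃ x ≠ 0, A x = μ • x := by
  rw [← hc.hasEigenvalue_iff_mem_spectrum hμ]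
  constructor
  · intro h
    obtain ⟨x, hx⟩ := h.exists_hasEigenvector
    exact ⟨x, hx.2, hx.apply_eq_smul⟩
  · rintro ⟨x, hx, h⟩
    exact Module.End.hasEigenvalue_of_hasEigenvector ⟨Module.End.mem_eigenspace_iff.2 h, hx⟩

lemma mem_spectrum_of_eigenvector {A : H →L[ℂ] H} {μ : ℂ} {x : H} (hx : x ≠ 0)
    (h : A x = μ • x) : μ ∈ spectrum ℂ A := by
  rw [ContinuousLinearMap.spectrum_eq]
  exact (Module.End.hasEigenvalue_of_hasEigenvector
    ⟨Module.End.mem_eigenspace_iff.2 h, hx⟩).mem_spectrum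

/-- For a self-adjoint operator positivity is read off the spectrum. Compactness makes the nonzero
spectrum consist of eigenvalues, and `0 ≤ b` takes care of zero. -/
lemma isPositive_sub_of_eigenvalues_le {A : H →L[ℂ] H} (hA : IsSelfAdjoint A)
    (hc : IsCompactOperator A) {b : ℝ} (hb : 0 ≤ b)
    (h : ∀ μ : ℝ, ∀ x ≠ 0, A x = (μ : ℂ) • x → μ ≤ b) :
    (algebraMap ℝ (H →L[ℂ] H) b - A).IsPositive := by
  rw [← ContinuousLinearMap.le_def]
  rw [le_algebraMap_iff_spectrum_le hA]
  intro μ hμ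
  rcases eq_or_ne μ 0 with rfl | hμ0
  · exact hb
  have h1 : (μ : ℂ) ∈ spectrum ℂ A := by
    rw [← spectrum.preimage_algebraMap (R := ℝ) ℂ] at hμ
    exact hμ
  obtain ⟨x, hx, hAx⟩ := (mem_spectrum_iff_exists_eigenvector hc (by exact_mod_cast hμ0)).1 h1
  exact h μ x hx hAx

lemma algebraMap_real_apply (b : ℝ) (x : H) : algebraMap ℝ (H →L[ℂ] H) b x = (b : ℂ) • x := by
  rw [Algebra.algebraMap_eq_smul_one]
  rfl

lemma re_inner_le_of_eigenvalues_le {A : H →L[ℂ] H} (hA : IsSelfAdjoint A)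
    (hc : IsCompactOperator A) {b : ℝ} (hb : 0 ≤ b)
    (h : ∀ μ : ℝ, ∀ x ≠ 0, A x = (μ : ℂ) • x → μ ≤ b) (x : H) :
    (inner ℂ x (A x)).re ≤ b * ‖x‖ ^ 2 := by
  have h1 := (isPositive_sub_of_eigenvalues_le hA hc hb h).re_inner_nonneg_right x
  rw [sub_apply, algebraMap_real_apply, inner_sub_right, inner_smul_right,
    inner_self_eq_norm_sq_to_K, map_sub] at h1
  simp only [RCLike.re_to_complex, RCLike.ofReal_eq_complex_ofReal] at h1
  rw [← ofReal_pow, ← ofReal_mul, ofReal_re] at h1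
  linarith

/-- A maximizer of the quadratic form is an eigenvector. -/
lemma eigenvector_of_re_inner_eq {A : H →L[ℂ] H} (hA : IsSelfAdjoint A)
    (hc : IsCompactOperator A) {b : ℝ} (hb : 0 ≤ b)
    (h : ∀ μ : ℝ, ∀ x ≠ 0, A x = (μ : ℂ) • x → μ ≤ b) {x : H}
    (hx : b * ‖x‖ ^ 2 ≤ (inner ℂ x (A x)).re) : A x = (b : ℂ) • x := by
  have hp := isPositive_sub_of_eigenvalues_le hA hc hb h
  set Q := algebraMap ℝ (H →L[ℂ] H) b - A with hQ
  have h0 : (inner ℂ x (Q x)).re ≤ 0 := by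
    rw [hQ, sub_apply, algebraMap_real_apply, inner_sub_right, inner_smul_right,
      inner_self_eq_norm_sq_to_K, sub_re, RCLike.ofReal_eq_complex_ofReal, ← ofReal_pow,
      ← ofReal_mul, ofReal_re]
    linarith
  have hQx : Q x = 0 := by
    by_contra hne
    have hy : 0 < ‖Q x‖ ^ 2 := by positivity
    -- Positivity of `Q` along the line `x + t Q x`. Since the form at `x` is nonpositive, the
    -- linear term would dominate for small negative `t`.
    have key : ∀ t : ℝ, 0 ≤ t * (2 * ‖Q x‖ ^ 2) + t ^ 2 * (inner ℂ (Q x) (Q (Q x))).re := by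
      intro t
      have h1 := hp.re_inner_nonneg_right (x + (t : ℂ) • Q x)
      rw [map_add, map_smul, inner_add_left, inner_add_right, inner_add_right, inner_smul_left,
        inner_smul_left, inner_smul_right, inner_smul_right, ← hp.inner_left_eq_inner_right x (Q x),
        inner_self_eq_norm_sq_to_K] at h1
      simp only [RCLike.re_to_complex, RCLike.ofReal_eq_complex_ofReal, conj_ofReal] at h1
      rw [← ofReal_pow, ← mul_assoc, ← ofReal_mul, ← ofReal_mul, add_re, add_re, add_re, ofReal_re,
        re_ofReal_mul] at h1
      nlinarith
    set c := (inner ℂ (Q x) (Q (Q x))).re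
    have h2 := key (-(‖Q x‖ ^ 2 / (|c| + 1)))
    have hc1 : 0 < |c| + 1 := by positivity
    have h3 : c * (‖Q x‖ ^ 2 / (|c| + 1)) ≤ ‖Q x‖ ^ 2 := by
      rw [mul_div_assoc', div_le_iff₀ hc1]
      nlinarith [le_abs_self c]
    have h4 : 0 < ‖Q x‖ ^ 2 / (|c| + 1) := by positivity
    nlinarith
  rw [hQ, sub_apply, algebraMap_real_apply, sub_eq_zero] at hQx
  exact hQx.symm

/-- Continuous functional calculus for `w ↦ (z - w)⁻¹`; normality turns the supremum over the
spectrum into an operator norm. -/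
lemma exists_resolvent {A : H →L[ℂ] H} (hA : IsSelfAdjoint A) {z : ℂ} {δ : ℝ} (hδ : 0 < δ)
    (h : ∀ w ∈ spectrum ℂ A, δ ≤ ‖z - w‖) :
    ∃ R : H →L[ℂ] H, ‖R‖ ≤ δ⁻¹ ∧ (∀ x, R (z • x - A x) = x) ∧ ∀ x, z • R x - A (R x) = x := by
  have hn : IsStarNormal A := hA.isStarNormal
  have hne : ∀ w ∈ spectrum ℂ A, z - w ≠ 0 := fun w hw h0 => by
    have := h w hw
    rw [h0, norm_zero] at this
    linarith
  have hcont : ContinuousOn (fun w => (z - w)⁻¹) (spectrum ℂ A) :=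
    ContinuousOn.inv₀ (by fun_prop) hne
  have hz : cfc (fun w : ℂ => z - w) A = algebraMap ℂ (H →L[ℂ] H) z - A := by
    rw [cfc_sub (fun _ => z) (fun w => w) A, cfc_const z A, cfc_id' ℂ A]
  have happ : ∀ x, (algebraMap ℂ (H →L[ℂ] H) z - A) x = z • x - A x := fun x => by
    rw [sub_apply, Algebra.algebraMap_eq_smul_one]
    rfl
  refine ⟨cfc (fun w => (z - w)⁻¹) A, norm_cfc_le (by positivity) fun w hw => ?_, fun x => ?_,
    fun x => ?_⟩
  · rw [norm_inv]
    exact inv_anti₀ hδ (h w hw)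
  · rw [← happ, ← hz, ← mul_apply_eq_comp, ← cfc_mul _ _ A hcont (by fun_prop),
      cfc_congr (g := fun _ => 1) (fun w hw => inv_mul_cancel₀ (hne w hw)), cfc_const_one ℂ A]
    rfl
  · rw [← happ, ← hz, ← mul_apply_eq_comp, ← cfc_mul _ _ A (by fun_prop) hcont,
      cfc_congr (g := fun _ => 1) (fun w hw => mul_inv_cancel₀ (hne w hw)), cfc_const_one ℂ A]
    rfl

/-- The operator `A` with the component along `φ` removed. -/
def deflate (A : H →L[ℂ] H) (φ : H) : H →L[ℂ] H :=
  A - (innerSL ℂ φ ∘L A).smulRight φ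

lemma deflate_apply (A : H →L[ℂ] H) (φ x : H) :
    deflate A φ x = A x - inner ℂ φ (A x) • φ := rfl

lemma inner_eigenvector {A : H →L[ℂ] H} (hA : IsSelfAdjoint A) {φ : H} {lam : ℝ}
    (h : A φ = (lam : ℂ) • φ) (x : H) : inner ℂ φ (A x) = lam * inner ℂ φ x := by
  have := (ContinuousLinearMap.isSelfAdjoint_iff_isSymmetric.1 hA) φ x
  simp only [ContinuousLinearMap.coe_coe] at this
  rw [← this, h, inner_smul_left, conj_ofReal]

lemma isSelfAdjoint_deflate {A : H →L[ℂ] H} (hA : IsSelfAdjoint A) {φ : H} {lam : ℝ}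
    (h : A φ = (lam : ℂ) • φ) : IsSelfAdjoint (deflate A φ) := by
  rw [ContinuousLinearMap.isSelfAdjoint_iff_isSymmetric]
  intro x y
  have hs := (ContinuousLinearMap.isSelfAdjoint_iff_isSymmetric.1 hA) x y
  simp only [ContinuousLinearMap.coe_coe, deflate_apply] at hs ⊢
  rw [inner_sub_left, inner_sub_right, inner_smul_left, inner_smul_right, hs,
    inner_eigenvector hA h, inner_eigenvector hA h, map_mul, conj_ofReal, inner_conj_symm]
  ring

lemma isCompactOperator_deflate {A : H →L[ℂ] H} (hA : IsCompactOperator A) (φ : H) :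
    IsCompactOperator (deflate A φ) := by
  have h : deflate A φ = (1 - (innerSL ℂ φ).smulRight φ) ∘L A := by
    ext x
    rfl
  rw [h]
  exact hA.clm_comp (1 - (innerSL ℂ φ).smulRight φ : H →L[ℂ] H)

/-- Deflation fixes the action on eigenvectors orthogonal to `φ` and sends `φ` to zero. Since the
eigenvalue is simple it disappears, and the new kernel vector adds nothing because `0` already
belongs to the spectrum. -/
lemma spectrum_deflate {A : H →L[ℂ] H} (hA : IsSelfAdjoint A) (hc : IsCompactOperator A) {φ : H}
    {lam : ℝ} (h : A φ = (lam : ℂ) • φ) (hn : ‖φ‖ = 1) (hl : lam ≠ 0)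
    (hs : ∀ x, A x = (lam : ℂ) • x → ∃ c : ℂ, x = c • φ) (h0 : (0 : ℂ) ∈ spectrum ℂ A) :
    spectrum ℂ (deflate A φ) = spectrum ℂ A \ {(lam : ℂ)} := by
  have hφ : φ ≠ 0 := by rw [← norm_ne_zero_iff, hn]; exact one_ne_zero
  have hφφ : inner ℂ φ φ = 1 := by rw [inner_self_eq_norm_sq_to_K, hn]; simp
  have hl' : (lam : ℂ) ≠ 0 := by exact_mod_cast hl
  have hsa := isSelfAdjoint_deflate hA h
  have hD : deflate A φ φ = 0 := by
    rw [deflate_apply, inner_eigenvector hA h, hφφ, h, mul_one, sub_self]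
  ext μ
  rcases eq_or_ne μ 0 with rfl | hμ
  · refine ⟨fun _ => ⟨h0, fun hh => hl' (mem_singleton_iff.1 hh).symm⟩, fun _ => ?_⟩
    exact mem_spectrum_of_eigenvector hφ (by rw [hD, zero_smul])
  rw [Set.mem_sdiff, mem_singleton_iff, mem_spectrum_iff_exists_eigenvector hc hμ,
    mem_spectrum_iff_exists_eigenvector (isCompactOperator_deflate hc φ) hμ]
  constructor
  · rintro ⟨x, hx, hDx⟩
    have h1 : inner ℂ φ x = 0 := by
      have := inner_eigenvector hsa (lam := 0) (by rw [hD, ofReal_zero, zero_smul]) x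
      rw [hDx, inner_smul_right, ofReal_zero, zero_mul] at this
      exact (mul_eq_zero.1 this).resolve_left hμ
    rw [deflate_apply, inner_eigenvector hA h, h1, mul_zero, zero_smul, sub_zero] at hDx
    refine ⟨⟨x, hx, hDx⟩, ?_⟩
    rintro rfl
    obtain ⟨c, rfl⟩ := hs x hDx
    rw [inner_smul_right, hφφ, mul_one] at h1
    exact hx (by rw [h1, zero_smul])
  · rintro ⟨⟨x, hx, hAx⟩, hne⟩
    refine ⟨x, hx, ?_⟩
    have := inner_eigenvector hA h x
    rw [hAx, inner_smul_right, mul_eq_mul_right_iff] at this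
    rw [deflate_apply, hAx, inner_smul_right, this.resolve_left hne, mul_zero, zero_smul, sub_zero]

end Hilbert


/-! ### The Newtonian potential operator -/

section

variable {D : Set E3} [hD : Fact (IsOpen D)] [hb : Fact (Bornology.IsBounded D)]

variable (D) in
/-- The Newtonian potential as an operator on `L²(D)`. -/
def newt : L2 D →L[ℂ] L2 D := inclL2 D ∘L potE D 0

lemma newt_ae (f : L2 D) : newt D f =ᵐ[volume.restrict D] convFun D (green 0) f :=
  (inclL2_ae _).trans (potE_ae 0 f)

lemma green_zero (x : E3) : green 0 x = (((4 * Real.pi * ‖x‖)⁻¹ : ℝ) : ℂ) := by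
  simp [green]

lemma stronglyMeasurable_green (z : ℂ) : StronglyMeasurable (green z) :=
  (measurable_green z).stronglyMeasurable

lemma inner_newt_right (f g : L2 D) :
    inner ℂ f (newt D g) = ∫ x in D, (starRingEnd ℂ) (f x) * convFun D (green 0) g x := by
  rw [L2.inner_def]
  refine integral_congr_ae ?_
  filter_upwards [newt_ae g] with x hx
  rw [hx, RCLike.inner_apply, mul_comm]

lemma integrable_conj_L2 (f : L2 D) :
    Integrable (fun x => (starRingEnd ℂ) (f x)) (volume.restrict D) :=
  (Lp.memLp f).star.integrable one_le_two

lemma isSelfAdjoint_newt : IsSelfAdjoint (newt D) := by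
  rw [ContinuousLinearMap.isSelfAdjoint_iff_isSymmetric]
  intro f g
  simp only [ContinuousLinearMap.coe_coe]
  rw [← inner_conj_symm (newt D f) g, inner_newt_right, inner_newt_right,
    integral_mul_convFun (stronglyMeasurable_green 0) (memLp_green_diffBall 0)
      (integrable_conj_L2 f), ← integral_conj]
  congr 1
  ext y
  rw [map_mul, Complex.conj_conj, mul_comm, convFun, ← integral_conj]
  congr 2
  ext x
  rw [map_mul, green_zero, green_zero, conj_ofReal, norm_sub_rev]

lemma isCompactOperator_newt (hne : D.Nonempty) : IsCompactOperator (newt D) :=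
  isCompactOperator_conv (greenKer D 0) hne

lemma eq_inclL2_of_newt_eq {f : L2 D} {lam : ℂ} (hl : lam ≠ 0) (h : newt D f = lam • f) :
    inclL2 D (lam⁻¹ • potE D 0 f) = f := by
  rw [map_smul]
  change lam⁻¹ • newt D f = f
  rw [h, inv_smul_smul₀ hl]

/-! #### Test functions concentrated on small balls -/

/-- The indicator of a ball of radius `s` and volume `m`: points of the ball are at distance at most
`2s`, so the energy is at least `m² / (8πs)`, while the pairing with a bounded function is only of
order `m`. As `s → 0` the energy outgrows every multiple of `m²`. -/
lemma exists_concentrated_test (hne : D.Nonempty) (K : ℝ) :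
    ∃ f : L2 D, ∃ m > (0 : ℝ), K * m ^ 2 < (inner ℂ f (newt D f)).re ∧
      ∀ φ : Linf D, ‖inner ℂ (inclL2 D φ) f‖ ≤ ‖φ‖ * m := by
  obtain ⟨x₀, hx₀⟩ := hne
  obtain ⟨s₀, hs₀, hball⟩ := Metric.isOpen_iff.1 hD.out x₀ hx₀
  -- `s₀` keeps the ball inside `D`; the second entry gives `(8πs)⁻¹ ≥ |K| + 1 > K`.
  set s := min s₀ (8 * Real.pi * (|K| + 1))⁻¹ with hs
  have hπ := Real.pi_pos
  have hs0 : 0 < s := by positivity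
  have hB : Metric.ball x₀ s ⊆ D := (Metric.ball_subset_ball (min_le_left _ _)).trans hball
  set B := Metric.ball x₀ s with hBdef
  have hBm : MeasurableSet B := Metric.isOpen_ball.measurableSet
  have hBf : volume B ≠ ∞ := measure_ball_lt_top.ne
  have hBr : (volume.restrict D) B = volume B := by
    rw [Measure.restrict_apply hBm, inter_eq_left.2 hB]
  set m := (volume B).toReal with hm
  have hm0 : 0 < m := ENNReal.toReal_pos (Metric.measure_ball_pos _ _ hs0).ne' hBf
  set f : L2 D := indicatorConstLp 2 hBm (by rwa [hBr]) (1 : ℂ) with hf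
  have hfae : f =ᵐ[volume.restrict D] B.indicator fun _ => (1 : ℂ) := indicatorConstLp_coeFn
  have hint : ∀ F : E3 → ℂ, ∫ x in D, F x * f x = ∫ x in B, F x := by
    intro F
    calc ∫ x in D, F x * f x = ∫ x in D, B.indicator F x := by
          refine integral_congr_ae ?_
          filter_upwards [hfae] with x hx
          rw [hx]
          by_cases hxB : x ∈ B
          · rw [indicator_of_mem hxB, indicator_of_mem hxB, mul_one]
          · rw [indicator_of_notMem hxB, indicator_of_notMem hxB, mul_zero]
      _ = ∫ x in B, F x := by
          rw [integral_indicator hBm, Measure.restrict_restrict hBm, inter_eq_left.2 hB]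
  have hmB : (volume.restrict B).real univ = m := by
    rw [measureReal_restrict_apply MeasurableSet.univ, univ_inter]; rfl
  have hfin : IsFiniteMeasure (volume.restrict B) := ⟨by
    rw [Measure.restrict_apply_univ]; exact hBf.lt_top⟩
  refine ⟨f, m, hm0, ?_, fun φ => ?_⟩
  · have hpot : ∀ x ∈ B, m * (8 * Real.pi * s)⁻¹ ≤ (convFun D (green 0) f x).re := by
      intro x hx
      have hi : IntegrableOn (fun y => green 0 (x - y)) B := by
        refine MemLp.integrable (q := 2) one_le_two ?_
        exact (memLp_sub_left (memLp_green_diffBall 0) (hB hx)).mono_measure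
          (Measure.restrict_mono hB le_rfl)
      rw [convFun, hint]
      have h1 : (∫ y in B, green 0 (x - y)) = ((∫ y in B, (4 * Real.pi * ‖x - y‖)⁻¹ : ℝ) : ℂ) := by
        rw [← integral_complex_ofReal]
        simp only [green_zero]
      rw [h1, ofReal_re]
      have h2 : ∫ _y in B, (8 * Real.pi * s)⁻¹ = m * (8 * Real.pi * s)⁻¹ := by
        rw [integral_const, hmB, smul_eq_mul]
      rw [← h2]
      refine integral_mono_ae (integrable_const _) ?_ ?_
      · refine hi.re.congr (Eventually.of_forall fun y => ?_)
        simp only [green_zero]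
        exact ofReal_re _
      · have hne : ∀ᵐ y ∂volume.restrict B, y ≠ x := by
          refine ae_restrict_of_ae ?_
          rw [ae_iff]
          simp
        filter_upwards [ae_restrict_mem hBm, hne] with y hy hyx
        have h3 : 0 < ‖x - y‖ := norm_pos_iff.2 (sub_ne_zero.2 hyx.symm)
        refine inv_anti₀ (by positivity) ?_
        have h4 : ‖x - y‖ ≤ 2 * s := by
          rw [← dist_eq_norm]
          have := dist_triangle_right x y x₀
          have h5 := Metric.mem_ball.1 hx
          have h6 := Metric.mem_ball.1 hy
          linarith
        nlinarith
    have h1 : m * (m * (8 * Real.pi * s)⁻¹) ≤ (inner ℂ f (newt D f)).re := by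
      have hE : inner ℂ f (newt D f) = ∫ x in B, convFun D (green 0) f x := by
        rw [inner_newt_right, ← hint]
        refine integral_congr_ae ?_
        filter_upwards [hfae] with x hx
        rw [hx]
        by_cases hxB : x ∈ B
        · rw [indicator_of_mem hxB, map_one, mul_comm]
        · rw [indicator_of_notMem hxB, map_zero, zero_mul, mul_zero]
      have hi : IntegrableOn (fun x => convFun D (green 0) f x) B := by
        have h3 := ((Lp.memLp (newt D f)).ae_eq (newt_ae f)).mono_measure
          (Measure.restrict_mono hB le_rfl)
        exact h3.integrable one_le_two
      have hre : (∫ x in B, convFun D (green 0) f x).re = ∫ x in B, (convFun D (green 0) f x).re :=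
        (integral_re hi).symm
      rw [hE, hre]
      have h2 : ∫ _y in B, m * (8 * Real.pi * s)⁻¹ = m * (m * (8 * Real.pi * s)⁻¹) := by
        rw [integral_const, hmB, smul_eq_mul]
      rw [← h2]
      refine setIntegral_mono_on (integrable_const _) hi.re hBm hpot
    refine lt_of_lt_of_le ?_ h1
    have h2 : |K| + 1 ≤ (8 * Real.pi * s)⁻¹ := by
      rw [le_inv_comm₀ (by positivity) (by positivity)]
      have h3 : s ≤ (8 * Real.pi * (|K| + 1))⁻¹ := min_le_right _ _
      calc 8 * Real.pi * s ≤ 8 * Real.pi * (8 * Real.pi * (|K| + 1))⁻¹ := by gcongr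
        _ = (|K| + 1)⁻¹ := by field_simp
    have h3 := le_abs_self K
    have h4 : 0 < m ^ 2 := by positivity
    nlinarith
  · rw [L2.inner_def]
    have hE : ∫ x in D, inner ℂ (inclL2 D φ x) (f x) =
        ∫ x in B, (starRingEnd ℂ) (inclL2 D φ x) := by
      rw [← hint]
      refine integral_congr_ae (Eventually.of_forall fun x => ?_)
      simp only [RCLike.inner_apply]
      rw [mul_comm]
    rw [hE]
    have h1 : ∀ᵐ x ∂volume.restrict B, ‖(starRingEnd ℂ) (inclL2 D φ x)‖ ≤ ‖φ‖ := by
      refine ae_restrict_of_ae_restrict_of_subset hB ?_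
      filter_upwards [inclL2_ae φ, ae_norm_le_Linf φ] with x hx hx'
      rw [RCLike.norm_conj, hx]
      exact hx'
    have := norm_integral_le_of_norm_le_const h1
    rwa [hmB] at this

/-- If the potential were invertible, every `f` would be a potential, with sup norm at most `C ‖f‖`.
A concentrated test function would then satisfy `‖f‖ ≤ C m`, which bounds its energy by a fixed
multiple of `m²`. -/
lemma zero_mem_spectrum_newt (hne : D.Nonempty) : (0 : ℂ) ∈ spectrum ℂ (newt D) := by
  rw [spectrum.zero_mem_iff]
  rintro ⟨U, hU⟩
  set S : L2 D →L[ℂ] L2 D := ↑U⁻¹ with hS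
  have hNS : ∀ h, newt D (S h) = h := fun h => by
    rw [← mul_apply_eq_comp, ← hU, hS, Units.mul_inv]
    rfl
  set C := ‖potE D 0‖ * ‖S‖ with hC
  obtain ⟨f, m, hm, h1, h2⟩ := exists_concentrated_test hne (‖newt D‖ * C ^ 2)
  have h3 : ‖f‖ ^ 2 ≤ C * ‖f‖ * m := by
    have h4 := h2 (potE D 0 (S f))
    rw [show inclL2 D (potE D 0 (S f)) = f from hNS f, inner_self_eq_norm_sq_to_K] at h4
    simp only [norm_pow, RCLike.norm_ofReal, abs_norm] at h4
    refine h4.trans ?_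
    gcongr
    calc ‖potE D 0 (S f)‖ ≤ ‖potE D 0‖ * ‖S f‖ := ContinuousLinearMap.le_opNorm _ _
      _ ≤ ‖potE D 0‖ * (‖S‖ * ‖f‖) := by gcongr; exact ContinuousLinearMap.le_opNorm _ _
      _ = C * ‖f‖ := by rw [hC]; ring
  have hC0 : 0 ≤ C := by positivity
  have h4 : ‖f‖ ≤ C * m := by
    rcases (norm_nonneg f).eq_or_lt with h0 | h0
    · rw [← h0]; positivity
    · nlinarith
  have h5 : (inner ℂ f (newt D f)).re ≤ ‖newt D‖ * (C * m) ^ 2 := by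
    calc (inner ℂ f (newt D f)).re ≤ ‖inner ℂ f (newt D f)‖ := re_le_norm _
      _ ≤ ‖f‖ * ‖newt D f‖ := norm_inner_le_norm _ _
      _ ≤ ‖f‖ * (‖newt D‖ * ‖f‖) := by gcongr; exact ContinuousLinearMap.le_opNorm _ _
      _ = ‖newt D‖ * ‖f‖ ^ 2 := by ring
      _ ≤ _ := by gcongr
  nlinarith

/-- A bounded rank-one perturbation cannot make the Newtonian potential nonpositive. -/
lemma pos_of_eigenvalues_le (hne : D.Nonempty) {A : L2 D →L[ℂ] L2 D} (hA : IsSelfAdjoint A)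
    (hc : IsCompactOperator A) {b C : ℝ} (hC : 0 ≤ C) (φ : Linf D)
    (h : ∀ f, (inner ℂ f (newt D f)).re ≤
      (inner ℂ f (A f)).re + C * ‖inner ℂ (inclL2 D φ) f‖ ^ 2)
    (hev : ∀ μ : ℝ, ∀ x ≠ 0, A x = (μ : ℂ) • x → μ ≤ b) : 0 < b := by
  by_contra! hb
  obtain ⟨f, m, hm, h1, h2⟩ := exists_concentrated_test hne (C * ‖φ‖ ^ 2)
  have h3 := re_inner_le_of_eigenvalues_le hA hc le_rfl
    (fun μ x hx hAx => (hev μ x hx hAx).trans hb) f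
  have h4 : ‖inner ℂ (inclL2 D φ) f‖ ^ 2 ≤ (‖φ‖ * m) ^ 2 := by gcongr; exact h2 φ
  have h5 := mul_le_mul_of_nonneg_left h4 hC
  nlinarith [h f]

/-! #### The ground state -/

/-- The modulus of a square integrable function. -/
def absL2 (f : L2 D) : L2 D := ((Lp.memLp f).norm.ofReal (K := ℂ)).toLp _

lemma absL2_ae (f : L2 D) : absL2 f =ᵐ[volume.restrict D] fun x => ((‖f x‖ : ℝ) : ℂ) :=
  MemLp.coeFn_toLp _

lemma norm_absL2 (f : L2 D) : ‖absL2 f‖ = ‖f‖ := by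
  rw [Lp.norm_def, Lp.norm_def]
  congr 1
  refine eLpNorm_congr_norm_ae ?_
  filter_upwards [absL2_ae f] with x hx
  rw [hx, norm_real, norm_norm]

lemma convFun_absL2 (f : L2 D) (x : E3) : convFun D (green 0) (absL2 f) x =
    ((∫ y in D, (4 * Real.pi * ‖x - y‖)⁻¹ * ‖f y‖ : ℝ) : ℂ) := by
  rw [← integral_complex_ofReal]
  refine integral_congr_ae ?_
  filter_upwards [absL2_ae f] with y hy
  rw [hy, green_zero]
  push_cast
  ring

lemma norm_convFun_le_absL2 (f : L2 D) (x : E3) :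
    ‖convFun D (green 0) f x‖ ≤ (convFun D (green 0) (absL2 f) x).re := by
  rw [convFun_absL2, ofReal_re]
  refine (norm_integral_le_integral_norm _).trans (le_of_eq ?_)
  congr 1
  ext y
  rw [norm_mul, green_zero, norm_real, Real.norm_of_nonneg]
  have := Real.pi_pos
  positivity

/-- The kernel is nonnegative, so replacing a function by its modulus cannot lower the energy. -/
lemma re_inner_newt_le_absL2 (f : L2 D) :
    (inner ℂ f (newt D f)).re ≤ (inner ℂ (absL2 f) (newt D (absL2 f))).re := by
  have hi : ∀ g h : L2 D, Integrable (fun x => (starRingEnd ℂ) (g x) * convFun D (green 0) h x)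
      (volume.restrict D) := by
    intro g h
    refine (L2.integrable_inner (𝕜 := ℂ) g (newt D h)).congr ?_
    filter_upwards [newt_ae h] with x hx
    rw [hx, RCLike.inner_apply, mul_comm]
  rw [inner_newt_right, inner_newt_right]
  have e1 : (∫ x in D, (starRingEnd ℂ) (absL2 f x) * convFun D (green 0) (absL2 f) x).re =
      ∫ x in D, ((starRingEnd ℂ) (absL2 f x) * convFun D (green 0) (absL2 f) x).re :=
    (integral_re (hi _ _)).symm
  rw [e1]
  refine (re_le_norm _).trans ((norm_integral_le_integral_norm _).trans ?_)
  refine integral_mono_ae (hi _ _).norm (hi _ _).re ?_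
  filter_upwards [absL2_ae f] with x hx
  rw [hx, conj_ofReal, re_ofReal_mul, norm_mul, RCLike.norm_conj]
  gcongr
  exact norm_convFun_le_absL2 f x

/-- `|f|` also maximizes the energy, hence is an eigenvector for the same value. Evaluating both
eigenvalue equations at one point `x` gives equality in the triangle inequality for the integral;
the kernel is strictly positive between all points of `D`, so the phase is constant almost
everywhere. Connectedness of `D` plays no role. -/
lemma exists_phase {lam : ℝ} (hne : D.Nonempty) (hl : 0 < lam)
    (hev : ∀ μ : ℝ, ∀ x ≠ 0, newt D x = (μ : ℂ) • x → μ ≤ lam) {f : L2 D}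
    (hf : newt D f = (lam : ℂ) • f) :
    ∃ s : ℂ, ‖s‖ = 1 ∧ ∀ᵐ y ∂volume.restrict D, f y = s * ((‖f y‖ : ℝ) : ℂ) := by
  have habs : newt D (absL2 f) = (lam : ℂ) • absL2 f := by
    refine eigenvector_of_re_inner_eq isSelfAdjoint_newt (isCompactOperator_newt hne) hl.le hev ?_
    refine le_trans (le_of_eq ?_) (re_inner_newt_le_absL2 f)
    rw [norm_absL2, hf, inner_smul_right, inner_self_eq_norm_sq_to_K,
      RCLike.ofReal_eq_complex_ofReal, ← ofReal_pow, ← ofReal_mul, ofReal_re]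
  have hnb : (ae (volume.restrict D)).NeBot := by
    rw [ae_neBot, Ne, Measure.restrict_eq_zero]
    exact (hD.out.measure_pos volume hne).ne'
  obtain ⟨x, hxD, h1, h2⟩ : ∃ x ∈ D, convFun D (green 0) f x = lam * f x ∧
      convFun D (green 0) (absL2 f) x = lam * ((‖f x‖ : ℝ) : ℂ) := by
    have : ∀ᵐ x ∂volume.restrict D, x ∈ D ∧ convFun D (green 0) f x = lam * f x ∧
        convFun D (green 0) (absL2 f) x = lam * ((‖f x‖ : ℝ) : ℂ) := by
      have e1 := newt_ae f
      have e2 := newt_ae (absL2 f)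
      rw [hf] at e1
      rw [habs] at e2
      filter_upwards [ae_restrict_mem hD.out.measurableSet, e1, e2, absL2_ae f,
        Lp.coeFn_smul (lam : ℂ) f, Lp.coeFn_smul (lam : ℂ) (absL2 f)] with x a1 a2 a3 a4 a5 a6
      rw [← a2, ← a3, a5, a6, Pi.smul_apply, Pi.smul_apply, a4]
      exact ⟨a1, rfl, rfl⟩
    exact this.exists
  obtain ⟨s, hs, hsx⟩ : ∃ s : ℂ, ‖s‖ = 1 ∧ (starRingEnd ℂ) s * f x = ((‖f x‖ : ℝ) : ℂ) := by
    rcases eq_or_ne (f x) 0 with h0 | h0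
    · exact ⟨1, norm_one, by rw [h0]; simp⟩
    · have hn : ((‖f x‖ : ℝ) : ℂ) ≠ 0 := by simpa using h0
      refine ⟨f x / ((‖f x‖ : ℝ) : ℂ), ?_, ?_⟩
      · rw [norm_div, norm_real, norm_norm, div_self (norm_ne_zero_iff.2 h0)]
      · rw [map_div₀, conj_ofReal, div_mul_eq_mul_div, conj_mul', div_eq_iff hn, sq]
  refine ⟨s, hs, ?_⟩
  have hss : s * (starRingEnd ℂ) s = 1 := by rw [mul_conj, normSq_eq_norm_sq, hs]; simp
  have hint := integrable_conv (memLp_green_diffBall 0) f hxD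
  set h : E3 → ℝ := fun y => (4 * Real.pi * ‖x - y‖)⁻¹ * ‖f y‖ -
    ((starRingEnd ℂ) s * (green 0 (x - y) * f y)).re with hh
  have hk : ∀ y, 0 ≤ (4 * Real.pi * ‖x - y‖)⁻¹ := fun y => by
    have := Real.pi_pos
    positivity
  have hfac : ∀ y, h y = (4 * Real.pi * ‖x - y‖)⁻¹ * (‖f y‖ - ((starRingEnd ℂ) s * f y).re) := by
    intro y
    rw [hh]
    beta_reduce
    rw [green_zero, mul_left_comm, re_ofReal_mul]
    ring
  have hpos : ∀ y, 0 ≤ ‖f y‖ - ((starRingEnd ℂ) s * f y).re := by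
    intro y
    have := re_le_norm ((starRingEnd ℂ) s * f y)
    rw [norm_mul, RCLike.norm_conj, hs, one_mul] at this
    linarith
  have hi1 : Integrable (fun y => (4 * Real.pi * ‖x - y‖)⁻¹ * ‖f y‖) (volume.restrict D) := by
    refine hint.norm.congr (Eventually.of_forall fun y => ?_)
    simp only [norm_mul, green_zero, norm_real, Real.norm_of_nonneg (hk y)]
  have hi2 : Integrable (fun y => ((starRingEnd ℂ) s * (green 0 (x - y) * f y)).re)
      (volume.restrict D) := (hint.const_mul _).re
  have hzero : ∫ y in D, h y = 0 := by
    rw [hh, integral_sub hi1 hi2]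
    have e1 : ∫ y in D, ((starRingEnd ℂ) s * (green 0 (x - y) * f y)).re = lam * ‖f x‖ := by
      have e2 : ∫ y in D, ((starRingEnd ℂ) s * (green 0 (x - y) * f y)).re =
          (∫ y in D, (starRingEnd ℂ) s * (green 0 (x - y) * f y)).re :=
        integral_re (hint.const_mul _)
      have e3 : ∫ y in D, green 0 (x - y) * f y = lam * f x := h1
      rw [e2, integral_const_mul, e3, mul_left_comm, hsx, ← ofReal_mul, ofReal_re]
    have e2 : ∫ y in D, (4 * Real.pi * ‖x - y‖)⁻¹ * ‖f y‖ = lam * ‖f x‖ := by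
      rw [convFun_absL2, ← ofReal_mul] at h2
      exact ofReal_injective h2
    rw [e1, e2, sub_self]
  have hae := (integral_eq_zero_iff_of_nonneg (f := h) (fun y => by
    rw [Pi.zero_apply, hfac]; exact mul_nonneg (hk y) (hpos y)) (hi1.sub hi2)).1 hzero
  have hne' : ∀ᵐ y ∂volume.restrict D, y ≠ x := by
    refine ae_restrict_of_ae ?_
    rw [ae_iff]
    simp
  filter_upwards [hae, hne'] with y hy hyx
  rw [Pi.zero_apply, hfac] at hy
  have h3 : (4 * Real.pi * ‖x - y‖)⁻¹ ≠ 0 := by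
    have := norm_pos_iff.2 (sub_ne_zero.2 hyx.symm)
    have := Real.pi_pos
    positivity
  have h4 := (mul_eq_zero.1 hy).resolve_left h3
  have h5 : ‖(starRingEnd ℂ) s * f y‖ = ‖f y‖ := by
    rw [norm_mul, RCLike.norm_conj, hs, one_mul]
  have h6 : (starRingEnd ℂ) s * f y = ((‖f y‖ : ℝ) : ℂ) := by
    rw [← h5]
    have h7 : ((starRingEnd ℂ) s * f y).re = ‖(starRingEnd ℂ) s * f y‖ := by rw [h5]; linarith
    exact (eq_coe_norm_of_nonneg (re_eq_norm.1 h7))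
  rw [← h6, ← mul_assoc, hss, one_mul]

/-- With constant phase, the modulus of the mean is the `L¹` norm. -/
lemma eq_zero_of_integral_eq_zero {lam : ℝ} (hne : D.Nonempty) (hl : 0 < lam)
    (hev : ∀ μ : ℝ, ∀ x ≠ 0, newt D x = (μ : ℂ) • x → μ ≤ lam) {f : L2 D}
    (hf : newt D f = (lam : ℂ) • f) (h0 : ∫ x in D, f x = 0) : f = 0 := by
  obtain ⟨s, hs, h⟩ := exists_phase hne hl hev hf
  have hs0 : s ≠ 0 := by rw [← norm_ne_zero_iff, hs]; exact one_ne_zero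
  rw [integral_congr_ae h, integral_const_mul, integral_complex_ofReal] at h0
  have h1 : ∫ x in D, ‖f x‖ = 0 := ofReal_eq_zero.1 ((mul_eq_zero.1 h0).resolve_left hs0)
  have h2 := (integral_eq_zero_iff_of_nonneg (fun x => norm_nonneg (f x))
    ((Lp.memLp f).integrable one_le_two).norm).1 h1
  rw [Lp.eq_zero_iff_ae_eq_zero]
  filter_upwards [h2] with x hx
  exact norm_eq_zero.1 hx

/-- Subtracting the multiple of `φ` with the same mean leaves an eigenvector of mean zero. -/
lemma eq_smul_of_eigenvector {lam : ℝ} (hne : D.Nonempty) (hl : 0 < lam)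
    (hev : ∀ μ : ℝ, ∀ x ≠ 0, newt D x = (μ : ℂ) • x → μ ≤ lam) {φ : L2 D} (hφ0 : φ ≠ 0)
    (hφ : newt D φ = (lam : ℂ) • φ) (f : L2 D) (hf : newt D f = (lam : ℂ) • f) :
    ∃ c : ℂ, f = c • φ := by
  have hI : ∫ x in D, φ x ≠ 0 := fun h => hφ0 (eq_zero_of_integral_eq_zero hne hl hev hφ h)
  set c := (∫ x in D, f x) / ∫ x in D, φ x with hc
  refine ⟨c, sub_eq_zero.1 (eq_zero_of_integral_eq_zero hne hl hev ?_ ?_)⟩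
  · rw [map_sub, map_smul, hf, hφ, smul_sub, smul_comm]
  · have h1 : ∫ x in D, (f - c • φ : L2 D) x = ∫ x in D, (f x - c * φ x) := by
      refine integral_congr_ae ?_
      filter_upwards [Lp.coeFn_sub f (c • φ), Lp.coeFn_smul c φ] with x hx hx'
      rw [hx, Pi.sub_apply, hx', Pi.smul_apply, smul_eq_mul]
    rw [h1, integral_sub ((Lp.memLp f).integrable one_le_two)
      (((Lp.memLp φ).integrable one_le_two).const_mul c), integral_const_mul, hc,
      div_mul_cancel₀ _ hI, sub_self]

end


/-! ### Conjugation, reflection and the cubic nonlinearity -/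

/-- Pointwise complex conjugation. -/
def conjLp {α : Type*} [MeasurableSpace α] (μ : Measure α) (p : ℝ≥0∞) :
    Lp ℂ p μ →ₗ⋆[ℂ] Lp ℂ p μ where
  toFun := star
  map_add' f g := by
    ext1
    filter_upwards [Lp.coeFn_star (f + g), Lp.coeFn_star f, Lp.coeFn_star g, Lp.coeFn_add f g,
      Lp.coeFn_add (star f) (star g)] with x h1 h2 h3 h4 h5
    rw [h1, h5, Pi.add_apply, h2, h3, Pi.star_apply, h4, Pi.add_apply, star_add, Pi.star_apply,
      Pi.star_apply]
  map_smul' c f := by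
    ext1
    filter_upwards [Lp.coeFn_star (c • f), Lp.coeFn_star f, Lp.coeFn_smul c f,
      Lp.coeFn_smul ((starRingEnd ℂ) c) (star f)] with x h1 h2 h3 h4
    rw [h1, h4, Pi.smul_apply, h2, Pi.star_apply, h3, Pi.smul_apply, star_smul, Pi.star_apply]
    rfl

lemma conjLp_ae {α : Type*} [MeasurableSpace α] {μ : Measure α} {p : ℝ≥0∞} (f : Lp ℂ p μ) :
    conjLp μ p f =ᵐ[μ] fun x => (starRingEnd ℂ) (f x) := Lp.coeFn_star f

lemma norm_conjLp {α : Type*} [MeasurableSpace α] {μ : Measure α} {p : ℝ≥0∞} [Fact (1 ≤ p)]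
    (f : Lp ℂ p μ) : ‖conjLp μ p f‖ = ‖f‖ := by
  rw [Lp.norm_def, Lp.norm_def]
  congr 1
  refine eLpNorm_congr_norm_ae ?_
  filter_upwards [conjLp_ae f] with x hx
  rw [hx, RCLike.norm_conj]

lemma conjLp_conjLp {α : Type*} [MeasurableSpace α] {μ : Measure α} {p : ℝ≥0∞} (f : Lp ℂ p μ) :
    conjLp μ p (conjLp μ p f) = f := star_star f

/-- Pointwise complex conjugation as a continuous real-linear map. -/
def conjLpL {α : Type*} [MeasurableSpace α] (μ : Measure α) (p : ℝ≥0∞) [Fact (1 ≤ p)] :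
    Lp ℂ p μ →L[ℝ] Lp ℂ p μ :=
  LinearMap.mkContinuous
    { toFun := conjLp μ p
      map_add' := map_add _
      map_smul' := fun c f => by
        have := (conjLp μ p).map_smulₛₗ (c : ℂ) f
        rw [conj_ofReal] at this
        exact this } 1 fun f => by
      rw [one_mul]
      exact (norm_conjLp f).le

/-- The reflection as a linear isometry. -/
def reflectL : E3 ≃ₗᵢ[ℝ] E3 where
  toFun := reflect
  invFun := reflect
  left_inv := reflect_reflect
  right_inv := reflect_reflect
  map_add' x y := by
    ext i
    fin_cases i <;> simp [reflect]
    ring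
  map_smul' c x := by
    ext i
    fin_cases i <;> simp [reflect]
  norm_map' x := by
    simp [EuclideanSpace.norm_eq, Fin.sum_univ_three, reflect]

lemma norm_reflect (x : E3) : ‖reflect x‖ = ‖x‖ := reflectL.norm_map x

lemma reflect_sub (x y : E3) : reflect (x - y) = reflect x - reflect y := map_sub reflectL x y

lemma measurableEmbedding_reflect : MeasurableEmbedding reflect :=
  reflectL.toHomeomorph.measurableEmbedding

lemma green_reflect (z : ℂ) (x : E3) : green z (reflect x) = green z x := by
  rw [green, green, norm_reflect]

lemma conj_green (z : ℂ) (x : E3) :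
    (starRingEnd ℂ) (green z x) = green (-(starRingEnd ℂ) z) x := by
  rw [green, green, map_div₀, ← exp_conj]
  simp only [map_mul, conj_I, conj_ofReal, map_ofNat, neg_mul, mul_neg]

section

variable {D : Set E3} [hD : Fact (IsOpen D)] [hb : Fact (Bornology.IsBounded D)]

lemma measurePreserving_reflect (hR : reflect ⁻¹' D = D) :
    MeasurePreserving reflect (volume.restrict D) (volume.restrict D) := by
  have h := (reflectL.measurePreserving (F := E3)).restrict_preimage
    (s := D) hD.out.measurableSet
  rw [show (⇑reflectL : E3 → E3) = reflect from rfl, hR] at h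
  exact h

/-- Composition with the reflection. -/
def reflLp (hR : reflect ⁻¹' D = D) (p : ℝ≥0∞) [Fact (1 ≤ p)] :
    Lp ℂ p (volume.restrict D) →L[ℂ] Lp ℂ p (volume.restrict D) :=
  (Lp.compMeasurePreservingₗᵢ ℂ reflect (measurePreserving_reflect hR)).toContinuousLinearMap

lemma reflLp_ae (hR : reflect ⁻¹' D = D) {p : ℝ≥0∞} [Fact (1 ≤ p)]
    (f : Lp ℂ p (volume.restrict D)) :
    reflLp hR p f =ᵐ[volume.restrict D] fun x => f (reflect x) :=
  Lp.coeFn_compMeasurePreserving f (measurePreserving_reflect hR)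

lemma norm_reflLp (hR : reflect ⁻¹' D = D) {p : ℝ≥0∞} [Fact (1 ≤ p)]
    (f : Lp ℂ p (volume.restrict D)) : ‖reflLp hR p f‖ = ‖f‖ :=
  (Lp.compMeasurePreservingₗᵢ ℂ reflect (measurePreserving_reflect hR)).norm_map f

lemma ae_reflect (hR : reflect ⁻¹' D = D) {q : E3 → Prop} (h : ∀ᵐ x ∂volume.restrict D, q x) :
    ∀ᵐ x ∂volume.restrict D, q (reflect x) :=
  (measurePreserving_reflect hR).quasiMeasurePreserving.ae h

lemma integral_reflect (hR : reflect ⁻¹' D = D) (F : E3 → ℂ) :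
    ∫ x in D, F (reflect x) = ∫ x in D, F x :=
  (measurePreserving_reflect hR).integral_comp measurableEmbedding_reflect F

lemma inner_inclL2 (u v : Linf D) :
    inner ℂ (inclL2 D u) (inclL2 D v) = ∫ x in D, (starRingEnd ℂ) (u x) * v x := by
  rw [L2.inner_def]
  refine integral_congr_ae ?_
  filter_upwards [inclL2_ae u, inclL2_ae v] with x h1 h2
  rw [h1, h2, RCLike.inner_apply, mul_comm]

lemma inner_reflLp (hR : reflect ⁻¹' D = D) (u v : Linf D) :
    inner ℂ (inclL2 D (reflLp hR ∞ u)) (inclL2 D (reflLp hR ∞ v)) =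
      inner ℂ (inclL2 D u) (inclL2 D v) := by
  rw [inner_inclL2, inner_inclL2, ← integral_reflect hR fun x => (starRingEnd ℂ) (u x) * v x]
  refine integral_congr_ae ?_
  filter_upwards [reflLp_ae hR u, reflLp_ae hR v] with x h1 h2
  rw [h1, h2]

lemma inner_conjLp (u v : Linf D) :
    inner ℂ (inclL2 D (conjLp _ ∞ u)) (inclL2 D (conjLp _ ∞ v)) =
      inner ℂ (inclL2 D v) (inclL2 D u) := by
  rw [inner_inclL2, inner_inclL2]
  refine integral_congr_ae ?_
  filter_upwards [conjLp_ae u, conjLp_ae v] with x h1 h2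
  rw [h1, h2, Complex.conj_conj, mul_comm]

lemma convFun_congr_right (k : E3 → ℂ) {f g : E3 → ℂ} (h : f =ᵐ[volume.restrict D] g) (x : E3) :
    convFun D k f x = convFun D k g x := by
  refine integral_congr_ae ?_
  filter_upwards [h] with y hy
  rw [hy]

lemma reflLp_potE (hR : reflect ⁻¹' D = D) (z : ℂ) (u : Linf D) :
    reflLp hR ∞ (potE D z (inclL2 D u)) = potE D z (inclL2 D (reflLp hR ∞ u)) := by
  ext1
  filter_upwards [reflLp_ae hR (potE D z (inclL2 D u)), ae_reflect hR (potE_ae z (inclL2 D u)),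
    potE_ae z (inclL2 D (reflLp hR ∞ u))] with x h1 h2 h3
  rw [h1, h2, h3]
  change convFun D (green z) _ _ = convFun D (green z) _ _
  rw [convFun_congr_right _ (inclL2_ae u),
    convFun_congr_right _ ((inclL2_ae _).trans (reflLp_ae hR u)), convFun, ← integral_reflect hR]
  simp only [← reflect_sub, green_reflect]
  rfl

lemma conjLp_potE (z : ℂ) (u : Linf D) :
    conjLp _ ∞ (potE D z (inclL2 D u)) =
      potE D (-(starRingEnd ℂ) z) (inclL2 D (conjLp _ ∞ u)) := by
  ext1
  filter_upwards [conjLp_ae (potE D z (inclL2 D u)), potE_ae z (inclL2 D u),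
    potE_ae (-(starRingEnd ℂ) z) (inclL2 D (conjLp _ ∞ u))] with x h1 h2 h3
  rw [h1, h2, h3]
  change (starRingEnd ℂ) (convFun D (green z) _ _) = convFun D (green _) _ _
  rw [convFun_congr_right _ (inclL2_ae u),
    convFun_congr_right _ ((inclL2_ae _).trans (conjLp_ae u)), convFun, ← integral_conj]
  simp only [map_mul, conj_green]
  rfl

/-- The cubic nonlinearity `u ↦ |u|² u` on bounded functions. -/
def cubic (u : Linf D) : Linf D :=
  (ContinuousLinearMap.mul ℝ ℂ).holderL (volume.restrict D) ∞ ∞ ∞ u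
    ((ContinuousLinearMap.mul ℝ ℂ).holderL (volume.restrict D) ∞ ∞ ∞ u (conjLpL _ ∞ u))

lemma cubic_ae (u : Linf D) :
    cubic u =ᵐ[volume.restrict D] fun x => ((‖u x‖ : ℝ) : ℂ) ^ 2 * u x := by
  filter_upwards [(ContinuousLinearMap.mul ℝ ℂ).coeFn_holder (r := ∞) u
      ((ContinuousLinearMap.mul ℝ ℂ).holderL (volume.restrict D) ∞ ∞ ∞ u (conjLpL _ ∞ u)),
    (ContinuousLinearMap.mul ℝ ℂ).coeFn_holder (r := ∞) u (conjLpL _ ∞ u), conjLp_ae u]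
    with x h1 h2 h3
  refine h1.trans ?_
  rw [ContinuousLinearMap.mul_apply']
  refine (congrArg (u x * ·) h2).trans ?_
  rw [ContinuousLinearMap.mul_apply']
  change u x * (u x * conjLp _ ∞ u x) = _
  rw [h3, mul_conj']
  ring

/-- The map is trilinear over `ℝ` in `u`, `u` and its conjugate, with bounded products; hence it is
analytic in this class. -/
lemma contDiff_cubic : ContDiff ℝ ⊤ (cubic : Linf D → Linf D) := by
  unfold cubic
  have h : ContDiff ℝ ⊤ fun u : Linf D =>
      (ContinuousLinearMap.mul ℝ ℂ).holderL (volume.restrict D) ∞ ∞ ∞ u :=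
    ContinuousLinearMap.contDiff _
  exact h.clm_apply (h.clm_apply (ContinuousLinearMap.contDiff _))

lemma cubic_smul (c : ℂ) (u : Linf D) :
    cubic (c • u) = ((‖c‖ ^ 2 : ℝ) : ℂ) • c • cubic u := by
  ext1
  filter_upwards [cubic_ae (c • u), cubic_ae u, Lp.coeFn_smul c u, Lp.coeFn_smul c (cubic u),
    Lp.coeFn_smul ((‖c‖ ^ 2 : ℝ) : ℂ) (c • cubic u)] with x h1 h2 h3 h4 h5
  rw [h1, h5, Pi.smul_apply, h4, Pi.smul_apply, h2, h3, Pi.smul_apply, smul_eq_mul, smul_eq_mul,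
    smul_eq_mul, norm_mul]
  push_cast
  ring

lemma norm_cube_sub_le {a b : ℂ} {M : ℝ} (ha : ‖a‖ ≤ M) (hb : ‖b‖ ≤ M) :
    ‖((‖a‖ : ℝ) : ℂ) ^ 2 * a - ((‖b‖ : ℝ) : ℂ) ^ 2 * b‖ ≤ 3 * M ^ 2 * ‖a - b‖ := by
  have e : ((‖a‖ : ℝ) : ℂ) ^ 2 * a - ((‖b‖ : ℝ) : ℂ) ^ 2 * b =
      ((‖a‖ ^ 2 : ℝ) : ℂ) * (a - b) + (((‖a‖ - ‖b‖) * (‖a‖ + ‖b‖) : ℝ) : ℂ) * b := by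
    push_cast
    ring
  have h1 : |‖a‖ - ‖b‖| ≤ ‖a - b‖ := abs_norm_sub_norm_le a b
  have ha0 := norm_nonneg a
  have hb0 := norm_nonneg b
  have hM : 0 ≤ M := ha0.trans ha
  rw [e]
  refine (norm_add_le _ _).trans ?_
  rw [norm_mul, norm_mul, norm_real, norm_real, Real.norm_eq_abs, Real.norm_eq_abs, abs_pow,
    abs_norm, abs_mul, abs_of_nonneg (add_nonneg ha0 hb0)]
  calc ‖a‖ ^ 2 * ‖a - b‖ + |‖a‖ - ‖b‖| * (‖a‖ + ‖b‖) * ‖b‖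
      ≤ M ^ 2 * ‖a - b‖ + ‖a - b‖ * (M + M) * M := by gcongr
    _ = 3 * M ^ 2 * ‖a - b‖ := by ring

lemma norm_cubic_sub_le (M : ℝ) (u w : Linf D) (hu : ‖u‖ ≤ M) (hw : ‖w‖ ≤ M) :
    ‖cubic u - cubic w‖ ≤ 3 * M ^ 2 * ‖u - w‖ := by
  refine Linf_norm_le (by positivity) ?_
  filter_upwards [Lp.coeFn_sub (cubic u) (cubic w), cubic_ae u, cubic_ae w, ae_norm_le_Linf u,
    ae_norm_le_Linf w, ae_norm_le_Linf (u - w), Lp.coeFn_sub u w] with x h1 h2 h3 h4 h5 h6 h7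
  rw [h7, Pi.sub_apply] at h6
  rw [h1, Pi.sub_apply, h2, h3]
  refine (norm_cube_sub_le (h4.trans hu) (h5.trans hw)).trans ?_
  gcongr

lemma reflLp_cubic (hR : reflect ⁻¹' D = D) (u : Linf D) :
    reflLp hR ∞ (cubic u) = cubic (reflLp hR ∞ u) := by
  ext1
  filter_upwards [reflLp_ae hR (cubic u), ae_reflect hR (cubic_ae u), cubic_ae (reflLp hR ∞ u),
    reflLp_ae hR u] with x h1 h2 h3 h4
  rw [h1, h2, h3, h4]

lemma conjLp_cubic (u : Linf D) : conjLp _ ∞ (cubic u) = cubic (conjLp _ ∞ u) := by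
  ext1
  filter_upwards [conjLp_ae (cubic u), cubic_ae u, cubic_ae (conjLp _ ∞ u),
    conjLp_ae u] with x h1 h2 h3 h4
  rw [h1, h2, h3, h4, map_mul, map_pow, conj_ofReal, RCLike.norm_conj]

/-- Pointwise `t³ ≤ t² + t⁴`, and the integral of `|u|⁴` is the pairing of `u` with its cubic term.
Only the test function is measured in the sup norm. -/
lemma norm_inner_cubic_le (φ u : Linf D) :
    ‖inner ℂ (inclL2 D φ) (inclL2 D (cubic u))‖ ≤
      ‖φ‖ * (‖inclL2 D u‖ ^ 2 + ‖inclL2 D u‖ * ‖inclL2 D (cubic u)‖) := by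
  have hi : ∀ f g : Linf D, Integrable (fun x => (starRingEnd ℂ) (f x) * g x)
      (volume.restrict D) := by
    intro f g
    refine (L2.integrable_inner (𝕜 := ℂ) (inclL2 D f) (inclL2 D g)).congr ?_
    filter_upwards [inclL2_ae f, inclL2_ae g] with x h1 h2
    rw [h1, h2, RCLike.inner_apply, mul_comm]
  have h1 : ∫ x in D, ((starRingEnd ℂ) (u x) * u x).re = ‖inclL2 D u‖ ^ 2 := by
    have e : ∫ x in D, ((starRingEnd ℂ) (u x) * u x).re =
        (∫ x in D, (starRingEnd ℂ) (u x) * u x).re := integral_re (hi u u)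
    rw [e, ← inner_inclL2, inner_self_eq_norm_sq_to_K, RCLike.ofReal_eq_complex_ofReal,
      ← ofReal_pow, ofReal_re]
  have h2 : ∫ x in D, ((starRingEnd ℂ) (u x) * cubic u x).re ≤
      ‖inclL2 D u‖ * ‖inclL2 D (cubic u)‖ := by
    have e : ∫ x in D, ((starRingEnd ℂ) (u x) * cubic u x).re =
        (∫ x in D, (starRingEnd ℂ) (u x) * cubic u x).re := integral_re (hi u _)
    rw [e, ← inner_inclL2]
    exact (re_le_norm _).trans (norm_inner_le_norm _ _)
  rw [inner_inclL2]
  have i1 : Integrable (fun x => ((starRingEnd ℂ) (u x) * u x).re) (volume.restrict D) :=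
    (hi u u).re
  have i2 : Integrable (fun x => ((starRingEnd ℂ) (u x) * cubic u x).re) (volume.restrict D) :=
    (hi u _).re
  calc ‖∫ x in D, (starRingEnd ℂ) (φ x) * cubic u x‖
      ≤ ∫ x in D, ‖φ‖ * (((starRingEnd ℂ) (u x) * u x).re +
          ((starRingEnd ℂ) (u x) * cubic u x).re) := by
        refine norm_integral_le_of_norm_le ((i1.add i2).const_mul _) ?_
        filter_upwards [cubic_ae u, ae_norm_le_Linf φ] with x h3 h4
        have e : ((starRingEnd ℂ) (u x) * (((‖u x‖ : ℝ) : ℂ) ^ 2 * u x)) =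
            ((‖u x‖ ^ 4 : ℝ) : ℂ) := by
          rw [mul_left_comm, conj_mul']
          push_cast
          ring
        have e' : (starRingEnd ℂ) (u x) * u x = ((‖u x‖ ^ 2 : ℝ) : ℂ) := by
          rw [conj_mul']
          push_cast
          ring
        rw [h3, e, e', ofReal_re, ofReal_re, norm_mul, RCLike.norm_conj, norm_mul, norm_pow,
          norm_real, norm_norm]
        refine mul_le_mul h4 ?_ (by positivity) (norm_nonneg _)
        nlinarith [sq_nonneg (‖u x‖ ^ 2 - ‖u x‖), norm_nonneg (u x), sq_nonneg (‖u x‖ - 1),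
          sq_nonneg (‖u x‖)]
    _ = ‖φ‖ * (‖inclL2 D u‖ ^ 2 + ∫ x in D, ((starRingEnd ℂ) (u x) * cubic u x).re) := by
        rw [integral_const_mul, integral_add i1 i2, h1]
    _ ≤ _ := by gcongr

end


/-! ### Spectral data of the dimer -/

instance (d : SymmetricDimer) : Fact (IsOpen d.D) := ⟨d.isOpen_D⟩

instance (d : SymmetricDimer) : Fact (Bornology.IsBounded d.D) := ⟨d.isBounded_D⟩

namespace SymmetricDimer

variable (d : SymmetricDimer)

lemma nonempty_D : d.D.Nonempty :=
  (d.isConnected.nonempty.image _).mono subset_union_left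

lemma reflect_shift (x : E3) (t : ℝ) : reflect (x + shift t) = reflect x + shift (-t) := by
  ext i
  fin_cases i <;> simp [reflect, shift]
  ring

lemma reflect_preimage_D : reflect ⁻¹' d.D = d.D := by
  have h : ∀ x ∈ d.D, reflect x ∈ d.D := by
    rintro x (⟨y, hy, rfl⟩ | ⟨_, ⟨y, hy, rfl⟩, rfl⟩)
    · refine Or.inr ⟨reflect y, ⟨y, hy, rfl⟩, ?_⟩
      beta_reduce
      rw [reflect_shift, neg_neg]
    · refine Or.inl ⟨y, hy, ?_⟩
      beta_reduce
      rw [reflect_shift, reflect_reflect]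
  refine Subset.antisymm (fun x hx => ?_) h
  rw [← reflect_reflect x]
  exact h _ hx

lemma K_eq (z : ℂ) : d.K z = inclL2 d.D ∘L potE d.D z := by
  ext1 f
  ext1
  refine ((memLp_potentialFun d.isBounded_D d.isOpen_D.measurableSet z f).coeFn_toLp).trans ?_
  exact ((inclL2_ae _).trans (potE_ae z f)).symm

lemma newton_eq : d.newton = newt d.D := d.K_eq 0

/-- The spectral information on the two modes that is used in the analysis. -/
structure HasModes (lamP lamM : ℝ) (φP φM : L2 d.D) : Prop where
  le_lamP : ∀ μ : ℝ, ∀ x ≠ 0, newt d.D x = (μ : ℂ) • x → μ ≤ lamP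
  newt_φP : newt d.D φP = (lamP : ℂ) • φP
  norm_φP : ‖φP‖ = 1
  le_lamM : ∀ μ : ℝ, μ ≠ lamP → ∀ x ≠ 0, newt d.D x = (μ : ℂ) • x → μ ≤ lamM
  lamM_ne : lamM ≠ lamP
  newt_φM : newt d.D φM = (lamM : ℂ) • φM
  norm_φM : ‖φM‖ = 1
  simple_φM : ∀ x, newt d.D x = (lamM : ℂ) • x → ∃ c : ℂ, x = c • φM
  odd_φM : d.IsOdd φM

variable {d}

namespace HasModes

variable {lamP lamM : ℝ} {φP φM : L2 d.D} (h : d.HasModes lamP lamM φP φM)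

include h

lemma lamP_pos : 0 < lamP :=
  pos_of_eigenvalues_le d.nonempty_D isSelfAdjoint_newt (isCompactOperator_newt d.nonempty_D)
    le_rfl 0 (fun f => by simp) h.le_lamP

lemma φP_ne_zero : φP ≠ 0 := by rw [← norm_ne_zero_iff, h.norm_φP]; exact one_ne_zero

lemma simple_φP (x : L2 d.D) (hx : newt d.D x = (lamP : ℂ) • x) : ∃ c : ℂ, x = c • φP :=
  eq_smul_of_eigenvector d.nonempty_D h.lamP_pos h.le_lamP h.φP_ne_zero h.newt_φP x hx

lemma inner_φP_φM : inner ℂ φP φM = 0 := by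
  have h1 := inner_eigenvector isSelfAdjoint_newt h.newt_φP φM
  rw [h.newt_φM, inner_smul_right, mul_eq_mul_right_iff] at h1
  exact h1.resolve_left (by exact_mod_cast h.lamM_ne)

lemma deflate_φM : deflate (newt d.D) φP φM = (lamM : ℂ) • φM := by
  rw [deflate_apply, h.newt_φM, inner_smul_right, h.inner_φP_φM, mul_zero, zero_smul, sub_zero]

lemma deflate_φP : deflate (newt d.D) φP φP = 0 := by
  rw [deflate_apply, h.newt_φP, inner_smul_right, inner_self_eq_norm_sq_to_K, h.norm_φP]
  simp

lemma spectrum_deflate_φP :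
    spectrum ℂ (deflate (newt d.D) φP) = spectrum ℂ (newt d.D) \ {(lamP : ℂ)} :=
  spectrum_deflate isSelfAdjoint_newt (isCompactOperator_newt d.nonempty_D) h.newt_φP h.norm_φP
    h.lamP_pos.ne' h.simple_φP (zero_mem_spectrum_newt d.nonempty_D)

lemma zero_mem_spectrum_deflate : (0 : ℂ) ∈ spectrum ℂ (deflate (newt d.D) φP) :=
  mem_spectrum_of_eigenvector h.φP_ne_zero (by rw [h.deflate_φP, zero_smul])

/-- Away from the eigenvalue zero, the deflated operator has the other eigenvectors. -/
lemma newt_eq_of_deflate_eq {μ : ℂ} (hμ : μ ≠ 0) {x : L2 d.D}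
    (hx : deflate (newt d.D) φP x = μ • x) : newt d.D x = μ • x ∧ inner ℂ φP x = 0 := by
  have h1 := inner_eigenvector (isSelfAdjoint_deflate isSelfAdjoint_newt h.newt_φP)
    (φ := φP) (lam := 0) (by rw [h.deflate_φP, ofReal_zero, zero_smul]) x
  rw [hx, inner_smul_right, ofReal_zero, zero_mul] at h1
  have h2 := (mul_eq_zero.1 h1).resolve_left hμ
  rw [deflate_apply, inner_eigenvector isSelfAdjoint_newt h.newt_φP, h2, mul_zero, zero_smul,
    sub_zero] at hx
  exact ⟨hx, h2⟩

/-- Otherwise the operator with `φP` removed would have no positive eigenvalue. But the energy of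
the Newtonian potential exceeds that of the deflated operator only by `lamP` times the squared
pairing with the bounded function `φP`, which concentrated test functions make negligible. -/
lemma lamM_pos : 0 < lamM := by
  by_contra! hM
  have hev : ∀ μ : ℝ, ∀ x ≠ 0, deflate (newt d.D) φP x = (μ : ℂ) • x → μ ≤ 0 := by
    intro μ x hx hAx
    by_contra! hμ
    obtain ⟨h1, h2⟩ := h.newt_eq_of_deflate_eq (by exact_mod_cast hμ.ne') hAx
    have hne : μ ≠ lamP := by
      rintro rfl
      obtain ⟨c, rfl⟩ := h.simple_φP x h1
      rw [inner_smul_right, inner_self_eq_norm_sq_to_K, h.norm_φP] at h2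
      apply hx
      have : c = 0 := by simpa using h2
      rw [this, zero_smul]
    linarith [h.le_lamM μ hne x hx h1]
  have hl : (lamP : ℂ) ≠ 0 := by exact_mod_cast h.lamP_pos.ne'
  refine lt_irrefl (0 : ℝ) (pos_of_eigenvalues_le d.nonempty_D
    (isSelfAdjoint_deflate isSelfAdjoint_newt h.newt_φP)
    (isCompactOperator_deflate (isCompactOperator_newt d.nonempty_D) φP) h.lamP_pos.le
    ((lamP : ℂ)⁻¹ • potE d.D 0 φP) (fun f => le_of_eq ?_) hev)
  rw [eq_inclL2_of_newt_eq hl h.newt_φP, deflate_apply, inner_sub_right, inner_smul_right,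
    inner_eigenvector isSelfAdjoint_newt h.newt_φP, ← inner_conj_symm f φP, mul_assoc, mul_conj',
    sub_re, ← ofReal_pow, ← ofReal_mul, ofReal_re]
  ring

/-- Realizes the rest of the spectrum as the spectrum of one self-adjoint operator: it is closed,
real, and controls the resolvent on the complement of the modes. -/
lemma restSpectrum_eq :
    d.restSpectrum lamP lamM = spectrum ℂ (deflate (deflate (newt d.D) φP) φM) := by
  have hl : (lamM : ℂ) ≠ 0 := by exact_mod_cast h.lamM_pos.ne'
  rw [spectrum_deflate (isSelfAdjoint_deflate isSelfAdjoint_newt h.newt_φP)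
    (isCompactOperator_deflate (isCompactOperator_newt d.nonempty_D) φP) h.deflate_φM h.norm_φM
    h.lamM_pos.ne' (fun x hx => h.simple_φM x (h.newt_eq_of_deflate_eq hl hx).1)
    h.zero_mem_spectrum_deflate, h.spectrum_deflate_φP, restSpectrum, newton_eq, Set.sdiff_sdiff]
  rfl

lemma isSelfAdjoint_deflate_deflate : IsSelfAdjoint (deflate (deflate (newt d.D) φP) φM) :=
  isSelfAdjoint_deflate (isSelfAdjoint_deflate isSelfAdjoint_newt h.newt_φP) h.deflate_φM

lemma zero_mem_restSpectrum : (0 : ℂ) ∈ d.restSpectrum lamP lamM := by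
  rw [restSpectrum, newton_eq]
  refine ⟨zero_mem_spectrum_newt d.nonempty_D, ?_⟩
  have h1 := h.lamP_pos.ne
  have h2 := h.lamM_pos.ne
  simp only [mem_insert_iff, mem_singleton_iff, not_or]
  exact ⟨by exact_mod_cast h1, by exact_mod_cast h2⟩

lemma infDist_pos {lam : ℂ} (hl : lam ∉ d.restSpectrum lamP lamM) :
    0 < Metric.infDist lam (d.restSpectrum lamP lamM) := by
  have hc : IsClosed (d.restSpectrum lamP lamM) := by
    rw [h.restSpectrum_eq]
    exact spectrum.isClosed _
  exact (hc.notMem_iff_infDist_pos ⟨0, h.zero_mem_restSpectrum⟩).1 hl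

lemma infDist_lamP_pos : 0 < Metric.infDist (lamP : ℂ) (d.restSpectrum lamP lamM) :=
  h.infDist_pos fun hh => hh.2 (mem_insert _ _)

lemma infDist_lamM_pos : 0 < Metric.infDist (lamM : ℂ) (d.restSpectrum lamP lamM) :=
  h.infDist_pos fun hh => hh.2 (mem_insert_of_mem _ (mem_singleton _))

lemma gap_pos : 0 < d.gap lamP lamM := by
  have h1 := h.infDist_lamP_pos
  have h2 := h.infDist_lamM_pos
  unfold gap
  positivity

/-- `0` belongs to the rest of the spectrum. Admissible frequencies are therefore bounded and
nonzero. -/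
lemma gap_lt_norm {ω : ℂ} (hω : ω ∈ d.freqRegion lamP lamM) :
    d.gap lamP lamM < ‖(ω ^ 2)⁻¹‖ := by
  refine lt_of_lt_of_le hω ?_
  rw [← dist_zero_right]
  exact Metric.infDist_le_dist_of_mem h.zero_mem_restSpectrum

lemma ne_zero_of_mem {ω : ℂ} (hω : ω ∈ d.freqRegion lamP lamM) : ω ≠ 0 := by
  rintro rfl
  have := h.gap_lt_norm hω
  simp only [ne_eq, OfNat.ofNat_ne_zero, not_false_eq_true, zero_pow, inv_zero, norm_zero] at this
  linarith [h.gap_pos]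

lemma norm_le_of_mem {ω : ℂ} (hω : ω ∈ d.freqRegion lamP lamM) :
    ‖ω‖ ≤ 1 + (d.gap lamP lamM)⁻¹ := by
  have h1 := h.gap_lt_norm hω
  have h2 : 0 < ‖ω‖ := norm_pos_iff.2 (h.ne_zero_of_mem hω)
  rw [norm_inv, norm_pow, lt_inv_comm₀ h.gap_pos (by positivity)] at h1
  nlinarith

lemma isOpen_freqRegion : IsOpen (d.freqRegion lamP lamM) := by
  have e : d.freqRegion lamP lamM = {0}ᶜ ∩
      (fun ω : ℂ => Metric.infDist ((ω ^ 2)⁻¹) (d.restSpectrum lamP lamM)) ⁻¹'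
        Ioi (d.gap lamP lamM) := by
    ext ω
    exact ⟨fun hω => ⟨h.ne_zero_of_mem hω, hω⟩, fun hω => hω.2⟩
  rw [e]
  refine ContinuousOn.isOpen_inter_preimage ?_ isOpen_compl_singleton isOpen_Ioi
  refine (Metric.continuous_infDist_pt _).comp_continuousOn ?_
  exact ContinuousOn.inv₀ (by fun_prop) fun ω hω => pow_ne_zero 2 hω

/-- The set is real. This is what makes the admissible region invariant under `ω ↦ -ω̄`. -/
lemma conj_image_restSpectrum :
    (starRingEnd ℂ) '' d.restSpectrum lamP lamM = d.restSpectrum lamP lamM := by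
  conv_rhs => rw [← image_id (d.restSpectrum lamP lamM)]
  refine image_congr fun w hw => ?_
  rw [h.restSpectrum_eq] at hw
  have := h.isSelfAdjoint_deflate_deflate.mem_spectrum_eq_re hw
  rw [this, conj_ofReal]
  rfl

lemma neg_conj_mem {ω : ℂ} (hω : ω ∈ d.freqRegion lamP lamM) :
    -(starRingEnd ℂ) ω ∈ d.freqRegion lamP lamM := by
  have h1 := Metric.infDist_image (x := (ω ^ 2)⁻¹) (t := d.restSpectrum lamP lamM)
    Complex.isometry_conj
  rw [h.conj_image_restSpectrum] at h1
  have h2 : ((-(starRingEnd ℂ) ω) ^ 2)⁻¹ = (starRingEnd ℂ) (ω ^ 2)⁻¹ := by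
    rw [neg_sq, map_inv₀, map_pow]
  rw [freqRegion, Set.mem_ofPred_eq, h2, h1]
  exact hω

lemma inv_sqrt_sq {lam : ℝ} (hl : 0 < lam) : ((((1 / √lam : ℝ) : ℂ)) ^ 2)⁻¹ = (lam : ℂ) := by
  rw [← ofReal_pow, div_pow, one_pow, Real.sq_sqrt hl.le, one_div, ofReal_inv, inv_inv]

lemma mem_p : ((1 / √lamP : ℝ) : ℂ) ∈ d.freqRegion lamP lamM := by
  rw [freqRegion, Set.mem_ofPred_eq, h.inv_sqrt_sq h.lamP_pos]
  have h1 := h.infDist_lamP_pos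
  have h2 := min_le_left (Metric.infDist (lamP : ℂ) (d.restSpectrum lamP lamM))
    (Metric.infDist (lamM : ℂ) (d.restSpectrum lamP lamM))
  unfold gap
  linarith

lemma mem_m : ((1 / √lamM : ℝ) : ℂ) ∈ d.freqRegion lamP lamM := by
  rw [freqRegion, Set.mem_ofPred_eq, h.inv_sqrt_sq h.lamM_pos]
  have h1 := h.infDist_lamM_pos
  have h2 := min_le_right (Metric.infDist (lamP : ℂ) (d.restSpectrum lamP lamM))
    (Metric.infDist (lamM : ℂ) (d.restSpectrum lamP lamM))
  unfold gap
  linarith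

lemma exists_resolvent_of_mem {ω : ℂ} (hω : ω ∈ d.freqRegion lamP lamM) :
    ∃ R : L2 d.D →L[ℂ] L2 d.D, ‖R‖ ≤ (d.gap lamP lamM)⁻¹ ∧
      (∀ x, R ((ω ^ 2)⁻¹ • x - (newt d.D x - inner ℂ φP (newt d.D x) • φP
        - inner ℂ φM (newt d.D x) • φM)) = x) ∧
      ∀ x, (ω ^ 2)⁻¹ • R x - (newt d.D (R x) - inner ℂ φP (newt d.D (R x)) • φP
        - inner ℂ φM (newt d.D (R x)) • φM) = x := by
  obtain ⟨R, h1, h2, h3⟩ := exists_resolvent h.isSelfAdjoint_deflate_deflate (z := (ω ^ 2)⁻¹)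
    h.gap_pos (fun w hw => by
      rw [← h.restSpectrum_eq] at hw
      rw [← dist_eq_norm]
      exact hω.le.trans (Metric.infDist_le_dist_of_mem hw))
  have e : ∀ x, deflate (deflate (newt d.D) φP) φM x = newt d.D x -
      inner ℂ φP (newt d.D x) • φP - inner ℂ φM (newt d.D x) • φM := by
    intro x
    have h4 : inner ℂ φM φP = 0 := by rw [← inner_conj_symm, h.inner_φP_φM, map_zero]
    rw [deflate_apply, deflate_apply, inner_sub_right, inner_smul_right, h4, mul_zero, sub_zero]
  exact ⟨R, h1, fun x => by rw [← e]; exact h2 x, fun x => by rw [← e]; exact h3 x⟩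

end HasModes

end SymmetricDimer


namespace SymmetricDimer.HasModes

/-! ### The resonance model of the dimer -/

variable {d : SymmetricDimer} {lamP lamM : ℝ} {φP φM : L2 d.D} (h : d.HasModes lamP lamM φP φM)

lemma potE_of_newt_eq {u : Linf d.D} {lam : ℂ}
    (hu : newt d.D (inclL2 d.D u) = lam • inclL2 d.D u) : potE d.D 0 (inclL2 d.D u) = lam • u :=
  inclL2_injective (by rw [map_smul]; exact hu)

lemma newt_reflLp {u : Linf d.D} {lam : ℂ}
    (hu : newt d.D (inclL2 d.D u) = lam • inclL2 d.D u) :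
    newt d.D (inclL2 d.D (reflLp d.reflect_preimage_D ∞ u)) =
      lam • inclL2 d.D (reflLp d.reflect_preimage_D ∞ u) := by
  change inclL2 d.D (potE d.D 0 _) = _
  rw [← reflLp_potE, potE_of_newt_eq hu, map_smul, map_smul]

lemma newt_conjLp {u : Linf d.D} {lam : ℝ}
    (hu : newt d.D (inclL2 d.D u) = (lam : ℂ) • inclL2 d.D u) :
    newt d.D (inclL2 d.D (conjLp _ ∞ u)) = (lam : ℂ) • inclL2 d.D (conjLp _ ∞ u) := by
  have h1 := conjLp_potE 0 u
  rw [map_zero, neg_zero, potE_of_newt_eq hu, map_smulₛₗ, conj_ofReal] at h1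
  change inclL2 d.D (potE d.D 0 _) = _
  rw [← h1, map_smul]

lemma norm_inclL2_conjLp (u : Linf d.D) : ‖inclL2 d.D (conjLp _ ∞ u)‖ = ‖inclL2 d.D u‖ := by
  rw [@norm_eq_sqrt_re_inner ℂ, @norm_eq_sqrt_re_inner ℂ, inner_conjLp]

lemma integral_inclL2_reflLp (u : Linf d.D) :
    ∫ x in d.D, inclL2 d.D (reflLp d.reflect_preimage_D ∞ u) x = ∫ x in d.D, inclL2 d.D u x := by
  rw [integral_congr_ae ((inclL2_ae _).trans (reflLp_ae d.reflect_preimage_D u)),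
    integral_congr_ae (inclL2_ae u), integral_reflect d.reflect_preimage_D fun x => u x]

/-- The bounded representative of a mode. -/
def bddMode (lam : ℝ) (φ : L2 d.D) : Linf d.D := (lam : ℂ)⁻¹ • potE d.D 0 φ

lemma inclL2_bddMode {lam : ℝ} (hl : 0 < lam) {φ : L2 d.D}
    (hφ : newt d.D φ = (lam : ℂ) • φ) : inclL2 d.D (bddMode lam φ) = φ :=
  eq_inclL2_of_newt_eq (by exact_mod_cast hl.ne') hφ

lemma potE_bddMode {lam : ℝ} (hl : 0 < lam) {φ : L2 d.D}
    (hφ : newt d.D φ = (lam : ℂ) • φ) :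
    potE d.D 0 (inclL2 d.D (bddMode lam φ)) = (lam : ℂ) • bddMode lam φ :=
  potE_of_newt_eq (by rwa [inclL2_bddMode hl hφ])

include h

lemma inclL2_φP : inclL2 d.D (bddMode lamP φP) = φP := inclL2_bddMode h.lamP_pos h.newt_φP

lemma inclL2_φM : inclL2 d.D (bddMode lamM φM) = φM := inclL2_bddMode h.lamM_pos h.newt_φM

/-- The potential commutes with the reflection, so the difference of `φP` and its reflection is an
eigenvector for the largest eigenvalue with mean zero, hence zero. -/
lemma reflLp_φP : reflLp d.reflect_preimage_D ∞ (bddMode lamP φP) = bddMode lamP φP := by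
  refine inclL2_injective (sub_eq_zero.1 (eq_zero_of_integral_eq_zero d.nonempty_D h.lamP_pos
    h.le_lamP ?_ ?_))
  · have h1 : newt d.D (inclL2 d.D (bddMode lamP φP)) =
        (lamP : ℂ) • inclL2 d.D (bddMode lamP φP) := by rw [h.inclL2_φP, h.newt_φP]
    rw [map_sub, newt_reflLp h1, h1, smul_sub]
  · rw [integral_congr_ae (Lp.coeFn_sub _ _)]
    simp only [Pi.sub_apply]
    rw [integral_sub ((Lp.memLp _).integrable one_le_two) ((Lp.memLp _).integrable one_le_two),
      integral_inclL2_reflLp, sub_self]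

lemma reflLp_φM : reflLp d.reflect_preimage_D ∞ (bddMode lamM φM) = -bddMode lamM φM := by
  ext1
  have h1 := inclL2_ae (bddMode lamM φM)
  rw [h.inclL2_φM] at h1
  filter_upwards [reflLp_ae d.reflect_preimage_D (bddMode lamM φM), h1,
    ae_reflect d.reflect_preimage_D h1, h.odd_φM, Lp.coeFn_neg (bddMode lamM φM)]
    with x h2 h3 h4 h5 h6
  rw [h2, h6, Pi.neg_apply, ← h3, ← h4, h5]

/-- The Newtonian kernel and the eigenvalue are real, so the conjugate is again an eigenvector;
simplicity and equality of norms give a unimodular factor. -/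
lemma exists_conjLp_φP : ∃ α : ℂ, ‖α‖ = 1 ∧
    conjLp _ ∞ (bddMode lamP φP) = α • bddMode lamP φP := by
  obtain ⟨c, hc⟩ := h.simple_φP _ (newt_conjLp (u := bddMode lamP φP)
    (by rw [h.inclL2_φP, h.newt_φP]))
  refine ⟨c, ?_, inclL2_injective (by rw [hc, map_smul, h.inclL2_φP])⟩
  have h1 := norm_inclL2_conjLp (bddMode lamP φP)
  rwa [hc, h.inclL2_φP, norm_smul, h.norm_φP, mul_one] at h1

lemma exists_conjLp_φM : ∃ α : ℂ, ‖α‖ = 1 ∧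
    conjLp _ ∞ (bddMode lamM φM) = α • bddMode lamM φM := by
  obtain ⟨c, hc⟩ := h.simple_φM _ (newt_conjLp (u := bddMode lamM φM)
    (by rw [h.inclL2_φM, h.newt_φM]))
  refine ⟨c, ?_, inclL2_injective (by rw [hc, map_smul, h.inclL2_φM])⟩
  have h1 := norm_inclL2_conjLp (bddMode lamM φM)
  rwa [hc, h.inclL2_φM, norm_smul, h.norm_φM, mul_one] at h1

/-- The resonance model of a dimer. -/
def model : ResonanceModel (L2 d.D) (Linf d.D) (H2 d.D) where
  ι := inclL2 d.D
  ι_injective := inclL2_injective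
  T := cubic
  contDiff_T := contDiff_cubic
  T_smul := cubic_smul
  T_lipschitz := ⟨3, by norm_num, norm_cubic_sub_le⟩
  G := potE d.D
  differentiable_G := differentiable_potE
  j := toL2L d.D
  j_injective := toL2L_injective
  GV := potV d.D
  differentiable_GV := differentiable_potV
  j_GV := toL2_potV
  GV_lower := ⟨3, by norm_num, norm_le_potV⟩
  symm := fun x y => (ContinuousLinearMap.isSelfAdjoint_iff_isSymmetric.1 isSelfAdjoint_newt) x y
  φp := bddMode lamP φP
  φm := bddMode lamM φM
  lp := lamP
  lm := lamM
  lp_pos := h.lamP_pos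
  lm_pos := h.lamM_pos
  lp_ne_lm := h.lamM_ne.symm
  G_φp := potE_bddMode h.lamP_pos h.newt_φP
  G_φm := potE_bddMode h.lamM_pos h.newt_φM
  norm_φp := by rw [h.inclL2_φP, h.norm_φP]
  norm_φm := by rw [h.inclL2_φM, h.norm_φM]
  Ω := d.freqRegion lamP lamM
  isOpen_Ω := h.isOpen_freqRegion
  ne_zero_of_mem := fun _ hω => h.ne_zero_of_mem hω
  bounded_Ω := ⟨1 + (d.gap lamP lamM)⁻¹, by have := h.gap_pos; positivity,
    fun _ hω => h.norm_le_of_mem hω⟩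
  neg_conj_mem := fun _ hω => h.neg_conj_mem hω
  mem_p := h.mem_p
  mem_m := h.mem_m
  resolvent := ⟨(d.gap lamP lamM)⁻¹, inv_pos.2 h.gap_pos, fun _ hω => by
    rw [h.inclL2_φP, h.inclL2_φM]
    exact h.exists_resolvent_of_mem hω⟩
  ρ := reflLp d.reflect_preimage_D ∞
  norm_ρ := fun x => (norm_reflLp _ x).le
  ρ_T := reflLp_cubic _
  ρ_G := reflLp_potE _
  ρ_φp := h.reflLp_φP
  ρ_φm := h.reflLp_φM
  inner_ρ := inner_reflLp _
  κ := conjLp _ ∞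
  norm_κ := fun x => (norm_conjLp x).le
  κ_κ := conjLp_conjLp
  inner_κ := inner_conjLp
  κ_T := conjLp_cubic
  κ_G := conjLp_potE
  κ_φp := h.exists_conjLp_φP
  κ_φm := h.exists_conjLp_φM
  weak_T := by
    refine ⟨‖bddMode lamP φP‖ + ‖bddMode lamM φM‖ + 1, by positivity, fun u => ⟨?_, ?_⟩⟩
    · refine (norm_inner_cubic_le _ u).trans ?_
      gcongr
      linarith [norm_nonneg (bddMode lamM φM)]
    · refine (norm_inner_cubic_le _ u).trans ?_
      gcongr
      linarith [norm_nonneg (bddMode lamP φP)]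

end SymmetricDimer.HasModes


/-! ### Translation between the dimer problem and the model -/

namespace SymmetricDimer

variable {d : SymmetricDimer} {lamP lamM : ℝ} {φP φM : L2 d.D}

lemma isKerr_inclL2 (u : Linf d.D) :
    d.IsKerr (inclL2 d.D u) (inclL2 d.D (u + ((1 : ℝ) : ℂ) • cubic u)) := by
  rw [ofReal_one, one_smul]
  unfold IsKerr
  filter_upwards [inclL2_ae u, inclL2_ae (u + cubic u), Lp.coeFn_add u (cubic u), cubic_ae u]
    with x h1 h2 h3 h4
  rw [h1, h2, h3, Pi.add_apply, h4]

lemma IsKerr.eq_inclL2 {u : Linf d.D} {v : L2 d.D} (h : d.IsKerr (inclL2 d.D u) v) :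
    v = inclL2 d.D (u + ((1 : ℝ) : ℂ) • cubic u) := by
  ext1
  filter_upwards [h, isKerr_inclL2 u] with x h1 h2
  rw [h1, h2]

/-- A solution is the potential of a square integrable density, hence bounded; no Sobolev embedding
is needed. -/
lemma exists_inclL2_of_isSolution {ε : ℝ} {ω : ℂ} {u : L2 d.D} (h : d.IsSolution ε ω u) :
    ∃ w : Linf d.D, inclL2 d.D w = u := by
  obtain ⟨-, Nu, -, h2⟩ := h
  refine ⟨ω ^ 2 • potE d.D (ε * ω) Nu, ?_⟩
  rw [map_smul, h2, K_eq]
  rfl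

lemma isEven_smul_inclL2 (c : ℂ) {u : Linf d.D} (hu : reflLp d.reflect_preimage_D ∞ u = u) :
    d.IsEven (c • inclL2 d.D u) := by
  have e : inclL2 d.D (reflLp d.reflect_preimage_D ∞ u) = inclL2 d.D u := by rw [hu]
  have h1 := (inclL2_ae (reflLp d.reflect_preimage_D ∞ u)).trans
    (reflLp_ae d.reflect_preimage_D u)
  rw [e] at h1
  have h2 := inclL2_ae u
  have h3 := Lp.coeFn_smul c (inclL2 d.D u)
  unfold IsEven
  filter_upwards [h1, ae_reflect d.reflect_preimage_D h2, h3,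
    ae_reflect d.reflect_preimage_D h3] with x a1 a2 a3 a4
  rw [a3, a4, Pi.smul_apply, Pi.smul_apply, a1, a2]

lemma isOdd_smul_inclL2 (c : ℂ) {u : Linf d.D} (hu : reflLp d.reflect_preimage_D ∞ u = -u) :
    d.IsOdd (c • inclL2 d.D u) := by
  have e : inclL2 d.D (reflLp d.reflect_preimage_D ∞ u) = -inclL2 d.D u := by rw [hu, map_neg]
  have h1 := (inclL2_ae (reflLp d.reflect_preimage_D ∞ u)).trans
    (reflLp_ae d.reflect_preimage_D u)
  rw [e] at h1
  have h2 := inclL2_ae u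
  have h3 := Lp.coeFn_smul c (inclL2 d.D u)
  have h4 := Lp.coeFn_neg (inclL2 d.D u)
  unfold IsOdd
  filter_upwards [h1, ae_reflect d.reflect_preimage_D h2, h3,
    ae_reflect d.reflect_preimage_D h3, h4] with x a1 a2 a3 a4 a5
  rw [a3, a4, Pi.smul_apply, Pi.smul_apply, a2, ← a1, a5, Pi.neg_apply, smul_neg]

namespace HasModes

variable (h : d.HasModes lamP lamM φP φM)

/-- Membership in `H²` is automatic for solutions of the model equation, because `potV` supplies the
jet of every potential. -/
lemma isSolution_iff {ε : ℝ} {ω : ℂ} {u : Linf d.D} :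
    d.IsSolution ε ω (inclL2 d.D u) ↔ h.model.IsSol ω ε 1 u := by
  constructor
  · rintro ⟨-, Nu, h1, h2⟩
    refine inclL2_injective ?_
    rw [h1.eq_inclL2, K_eq] at h2
    rw [map_smul]
    exact h2
  · intro hu
    have e : inclL2 d.D u = ω ^ 2 • inclL2 d.D (potE d.D (ε * ω)
        (inclL2 d.D (u + ((1 : ℝ) : ℂ) • cubic u))) := by
      rw [← map_smul]
      exact congrArg _ hu
    refine ⟨⟨ω ^ 2 • potV d.D (ε * ω) (inclL2 d.D (u + ((1 : ℝ) : ℂ) • cubic u)), ?_⟩,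
      _, isKerr_inclL2 u, ?_⟩
    · rw [← toL2L_apply, map_smul, toL2L_apply, toL2_potV, ← e]
    · rw [K_eq]
      exact e

/-- Linear resonances are the solutions of strength `τ = 0`; the equation itself provides both the
bounded and the `H²` representative. -/
lemma isLinearResonance_iff {ε : ℝ} {ω : ℂ} :
    d.IsLinearResonance ε ω ↔ ∃ u ≠ 0, h.model.IsSol ω ε 0 u := by
  have e0 : ∀ u : Linf d.D, u + ((0 : ℝ) : ℂ) • cubic u = u := fun u => by
    rw [ofReal_zero, zero_smul, add_zero]
  constructor
  · rintro ⟨v, h1, h2⟩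
    set u : Linf d.D := ω ^ 2 • potE d.D (ε * ω) (toL2 v) with hu
    have e : inclL2 d.D u = toL2 v := by
      rw [hu, map_smul]
      nth_rewrite 2 [h2]
      rw [K_eq]
      rfl
    refine ⟨u, fun h0 => h1 ?_, ?_⟩
    · rw [← e, h0, map_zero]
    · change u = ω ^ 2 • potE d.D (ε * ω) (inclL2 d.D (u + ((0 : ℝ) : ℂ) • cubic u))
      rw [e0, e]
  · rintro ⟨u, h1, h2⟩
    change u = ω ^ 2 • potE d.D (ε * ω) (inclL2 d.D (u + ((0 : ℝ) : ℂ) • cubic u)) at h2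
    rw [e0] at h2
    have e : toL2 (ω ^ 2 • potV d.D (ε * ω) (inclL2 d.D u)) = inclL2 d.D u := by
      rw [← toL2L_apply, map_smul, toL2L_apply, toL2_potV, ← map_smul, ← h2]
    refine ⟨ω ^ 2 • potV d.D (ε * ω) (inclL2 d.D u), ?_, ?_⟩
    · rw [e]
      exact fun h0 => h1 (inclL2_injective (by rw [h0, map_zero]))
    · rw [e, K_eq]
      exact (congrArg (inclL2 d.D) h2).trans (map_smul _ _ _)

lemma ansatz_eq {a b : ℂ} {r : H2 d.D} {q : Linf d.D} (hr : toL2 r = inclL2 d.D q) :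
    d.ansatz φP φM a b r = inclL2 d.D (h.model.mode a b + q) := by
  rw [ansatz, hr, map_add]
  congr 1
  change _ = inclL2 d.D (a • bddMode lamP φP + b • bddMode lamM φM)
  rw [map_add, map_smul, map_smul, h.inclL2_φP, h.inclL2_φM]

lemma projRest_inclL2 (x : Linf d.D) :
    d.projRest φP φM (inclL2 d.D x) = inclL2 d.D (h.model.P x) := by
  rw [ResonanceModel.P_apply, map_sub, map_sub, map_smul, map_smul,
    ResonanceModel.cp_apply, ResonanceModel.cm_apply]
  change _ = inclL2 d.D x - inner ℂ (inclL2 d.D (bddMode lamP φP)) (inclL2 d.D x) •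
    inclL2 d.D (bddMode lamP φP) - inner ℂ (inclL2 d.D (bddMode lamM φM)) (inclL2 d.D x) •
    inclL2 d.D (bddMode lamM φM)
  rw [h.inclL2_φP, h.inclL2_φM]
  rfl

lemma cp_eq (x : Linf d.D) : h.model.cp x = inner ℂ φP (inclL2 d.D x) := by
  rw [ResonanceModel.cp_apply]
  change inner ℂ (inclL2 d.D (bddMode lamP φP)) (inclL2 d.D x) = _
  rw [h.inclL2_φP]

lemma cm_eq (x : Linf d.D) : h.model.cm x = inner ℂ φM (inclL2 d.D x) := by
  rw [ResonanceModel.cm_apply]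
  change inner ℂ (inclL2 d.D (bddMode lamM φM)) (inclL2 d.D x) = _
  rw [h.inclL2_φM]

/-- The right-hand side is a projected potential, hence bounded; it also forces orthogonality to
both modes. -/
lemma isRemainder_iff {ε : ℝ} {ω a b : ℂ} {r : H2 d.D} :
    d.IsRemainder φP φM ω a b ε r ↔
      ∃ q, toL2 r = inclL2 d.D q ∧ h.model.IsRem ω ε 1 (h.model.mode a b) q := by
  constructor
  · rintro ⟨-, -, Nu, h1, h2⟩
    rw [K_eq] at h2
    change toL2 r = ω ^ 2 • d.projRest φP φM (inclL2 d.D (potE d.D (ε * ω) Nu)) at h2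
    rw [h.projRest_inclL2, ← map_smul] at h2
    refine ⟨_, h2, ?_⟩
    rw [h.ansatz_eq h2] at h1
    have h3 := h1.eq_inclL2
    exact congrArg (fun f => ω ^ 2 • h.model.P (potE d.D (ε * ω) f)) h3
  · rintro ⟨q, h1, h2⟩
    have hq : h.model.cp q = 0 ∧ h.model.cm q = 0 := by
      rw [ResonanceModel.IsRem] at h2
      rw [h2, map_smul, map_smul, ResonanceModel.cp_P, ResonanceModel.cm_P, smul_zero]
      exact ⟨rfl, rfl⟩
    refine ⟨by rw [h1, ← h.cp_eq, hq.1], by rw [h1, ← h.cm_eq, hq.2], _,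
      by rw [h.ansatz_eq h1]; exact isKerr_inclL2 _, ?_⟩
    rw [K_eq]
    change toL2 r = ω ^ 2 • d.projRest φP φM (inclL2 d.D (potE d.D (ε * ω) _))
    rw [h.projRest_inclL2, ← map_smul, h1]
    exact congrArg _ h2

end HasModes

/-- The data of the theorem provide two modes. -/
lemma hasModes (hP : IsGreatest d.eigenvalues lamP) (hφP : d.IsNormalizedMode lamP φP)
    (hM : IsGreatest (d.eigenvalues \ {lamP}) lamM)
    (hM_simple : Module.finrank ℂ (Module.End.eigenspace
      (d.newton : L2 d.D →ₗ[ℂ] L2 d.D) (lamM : ℂ)) = 1)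
    (hφM : d.IsNormalizedMode lamM φM) (hM_odd : d.IsOdd φM) :
    d.HasModes lamP lamM φP φM := by
  have hev : ∀ μ : ℝ, ∀ x ≠ 0, newt d.D x = (μ : ℂ) • x → μ ∈ d.eigenvalues := by
    intro μ x hx hμ
    rw [← newton_eq] at hμ
    exact Module.End.hasEigenvalue_of_hasEigenvector ⟨Module.End.mem_eigenspace_iff.2 hμ, hx⟩
  refine ⟨fun μ x hx hμ => hP.2 (hev μ x hx hμ), ?_, hφP.2,
    fun μ hne x hx hμ => hM.2 ⟨hev μ x hx hμ, hne⟩, hM.1.2, ?_, hφM.2, fun x hx => ?_, hM_odd⟩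
  · rw [← newton_eq]
    exact hφP.1
  · rw [← newton_eq]
    exact hφM.1
  · rw [← newton_eq] at hx
    have h0 : (⟨φM, Module.End.mem_eigenspace_iff.2 hφM.1⟩ : Module.End.eigenspace
        (d.newton : L2 d.D →ₗ[ℂ] L2 d.D) (lamM : ℂ)) ≠ 0 := fun h0 => by
      have h1 : φM = 0 := congrArg Subtype.val h0
      have h2 := hφM.2
      rw [h1, norm_zero] at h2
      exact zero_ne_one h2
    obtain ⟨c, hc⟩ := (finrank_eq_one_iff_of_nonzero' _ h0).1 hM_simple
      ⟨x, Module.End.mem_eigenspace_iff.2 hx⟩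
    exact ⟨c, (congrArg Subtype.val hc).symm⟩

end SymmetricDimer

end KerrDimer
end

/-! ### The theorem for the dimer -/

theorem mainTheorem6 (d : KerrDimer.SymmetricDimer) (lamP lamM : ℝ)
    (φP φM : KerrDimer.L2 d.D)
    (hP : IsGreatest d.eigenvalues lamP)
    (hφP : d.IsNormalizedMode lamP φP)
    (hM : IsGreatest (d.eigenvalues \ {lamP}) lamM)
    (hM_simple : Module.finrank ℂ (Module.End.eigenspace
      (d.newton : KerrDimer.L2 d.D →ₗ[ℂ] KerrDimer.L2 d.D) (lamM : ℂ)) = 1)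
    (hφM : d.IsNormalizedMode lamM φM)
    (hM_odd : d.IsOdd φM) :
    ∃ cs > (0 : ℝ), ∃ εs > (0 : ℝ), ∃ ρ > (0 : ℝ), ∃ C > (0 : ℝ),
    ∃ r : ℂ → ℂ → ℂ → ℝ → KerrDimer.H2 d.D,
      -- the remainder function: existence, uniqueness, size, analyticity
      (∀ ω ∈ d.freqRegion lamP lamM, ∀ cP cM : ℂ, ‖cP‖ + ‖cM‖ < cs →
        ∀ ε : ℝ, 0 < ε → ε < εs →
          d.IsRemainder φP φM ω cP cM ε (r ω cP cM ε) ∧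
          ‖r ω cP cM ε‖ < ρ ∧
          (∀ s : KerrDimer.H2 d.D, d.IsRemainder φP φM ω cP cM ε s → ‖s‖ < ρ →
            s = r ω cP cM ε) ∧
          ‖r ω cP cM ε‖ ≤ C * (‖cP‖ ^ 2 + ‖cM‖ ^ 2 + ε) * (‖cP‖ + ‖cM‖)) ∧
      AnalyticOnNhd ℝ (fun p : ℂ × ℂ × ℂ × ℝ => r p.1 p.2.1 p.2.2.1 p.2.2.2)
        {p | p.1 ∈ d.freqRegion lamP lamM ∧ ‖p.2.1‖ + ‖p.2.2.1‖ < cs ∧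
          0 < p.2.2.2 ∧ p.2.2.2 < εs} ∧
      ∃ δ > (0 : ℝ), δ ≤ cs ∧ δ ≤ εs ∧
      ∃ ωP ωM : ℝ → ℝ → ℂ, ∃ ωlinP ωlinM : ℝ → ℂ,
        -- the scaled linear resonances associated with the two eigenvalues
        (∀ ε : ℝ, 0 < ε → ε < δ →
          d.IsLinearResonance ε (ωlinP ε) ∧
          ‖ωlinP ε - ((1 / √lamP : ℝ) : ℂ)‖ ≤ C * ε ∧
          (∀ z : ℂ, ‖z - ((1 / √lamP : ℝ) : ℂ)‖ < δ → d.IsLinearResonance ε z →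
            z = ωlinP ε) ∧
          d.IsLinearResonance ε (ωlinM ε) ∧
          ‖ωlinM ε - ((1 / √lamM : ℝ) : ℂ)‖ ≤ C * ε ∧
          (∀ z : ℂ, ‖z - ((1 / √lamM : ℝ) : ℂ)‖ < δ → d.IsLinearResonance ε z →
            z = ωlinM ε)) ∧
        -- the even and the odd family of solutions
        (∀ c ε : ℝ, |c| < δ → 0 < ε → ε < δ →
          (ωP c ε ∈ d.freqRegion lamP lamM ∧
            ‖ωP c ε - ωlinP ε‖ ≤ C * (c ^ 2 + |c| * ε) ∧
            ∀ θ : ℝ,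
              d.IsSolution ε (ωP c ε) (Complex.exp (Complex.I * θ) •
                d.ansatz φP φM (c : ℂ) 0 (r (ωP c ε) (c : ℂ) 0 ε)) ∧
              d.IsEven (Complex.exp (Complex.I * θ) •
                d.ansatz φP φM (c : ℂ) 0 (r (ωP c ε) (c : ℂ) 0 ε))) ∧
          (ωM c ε ∈ d.freqRegion lamP lamM ∧
            ‖ωM c ε - ωlinM ε‖ ≤ C * (c ^ 2 + |c| * ε) ∧
            ∀ θ : ℝ,
              d.IsSolution ε (ωM c ε) (Complex.exp (Complex.I * θ) •
                d.ansatz φP φM 0 (c : ℂ) (r (ωM c ε) 0 (c : ℂ) ε)) ∧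
              d.IsOdd (Complex.exp (Complex.I * θ) •
                d.ansatz φP φM 0 (c : ℂ) (r (ωM c ε) 0 (c : ℂ) ε)))) ∧
        -- up to the symmetry `(ω, u) ↦ (-conj ω, conj u)` there are no other small solutions
        (∀ ε : ℝ, 0 < ε → ε < δ → ∀ ω ∈ d.freqRegion lamP lamM, ∀ cP cM : ℂ,
          ‖cP‖ + ‖cM‖ < δ → ∀ s : KerrDimer.H2 d.D, ‖s‖ < ρ →
          inner ℂ φP (KerrDimer.toL2 s) = 0 → inner ℂ φM (KerrDimer.toL2 s) = 0 →
          d.ansatz φP φM cP cM s ≠ 0 → d.IsSolution ε ω (d.ansatz φP φM cP cM s) →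
          ∃ c θ : ℝ, |c| < δ ∧ ∃ (ω' : ℂ) (u' : KerrDimer.L2 d.D),
            ((ω' = ωP c ε ∧ u' = Complex.exp (Complex.I * θ) •
                d.ansatz φP φM (c : ℂ) 0 (r (ωP c ε) (c : ℂ) 0 ε)) ∨
              (ω' = ωM c ε ∧ u' = Complex.exp (Complex.I * θ) •
                d.ansatz φP φM 0 (c : ℂ) (r (ωM c ε) 0 (c : ℂ) ε))) ∧
            ((ω = ω' ∧ d.ansatz φP φM cP cM s = u') ∨
              (ω = -(starRingEnd ℂ) ω' ∧
                ∀ᵐ x ∂(MeasureTheory.volume.restrict d.D),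
                  (d.ansatz φP φM cP cM s : KerrDimer.E3 → ℂ) x = (starRingEnd ℂ) (u' x)))) := by
  have h := KerrDimer.SymmetricDimer.hasModes hP hφP hM hM_simple hφM hM_odd
  obtain ⟨cs, hcs, εs, hεs, ρ, hρ, C, hC, r, q, hr, han, δ, hδ, hδc, hδε, ωP, ωM, ωlinP, ωlinM,
    hlin, hfam, hcl⟩ := h.model.main
  have hnc : ∀ c : ℝ, |c| < δ → ‖(c : ℂ)‖ + ‖(0 : ℂ)‖ < cs := fun c hc => by
    rw [norm_zero, add_zero, Complex.norm_real]
    exact hc.trans_le hδc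
  have hnc' : ∀ c : ℝ, |c| < δ → ‖(0 : ℂ)‖ + ‖(c : ℂ)‖ < cs := fun c hc => by
    rw [add_comm]
    exact hnc c hc
  have hexp : ∀ θ : ℝ, ‖Complex.exp (Complex.I * θ)‖ = 1 := fun θ => by
    rw [mul_comm, Complex.norm_exp_ofReal_mul_I]
  -- The model gives the shift bound `C c²`; the stated bound is weaker.
  have hC1 : ∀ c ε : ℝ, 0 < ε → C * c ^ 2 ≤ C * (c ^ 2 + |c| * ε) := fun c ε hε => by
    gcongr
    exact le_add_of_nonneg_right (by positivity)
  refine ⟨cs, hcs, εs, hεs, ρ, hρ, C, hC, r, ?_, han, δ, hδ, hδc, hδε, ωP, ωM, ωlinP, ωlinM,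
    ?_, ?_, ?_⟩
  · intro ω hω a b hab ε hε hεs'
    obtain ⟨h1, h2, h3, h4, h5⟩ := hr ω hω a b hab ε hε hεs'
    refine ⟨h.isRemainder_iff.2 ⟨_, h1, h2⟩, h3, fun s hs hsρ => ?_, h5⟩
    obtain ⟨q', h6, h7⟩ := h.isRemainder_iff.1 hs
    exact h4 s q' h6 h7 hsρ
  · intro ε hε hεδ
    obtain ⟨h1, h2, h3, h4, h5, h6⟩ := hlin ε hε hεδ
    refine ⟨h.isLinearResonance_iff.2 h1, h2, fun z hz hres => ?_,
      h.isLinearResonance_iff.2 h4, h5, fun z hz hres => ?_⟩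
    · obtain ⟨u, hu0, hu⟩ := h.isLinearResonance_iff.1 hres
      exact h3 z hz u hu0 hu
    · obtain ⟨u, hu0, hu⟩ := h.isLinearResonance_iff.1 hres
      exact h6 z hz u hu0 hu
  · intro c ε hc hε hεδ
    obtain ⟨⟨p1, p2, p3, p4⟩, n1, n2, n3, n4⟩ := hfam c ε hc hε hεδ
    have hp := h.ansatz_eq (a := c) (b := 0) (hr _ p1 c 0 (hnc c hc) ε hε (hεδ.trans_le hδε)).1
    have hn := h.ansatz_eq (a := 0) (b := c) (hr _ n1 0 c (hnc' c hc) ε hε (hεδ.trans_le hδε)).1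
    refine ⟨⟨p1, p2.trans (hC1 c ε hε), fun θ => ⟨?_, ?_⟩⟩,
      ⟨n1, n2.trans (hC1 c ε hε), fun θ => ⟨?_, ?_⟩⟩⟩
    · rw [hp, ← map_smul, h.isSolution_iff]
      exact h.model.isSol_smul (hexp θ) p3
    · rw [hp]
      exact KerrDimer.SymmetricDimer.isEven_smul_inclL2 _ p4
    · rw [hn, ← map_smul, h.isSolution_iff]
      exact h.model.isSol_smul (hexp θ) n3
    · rw [hn]
      exact KerrDimer.SymmetricDimer.isOdd_smul_inclL2 _ n4
  · intro ε hε hεδ ω hω a b hab s hs hsP hsM hu0 hsol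
    obtain ⟨w, hw⟩ := KerrDimer.SymmetricDimer.exists_inclL2_of_isSolution hsol
    -- The bounded representative of `s` is that of the solution minus its mode part, because both
    -- the solution and the modes are bounded.
    have hsp : KerrDimer.toL2 s = KerrDimer.inclL2 d.D (w - h.model.mode a b) := by
      have h1 := h.ansatz_eq (a := a) (b := b) (r := 0) (q := 0) (by
        rw [map_zero]
        rfl)
      rw [add_zero, KerrDimer.SymmetricDimer.ansatz] at h1
      rw [map_sub, hw, ← h1, KerrDimer.SymmetricDimer.ansatz]
      change _ = a • φP + b • φM + KerrDimer.toL2 s - (a • φP + b • φM + 0)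
      rw [add_zero, add_sub_cancel_left]
    set p := w - h.model.mode a b with hpdef
    have hA := h.ansatz_eq (a := a) (b := b) hsp
    rw [hA, h.isSolution_iff] at hsol
    rw [hA] at hu0 ⊢
    obtain ⟨c, θ, hc, ω', u', h1, h2⟩ := hcl ε hε hεδ ω hω a b hab s p hs hsp
      (by rw [h.cp_eq, ← hsp, hsP]) (by rw [h.cm_eq, ← hsp, hsM])
      (fun h0 => hu0 (by rw [h0, map_zero])) hsol
    refine ⟨c, θ, hc, ω', KerrDimer.inclL2 d.D u', ?_, ?_⟩
    · rcases h1 with ⟨rfl, rfl⟩ | ⟨rfl, rfl⟩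
      · left
        have hm := (hfam c ε hc hε hεδ).1.1
        rw [h.ansatz_eq (hr _ hm c 0 (hnc c hc) ε hε (hεδ.trans_le hδε)).1, map_smul]
        exact ⟨rfl, rfl⟩
      · right
        have hm := (hfam c ε hc hε hεδ).2.1
        rw [h.ansatz_eq (hr _ hm 0 c (hnc' c hc) ε hε (hεδ.trans_le hδε)).1, map_smul]
        exact ⟨rfl, rfl⟩
    · rcases h2 with ⟨h3, h4⟩ | ⟨h3, h4⟩
      · exact Or.inl ⟨h3, by rw [h4]⟩
      · refine Or.inr ⟨h3, ?_⟩
        rw [h4]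
        filter_upwards [KerrDimer.inclL2_ae (h.model.κ u'), KerrDimer.conjLp_ae u',
          KerrDimer.inclL2_ae u'] with x e1 e2 e3
        rw [e1, e3]
        exact e2
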